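/- Let $K$ be a field of characteristic $0$, $N\ge 1$ an integer, and $q\in K^\times$ not a root of unity. Treat two cases, $H=U_q\,gl(N)$ and $H=U_q\,so(N)$; in the second a square root $q^{1/2}\in K$ is fixed. Repeated indices are summed; a matrix $M^{ij}_{hk}$ has rows $(i,j)$ and columns $(h,k)$; $e_i^j$ is the $N\times N$ matrix unit with its $1$ in column $i$ and row $j$; $k:=q-q^{-1}$; $[y]_q:=\frac{q^y-q^{-y}}{q-q^{-1}}$ and $[m]_q!:=[1]_q\cdots[m]_q$. Case $gl$: indices run over $1,\dots,N$, and $$\hat R=q\sum_i e_i^i\otimes e_i^i+\sum_{i\ne j}e_i^j\otimes e_j^i+k\sum_{i<j}e_i^i\otimes e_j^j,\qquad \mathcal P^{\pm}=\frac{q^{\mp1}\mathbf 1\pm\hat R}{q+q^{-1}},\qquad U^i_j=\delta^i_j\,q^{2i-N-1}.$$ Case $so$: with $n=\lfloor N/2\rfloor$, indices run over $-n,\dots,n$, with $0$ omitted if $N$ is even. In increasing order of $j$ the numbers $2\rho_j$ are $(N-2,N-4,\dots,1,0,-1,\dots,2-N)$ for $N$ odd (just $(0)$ for $N=1$) and $(N-2,N-4,\dots,0,0,\dots,2-N)$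 for $N$ even. Put $g_{ij}=g^{ij}=q^{\rho_j}\delta_{-i,j}$, $U^i_j=g^{ik}g_{jk}=\delta^i_jq^{-2\rho_i}$, $Q_N=g^{lm}g_{lm}$, $$\hat R=q\sum_{i\neq0}e_i^i\otimes e_i^i+\sum_{i\ne j,-j\ \text{or}\ i=-j=0}e_i^j\otimes e_j^i+q^{-1}\sum_{i\ne0}e_i^{-i}\otimes e_{-i}^i+k\Big(\sum_{i<j}e_i^i\otimes e_j^j-\sum_{i<j}q^{-\rho_i+\rho_j}e_i^{-j}\otimes e_{-i}^j\Big),$$ $$\mathcal P^{t\,ij}_{\ \ hk}=\frac{g^{ij}g_{hk}}{Q_N},\qquad \mathcal P^\pm=\frac{q^{\mp1}\mathbf 1\pm\hat R-(q^{\mp1}\pm q^{1-N})\mathcal P^t}{q+q^{-1}}.$$ For $0\le l\le N$ let $\mathcal P^{-,l}$ be the $N^l\times N^l$ matrix characterized by $$\mathcal P^{-,l}\mathcal P^{\pi}_{m(m+1)}=\delta^-_\pi\,\mathcal P^{-,l}=\mathcal P^{\pi}_{m(m+1)}\mathcal P^{-,l}\ \ (1\le m\le l-1),\qquad (\mathcal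 P^{-,l})^2=\mathcal P^{-,l},\qquad \operatorname{tr}\mathcal P^{-,l}=\binom Nl,$$ where $\pi\in\{-,+\}$ for $gl$ and $\pi\in\{-,+,t\}$ for $so$, and $\mathcal P^\pi_{m(m+1)}$ acts as $\mathcal P^\pi$ on the $m$-th and $(m+1)$-th tensor factors and as the identity on the others. Let $\bigwedge^*$ be the unital associative $K$-algebra generated by the $N$ elements $\xi^i$ modulo $(\mathbf 1-\mathcal P^-)^{ij}_{hk}\xi^h\xi^k=0$. For $\gamma_N\in K^\times$ define $d^Nx$ by $\gamma_N\,d^Nx=\xi^{1}\xi^2\cdots\xi^{N}$ (case $gl$), respectively $\gamma_N\,d^Nx=\xi^{-n}\xi^{1-n}\cdots\xi^{n}$ (case $so$), and the $\varepsilon$-tensor by $\xi^{i_1}\cdots\xi^{i_N}=d^Nx\,\varepsilon^{i_1\dots i_N}$. Proposition 3. The tensor $\varepsilon$ and the projectors $\mathcal P^{-,l}$ exist and are unique, and $\sum_{\{a_i\}}(\varepsilon^{a_1\dots a_N})^2\neq0$. Let $(d_0)^{-1}:=\sum_{\{a_i\}}(\varepsilon^{a_1\dots a_N})^2$ and, for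 $0\le l\le N$, $$d_l:=d_0\frac{[N]_q!}{[l]_q!\,[N-l]_q!}\ \ (gl),\qquad d_l:=d_0\frac{[N]_q!}{[l]_q!\,[N-l]_q!}\;\frac{q^{l-\frac N2}+q^{\frac N2-l}}{q^{-\frac N2}+q^{\frac N2}}\ \ (so).$$ Then $d_l=d_{N-l}$ and $$\mathcal P^{-,l\;i_1\dots i_l}_{\ \ \ \ \;j_1\dots j_l}=d_l\,U^{k_1}_{j_1}\cdots U^{k_l}_{j_l}\,\varepsilon^{i_{l+1}\dots i_Ni_1\dots i_l}\,\varepsilon^{i_{l+1}\dots i_Nk_1\dots k_l}=(-1)^{l(N-1)}d_l\,\varepsilon^{j_1\dots j_l i_{l+1}\dots i_N}\,\varepsilon^{i_{l+1}\dots i_Ni_1\dots i_l}.$$ In the case $so$, lowering indices by $\varepsilon_{a_1\dots a_r}{}^{b_{r+1}\dots b_N}:=g_{a_1c_1}\cdots g_{a_rc_r}\,\varepsilon^{c_1\dots c_rb_{r+1}\dots b_N}$, one also has $$\mathcal P^{-,l\;i_1\dots i_l}_{\ \ \ \ \;j_1\dots j_l}=d_l\,\varepsilon_{j_l\dots j_1}{}^{i_{l+1}\dots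 i_N}\,\varepsilon_{i_N\dots i_{l+1}}{}^{i_1\dots i_l}.$$ -/

import Mathlib

open scoped Kronecker

namespace QEpsilon

/-! ### Conventions

An `N² × N²` matrix `M^{ij}_{hk}` is a `Matrix (Fin N × Fin N) (Fin N × Fin N) K`; the row is the pair
of upper indices, the column the pair of lower indices. Likewise an `N^l × N^l` matrix
`P^{i₁…i_l}_{j₁…j_l}` has rows and columns in `Fin l → Fin N`. -/

section General

variable {K : Type*} [Field K] {N : ℕ}

/-- The `q`-number `[n]_q = (q^n - q^{-n}) / (q - q⁻¹)`. -/
def qNum (q : K) (n : ℕ) : K := (q ^ (n : ℤ) - q ^ (-(n : ℤ))) / (q - q⁻¹)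

/-- The `q`-factorial `[n]_q! = [1]_q [2]_q ⋯ [n]_q`. -/
def qFactorial (q : K) (n : ℕ) : K := ∏ k ∈ Finset.range n, qNum q (k + 1)

/-- `e i j` is the matrix `e_i^j`, with a single entry `1`, in the `i`-th column and `j`-th row. -/
def e (i j : Fin N) : Matrix (Fin N) (Fin N) K := Matrix.single j i 1

/-- `M_{m(m+1)}`: the matrix acting as `M` on the two neighbouring tensor factors at (0-based)
positions `m` and `m + 1` of the `l`-fold tensor power and as the identity on the others. -/
def onPair (M : Matrix (Fin N × Fin N) (Fin N × Fin N) K) (l m : ℕ) (hm : m + 1 < l) :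
    Matrix (Fin l → Fin N) (Fin l → Fin N) K :=
  Matrix.of fun I J =>
    if ∀ k : Fin l, (k : ℕ) ≠ m → (k : ℕ) ≠ m + 1 → I k = J k then
      M (I ⟨m, by omega⟩, I ⟨m + 1, hm⟩) (J ⟨m, by omega⟩, J ⟨m + 1, hm⟩)
    else 0

/-- The characterization of the completely antisymmetric projector `𝒫^{-,l}`. Here `Pminus` is
`𝒫^-` and `others` is the set of the remaining projectors in the decomposition of the braid
matrix (`{𝒫^+}` for `gl`, `{𝒫^+, 𝒫^t}` for `so`). -/
structure IsAntisymmetrizer (Pminus : Matrix (Fin N × Fin N) (Fin N × Fin N) K)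
    (others : Set (Matrix (Fin N × Fin N) (Fin N × Fin N) K)) (l : ℕ)
    (P : Matrix (Fin l → Fin N) (Fin l → Fin N) K) : Prop where
  mul_minus : ∀ (m : ℕ) (hm : m + 1 < l), P * onPair Pminus l m hm = P
  minus_mul : ∀ (m : ℕ) (hm : m + 1 < l), onPair Pminus l m hm * P = P
  mul_other : ∀ M ∈ others, ∀ (m : ℕ) (hm : m + 1 < l), P * onPair M l m hm = 0
  other_mul : ∀ M ∈ others, ∀ (m : ℕ) (hm : m + 1 < l), onPair M l m hm * P = 0
  idem : P * P = P
  trace_eq : P.trace = (N.choose l : K)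

/-- The relations `(1 - 𝒫^-)^{ij}_{hk} ξ^h ξ^k = 0` of the exterior algebra. -/
inductive ExtRel (Pminus : Matrix (Fin N × Fin N) (Fin N × Fin N) K) :
    FreeAlgebra K (Fin N) → FreeAlgebra K (Fin N) → Prop
  | rel (i j : Fin N) :
      ExtRel Pminus
        (∑ h : Fin N, ∑ k : Fin N,
          (1 - Pminus : Matrix (Fin N × Fin N) (Fin N × Fin N) K) (i, j) (h, k) • (FreeAlgebra.ι K h * FreeAlgebra.ι K k)) 0

/-- The quantum exterior algebra: the unital associative algebra generated by `ξ^1, …, ξ^N` modulo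
`(1 - 𝒫^-)^{ij}_{hk} ξ^h ξ^k = 0`. -/
abbrev ExtAlg (Pminus : Matrix (Fin N × Fin N) (Fin N × Fin N) K) : Type _ :=
  RingQuot (ExtRel Pminus)

/-- The product `ξ^{i₁} ⋯ ξ^{i_l}` in the quantum exterior algebra. -/
noncomputable def xiProd (Pminus : Matrix (Fin N × Fin N) (Fin N × Fin N) K) {l : ℕ}
    (I : Fin l → Fin N) : ExtAlg Pminus :=
  (List.ofFn fun k => RingQuot.mkAlgHom K (ExtRel Pminus) (FreeAlgebra.ι K (I k))).prod

/-- `ε` is the `ε`-tensor with normalization constant `γ`: the volume form `d^N x` is given by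
`γ d^N x = ξ^{first} ⋯ ξ^{last}` (the indices in increasing order), and
`ξ^{i₁} ⋯ ξ^{i_N} = d^N x ε^{i₁…i_N}`. -/
def IsEpsilon (Pminus : Matrix (Fin N × Fin N) (Fin N × Fin N) K) (γ : K)
    (ε : (Fin N → Fin N) → K) : Prop :=
  ∃ dx : ExtAlg Pminus, γ • dx = xiProd Pminus (fun k : Fin N => k) ∧
    ∀ I : Fin N → Fin N, xiProd Pminus I = ε I • dx

/-- The multi-index `(x₁, …, x_a, y₁, …, y_b)`, with `a + b = N`. -/
def cat {a b : ℕ} (h : a + b = N) (x : Fin a → Fin N) (y : Fin b → Fin N) : Fin N → Fin N :=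
  fun k => Fin.append x y (Fin.cast h.symm k)

/-- `d_0 = (∑ (ε^{a₁…a_N})²)⁻¹`. -/
def dZero (ε : (Fin N → Fin N) → K) : K := (∑ a : Fin N → Fin N, ε a ^ 2)⁻¹

end General

section LinearCase

variable {K : Type*} [Field K]

/-- The braid matrix of `U_q gl(N)`; the index `i ∈ {1, …, N}` is represented by `i - 1 : Fin N`. -/
def braidGL (q : K) (N : ℕ) : Matrix (Fin N × Fin N) (Fin N × Fin N) K :=
  q • (∑ i : Fin N, e i i ⊗ₖ e i i)
    + (∑ i : Fin N, ∑ j : Fin N with i ≠ j, e i j ⊗ₖ e j i)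
    + (q - q⁻¹) • (∑ i : Fin N, ∑ j : Fin N with i < j, e i i ⊗ₖ e j j)

/-- The `U_q gl(N)`-covariant symmetric projector `𝒫^+`. -/
def plusGL (q : K) (N : ℕ) : Matrix (Fin N × Fin N) (Fin N × Fin N) K :=
  (q + q⁻¹)⁻¹ • (q⁻¹ • 1 + braidGL q N)

/-- The `U_q gl(N)`-covariant antisymmetric projector `𝒫^-`. -/
def minusGL (q : K) (N : ℕ) : Matrix (Fin N × Fin N) (Fin N × Fin N) K :=
  (q + q⁻¹)⁻¹ • (q • 1 - braidGL q N)

/-- `U^i_j = δ^i_j q^{2i-N-1}`, `i = 1, …, N`. -/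
def uGL (q : K) (N : ℕ) : Matrix (Fin N) (Fin N) K :=
  Matrix.diagonal fun i => q ^ (2 * ((i : ℤ) + 1) - N - 1)

/-- The constants `d_l` for `U_q gl(N)`. -/
def dGL (q : K) {N : ℕ} (ε : (Fin N → Fin N) → K) (l : ℕ) : K :=
  dZero ε * (qFactorial q N / (qFactorial q l * qFactorial q (N - l)))

end LinearCase

section OrthogonalCase

variable {K : Type*} [Field K]

/-! The indices `-n, …, -1, (0,) 1, …, n` of `U_q so(N)` are represented, in increasing order, by
`Fin N`. Thus `-i` is `Fin.rev i`, and `i = 0` means `i = Fin.rev i`. The parameter `s` is a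
square root of `q`. -/

/-- `2ρ_j`: the sequence `(N-2, N-4, …, 1, 0, -1, …, 2-N)` for odd `N` and
`(N-2, N-4, …, 0, 0, …, 2-N)` for even `N`. -/
def twoRho {N : ℕ} (j : Fin N) : ℤ :=
  if j < j.rev then (N : ℤ) - 2 - 2 * (j : ℕ)
  else if j.rev < j then -((N : ℤ) - 2 - 2 * (j.rev : ℕ))
  else 0

/-- The metric matrix `g_{ij} = g^{ij} = q^{ρ_j} δ_{-i,j}`, with `q = s²`. -/
def metric (s : K) (N : ℕ) : Matrix (Fin N) (Fin N) K :=
  Matrix.of fun i j => if i.rev = j then s ^ twoRho j else 0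

/-- The braid matrix of `U_q so(N)`, with `q = s²`. -/
def braidSO (s : K) (N : ℕ) : Matrix (Fin N × Fin N) (Fin N × Fin N) K :=
  s ^ 2 • (∑ i : Fin N with i ≠ i.rev, e i i ⊗ₖ e i i)
    + (∑ i : Fin N, ∑ j : Fin N with (i ≠ j ∧ i ≠ j.rev) ∨ (i = j.rev ∧ j = j.rev),
        e i j ⊗ₖ e j i)
    + (s ^ 2)⁻¹ • (∑ i : Fin N with i ≠ i.rev, e i i.rev ⊗ₖ e i.rev i)
    + (s ^ 2 - (s ^ 2)⁻¹) •
      ((∑ i : Fin N, ∑ j : Fin N with i < j, e i i ⊗ₖ e j j)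
        - ∑ i : Fin N, ∑ j : Fin N with i < j,
            s ^ (-twoRho i + twoRho j) • (e i j.rev ⊗ₖ e i.rev j))

/-- `Q_N = g^{lm} g_{lm}`. -/
def traceConst (s : K) (N : ℕ) : K := ∑ l : Fin N, ∑ m : Fin N, metric s N l m * metric s N l m

/-- The trace projector `𝒫^t`, with entries `g^{ij} g_{kl} / Q_N`. -/
def traceSO (s : K) (N : ℕ) : Matrix (Fin N × Fin N) (Fin N × Fin N) K :=
  Matrix.of fun x y => (traceConst s N)⁻¹ * (metric s N x.1 x.2 * metric s N y.1 y.2)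

/-- The `U_q so(N)`-covariant symmetric trace-free projector `𝒫^+`. -/
def plusSO (s : K) (N : ℕ) : Matrix (Fin N × Fin N) (Fin N × Fin N) K :=
  (s ^ 2 + (s ^ 2)⁻¹)⁻¹ •
    ((s ^ 2)⁻¹ • 1 + braidSO s N - ((s ^ 2)⁻¹ + (s ^ 2) ^ (1 - (N : ℤ))) • traceSO s N)

/-- The `U_q so(N)`-covariant antisymmetric projector `𝒫^-`. -/
def minusSO (s : K) (N : ℕ) : Matrix (Fin N × Fin N) (Fin N × Fin N) K :=
  (s ^ 2 + (s ^ 2)⁻¹)⁻¹ •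
    (s ^ 2 • 1 - braidSO s N - (s ^ 2 - (s ^ 2) ^ (1 - (N : ℤ))) • traceSO s N)

/-- `U^i_j = g^{ik} g_{jk}`, which is `δ^i_j q^{-2ρ_i}`. -/
def uSO (s : K) (N : ℕ) : Matrix (Fin N) (Fin N) K := metric s N * (metric s N).transpose

/-- The constants `d_l` for `U_q so(N)`; here `q^{l-N/2} = s^{2l-N}`. -/
def dSO (s : K) {N : ℕ} (ε : (Fin N → Fin N) → K) (l : ℕ) : K :=
  dZero ε * (qFactorial (s ^ 2) N / (qFactorial (s ^ 2) l * qFactorial (s ^ 2) (N - l)))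
    * ((s ^ (2 * (l : ℤ) - N) + s ^ ((N : ℤ) - 2 * l)) / (s ^ (-(N : ℤ)) + s ^ (N : ℤ)))

/-- The `ε`-tensor with its first `a` indices lowered by the metric:
`ε_{x₁…x_a}^{y₁…y_b} = g_{x₁ k₁} ⋯ g_{x_a k_a} ε^{k₁…k_a y₁…y_b}`. -/
def lowerEps (s : K) {N a b : ℕ} (h : a + b = N) (ε : (Fin N → Fin N) → K)
    (x : Fin a → Fin N) (y : Fin b → Fin N) : K :=
  ∑ k : Fin a → Fin N, (∏ t : Fin a, metric s N (x t) (k t)) * ε (cat h k y)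

end OrthogonalCase

end QEpsilon

/-! Let `Λ` be the quantum exterior algebra and `τ` the functional reading off the coefficient of
the volume form. Once suitably ordered words are known to form a basis of `Λ` with `2 ^ N` elements
(`exists_pbw_basis`: the relations give the upper bound on the dimension, a Fock representation
gives the lower one), `τ` exists, `ε` is forced to be `γ τ(ξ^I)`, and every claim becomes a claim
about `τ`.

The vectors fixed by all the neighbouring `𝒫^-` are exactly the value tables `I ↦ φ(ξ^I)` of
functionals `φ` on `Λ` (`exists_functional_of_fixed`). Three properties, collected in `IsFrobenius`,
then suffice: a letter may be rotated under `τ` from the front to the back at the cost of a sign and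
a weight; the Hodge maps `β ↦ ∑ τ(ξ^k β) ξ^k` compose to a scalar `c l` in degree `l`; and a basis
of words indexed by subsets exists. The contracted product `gram` of two `ε`-tensors is a symmetric
matrix whose columns are fixed vectors; by the Hodge property it acts on the fixed space as a
scalar, and by the basis its trace is that scalar times a binomial coefficient. Hence a multiple of
it is the antisymmetrizer. A second candidate differs from it by an idempotent of trace zero, which
vanishes in characteristic zero. The various placements of indices are rotations of one another.

The scalar `c l` is found by induction on `N`. For `gl` the last generator is adjoined: `∑ ξ^c ⊗
ξ^c` becomes a sum of two `q ^ 2`-commuting terms, the second of square zero, so its powers expand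
in two terms (`hodge_incl`, `hodge_incl_mul_last`).

For `so` an outermost pair `x, y` of opposite generators is adjoined. The inner letters no longer
generate a copy of the smaller algebra, but they act like it on whatever `x y` annihilates, so the
images `b x` and `b y` of the smaller algebra are available, and the Hodge maps exchange them
(`hodge_mapX`, `hodge_mapY`). The remaining words are reached by symmetry: skew derivations attached
to the simple roots, and for even `N` the exchange of the innermost pair, commute with the square of
the Hodge map (`IsSkewDer.hodge_hodge_comm`, `hodge_hodge_permute`) and carry `b x`, `b y` to every
basis word except `1` and the volume form (`basis_mem_of_stable`). The two extreme degrees share the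
constant `∑ τ(ξ^I)^2`, which cyclicity computes from degree one; this brings in the factor `Q_N`
(`sum_sq_eq`). The formula with lowered indices follows from the anti-automorphism `ξ^i ↦ ξ^{-i}`,
which preserves `τ`. -/

namespace QEpsilon

open scoped TensorProduct

/-! ### The quantum exterior algebra: universal property, words, functionals, Hodge map. -/

section ExtAlgebra

variable {K : Type*} [Field K] {N : ℕ} (Pm : Matrix (Fin N × Fin N) (Fin N × Fin N) K)

/-- The generator `ξ^c` of the quantum exterior algebra. -/
noncomputable def xi (c : Fin N) : ExtAlg Pm :=
  RingQuot.mkAlgHom K (ExtRel Pm) (FreeAlgebra.ι K c)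

/-- The elements `z_1, …, z_N` of an algebra satisfy the relations of the exterior algebra. -/
def QuadRel {B : Type*} [Ring B] [Algebra K B] (z : Fin N → B) : Prop :=
  ∀ i j, ∑ h : Fin N, ∑ k : Fin N,
    (1 - Pm : Matrix (Fin N × Fin N) (Fin N × Fin N) K) (i, j) (h, k) • (z h * z k) = 0

theorem quadRel_xi : QuadRel Pm (xi Pm) := by
  intro i j
  have h := RingQuot.mkAlgHom_rel K (ExtRel.rel (Pminus := Pm) i j)
  simpa [xi, map_sum] using h

variable {Pm}

/-- The universal property of the exterior algebra. -/
noncomputable def extLift {B : Type*} [Ring B] [Algebra K B] (z : Fin N → B)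
    (hz : QuadRel Pm z) : ExtAlg Pm →ₐ[K] B :=
  RingQuot.liftAlgHom K ⟨FreeAlgebra.lift K z, by
    rintro _ _ ⟨i, j⟩
    simpa [map_sum] using hz i j⟩

@[simp]
theorem extLift_xi {B : Type*} [Ring B] [Algebra K B] (z : Fin N → B)
    (hz : QuadRel Pm z) (c : Fin N) : extLift z hz (xi Pm c) = z c := by
  simp [extLift, xi]

theorem ext_of_xi {B : Type*} [Ring B] [Algebra K B] {f g : ExtAlg Pm →ₐ[K] B}
    (h : ∀ c, f (xi Pm c) = g (xi Pm c)) : f = g := by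
  apply RingQuot.ringQuot_ext'
  ext c
  exact h c

/-- A subspace containing `1` and stable under left multiplication by generators is everything. -/
theorem eq_top_of_xi_mul_mem (Q : Submodule K (ExtAlg Pm)) (h1 : 1 ∈ Q)
    (h : ∀ c, ∀ b ∈ Q, xi Pm c * b ∈ Q) : Q = ⊤ := by
  -- Stability of `Q` is proved for left multiplication by every element, since membership alone
  -- would not pass through products in the induction.
  have key : ∀ x : FreeAlgebra K (Fin N), ∀ b ∈ Q, RingQuot.mkAlgHom K (ExtRel Pm) x * b ∈ Q := by
    intro x
    induction x using FreeAlgebra.induction with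
    | grade0 r =>
      intro b hb
      rw [AlgHom.commutes, ← Algebra.smul_def]
      exact Q.smul_mem r hb
    | grade1 c => exact h c
    | mul a b ha hb =>
      intro c hc
      rw [map_mul, mul_assoc]
      exact ha _ (hb _ hc)
    | add a b ha hb =>
      intro c hc
      rw [map_add, add_mul]
      exact Q.add_mem (ha _ hc) (hb _ hc)
  rw [eq_top_iff]
  intro a _
  obtain ⟨x, rfl⟩ := RingQuot.mkAlgHom_surjective K (ExtRel Pm) a
  simpa using key x 1 h1

variable (Pm) in
/-- The product of the generators along a list of indices. -/
noncomputable def word (L : List (Fin N)) : ExtAlg Pm := (L.map (xi Pm)).prod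

@[simp] theorem word_nil : word Pm [] = 1 := rfl

@[simp] theorem word_cons (c : Fin N) (L : List (Fin N)) :
    word Pm (c :: L) = xi Pm c * word Pm L := by simp [word]

theorem word_append (L L' : List (Fin N)) :
    word Pm (L ++ L') = word Pm L * word Pm L' := by simp [word]

theorem xiProd_eq_word {l : ℕ} (I : Fin l → Fin N) : xiProd Pm I = word Pm (List.ofFn I) := by
  simp only [xiProd, word, List.map_ofFn]
  rfl

theorem exists_eq_ofFn {α : Type*} {m : ℕ} (L : List α) (h : L.length = m) :
    ∃ I : Fin m → α, L = List.ofFn I := by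
  subst h
  exact ⟨L.get, (List.ofFn_get L).symm⟩

@[simp] theorem xiProd_zero (I : Fin 0 → Fin N) : xiProd Pm I = 1 := by
  simp [xiProd_eq_word]

theorem xiProd_cons {l : ℕ} (c : Fin N) (I : Fin l → Fin N) :
    xiProd Pm (Fin.cons c I : Fin (l + 1) → Fin N) = xi Pm c * xiProd Pm I := by
  simp [xiProd_eq_word]

theorem xiProd_append {a b : ℕ} (x : Fin a → Fin N) (y : Fin b → Fin N) :
    xiProd Pm (Fin.append x y) = xiProd Pm x * xiProd Pm y := by
  simp [xiProd_eq_word, List.ofFn_fin_append, word_append]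

theorem xiProd_cat {a b : ℕ} (h : a + b = N) (x : Fin a → Fin N) (y : Fin b → Fin N) :
    xiProd Pm (cat h x y) = xiProd Pm x * xiProd Pm y := by
  subst h
  exact xiProd_append x y

theorem span_word : Submodule.span K (Set.range (word Pm)) = ⊤ := by
  apply eq_top_of_xi_mul_mem
  · exact Submodule.subset_span ⟨[], rfl⟩
  · intro c b hb
    induction hb using Submodule.span_induction with
    | mem x hx =>
      obtain ⟨L, rfl⟩ := hx
      exact Submodule.subset_span ⟨c :: L, word_cons c L⟩
    | zero => simp
    | add x y _ _ hx hy => rw [mul_add]; exact Submodule.add_mem _ hx hy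
    | smul r x _ hx => rw [mul_smul_comm]; exact Submodule.smul_mem _ r hx

theorem linearMap_ext_word {X : Type*} [AddCommGroup X] [Module K X]
    {f g : ExtAlg Pm →ₗ[K] X} (h : ∀ L, f (word Pm L) = g (word Pm L)) : f = g := by
  apply LinearMap.ext_on_range (v := word Pm)
  · exact span_word
  · exact h

/-! ### Functionals -/

variable (Pm) in
/-- The functions on words that are compatible with the relations of the exterior algebra. -/
def relFun : Submodule K (List (Fin N) → K) where
  carrier := {f | ∀ (L L' : List (Fin N)) (i j : Fin N), ∑ h : Fin N, ∑ k : Fin N,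
    (1 - Pm : Matrix (Fin N × Fin N) (Fin N × Fin N) K) (i, j) (h, k) *
      f (L ++ h :: k :: L') = 0}
  add_mem' := by
    intro f g hf hg L L' i j
    simp only [Pi.add_apply, mul_add, Finset.sum_add_distrib]
    rw [hf, hg, add_zero]
  zero_mem' := by intro L L' i j; simp
  smul_mem' := by
    intro r f hf L L' i j
    have := hf L L' i j
    simp only [Pi.smul_apply, smul_eq_mul, mul_left_comm _ r, ← Finset.mul_sum]
    rw [this, mul_zero]

/-- Appending a letter to the argument. -/
def shiftRel (c : Fin N) : relFun Pm →ₗ[K] relFun Pm where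
  toFun f := ⟨fun L => f.1 (L ++ [c]), fun L L' i j => by
    simpa using f.2 L (L' ++ [c]) i j⟩
  map_add' _ _ := rfl
  map_smul' _ _ := rfl

/-- The composite of the shifts by `h` and `k` evaluates `f` at `L ++ [h, k]`, so the defining
condition of `relFun` is the relation itself. This makes the dual space a module over the exterior
algebra before any basis is known. -/
theorem quadRel_shiftRel :
    QuadRel Pm (shiftRel (Pm := Pm) : Fin N → Module.End K (relFun Pm)) := by
  intro i j
  ext f L
  have := f.2 L [] i j
  simpa [shiftRel, LinearMap.sum_apply] using this

/-- Every function on words that is compatible with the relations comes from a functional. -/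
theorem exists_functional (f : List (Fin N) → K) (hf : f ∈ relFun Pm) :
    ∃ φ : ExtAlg Pm →ₗ[K] K, ∀ L, φ (word Pm L) = f L := by
  let Φ := extLift _ (quadRel_shiftRel (Pm := Pm))
  -- Acting with a word appends it to the argument; evaluation at the empty list then gives the
  -- functional sought.
  have key : ∀ (L : List (Fin N)) (g : relFun Pm) (L' : List (Fin N)),
      (Φ (word Pm L) g).1 L' = g.1 (L' ++ L) := by
    intro L
    induction L with
    | nil => intro g L'; simp
    | cons c L ih =>
      intro g L'
      simp only [word_cons, map_mul, Module.End.mul_apply]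
      have : Φ (xi Pm c) = shiftRel c := extLift_xi _ _ _
      rw [this]
      change (Φ (word Pm L) g).1 (L' ++ [c]) = _
      rw [ih]
      simp
  let ev : (relFun Pm) →ₗ[K] K := LinearMap.proj [] ∘ₗ (relFun Pm).subtype
  refine ⟨ev ∘ₗ (LinearMap.applyₗ (⟨f, hf⟩ : relFun Pm)) ∘ₗ Φ.toLinearMap, fun L => ?_⟩
  have := key L ⟨f, hf⟩ []
  rw [List.nil_append] at this
  exact this

theorem mem_relFun_of_functional (φ : ExtAlg Pm →ₗ[K] K) :
    (fun L => φ (word Pm L)) ∈ relFun Pm := by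
  intro L L' i j
  have h := quadRel_xi Pm i j
  have h2 := congrArg (fun t => φ (word Pm L * t * word Pm L')) h
  simpa [word_append, Finset.mul_sum, Finset.sum_mul, map_sum, mul_assoc] using h2

/-- Compatibility with the relations can be checked degree by degree. -/
theorem truncate_mem_relFun {f : List (Fin N) → K} (hf : f ∈ relFun Pm) (m : ℕ) :
    (fun L => if L.length = m then f L else 0) ∈ relFun Pm := by
  intro L L' i j
  have := hf L L' i j
  by_cases h : L.length + (L'.length + 1 + 1) = m
  · simpa [h] using this
  · simp [h]

/-- The relations are homogeneous of degree two, so a functional can be cut off to one degree. This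
replaces a grading of the algebra in later arguments. -/
theorem exists_truncate (φ : ExtAlg Pm →ₗ[K] K) (m : ℕ) :
    ∃ ψ : ExtAlg Pm →ₗ[K] K, ∀ L, ψ (word Pm L) = if L.length = m then φ (word Pm L) else 0 :=
  exists_functional _ (truncate_mem_relFun (mem_relFun_of_functional φ) m)

/-! ### The canonical tensor and the Hodge map -/

variable (Pm) in
/-- `∑ ξ^c ⊗ ξ^c`. -/
noncomputable def theta : ExtAlg Pm ⊗[K] ExtAlg Pm := ∑ c, xi Pm c ⊗ₜ[K] xi Pm c

theorem pow_sum_tmul {R : Type*} [Ring R] [Algebra K R] {ι : Type*} [Fintype ι]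
    (z : ι → R) (l : ℕ) :
    (∑ c, z c ⊗ₜ[K] z c) ^ l =
      ∑ k : Fin l → ι, (List.ofFn fun t => z (k t)).prod ⊗ₜ[K] (List.ofFn fun t => z (k t)).prod := by
  induction l with
  | zero => simp [Algebra.TensorProduct.one_def]
  | succ l ih =>
    rw [pow_succ', ih, ← (Fin.consEquiv fun _ => ι).sum_comp, Fintype.sum_prod_type,
      Finset.sum_mul]
    refine Finset.sum_congr rfl fun c _ => ?_
    rw [Finset.mul_sum]
    refine Finset.sum_congr rfl fun k _ => ?_
    simp [Fin.consEquiv, Algebra.TensorProduct.tmul_mul_tmul]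

/-- A sum over all words of length `l` becomes the power of one element, so that a decomposition of
`theta` can be expanded by a binomial formula. -/
theorem theta_pow (l : ℕ) :
    theta Pm ^ l = ∑ k : Fin l → Fin N, xiProd Pm k ⊗ₜ[K] xiProd Pm k :=
  pow_sum_tmul _ _

/-- The contraction `α ⊗ α' ↦ τ(α β) α'`. -/
noncomputable def contract {A : Type*} [Ring A] [Algebra K A] (τ : A →ₗ[K] K) (β : A) :
    A ⊗[K] A →ₗ[K] A :=
  TensorProduct.lift (LinearMap.lsmul K A ∘ₗ τ ∘ₗ LinearMap.mulRight K β)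

@[simp]
theorem contract_tmul {A : Type*} [Ring A] [Algebra K A] (τ : A →ₗ[K] K) (β a b : A) :
    contract τ β (a ⊗ₜ[K] b) = τ (a * β) • b := by
  simp [contract]

/-- The Hodge map `β ↦ ∑ τ(ξ^k β) ξ^k`, the sum over all words of length `l`. -/
noncomputable def hodge (τ : ExtAlg Pm →ₗ[K] K) (l : ℕ) : ExtAlg Pm →ₗ[K] ExtAlg Pm :=
  ∑ k : Fin l → Fin N, (τ ∘ₗ LinearMap.mulLeft K (xiProd Pm k)).smulRight (xiProd Pm k)

theorem hodge_apply (τ : ExtAlg Pm →ₗ[K] K) (l : ℕ) (β : ExtAlg Pm) :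
    hodge τ l β = ∑ k : Fin l → Fin N, τ (xiProd Pm k * β) • xiProd Pm k := by
  simp [hodge, LinearMap.sum_apply]

theorem hodge_eq_contract (τ : ExtAlg Pm →ₗ[K] K) (l : ℕ) (β : ExtAlg Pm) :
    hodge τ l β = contract τ β (theta Pm ^ l) := by
  simp [theta_pow, hodge_apply, map_sum]

variable (Pm) in
/-- `τ` reads off the coefficient of the volume form `ξ^1 ⋯ ξ^N`. -/
structure IsVolume (τ : ExtAlg Pm →ₗ[K] K) : Prop where
  top : τ (xiProd Pm (fun k : Fin N => k)) = 1
  eq_smul : ∀ I : Fin N → Fin N, xiProd Pm I = τ (xiProd Pm I) • xiProd Pm (fun k : Fin N => k)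
  off : ∀ L : List (Fin N), L.length ≠ N → τ (word Pm L) = 0

/-- A functional supported in top degree is a multiple of the volume functional. -/
theorem IsVolume.eq_smul_of_off {τ : ExtAlg Pm →ₗ[K] K} (h : IsVolume Pm τ)
    {φ : ExtAlg Pm →ₗ[K] K} (hφ : ∀ L : List (Fin N), L.length ≠ N → φ (word Pm L) = 0) :
    φ = φ (xiProd Pm (fun k : Fin N => k)) • τ := by
  apply linearMap_ext_word
  intro L
  by_cases hL : L.length = N
  · obtain ⟨I, rfl⟩ := exists_eq_ofFn L hL
    rw [← xiProd_eq_word, h.eq_smul I]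
    simp [h.top, mul_comm]
  · rw [hφ L hL]
    simp [h.off L hL]

end ExtAlgebra

end QEpsilon

namespace QEpsilon

open scoped TensorProduct

/-! ### Matrices on neighbouring tensor factors, applied to value tables of functionals. -/

section OnPair

variable {K : Type*} [Field K] {N : ℕ} {Pm : Matrix (Fin N × Fin N) (Fin N × Fin N) K}

/-- Translates between the two indexings: matrices change two entries of a function on `Fin l`,
while relations insert two letters in the middle of a word. -/
theorem ofFn_update_update {α : Type*} {l m : ℕ} (hm : m + 1 < l) (I : Fin l → α) (h k : α) :
    List.ofFn (Function.update (Function.update I ⟨m, by omega⟩ h) ⟨m + 1, hm⟩ k) =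
      (List.ofFn I).take m ++ h :: k :: (List.ofFn I).drop (m + 2) := by
  apply List.ext_getElem
  · simp; omega
  · intro t h1 h2
    simp only [List.length_ofFn] at h1
    rw [List.getElem_ofFn]
    rcases lt_trichotomy t m with ht | ht | ht
    · rw [List.getElem_append_left (by simp; omega)]
      simp [Fin.ext_iff, ht.ne, show t ≠ m + 1 by omega]
    · subst ht
      rw [List.getElem_append_right (by simp)]
      simp [show min t l = t by omega]
    · rw [List.getElem_append_right (by simp; omega)]
      obtain ⟨d, rfl⟩ := Nat.exists_eq_add_of_lt ht
      cases d with
      | zero => simp [show min m l = m by omega]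
      | succ d =>
        simp only [List.length_take, List.length_ofFn, show min m l = m by omega,
          show m + (d + 1) + 1 - m = d + 2 by omega, List.getElem_cons_succ, List.getElem_drop,
          List.getElem_ofFn]
        rw [Function.update_of_ne (by rw [Ne, Fin.mk.injEq]; omega),
          Function.update_of_ne (by rw [Ne, Fin.mk.injEq]; omega)]
        congr 2; omega

theorem onPair_apply (M : Matrix (Fin N × Fin N) (Fin N × Fin N) K) {l m : ℕ} (hm : m + 1 < l)
    (I J : Fin l → Fin N) : onPair M l m hm I J =
      if ∀ k : Fin l, (k : ℕ) ≠ m → (k : ℕ) ≠ m + 1 → I k = J k then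
        M (I ⟨m, by omega⟩, I ⟨m + 1, hm⟩) (J ⟨m, by omega⟩, J ⟨m + 1, hm⟩)
      else 0 := rfl

theorem onPair_mulVec (M : Matrix (Fin N × Fin N) (Fin N × Fin N) K) {l m : ℕ} (hm : m + 1 < l)
    (v : (Fin l → Fin N) → K) (I : Fin l → Fin N) :
    (onPair M l m hm).mulVec v I = ∑ h : Fin N, ∑ k : Fin N,
      M (I ⟨m, by omega⟩, I ⟨m + 1, hm⟩) (h, k) *
        v (Function.update (Function.update I ⟨m, by omega⟩ h) ⟨m + 1, hm⟩ k) := by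
  rw [← Fintype.sum_prod_type']
  symm
  have hne : (⟨m, by omega⟩ : Fin l) ≠ ⟨m + 1, hm⟩ := by simp [Fin.ext_iff]
  apply Fintype.sum_of_injective
    (fun p : Fin N × Fin N =>
      Function.update (Function.update I ⟨m, by omega⟩ p.1) ⟨m + 1, hm⟩ p.2)
  · rintro ⟨a, b⟩ ⟨a', b'⟩ hab
    have h1 := congrFun hab ⟨m, by omega⟩
    have h2 := congrFun hab ⟨m + 1, hm⟩
    simp [hne] at h1 h2
    simp [h1, h2]
  · intro J hJ
    change onPair M l m hm I J * v J = 0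
    rw [onPair_apply, if_neg, zero_mul]
    intro hall
    apply hJ
    refine ⟨(J ⟨m, by omega⟩, J ⟨m + 1, hm⟩), ?_⟩
    funext t
    by_cases h1 : t = ⟨m + 1, hm⟩
    · subst h1; simp
    by_cases h2 : t = ⟨m, by omega⟩
    · subst h2; simp [hne]
    simp only [Function.update_of_ne h1, Function.update_of_ne h2]
    exact hall t (by simpa [Fin.ext_iff] using h2) (by simpa [Fin.ext_iff] using h1)
  · rintro ⟨a, b⟩
    change _ = onPair M l m hm I _ * _
    rw [onPair_apply, if_pos]
    · simp [hne]
    · intro t h1 h2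
      rw [Function.update_of_ne (by simpa [Fin.ext_iff] using h2),
        Function.update_of_ne (by simpa [Fin.ext_iff] using h1)]

theorem onPair_transpose (M : Matrix (Fin N × Fin N) (Fin N × Fin N) K) {l m : ℕ}
    (hm : m + 1 < l) : (onPair M l m hm).transpose = onPair M.transpose l m hm := by
  ext I J
  simp only [Matrix.transpose_apply, onPair, Matrix.of_apply]
  congr 1
  simp only [eq_comm]

theorem onPair_mulVec_functional (M : Matrix (Fin N × Fin N) (Fin N × Fin N) K) {l m : ℕ}
    (hm : m + 1 < l) (φ : ExtAlg Pm →ₗ[K] K) (I : Fin l → Fin N) :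
    (onPair M l m hm).mulVec (fun J => φ (xiProd Pm J)) I = ∑ h : Fin N, ∑ k : Fin N,
      M (I ⟨m, by omega⟩, I ⟨m + 1, hm⟩) (h, k) *
        φ (word Pm ((List.ofFn I).take m ++ h :: k :: (List.ofFn I).drop (m + 2))) := by
  rw [onPair_mulVec]
  simp only [xiProd_eq_word, ofFn_update_update]

/-- Multiples of `1 - 𝒫^-` annihilate functionals. -/
theorem onPair_mulVec_functional_eq_zero {M X : Matrix (Fin N × Fin N) (Fin N × Fin N) K}
    (hM : M = X * (1 - Pm)) {l m : ℕ} (hm : m + 1 < l) (φ : ExtAlg Pm →ₗ[K] K) :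
    (onPair M l m hm).mulVec (fun J => φ (xiProd Pm J)) = 0 := by
  funext I
  rw [onPair_mulVec_functional, hM]
  set L := (List.ofFn I).take m
  set L' := (List.ofFn I).drop (m + 2)
  simp only [Matrix.mul_apply, Finset.sum_mul, Pi.zero_apply]
  rw [Finset.sum_congr rfl fun h _ => Finset.sum_comm, Finset.sum_comm]
  refine Finset.sum_eq_zero fun p _ => ?_
  simp only [mul_assoc, ← Finset.mul_sum]
  obtain ⟨i, j⟩ := p
  have := mem_relFun_of_functional φ L L' i j
  rw [this, mul_zero]

/-- The complement `1 - Pm` annihilates value tables by the relations, so `Pm` fixes them. -/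
theorem onPair_minus_mulVec_functional {l m : ℕ} (hm : m + 1 < l) (φ : ExtAlg Pm →ₗ[K] K) :
    (onPair Pm l m hm).mulVec (fun J => φ (xiProd Pm J)) = fun J => φ (xiProd Pm J) := by
  have h := onPair_mulVec_functional_eq_zero (Pm := Pm) (M := 1 - Pm) (X := 1) (by simp) hm φ
  funext I
  have h2 := congrFun h I
  rw [onPair_mulVec] at h2 ⊢
  simp only [Matrix.sub_apply, sub_mul, Finset.sum_sub_distrib, Pi.zero_apply, sub_eq_zero] at h2
  rw [← h2, Finset.sum_eq_single (I ⟨m, by omega⟩), Finset.sum_eq_single (I ⟨m + 1, hm⟩)]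
  · simp
  · intro b _ hb
    simp [Ne.symm hb]
  · simp
  · intro b _ hb
    refine Finset.sum_eq_zero fun c _ => ?_
    simp [Ne.symm hb]
  · simp

/-- Vectors fixed by all `𝒫^-_{m(m+1)}` come from functionals on the exterior algebra. -/
theorem exists_functional_of_fixed {l : ℕ} (v : (Fin l → Fin N) → K)
    (hv : ∀ (m : ℕ) (hm : m + 1 < l), (onPair Pm l m hm).mulVec v = v) :
    ∃ φ : ExtAlg Pm →ₗ[K] K, ∀ I : Fin l → Fin N, φ (xiProd Pm I) = v I := by
  classical
  -- The extension by zero to other lengths is compatible with the relations because these preserve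
  -- the length of a word.
  let f : List (Fin N) → K := fun L => if h : L.length = l then v (fun t => L.get (t.cast h.symm))
    else 0
  have hfI : ∀ I : Fin l → Fin N, f (List.ofFn I) = v I := by
    intro I
    simp [f]
  have hf : f ∈ relFun Pm := by
    intro L L' i j
    by_cases hl : (L ++ i :: j :: L').length = l
    · have hm : L.length + 1 < l := by simp at hl; omega
      obtain ⟨I, hI⟩ := exists_eq_ofFn _ hl
      have e : ∀ h k, L ++ h :: k :: L' = List.ofFn
          (Function.update (Function.update I ⟨L.length, by omega⟩ h) ⟨L.length + 1, hm⟩ k) := by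
        intro h k
        rw [ofFn_update_update, ← hI]
        simp [List.drop_append]
      have e1 : I ⟨L.length, by omega⟩ = i := by
        have : (List.ofFn I)[L.length]'(by simp; omega) = i := by simp [← hI]
        simpa using this
      have e2 : I ⟨L.length + 1, hm⟩ = j := by
        have : (List.ofFn I)[L.length + 1]'(by simp; omega) = j := by simp [← hI]
        simpa using this
      simp only [e, hfI]
      have := congrFun (hv L.length hm) I
      rw [onPair_mulVec, e1, e2] at this
      simp only [Matrix.sub_apply, sub_mul, Finset.sum_sub_distrib, this, sub_eq_zero]
      rw [Finset.sum_eq_single i, Finset.sum_eq_single j]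
      · rw [Matrix.one_apply_eq, one_mul]
        congr 1
        rw [← e1, ← e2]
        simp
      · intro b _ hb
        simp [Ne.symm hb]
      · simp
      · intro b _ hb
        refine Finset.sum_eq_zero fun c _ => ?_
        simp [Ne.symm hb]
      · simp
    · refine Finset.sum_eq_zero fun h _ => Finset.sum_eq_zero fun k _ => ?_
      have : f (L ++ h :: k :: L') = 0 := dif_neg (by simpa using hl)
      rw [this, mul_zero]
  obtain ⟨φ, hφ⟩ := exists_functional f hf
  refine ⟨φ, fun I => ?_⟩
  rw [xiProd_eq_word, hφ, hfI]

end OnPair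

/-! ### Consequences of cyclicity, of the Hodge property and of a word basis for the Gram matrix. -/

section Frobenius

variable {K : Type*} [Field K] {N : ℕ} {Pm : Matrix (Fin N × Fin N) (Fin N × Fin N) K}

variable (Pm) in
/-- The Frobenius structure of the exterior algebra: the volume functional `τ`, its behaviour
under cyclic permutations, the square of the Hodge map and a basis consisting of words. -/
structure IsFrobenius (u : Fin N → K) (τ : ExtAlg Pm →ₗ[K] K) (c : ℕ → K) : Prop where
  vol : IsVolume Pm τ
  cyc : ∀ j α, τ (xi Pm j * α) = (-1) ^ (N - 1) * u j * τ (α * xi Pm j)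
  hodge_hodge : ∀ l m, l + m = N → ∀ I : Fin l → Fin N,
    hodge τ l (hodge τ m (xiProd Pm I)) = c l • xiProd Pm I
  pbw : ∃ b : Module.Basis (Finset (Fin N)) K (ExtAlg Pm),
    ∀ S, ∃ L : List (Fin N), L.length = S.card ∧ b S = word Pm L

variable {u : Fin N → K} {τ : ExtAlg Pm →ₗ[K] K} {c : ℕ → K}

theorem IsFrobenius.cyc_word (h : IsFrobenius Pm u τ c) {l : ℕ} (I : Fin l → Fin N)
    (α : ExtAlg Pm) :
    τ (xiProd Pm I * α) = (-1) ^ (l * (N - 1)) * (∏ t, u (I t)) * τ (α * xiProd Pm I) := by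
  induction l generalizing α with
  | zero => simp
  | succ l ih =>
    obtain ⟨a, J, rfl⟩ : ∃ a J, I = (Fin.cons a J : Fin (l + 1) → Fin N) :=
      ⟨I 0, Fin.tail I, (Fin.cons_self_tail I).symm⟩
    rw [xiProd_cons, mul_assoc, h.cyc, mul_assoc (xiProd Pm J), ih, Fin.prod_univ_succ]
    simp only [Fin.cons_zero, Fin.cons_succ, mul_assoc]
    ring

/-- Rotating `I` and then `J` to the back is a full turn, which restores the word. The accumulated
sign is `(-1) ^ (N * (N - 1)) = 1`, so the weights alone must act trivially wherever `τ` is nonzero.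
-/
theorem IsFrobenius.weight (h : IsFrobenius Pm u τ c) {l m : ℕ} (hlm : l + m = N)
    (I : Fin l → Fin N) (J : Fin m → Fin N) :
    (∏ t, u (I t)) * (∏ t, u (J t)) * τ (xiProd Pm I * xiProd Pm J) =
      τ (xiProd Pm I * xiProd Pm J) := by
  have h1 := h.cyc_word I (xiProd Pm J)
  have h2 := h.cyc_word J (xiProd Pm I)
  have hs : (-1 : K) ^ (l * (N - 1)) * (-1) ^ (m * (N - 1)) = 1 := by
    rw [← pow_add, ← add_mul, hlm]
    exact (Nat.even_mul_pred_self N).neg_one_pow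
  rw [h2] at h1
  conv_rhs => rw [h1]
  linear_combination (-(∏ t, u (I t)) * (∏ t, u (J t)) * τ (xiProd Pm I * xiProd Pm J)) * hs

/-- The matrix `∑_a u_a ε^{ia} ε^{ja}`. -/
noncomputable def gram (u : Fin N → K) (τ : ExtAlg Pm →ₗ[K] K) (l m : ℕ) :
    Matrix (Fin l → Fin N) (Fin l → Fin N) K :=
  Matrix.of fun i j => ∑ a : Fin m → Fin N,
    (∏ t, u (a t)) * τ (xiProd Pm i * xiProd Pm a) * τ (xiProd Pm j * xiProd Pm a)

theorem gram_symm (l m : ℕ) (i j : Fin l → Fin N) : gram u τ l m i j = gram u τ l m j i := by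
  simp only [gram, Matrix.of_apply]
  exact Finset.sum_congr rfl fun a _ => by ring

/-- The columns are value tables of functionals, hence fixed by the neighbouring antisymmetrizers.
The vanishing in other degrees is what the computation of the trace needs. -/
theorem gram_functional (l m : ℕ) (j : Fin l → Fin N) :
    ∃ φ : ExtAlg Pm →ₗ[K] K, (∀ i, gram u τ l m i j = φ (xiProd Pm i)) ∧
      (IsVolume Pm τ → l + m = N → ∀ L : List (Fin N), L.length ≠ l → φ (word Pm L) = 0) := by
  refine ⟨∑ a : Fin m → Fin N, ((∏ t, u (a t)) * τ (xiProd Pm j * xiProd Pm a)) •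
    (τ ∘ₗ LinearMap.mulRight K (xiProd Pm a)), fun i => ?_, ?_⟩
  · simp only [gram, Matrix.of_apply, LinearMap.sum_apply, LinearMap.smul_apply,
      LinearMap.comp_apply, LinearMap.mulRight_apply, smul_eq_mul]
    exact Finset.sum_congr rfl fun a _ => by ring
  · intro hv hlm L hL
    simp only [LinearMap.sum_apply, LinearMap.smul_apply, LinearMap.comp_apply,
      LinearMap.mulRight_apply]
    refine Finset.sum_eq_zero fun a _ => ?_
    rw [xiProd_eq_word, xiProd_eq_word, ← word_append, ← word_append, hv.off (L ++ _), smul_zero]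
    simp
    omega

/-- This is the Hodge property with the two sums interchanged; rotating `ξ^a` to the back in one of
the factors supplies the weight in `gram` and the sign. -/
theorem IsFrobenius.sum_gram_smul (h : IsFrobenius Pm u τ c) {l m : ℕ} (hlm : l + m = N)
    (j : Fin l → Fin N) :
    ∑ i, gram u τ l m i j • xiProd Pm i = ((-1) ^ (m * (N - 1)) * c l) • xiProd Pm j := by
  have h1 := h.hodge_hodge l m hlm j
  rw [hodge_apply τ m, map_sum] at h1
  simp only [map_smul, hodge_apply, h.cyc_word _ (xiProd Pm j), Finset.smul_sum, smul_smul] at h1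
  rw [Finset.sum_comm] at h1
  have hs : (-1 : K) ^ (m * (N - 1)) * (-1) ^ (m * (N - 1)) = 1 := by
    rw [← mul_pow]; simp
  rw [mul_smul, ← h1, Finset.smul_sum]
  refine Finset.sum_congr rfl fun i _ => ?_
  rw [← Finset.sum_smul, smul_smul, gram, Matrix.of_apply, Finset.mul_sum]
  congr 1
  refine Finset.sum_congr rfl fun a _ => ?_
  linear_combination (-(∏ t, u (a t)) * τ (xiProd Pm i * xiProd Pm a) *
    τ (xiProd Pm j * xiProd Pm a)) * hs

/-- Dual form of `sum_gram_smul`: on the space of fixed vectors the Gram matrix is a scalar. -/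
theorem IsFrobenius.gram_mulVec (h : IsFrobenius Pm u τ c) {l m : ℕ} (hlm : l + m = N)
    (φ : ExtAlg Pm →ₗ[K] K) :
    (gram u τ l m).mulVec (fun i => φ (xiProd Pm i)) =
      ((-1) ^ (m * (N - 1)) * c l) • fun i => φ (xiProd Pm i) := by
  funext j
  have := congrArg φ (h.sum_gram_smul hlm j)
  simp only [map_sum, map_smul, smul_eq_mul] at this
  rw [Pi.smul_apply, smul_eq_mul, ← this]
  simp only [Matrix.mulVec, dotProduct]
  exact Finset.sum_congr rfl fun i _ => by rw [gram_symm]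

/-- Expanding the diagonal in the word basis, each basis word of degree `l` contributes the scalar
once and the others nothing; the basis words of degree `l` correspond to the subsets of size `l`. -/
theorem IsFrobenius.trace_gram (h : IsFrobenius Pm u τ c) {l m : ℕ} (hlm : l + m = N) :
    (gram u τ l m).trace = ((-1) ^ (m * (N - 1)) * c l) * (N.choose l : K) := by
  classical
  obtain ⟨b, hb⟩ := h.pbw
  choose φ hφ hφ0 using fun j => gram_functional (u := u) (τ := τ) l m j
  have hexp : ∀ j, φ j (xiProd Pm j) = ∑ S, b.repr (xiProd Pm j) S * φ j (b S) := by
    intro j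
    conv_lhs => rw [← b.sum_repr (xiProd Pm j)]
    rw [map_sum]
    simp only [map_smul, smul_eq_mul]
  simp only [Matrix.trace, Matrix.diag_apply, hφ, hexp]
  rw [Finset.sum_comm]
  have hS : ∀ S : Finset (Fin N), ∑ j, b.repr (xiProd Pm j) S * φ j (b S) =
      if S.card = l then (-1) ^ (m * (N - 1)) * c l else 0 := by
    intro S
    obtain ⟨L, hL, hbS⟩ := hb S
    split_ifs with hc
    · obtain ⟨I, rfl⟩ := exists_eq_ofFn L (hL.trans hc)
      rw [← xiProd_eq_word] at hbS
      have h1 := congrArg (fun x => b.repr x S) (h.sum_gram_smul hlm I)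
      simp only [map_sum, map_smul, Finsupp.coe_finsetSum, Finset.sum_apply, Finsupp.smul_apply,
        smul_eq_mul, ← hbS, Module.Basis.repr_self, Finsupp.single_eq_same, mul_one] at h1
      rw [← h1]
      refine Finset.sum_congr rfl fun j _ => ?_
      rw [hbS, ← hφ, gram_symm, mul_comm]
    · refine Finset.sum_eq_zero fun j _ => ?_
      rw [hbS, hφ0 j h.vol hlm L (by rw [hL]; exact hc), mul_zero]
  simp only [hS, ← Finset.sum_filter, Finset.sum_const, nsmul_eq_mul]
  rw [mul_comm]
  congr 2
  rw [Finset.univ_filter_card_eq, Finset.card_powersetCard, Finset.card_univ, Fintype.card_fin]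

end Frobenius

end QEpsilon

namespace QEpsilon

/-! ### From the Frobenius structure to existence, uniqueness and formulas. -/

section Conclusion

variable {K : Type*} [Field K] {N : ℕ} {Pm : Matrix (Fin N × Fin N) (Fin N × Fin N) K}
  {others : Set (Matrix (Fin N × Fin N) (Fin N × Fin N) K)}
  {u : Fin N → K} {τ : ExtAlg Pm →ₗ[K] K} {c : ℕ → K}

/-- The volume form is nonzero and every word of length `N` is a known multiple of it, so both `dx`
and `ε` are forced. -/
theorem isEpsilon_iff (h : IsVolume Pm τ) {γ : K} (hγ : γ ≠ 0) (ε : (Fin N → Fin N) → K) :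
    IsEpsilon Pm γ ε ↔ ε = fun I => γ * τ (xiProd Pm I) := by
  have htop : xiProd Pm (fun k : Fin N => k) ≠ 0 := by
    intro h0
    have := h.top
    rw [h0, map_zero] at this
    exact zero_ne_one this
  constructor
  · rintro ⟨dx, hdx, hI⟩
    have e : dx = γ⁻¹ • xiProd Pm (fun k : Fin N => k) := by rw [← hdx, smul_smul]; simp [hγ]
    funext I
    have h1 := hI I
    rw [e, smul_smul, h.eq_smul I] at h1
    have h2 := smul_left_injective K htop h1
    change τ (xiProd Pm I) = ε I * γ⁻¹ at h2
    rw [h2]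
    field_simp
  · rintro rfl
    refine ⟨γ⁻¹ • xiProd Pm (fun k : Fin N => k), by rw [smul_smul]; simp [hγ], fun I => ?_⟩
    rw [smul_smul]
    conv_lhs => rw [h.eq_smul I]
    congr 1
    field_simp

theorem existsUnique_isEpsilon (h : IsVolume Pm τ) {γ : K} (hγ : γ ≠ 0) :
    ∃! ε : (Fin N → Fin N) → K, IsEpsilon Pm γ ε := by
  refine ⟨fun I => γ * τ (xiProd Pm I), (isEpsilon_iff h hγ _).2 rfl, fun ε hε => ?_⟩
  exact (isEpsilon_iff h hγ _).1 hε

/-- The left identities hold column by column, the columns being value tables. The right ones follow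
by transposition, since `gram` and `Pm` are symmetric; this is why the other projectors must factor
through `1 - Pm` on both sides. -/
theorem IsFrobenius.isAntisymmetrizer (h : IsFrobenius Pm u τ c) (hsymm : Pm.transpose = Pm)
    (hothers : ∀ M ∈ others, (∃ X, M = X * (1 - Pm)) ∧ ∃ X, M = (1 - Pm) * X)
    {l m : ℕ} (hlm : l + m = N) {d : K} (hd : d * ((-1) ^ (m * (N - 1)) * c l) = 1) :
    IsAntisymmetrizer Pm others l (d • gram u τ l m) := by
  have col : ∀ j : Fin l → Fin N, ∃ φ : ExtAlg Pm →ₗ[K] K,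
      (fun i => (d • gram u τ l m) i j) = fun i => φ (xiProd Pm i) := by
    intro j
    obtain ⟨φ, hφ, -⟩ := gram_functional (u := u) (τ := τ) l m j
    refine ⟨d • φ, funext fun i => ?_⟩
    simp [hφ]
  have hT : (d • gram u τ l m).transpose = d • gram u τ l m := by
    ext i j
    simp [gram_symm (u := u) (τ := τ) l m i j]
  have mulL : ∀ (M : Matrix (Fin l → Fin N) (Fin l → Fin N) K) (i j : Fin l → Fin N),
      (M * (d • gram u τ l m)) i j = M.mulVec (fun i => (d • gram u τ l m) i j) i :=
    fun M i j => rfl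
  have minus_mul : ∀ (m' : ℕ) (hm : m' + 1 < l),
      onPair Pm l m' hm * (d • gram u τ l m) = d • gram u τ l m := by
    intro m' hm
    ext i j
    obtain ⟨φ, hφ⟩ := col j
    rw [mulL, hφ, onPair_minus_mulVec_functional]
    exact (congrFun hφ i).symm
  have other_mul : ∀ (M X : Matrix (Fin N × Fin N) (Fin N × Fin N) K), M = X * (1 - Pm) →
      ∀ (m' : ℕ) (hm : m' + 1 < l), onPair M l m' hm * (d • gram u τ l m) = 0 := by
    intro M X hM m' hm
    ext i j
    obtain ⟨φ, hφ⟩ := col j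
    rw [mulL, hφ, onPair_mulVec_functional_eq_zero hM]
    rfl
  refine ⟨fun m' hm => ?_, minus_mul, fun M hM m' hm => ?_, fun M hM m' hm => ?_, ?_, ?_⟩
  · rw [← Matrix.transpose_inj, Matrix.transpose_mul, onPair_transpose, hsymm, hT, minus_mul]
  · rw [← Matrix.transpose_inj, Matrix.transpose_mul, onPair_transpose, hT, Matrix.transpose_zero]
    obtain ⟨X, hX⟩ := (hothers M hM).2
    refine other_mul _ X.transpose ?_ m' hm
    rw [hX, Matrix.transpose_mul, Matrix.transpose_sub, hsymm, Matrix.transpose_one]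
  · obtain ⟨X, hX⟩ := (hothers M hM).1
    exact other_mul M X hX m' hm
  · ext i j
    obtain ⟨φ, hφ⟩ := col j
    rw [mulL, hφ, Matrix.smul_mulVec, h.gram_mulVec hlm, smul_smul, hd, one_smul]
    exact (congrFun hφ i).symm
  · rw [Matrix.trace_smul, h.trace_gram hlm, smul_eq_mul, ← mul_assoc, hd, one_mul]

/-- The columns of a competitor `P` are fixed vectors, so `Q * P = P`, and `P * Q = P` by
transposition. Then `Q - P` is idempotent with trace zero, which forces it to vanish in
characteristic zero. -/
theorem IsFrobenius.antisymmetrizer_eq [CharZero K] (h : IsFrobenius Pm u τ c)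
    (hsymm : Pm.transpose = Pm)
    (hothers : ∀ M ∈ others, (∃ X, M = X * (1 - Pm)) ∧ ∃ X, M = (1 - Pm) * X)
    {l m : ℕ} (hlm : l + m = N) {d : K} (hd : d * ((-1) ^ (m * (N - 1)) * c l) = 1)
    {P : Matrix (Fin l → Fin N) (Fin l → Fin N) K} (hP : IsAntisymmetrizer Pm others l P) :
    P = d • gram u τ l m := by
  have hA := h.isAntisymmetrizer hsymm hothers hlm hd
  set Q := d • gram u τ l m with hQ
  have hQP : ∀ P' : Matrix (Fin l → Fin N) (Fin l → Fin N) K,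
      (∀ (m : ℕ) (hm : m + 1 < l), onPair Pm l m hm * P' = P') → Q * P' = P' := by
    intro P' hP'
    ext i j
    obtain ⟨φ, hφ⟩ := exists_functional_of_fixed (Pm := Pm) (fun i => P' i j)
      (fun m hm => funext fun i => congrFun (congrFun (hP' m hm) i) j)
    change Q.mulVec (fun i => P' i j) i = _
    simp only [← hφ]
    rw [hQ, Matrix.smul_mulVec, h.gram_mulVec hlm, smul_smul, hd, one_smul]
  have hQT : Q.transpose = Q := by
    ext i j
    simp [hQ, gram_symm (u := u) (τ := τ) l m i j]
  have h1 : Q * P = P := hQP P hP.minus_mul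
  have h2 : P * Q = P := by
    have := hQP P.transpose fun m hm => by
      have h3 := congrArg Matrix.transpose (hP.mul_minus m hm)
      rwa [Matrix.transpose_mul, onPair_transpose, hsymm] at h3
    rw [← Matrix.transpose_inj, Matrix.transpose_mul, hQT, this]
  have hidem : IsIdempotentElem (Matrix.toLin' (Q - P)) := by
    rw [IsIdempotentElem, Module.End.mul_eq_comp, ← Matrix.toLin'_mul]
    congr 1
    rw [sub_mul, mul_sub, mul_sub, hA.idem, hP.idem, h1, h2]
    abel
  have htr : LinearMap.trace K _ (Matrix.toLin' (Q - P)) = 0 := by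
    rw [Matrix.trace_toLin'_eq, Matrix.trace_sub, hA.trace_eq, hP.trace_eq, sub_self]
  have h0 := LinearMap.IsIdempotentElem.eq_zero_of_trace_eq_zero hidem htr
  have h3 : Q - P = 0 := (LinearEquiv.map_eq_zero_iff Matrix.toLin').1 h0
  exact (sub_eq_zero.1 h3).symm

theorem IsFrobenius.existsUnique_antisymmetrizer [CharZero K] (h : IsFrobenius Pm u τ c)
    (hsymm : Pm.transpose = Pm)
    (hothers : ∀ M ∈ others, (∃ X, M = X * (1 - Pm)) ∧ ∃ X, M = (1 - Pm) * X)
    {l m : ℕ} (hlm : l + m = N) {d : K} (hd : d * ((-1) ^ (m * (N - 1)) * c l) = 1) :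
    ∃! P, IsAntisymmetrizer Pm others l P :=
  ⟨_, h.isAntisymmetrizer hsymm hothers hlm hd, fun _ hP =>
    h.antisymmetrizer_eq hsymm hothers hlm hd hP⟩

/-- Rotating `ξ^a` to the front in both factors leaves no sign; the surplus weight of `a` is traded
for that of `j` by `weight`. -/
theorem IsFrobenius.gram_eq_left (h : IsFrobenius Pm u τ c) {l m : ℕ} (hlm : l + m = N)
    (i j : Fin l → Fin N) : gram u τ l m i j =
      (∏ t, u (j t)) * ∑ a : Fin m → Fin N,
        τ (xiProd Pm a * xiProd Pm i) * τ (xiProd Pm a * xiProd Pm j) := by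
  rw [gram, Matrix.of_apply, Finset.mul_sum]
  refine Finset.sum_congr rfl fun a _ => ?_
  rw [h.cyc_word a, h.cyc_word a]
  have hs : (-1 : K) ^ (m * (N - 1)) * (-1) ^ (m * (N - 1)) = 1 := by
    rw [← mul_pow]; simp
  have hw := h.weight hlm j a
  linear_combination (-(∏ t, u (a t)) * τ (xiProd Pm i * xiProd Pm a)) * hw -
    (∏ t, u (a t)) * τ (xiProd Pm i * xiProd Pm a) * (∏ t, u (j t)) * (∏ t, u (a t)) *
      τ (xiProd Pm j * xiProd Pm a) * hs

/-- Rotating in only one of the two factors absorbs the weight of `a` completely and leaves a sign.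
-/
theorem IsFrobenius.gram_eq_cyclic (h : IsFrobenius Pm u τ c) {l m : ℕ} (hlm : l + m = N)
    (i j : Fin l → Fin N) : gram u τ l m i j =
      (-1) ^ (l * (N - 1)) * ∑ a : Fin m → Fin N,
        τ (xiProd Pm j * xiProd Pm a) * τ (xiProd Pm a * xiProd Pm i) := by
  rw [gram, Matrix.of_apply, Finset.mul_sum]
  refine Finset.sum_congr rfl fun a _ => ?_
  rw [h.cyc_word a]
  have hs : (-1 : K) ^ (l * (N - 1)) * (-1) ^ (m * (N - 1)) = 1 := by
    rw [← pow_add, ← add_mul, hlm]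
    exact (Nat.even_mul_pred_self N).neg_one_pow
  linear_combination (-(∏ t, u (a t)) * τ (xiProd Pm i * xiProd Pm a) *
    τ (xiProd Pm j * xiProd Pm a)) * hs

theorem sum_prod_diagonal {l : ℕ} (j : Fin l → Fin N) (f : (Fin l → Fin N) → K) :
    ∑ k : Fin l → Fin N, (∏ t, Matrix.diagonal u (k t) (j t)) * f k = (∏ t, u (j t)) * f j := by
  classical
  rw [Finset.sum_eq_single j]
  · simp
  · intro k _ hk
    obtain ⟨t, ht⟩ := Function.ne_iff.1 hk
    rw [Finset.prod_eq_zero (Finset.mem_univ t) (by simp [ht]), zero_mul]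
  · simp

/-- The common part of the two cases: the formulas for the antisymmetrizers. -/
theorem IsFrobenius.antisymmetrizer_formulas [CharZero K] (h : IsFrobenius Pm u τ c)
    (hsymm : Pm.transpose = Pm)
    (hothers : ∀ M ∈ others, (∃ X, M = X * (1 - Pm)) ∧ ∃ X, M = (1 - Pm) * X)
    {γ : K} {l m : ℕ} (hlm : l + m = N) {d : K}
    (hd : d * γ ^ 2 * ((-1) ^ (m * (N - 1)) * c l) = 1)
    {ε : (Fin N → Fin N) → K} (hε : ε = fun I => γ * τ (xiProd Pm I))
    {P : Matrix (Fin l → Fin N) (Fin l → Fin N) K} (hP : IsAntisymmetrizer Pm others l P)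
    (i j : Fin l → Fin N) :
    P i j = d * ∑ k : Fin l → Fin N, ∑ a : Fin m → Fin N,
        (∏ t : Fin l, Matrix.diagonal u (k t) (j t)) *
          ε (cat ((add_comm m l).trans hlm) a i) * ε (cat ((add_comm m l).trans hlm) a k) ∧
    P i j = (-1) ^ (l * (N - 1)) * d *
        ∑ a : Fin m → Fin N, ε (cat hlm j a) * ε (cat ((add_comm m l).trans hlm) a i) := by
  have hPe := h.antisymmetrizer_eq hsymm hothers hlm hd hP
  subst hε
  constructor
  · simp only [mul_assoc, ← Finset.mul_sum]
    rw [sum_prod_diagonal, hPe, Matrix.smul_apply, smul_eq_mul, h.gram_eq_left hlm]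
    simp only [xiProd_cat, Finset.mul_sum]
    exact Finset.sum_congr rfl fun a _ => by ring
  · rw [hPe, Matrix.smul_apply, smul_eq_mul, h.gram_eq_cyclic hlm]
    simp only [xiProd_cat, Finset.mul_sum]
    exact Finset.sum_congr rfl fun a _ => by ring

end Conclusion

end QEpsilon

namespace QEpsilon

/-! ### Bases of ordered words and the existence of the volume functional. -/

section PBW

variable {K : Type*} [Field K] {N : ℕ}

variable (K) in
/-- The letters of the list can be adjoined one after the other (the last one first) so that each
new letter commutes with the previous ones up to a scalar and up to previous elements. -/
def IsTower {B : Type*} [Ring B] [Algebra K B] (z : Fin N → B) : List (Fin N) → Prop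
  | [] => True
  | c :: L => (z c * z c ∈ Algebra.adjoin K (z '' {j | j ∈ L}) ∧
      ∀ j ∈ L, ∃ κ : K, z j * z c - κ • (z c * z j) ∈ Algebra.adjoin K (z '' {j | j ∈ L})) ∧
      IsTower z L

theorem adjoin_le_of_mul_mem {B : Type*} [Ring B] [Algebra K B] (s : Set B) (Q : Submodule K B)
    (h1 : 1 ∈ Q) (h : ∀ a ∈ s, ∀ b ∈ Q, a * b ∈ Q) {x : B} (hx : x ∈ Algebra.adjoin K s) :
    x ∈ Q := by
  suffices H : ∀ b ∈ Q, x * b ∈ Q by simpa using H 1 h1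
  induction hx using Algebra.adjoin_induction with
  | mem a ha => exact h a ha
  | algebraMap r =>
    intro b hb
    rw [← Algebra.smul_def]
    exact Q.smul_mem r hb
  | add a b _ _ ha hb =>
    intro c hc
    rw [add_mul]
    exact Q.add_mem (ha c hc) (hb c hc)
  | mul a b _ _ ha hb =>
    intro c hc
    rw [mul_assoc]
    exact ha _ (hb c hc)

/-- If `D` is generated by the letters of `L`, adjoining `c` gives only `D + z c * D`: the tower
conditions allow `z c` to be moved to the far left. Each letter therefore at most doubles the
spanning family. -/
theorem adjoin_le_span_of_isTower {B : Type*} [Ring B] [Algebra K B] {z : Fin N → B}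
    (L : List (Fin N)) (hL : L.Nodup) (hT : IsTower K z L) {x : B}
    (hx : x ∈ Algebra.adjoin K (z '' {j | j ∈ L})) :
    x ∈ Submodule.span K (Set.range fun S : Finset (Fin N) =>
      ((L.filter (· ∈ S)).map z).prod) := by
  induction L generalizing x with
  | nil =>
    simp only [List.not_mem_nil, Set.ofPred_false, Set.image_empty, Algebra.adjoin_empty] at hx
    obtain ⟨r, rfl⟩ := Algebra.mem_bot.1 hx
    rw [Algebra.algebraMap_eq_smul_one]
    exact Submodule.smul_mem _ _ (Submodule.subset_span ⟨∅, by simp⟩)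
  | cons c L ih =>
    obtain ⟨⟨hcc, hjc⟩, hT'⟩ := hT
    obtain ⟨hcL, hL'⟩ := List.nodup_cons.1 hL
    set D := Algebra.adjoin K (z '' {j | j ∈ L}) with hD
    have hQ : x ∈ Subalgebra.toSubmodule D ⊔
        (Subalgebra.toSubmodule D).map (LinearMap.mulLeft K (z c)) := by
      refine adjoin_le_of_mul_mem _ _ (Submodule.mem_sup_left (one_mem D)) ?_ hx
      rintro _ ⟨j, hj, rfl⟩ b hb
      obtain ⟨b0, hb0, _, hb2, rfl⟩ := Submodule.mem_sup.1 hb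
      obtain ⟨b1, hb1, rfl⟩ := Submodule.mem_map.1 hb2
      have hb0' : b0 ∈ D := hb0
      have hb1' : b1 ∈ D := hb1
      rw [LinearMap.mulLeft_apply, mul_add]
      rcases List.mem_cons.1 hj with rfl | hjL
      · rw [← mul_assoc]
        exact add_comm (z j * z j * b1) (z j * b0) ▸ Submodule.add_mem_sup
          (D.mul_mem hcc hb1') (Submodule.mem_map_of_mem hb0)
      · obtain ⟨κ, hκ⟩ := hjc j hjL
        have hzj : z j ∈ D := Algebra.subset_adjoin ⟨j, hjL, rfl⟩
        have e : z j * b0 + z j * (z c * b1) =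
            (z j * b0 + (z j * z c - κ • (z c * z j)) * b1) + z c * (κ • (z j * b1)) := by
          simp only [sub_mul, smul_mul_assoc, mul_smul_comm, mul_assoc]
          abel
        rw [e]
        exact Submodule.add_mem_sup
          (D.add_mem (D.mul_mem hzj hb0') (D.mul_mem hκ hb1'))
          (Submodule.mem_map_of_mem (D.smul_mem (D.mul_mem hzj hb1') κ))
    have hfilter : ∀ S T : Finset (Fin N), (∀ j, j ≠ c → (j ∈ S ↔ j ∈ T)) →
        L.filter (· ∈ S) = L.filter (· ∈ T) := by
      intro S T hST
      refine List.filter_congr fun j hj => ?_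
      have : j ≠ c := fun h => hcL (h ▸ hj)
      simp [hST j this]
    obtain ⟨b0, hb0, b1', hb1', rfl⟩ := Submodule.mem_sup.1 hQ
    obtain ⟨b1, hb1, rfl⟩ := Submodule.mem_map.1 hb1'
    refine Submodule.add_mem _ ?_ ?_
    · refine Submodule.span_le.2 ?_ (ih hL' hT' hb0)
      rintro _ ⟨S, rfl⟩
      refine Submodule.subset_span ⟨S.erase c, ?_⟩
      simp only [List.filter_cons, Finset.notMem_erase, decide_false, Bool.false_eq_true, if_false]
      rw [hfilter (S.erase c) S fun j hj => by simp [hj]]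
    · have := Submodule.mem_map_of_mem (f := LinearMap.mulLeft K (z c)) (ih hL' hT' hb1)
      rw [Submodule.map_span] at this
      refine Submodule.span_le.2 ?_ this
      rintro _ ⟨_, ⟨S, rfl⟩, rfl⟩
      refine Submodule.subset_span ⟨insert c S, ?_⟩
      simp only [List.filter_cons, Finset.mem_insert_self, decide_true, if_true, List.map_cons,
        List.prod_cons, LinearMap.mulLeft_apply]
      rw [hfilter (insert c S) S fun j hj => by simp [hj]]

variable {Pm : Matrix (Fin N × Fin N) (Fin N × Fin N) K}

/-- The Poincaré–Birkhoff–Witt property, from a tower of generators and a cyclic module of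
the right dimension. -/
theorem exists_pbw_basis (L : List (Fin N)) (hL : L.Perm (List.finRange N))
    (hT : IsTower K (xi Pm) L) {M : Type*} [AddCommGroup M] [Module K M]
    (hM : Module.finrank K M = 2 ^ N) (Φ : ExtAlg Pm →ₐ[K] Module.End K M) (v : M)
    (hv : ∀ Q : Submodule K M, v ∈ Q → (∀ c, ∀ x ∈ Q, Φ (xi Pm c) x ∈ Q) → Q = ⊤) :
    ∃ b : Module.Basis (Finset (Fin N)) K (ExtAlg Pm),
      ∀ S, b S = word Pm (L.filter (· ∈ S)) ∧ (L.filter (· ∈ S)).length = S.card := by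
  have hmem : ∀ j, j ∈ L := fun j => hL.mem_iff.2 (List.mem_finRange j)
  have hnd : L.Nodup := hL.nodup_iff.2 (List.nodup_finRange N)
  have hspan : ⊤ ≤ Submodule.span K (Set.range fun S : Finset (Fin N) =>
      word Pm (L.filter (· ∈ S))) := by
    rw [← eq_top_of_xi_mul_mem (Pm := Pm)
      (Subalgebra.toSubmodule (Algebra.adjoin K (xi Pm '' {j | j ∈ L})))
      (one_mem (Algebra.adjoin K (xi Pm '' {j | j ∈ L}))) ?_]
    · exact fun x hx => adjoin_le_span_of_isTower L hnd hT hx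
    · intro c b hb
      exact Subalgebra.mul_mem _ (Algebra.subset_adjoin ⟨c, hmem c, rfl⟩) hb
  have hfin : Module.Finite K (ExtAlg Pm) :=
    ⟨⟨(Set.finite_range _).toFinset, by simpa using top_le_iff.1 hspan⟩⟩
  -- The orbit map of the cyclic vector is onto a space of dimension `2 ^ N`. Together with the
  -- spanning family of that size, this makes the family a basis.
  let ev : ExtAlg Pm →ₗ[K] M := LinearMap.applyₗ v ∘ₗ Φ.toLinearMap
  have hsurj : Function.Surjective ev := by
    rw [← LinearMap.range_eq_top]
    apply hv
    · exact ⟨1, by simp [ev]⟩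
    · rintro c _ ⟨a, rfl⟩
      exact ⟨xi Pm c * a, by simp [ev]⟩
  have hle : Module.finrank K M ≤ Module.finrank K (ExtAlg Pm) :=
    LinearMap.finrank_le_finrank_of_surjective hsurj
  have hge : Module.finrank K (ExtAlg Pm) ≤ 2 ^ N := by
    have := finrank_le_of_span_eq_top (top_le_iff.1 hspan)
    simpa using this
  have hcard : Fintype.card (Finset (Fin N)) = Module.finrank K (ExtAlg Pm) := by
    simp only [Fintype.card_finset, Fintype.card_fin]
    omega
  refine ⟨basisOfTopLeSpanOfCardEqFinrank _ hspan hcard, fun S => ⟨by simp, ?_⟩⟩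
  rw [(hL.filter _).length_eq, ← List.toFinset_card_of_nodup ((List.nodup_finRange N).filter _)]
  congr 1
  ext j
  simp

/-- A volume functional exists as soon as some scalar multiple of the volume form belongs to a
basis of words. -/
theorem exists_isVolume (b : Module.Basis (Finset (Fin N)) K (ExtAlg Pm))
    (hb : ∀ S, ∃ L : List (Fin N), L.length = S.card ∧ b S = word Pm L) {κ : K} (hκ : κ ≠ 0)
    (htop : xiProd Pm (fun k : Fin N => k) = κ • b Finset.univ) :
    ∃ τ : ExtAlg Pm →ₗ[K] K, IsVolume Pm τ := by
  obtain ⟨ψ, hψ⟩ := exists_truncate (κ⁻¹ • b.coord Finset.univ) N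
  -- Cutting the coordinate functional off to degree `N` shows that a word of length `N` involves no
  -- basis word of smaller length.
  have htr : ∀ (S : Finset (Fin N)) (I : Fin N → Fin N), S ≠ Finset.univ →
      b.repr (xiProd Pm I) S = 0 := by
    intro S I hS
    obtain ⟨φ, hφ⟩ := exists_truncate (b.coord S) N
    have h1 : φ (xiProd Pm I) = b.repr (xiProd Pm I) S := by
      rw [xiProd_eq_word, hφ]
      simp
    have h2 : φ = 0 := by
      apply b.ext
      intro T
      obtain ⟨L, hL, hT⟩ := hb T
      rw [hT, hφ, ← hT]
      split_ifs with h
      · have : T = Finset.univ := by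
          rw [← Finset.card_eq_iff_eq_univ, Fintype.card_fin, ← hL, h]
        subst this
        simp [hS]
      · simp
    rw [← h1, h2]
    simp
  have hval : ∀ I : Fin N → Fin N, ψ (xiProd Pm I) = κ⁻¹ * b.repr (xiProd Pm I) Finset.univ := by
    intro I
    rw [xiProd_eq_word, hψ]
    simp
  refine ⟨ψ, ?_, ?_, ?_⟩
  · rw [hval, htop]
    simp [hκ]
  · intro I
    rw [hval, htop, smul_smul]
    conv_lhs => rw [← b.sum_repr (xiProd Pm I)]
    rw [Finset.sum_eq_single Finset.univ]
    · congr 1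
      field_simp
    · intro S _ hS
      rw [htr S I hS, zero_smul]
    · simp
  · intro L hL
    rw [hψ, if_neg hL]

end PBW

end QEpsilon

namespace QEpsilon

open scoped TensorProduct

/-! ### Homogeneous components. -/

section Degree

variable {K : Type*} [Field K] {N : ℕ} {Pm : Matrix (Fin N × Fin N) (Fin N × Fin N) K}

variable (Pm) in
/-- The homogeneous component of degree `m`. -/
def deg (m : ℕ) : Submodule K (ExtAlg Pm) :=
  Submodule.span K {a | ∃ L : List (Fin N), L.length = m ∧ word Pm L = a}

theorem word_mem_deg (L : List (Fin N)) : word Pm L ∈ deg Pm L.length :=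
  Submodule.subset_span ⟨L, rfl, rfl⟩

theorem word_mem_deg' {L : List (Fin N)} {m : ℕ} (h : L.length = m) : word Pm L ∈ deg Pm m :=
  Submodule.subset_span ⟨L, h, rfl⟩

theorem xiProd_mem_deg {m : ℕ} (I : Fin m → Fin N) : xiProd Pm I ∈ deg Pm m := by
  rw [xiProd_eq_word]
  exact word_mem_deg' (by simp)

theorem one_mem_deg : (1 : ExtAlg Pm) ∈ deg Pm 0 := word_mem_deg []

theorem mul_mem_deg {a b : ExtAlg Pm} {m n : ℕ} (ha : a ∈ deg Pm m) (hb : b ∈ deg Pm n) :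
    a * b ∈ deg Pm (m + n) := by
  induction ha using Submodule.span_induction with
  | mem x hx =>
    obtain ⟨L, rfl, rfl⟩ := hx
    induction hb using Submodule.span_induction with
    | mem y hy =>
      obtain ⟨L', rfl, rfl⟩ := hy
      rw [← word_append]
      exact word_mem_deg' (by simp)
    | zero => simp
    | add x y _ _ hx hy => rw [mul_add]; exact Submodule.add_mem _ hx hy
    | smul r x _ hx => rw [mul_smul_comm]; exact Submodule.smul_mem _ r hx
  | zero => simp
  | add x y _ _ hx hy => rw [add_mul]; exact Submodule.add_mem _ hx hy
  | smul r x _ hx => rw [smul_mul_assoc]; exact Submodule.smul_mem _ r hx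

theorem xi_mem_deg (c : Fin N) : xi Pm c ∈ deg Pm 1 := by
  simpa using word_mem_deg (Pm := Pm) [c]

theorem hodge_mem_deg (τ : ExtAlg Pm →ₗ[K] K) (l : ℕ) (β : ExtAlg Pm) :
    hodge τ l β ∈ deg Pm l := by
  rw [hodge_apply]
  exact Submodule.sum_mem _ fun k _ => Submodule.smul_mem _ _ (xiProd_mem_deg k)

/-- Linear maps agreeing on words of length `m` agree in degree `m`. -/
theorem eqOn_deg {X : Type*} [AddCommGroup X] [Module K X] {f g : ExtAlg Pm →ₗ[K] X} {m : ℕ}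
    (h : ∀ L : List (Fin N), L.length = m → f (word Pm L) = g (word Pm L)) {a : ExtAlg Pm}
    (ha : a ∈ deg Pm m) : f a = g a := by
  induction ha using Submodule.span_induction with
  | mem x hx =>
    obtain ⟨L, hL, rfl⟩ := hx
    exact h L hL
  | zero => simp
  | add x y _ _ hx hy => rw [map_add, map_add, hx, hy]
  | smul r x _ hx => rw [map_smul, map_smul, hx]

theorem IsFrobenius.hodge_hodge_deg {u : Fin N → K} {τ : ExtAlg Pm →ₗ[K] K} {c : ℕ → K}
    (h : IsFrobenius Pm u τ c) {l m : ℕ} (hlm : l + m = N) {a : ExtAlg Pm} (ha : a ∈ deg Pm l) :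
    hodge τ l (hodge τ m a) = c l • a := by
  refine eqOn_deg (f := hodge τ l ∘ₗ hodge τ m) (g := c l • LinearMap.id) (fun L hL => ?_) ha
  obtain ⟨I, rfl⟩ := exists_eq_ofFn L hL
  rw [← xiProd_eq_word]
  exact h.hodge_hodge l m hlm I

/-- Degree zero of the Hodge property: the composite sends `1` to the sum of squares. This
identifies `d_0` with `c 0` up to the normalization of the volume form. -/
theorem IsFrobenius.sum_sq {u : Fin N → K} {τ : ExtAlg Pm →ₗ[K] K} {c : ℕ → K}
    (h : IsFrobenius Pm u τ c) : ∑ I : Fin N → Fin N, τ (xiProd Pm I) ^ 2 = c 0 := by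
  have h1 := h.hodge_hodge_deg (zero_add N) one_mem_deg
  have h10 : (1 : ExtAlg Pm) ≠ 0 := by
    intro h0
    have := h.vol.top
    rw [← mul_one (xiProd Pm _), h0, mul_zero, map_zero] at this
    exact zero_ne_one this
  have h2 : hodge τ 0 (hodge τ N 1) = (∑ I : Fin N → Fin N, τ (xiProd Pm I) ^ 2) • 1 := by
    simp [hodge_apply, Finset.sum_smul, pow_two, map_sum, mul_smul]
  rw [h2] at h1
  exact smul_left_injective K h10 h1

/-- Above the top degree everything vanishes. -/
theorem word_eq_zero_of_basis (b : Module.Basis (Finset (Fin N)) K (ExtAlg Pm))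
    (hb : ∀ S, ∃ L : List (Fin N), L.length = S.card ∧ b S = word Pm L) (L : List (Fin N))
    (hL : N < L.length) : word Pm L = 0 := by
  apply b.repr.injective
  ext S
  obtain ⟨φ, hφ⟩ := exists_truncate (b.coord S) L.length
  have h1 : φ (word Pm L) = b.repr (word Pm L) S := by
    rw [hφ]
    simp
  have h2 : φ = 0 := by
    apply b.ext
    intro T
    obtain ⟨L', hL', hT⟩ := hb T
    rw [hT, hφ, if_neg]
    · simp
    · have := Finset.card_le_univ T
      rw [Fintype.card_fin] at this
      omega
  rw [← h1, h2]
  simp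

theorem eq_zero_of_mem_deg (b : Module.Basis (Finset (Fin N)) K (ExtAlg Pm))
    (hb : ∀ S, ∃ L : List (Fin N), L.length = S.card ∧ b S = word Pm L) {m : ℕ} (hm : N < m)
    {a : ExtAlg Pm} (ha : a ∈ deg Pm m) : a = 0 :=
  eqOn_deg (f := LinearMap.id) (g := 0)
    (fun L hL => word_eq_zero_of_basis b hb L (by omega)) ha

/-- If the vectors `z_j` and `z_i` commute up to scalars, then `z_j` can be moved through products. -/
theorem mul_prod_eq {B : Type*} [Ring B] [Algebra K B] {ι : Type*} (z : ι → B) (y : B) (κ : ι → K)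
    (L : List ι) (h : ∀ i ∈ L, y * z i = κ i • (z i * y)) :
    y * (L.map z).prod = (L.map κ).prod • ((L.map z).prod * y) := by
  induction L with
  | nil => simp
  | cons i L ih =>
    simp only [List.map_cons, List.prod_cons]
    rw [← mul_assoc, h i (by simp), smul_mul_assoc, mul_assoc,
      ih fun j hj => h j (List.mem_cons_of_mem _ hj), mul_smul_comm, smul_smul, mul_assoc]

end Degree

/-! ### Quadratic relations read off from rows of a matrix. -/

section QuadAct

variable {K : Type*} [Field K] {N : ℕ}

/-- `M^{ij}_{hk} w_{hk}`, as a linear function of `M`. -/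
def pairAct {V : Type*} [AddCommGroup V] [Module K V] (w : Fin N → Fin N → V)
    (p : Fin N × Fin N) : Matrix (Fin N × Fin N) (Fin N × Fin N) K →ₗ[K] V where
  toFun M := ∑ h : Fin N, ∑ k : Fin N, M p (h, k) • w h k
  map_add' M M' := by simp [add_smul, Finset.sum_add_distrib]
  map_smul' r M := by simp [mul_smul, Finset.smul_sum]

theorem pairAct_apply {V : Type*} [AddCommGroup V] [Module K V] (w : Fin N → Fin N → V)
    (p : Fin N × Fin N) (M : Matrix (Fin N × Fin N) (Fin N × Fin N) K) :
    pairAct w p M = ∑ h : Fin N, ∑ k : Fin N, M p (h, k) • w h k := rfl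

theorem quadRel_iff {B : Type*} [Ring B] [Algebra K B]
    (Pm : Matrix (Fin N × Fin N) (Fin N × Fin N) K) (z : Fin N → B) :
    QuadRel Pm z ↔ ∀ p, pairAct (fun h k => z h * z k) p (1 - Pm) = 0 :=
  ⟨fun h p => h p.1 p.2, fun h i j => h (i, j)⟩

variable {V : Type*} [AddCommGroup V] [Module K V]

theorem pairAct_one (w : Fin N → Fin N → V) (p : Fin N × Fin N) :
    pairAct (K := K) w p 1 = w p.1 p.2 := by
  obtain ⟨i, j⟩ := p
  simp only [pairAct_apply, Matrix.one_apply, Prod.mk.injEq, ite_smul, one_smul, zero_smul,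
    ite_and]
  simp

theorem pairAct_kronecker (w : Fin N → Fin N → V) (p : Fin N × Fin N) (a b c d : Fin N) :
    pairAct w p ((e a b : Matrix (Fin N) (Fin N) K) ⊗ₖ e c d) =
      if b = p.1 ∧ d = p.2 then w a c else 0 := by
  obtain ⟨i, j⟩ := p
  simp only [pairAct_apply, Matrix.kroneckerMap_apply, e, Matrix.single_apply]
  by_cases hb : b = i
  · by_cases hd : d = j
    · subst hb hd
      simp
    · simp [hd]
  · simp [hb]

theorem pairAct_mul (w : Fin N → Fin N → V) (p : Fin N × Fin N)
    (M X : Matrix (Fin N × Fin N) (Fin N × Fin N) K) :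
    pairAct w p (M * X) = ∑ r, M p r • pairAct w r X := by
  simp only [pairAct_apply, Matrix.mul_apply, Finset.smul_sum, Finset.sum_smul, smul_smul]
  rw [Finset.sum_congr rfl fun h _ => Finset.sum_comm, Finset.sum_comm]

end QuadAct

/-! ### The relations of the exterior algebra for `gl`. -/

section LinearRelations

variable {K : Type*} [Field K] {N : ℕ} {B : Type*} [Ring B] [Algebra K B]

/-- The relations of the `U_q gl(N)`-covariant exterior algebra. -/
structure RelGL (q : K) (z : Fin N → B) : Prop where
  sq : ∀ i, z i * z i = 0
  comm : ∀ i j, i < j → z j * z i = -q • (z i * z j)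

theorem pairAct_braidGL (q : K) (z : Fin N → B) (i j : Fin N) :
    pairAct (fun h k => z h * z k) (i, j) (braidGL q N) =
      (if i = j then q • (z i * z i) else 0) + (if i ≠ j then z j * z i else 0) +
        (if i < j then (q - q⁻¹) • (z i * z j) else 0) := by
  rw [braidGL, map_add, map_add, map_smul, map_smul, map_sum, map_sum, map_sum]
  simp only [map_sum, pairAct_kronecker]
  congr 1
  · congr 1
    · by_cases h : i = j
      · subst h
        simp
      · rw [Finset.sum_eq_zero]
        · simp [h]
        · intro k _
          rw [if_neg]
          rintro ⟨rfl, rfl⟩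
          exact h rfl
    · simp only [Finset.sum_filter, ← ite_and]
      rw [Finset.sum_eq_single j]
      · rw [Finset.sum_eq_single i]
        · by_cases h : i = j
          · simp [h]
          · simp [h, Ne.symm h]
        · intro b _ hb
          simp [hb]
        · simp
      · intro b _ hb
        refine Finset.sum_eq_zero fun c _ => ?_
        simp [hb]
      · simp
  · simp only [Finset.sum_filter]
    rw [Finset.sum_eq_single i]
    · rw [Finset.sum_eq_single j]
      · by_cases h : i < j
        · simp [h]
        · simp [h]
      · intro b _ hb
        simp [hb]
      · simp
    · intro b _ hb
      refine Finset.sum_eq_zero fun c _ => ?_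
      simp [hb]
    · simp

theorem one_sub_minusGL {q : K} (hq : q + q⁻¹ ≠ 0) : 1 - minusGL q N = plusGL q N := by
  rw [minusGL, plusGL]
  have : (1 : Matrix (Fin N × Fin N) (Fin N × Fin N) K) = (q + q⁻¹)⁻¹ • ((q + q⁻¹) • 1) := by
    rw [smul_smul, inv_mul_cancel₀ hq, one_smul]
  nth_rewrite 1 [this]
  rw [← smul_sub]
  congr 1
  module

/-- Up to a nonzero scalar, the row `(i, j)` with `i < j` reads `z j * z i + q z i * z j`, the row
with `i > j` is a multiple of the same relation, and a diagonal row is a multiple of a square. -/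
theorem quadRel_minusGL_iff {q : K} (hq0 : q ≠ 0) (hq : q + q⁻¹ ≠ 0) (z : Fin N → B) :
    QuadRel (minusGL q N) z ↔ RelGL q z := by
  rw [quadRel_iff, one_sub_minusGL hq]
  have key : ∀ i j, pairAct (fun h k => z h * z k) (i, j) (plusGL q N) = (q + q⁻¹)⁻¹ • (q⁻¹ • (z i * z j) +
      ((if i = j then q • (z i * z i) else 0) + (if i ≠ j then z j * z i else 0) +
        (if i < j then (q - q⁻¹) • (z i * z j) else 0))) := by
    intro i j
    rw [plusGL, map_smul, map_add, map_smul, pairAct_one, pairAct_braidGL]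
  constructor
  · intro h
    refine ⟨fun i => ?_, fun i j hij => ?_⟩
    · have h1 := h (i, i)
      rw [key, smul_eq_zero_iff_right (inv_ne_zero hq)] at h1
      simp only [if_true, ne_eq, not_true_eq_false, if_false, lt_irrefl, add_zero] at h1
      rw [← add_smul, smul_eq_zero_iff_right (by rwa [add_comm])] at h1
      exact h1
    · have h1 := h (i, j)
      rw [key, smul_eq_zero_iff_right (inv_ne_zero hq)] at h1
      simp only [hij.ne, ne_eq, not_false_eq_true, hij, if_true, if_false] at h1
      rw [neg_smul, eq_neg_iff_add_eq_zero, ← h1]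
      module
  · rintro h ⟨i, j⟩
    rw [key, smul_eq_zero_iff_right (inv_ne_zero hq)]
    rcases lt_trichotomy i j with hij | rfl | hij
    · simp only [hij.ne, ne_eq, not_false_eq_true, hij, if_true, if_false, h.comm i j hij]
      module
    · simp [h.sq]
    · simp only [hij.ne', ne_eq, not_false_eq_true, hij.not_gt, if_true, if_false, h.comm j i hij]
      rw [smul_smul, mul_neg, inv_mul_cancel₀ hq0]
      module

end LinearRelations

end QEpsilon

namespace QEpsilon

open scoped TensorProduct

universe v

/-! ### Rescaling of generators, geometric sums and the truncated `q`-binomial formula. -/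

section Tools

variable {K : Type*} [Field K] {N : ℕ} {Pm : Matrix (Fin N × Fin N) (Fin N × Fin N) K}

theorem scale_word {σ : ExtAlg Pm →ₐ[K] ExtAlg Pm} {t : Fin N → K}
    (hσ : ∀ c, σ (xi Pm c) = t c • xi Pm c) (L : List (Fin N)) :
    σ (word Pm L) = (L.map t).prod • word Pm L := by
  induction L with
  | nil => simp
  | cons c L ih => simp [ih, hσ, smul_smul, mul_comm]

/-- Rescaling the generators rescales the volume functional. -/
theorem IsVolume.scale {τ : ExtAlg Pm →ₗ[K] K} (h : IsVolume Pm τ)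
    {σ : ExtAlg Pm →ₐ[K] ExtAlg Pm} {t : Fin N → K}
    (hσ : ∀ c, σ (xi Pm c) = t c • xi Pm c) (a : ExtAlg Pm) : τ (σ a) = (∏ c, t c) * τ a := by
  have h1 := h.eq_smul_of_off (φ := τ ∘ₗ σ.toLinearMap) fun L hL => by
    simp [scale_word hσ, h.off L hL]
  have h2 : (τ ∘ₗ σ.toLinearMap) (xiProd Pm (fun k : Fin N => k)) = ∏ c, t c := by
    simp only [LinearMap.comp_apply, AlgHom.toLinearMap_apply, xiProd_eq_word, scale_word hσ,
      map_smul]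
    rw [← xiProd_eq_word, h.top, smul_eq_mul, mul_one, List.map_ofFn, List.prod_ofFn]
    rfl
  have := LinearMap.congr_fun h1 a
  rw [h2] at this
  simpa using this

/-- The geometric sum `1 + a + ⋯ + a^(l-1)`. -/
def geomSum (a : K) (l : ℕ) : K := ∑ i ∈ Finset.range l, a ^ i

@[simp] theorem geomSum_zero (a : K) : geomSum a 0 = 0 := by simp [geomSum]

theorem geomSum_succ (a : K) (l : ℕ) : geomSum a (l + 1) = 1 + a * geomSum a l := by
  simp only [geomSum, Finset.sum_range_succ', pow_succ', Finset.mul_sum]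
  simp [add_comm]

/-- Because `Y * Y = 0`, the `q`-binomial expansion stops after the linear term. For `l = 0` the
truncated exponent `l - 1` is harmless, the coefficient being zero. -/
theorem add_pow_of_skew {R : Type*} [Ring R] [Algebra K R] {T Y : R} {a : K}
    (h : Y * T = a • (T * Y)) (hY : Y * Y = 0) (l : ℕ) :
    (T + Y) ^ l = T ^ l + geomSum a l • (T ^ (l - 1) * Y) := by
  induction l with
  | zero => simp
  | succ l ih =>
    rw [pow_succ, ih, Nat.add_sub_cancel, geomSum_succ]
    cases l with
    | zero => simp
    | succ l =>
      simp only [Nat.add_sub_cancel]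
      have e1 : T ^ l * Y * T = a • (T ^ (l + 1) * Y) := by
        rw [mul_assoc, h, mul_smul_comm, ← mul_assoc, pow_succ]
      have e2 : T ^ l * Y * Y = 0 := by rw [mul_assoc, hY, mul_zero]
      rw [add_mul, mul_add, mul_add, smul_mul_assoc, smul_mul_assoc, e1, e2, ← pow_succ]
      module

theorem contract_mul_tmul {A : Type*} [Ring A] [Algebra K A] (τ : A →ₗ[K] K) (β a b : A)
    (Θ : A ⊗[K] A) : contract τ β (Θ * (a ⊗ₜ[K] b)) = contract τ (a * β) Θ * b := by
  induction Θ using TensorProduct.induction_on with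
  | zero => simp
  | tmul x y => simp [Algebra.TensorProduct.tmul_mul_tmul, mul_assoc]
  | add x y hx hy => rw [add_mul, map_add, map_add, hx, hy, add_mul]

theorem contract_smul_right {A : Type*} [Ring A] [Algebra K A] (τ : A →ₗ[K] K) (r : K) (β : A)
    (Θ : A ⊗[K] A) : contract τ (r • β) Θ = r • contract τ β Θ := by
  induction Θ using TensorProduct.induction_on with
  | zero => simp
  | tmul x y => simp [mul_smul]
  | add x y hx hy => rw [map_add, map_add, hx, hy, smul_add]

theorem contract_zero_right {A : Type*} [Ring A] [Algebra K A] (τ : A →ₗ[K] K)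
    (Θ : A ⊗[K] A) : contract τ 0 Θ = 0 := by
  simpa using contract_smul_right τ (0 : K) 0 Θ

end Tools

/-! ### Fock representation for `gl`. -/

section LinearFock

variable {K : Type v} [Field K] {q : K}

/-- A Fock representation of the relations of the `U_q gl(N)`-covariant exterior algebra. -/
theorem exists_fock_GL (hq : q ≠ 0) (N : ℕ) :
    ∃ (M : Type v) (_ : AddCommGroup M) (_ : Module K M) (_ : Module.Finite K M)
      (z : Fin N → Module.End K M) (w : M), RelGL q z ∧ Module.finrank K M = 2 ^ N ∧
      ∀ Q : Submodule K M, w ∈ Q → (∀ c, ∀ x ∈ Q, z c x ∈ Q) → Q = ⊤ := by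
  induction N with
  | zero =>
    refine ⟨K, inferInstance, inferInstance, inferInstance, Fin.elim0, 1,
      ⟨fun i => i.elim0, fun i => i.elim0⟩, by simp, fun Q h1 _ => ?_⟩
    rw [eq_top_iff]
    intro x _
    simpa using Q.smul_mem x h1
  | succ N ih =>
    obtain ⟨M, _, _, _, z, w, hz, hM, hcyc⟩ := ih
    -- The space `M × M` models `M` plus the new generator times `M`: the new generator moves the
    -- first copy to the second, and an old generator picks up `-q⁻¹` when it passes the new one.
    let old : Fin N → Module.End K (M × M) := fun i => (z i).prodMap (-q⁻¹ • z i)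
    let new : Module.End K (M × M) := LinearMap.inr K M M ∘ₗ LinearMap.fst K M M
    refine ⟨M × M, inferInstance, inferInstance, inferInstance,
      Fin.snoc (α := fun _ => Module.End K (M × M)) old new, (w, 0), ⟨?_, ?_⟩, ?_, ?_⟩
    · intro i
      induction i using Fin.lastCases with
      | last =>
        simp only [Fin.snoc_last]
        ext x <;> simp [new]
      | cast i =>
        simp only [Fin.snoc_castSucc]
        have h := fun x => LinearMap.congr_fun (hz.sq i) x
        simp only [Module.End.mul_apply, LinearMap.zero_apply] at h
        ext x <;> simp [old, h]
    · intro i j hij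
      induction j using Fin.lastCases with
      | last =>
        obtain ⟨i, rfl⟩ := Fin.exists_castSucc_eq.2 hij.ne
        simp only [Fin.snoc_last, Fin.snoc_castSucc]
        ext x <;> simp [new, old, smul_smul, hq]
      | cast j =>
        obtain ⟨i, rfl⟩ := Fin.exists_castSucc_eq.2 (hij.trans (Fin.castSucc_lt_last j)).ne
        simp only [Fin.snoc_castSucc]
        have h := fun x => LinearMap.congr_fun (hz.comm i j (by simpa using hij)) x
        simp only [Module.End.mul_apply, LinearMap.smul_apply] at h
        ext x
        · simp [old, h]
        · simp [old, h]
        · simp [old, h]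
        · simp only [old, LinearMap.coe_comp, LinearMap.coe_inr, Function.comp_apply,
            Module.End.mul_apply, LinearMap.prodMap_apply, LinearMap.smul_apply, map_smul, h,
            Prod.smul_mk]
          module
    · rw [Module.finrank_prod, hM, pow_succ]
      ring
    · intro Q hw hQ
      have hold : ∀ x ∈ Q, ∀ i, old i x ∈ Q := fun x hx i => by
        simpa using hQ i.castSucc x hx
      have hnew : ∀ x ∈ Q, new x ∈ Q := fun x hx => by
        simpa using hQ (Fin.last N) x hx
      have h0 : ∀ x : M, (x, (0 : M)) ∈ Q := by
        have : Q.comap (LinearMap.inl K M M) = ⊤ := by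
          apply hcyc
          · exact hw
          · intro c x hx
            simpa [old] using hold _ hx c
        intro x
        exact (this ▸ Submodule.mem_top : x ∈ Q.comap (LinearMap.inl K M M))
      rw [eq_top_iff]
      rintro ⟨x, y⟩ _
      have : (x, y) = (x, (0 : M)) + new (y, 0) := by simp [new]
      rw [this]
      exact Q.add_mem (h0 x) (hnew _ (h0 y))

theorem isTower_of_relGL {N : ℕ} {B : Type*} [Ring B] [Algebra K B] {z : Fin N → B} (hq : q ≠ 0)
    (hz : RelGL q z) (L : List (Fin N)) : IsTower K z L := by
  induction L with
  | nil => trivial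
  | cons c L ih =>
    refine ⟨⟨by rw [hz.sq]; exact zero_mem _, fun j _ => ?_⟩, ih⟩
    rcases lt_trichotomy j c with h | rfl | h
    · refine ⟨-q⁻¹, ?_⟩
      rw [hz.comm j c h, smul_smul]
      simp [hq]
    · exact ⟨1, by simp⟩
    · refine ⟨-q, ?_⟩
      rw [hz.comm c j h]
      simp

end LinearFock

/-! ### Cyclicity and the Hodge recursion for `gl`. -/

section LinearFrobenius

variable {K : Type v} [Field K] {q : K}

theorem relGL_xi (hq : q ≠ 0) (hq2 : q + q⁻¹ ≠ 0) (N : ℕ) : RelGL q (xi (minusGL q N)) :=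
  (quadRel_minusGL_iff hq hq2 _).1 (quadRel_xi _)

theorem exists_basis_GL (hq : q ≠ 0) (hq2 : q + q⁻¹ ≠ 0) (N : ℕ) :
    ∃ b : Module.Basis (Finset (Fin N)) K (ExtAlg (minusGL q N)),
      ∀ S, b S = word (minusGL q N) ((List.finRange N).filter (· ∈ S)) ∧
        ((List.finRange N).filter (· ∈ S)).length = S.card := by
  obtain ⟨M, _, _, _, z, w, hz, hM, hcyc⟩ := exists_fock_GL hq N
  refine exists_pbw_basis (List.finRange N) (List.Perm.refl _)
    (isTower_of_relGL hq (relGL_xi hq hq2 N) _) hM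
    (extLift z ((quadRel_minusGL_iff hq hq2 _).2 hz)) w fun Q h1 h2 => hcyc Q h1 ?_
  simpa using h2

theorem exists_volume_GL (hq : q ≠ 0) (hq2 : q + q⁻¹ ≠ 0) (N : ℕ) :
    ∃ τ : ExtAlg (minusGL q N) →ₗ[K] K, IsVolume (minusGL q N) τ := by
  obtain ⟨b, hb⟩ := exists_basis_GL hq hq2 N
  refine exists_isVolume b (fun S => ⟨_, (hb S).2, (hb S).1⟩) (κ := 1) one_ne_zero ?_
  rw [one_smul, (hb _).1, xiProd_eq_word]
  congr 1
  simp only [Finset.mem_univ, decide_true, List.filter_true]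
  exact List.ofFn_id N

/-- The case `i = j`, where both sides vanish, is included on purpose, so that `mul_prod_eq` applies
to any word. -/
theorem RelGL.mul_comm_scalar {N : ℕ} {B : Type*} [Ring B] [Algebra K B] {z : Fin N → B}
    (hq : q ≠ 0) (hz : RelGL q z) (i j : Fin N) :
    z j * z i = (if i < j then -q else -q⁻¹) • (z i * z j) := by
  rcases lt_trichotomy i j with h | rfl | h
  · rw [if_pos h, hz.comm i j h]
  · simp [hz.sq]
  · rw [if_neg h.not_gt, hz.comm j i h, smul_smul]
    simp [hq]

theorem RelGL.prod_mul_eq_zero {N : ℕ} {B : Type*} [Ring B] [Algebra K B] {z : Fin N → B}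
    (hq : q ≠ 0) (hz : RelGL q z) {j : Fin N} {L : List (Fin N)} (hj : j ∈ L) :
    (L.map z).prod * z j = 0 := by
  induction L with
  | nil => simp at hj
  | cons i L ih =>
    rw [List.map_cons, List.prod_cons, mul_assoc]
    by_cases h : j ∈ L
    · rw [ih h, mul_zero]
    · obtain rfl : j = i := by simpa [h] using hj
      have := mul_prod_eq z (z j) _ L fun i _ => hz.mul_comm_scalar hq i j
      rw [← mul_assoc, this, smul_mul_assoc, mul_assoc, hz.sq, mul_zero, smul_zero]

/-- With `j` counted from zero there are `j` smaller and `N - 1 - j` larger indices, and the two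
powers of `q` combine to `j - (N - 1 - j)`. -/
theorem prod_skew_scalar (hq : q ≠ 0) {N : ℕ} (j : Fin N) :
    ∏ i ∈ Finset.univ.erase j, (if i < j then -q else -q⁻¹ : K) =
      (-1) ^ (N - 1) * q ^ (2 * ((j : ℤ) + 1) - N - 1) := by
  have e1 : (Finset.univ.erase j).filter (fun i => i < j) = Finset.Iio j := by
    ext i; simp only [Finset.mem_filter, Finset.mem_erase, Finset.mem_univ, and_true,
      Finset.mem_Iio]; exact ⟨fun h => h.2, fun h => ⟨h.ne, h⟩⟩
  have e2 : (Finset.univ.erase j).filter (fun i => ¬ i < j) = Finset.Ioi j := by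
    ext i; simp only [Finset.mem_filter, Finset.mem_erase, Finset.mem_univ, and_true,
      Finset.mem_Ioi]
    exact ⟨fun h => lt_of_le_of_ne (not_lt.1 h.2) (Ne.symm h.1), fun h => ⟨h.ne', h.not_gt⟩⟩
  rw [Finset.prod_ite, Finset.prod_const, Finset.prod_const, e1, e2, Fin.card_Iio, Fin.card_Ioi]
  have hj := j.2
  obtain ⟨r, hr⟩ : ∃ r, N - 1 - (j : ℕ) = r := ⟨_, rfl⟩
  have hN : N - 1 = j + r := by omega
  have hN' : (N : ℤ) = j + r + 1 := by omega
  rw [hr, hN, neg_pow q, neg_pow q⁻¹, pow_add, hN',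
    show (2 * ((j : ℤ) + 1) - (j + r + 1) - 1) = (j : ℤ) - r by ring, zpow_sub₀ hq]
  simp only [zpow_natCast, inv_pow]
  field_simp

/-- On an ordered basis word both sides vanish if `j` occurs in it or if its length is not `N - 1`.
The only remaining word omits exactly `j`, and passing `ξ^j` through it produces the weight. -/
theorem cyc_GL (hq : q ≠ 0) (hq2 : q + q⁻¹ ≠ 0) {N : ℕ} {τ : ExtAlg (minusGL q N) →ₗ[K] K}
    (hτ : IsVolume (minusGL q N) τ) (j : Fin N) (α : ExtAlg (minusGL q N)) :
    τ (xi _ j * α) = (-1) ^ (N - 1) * q ^ (2 * ((j : ℤ) + 1) - N - 1) * τ (α * xi _ j) := by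
  obtain ⟨b, hb⟩ := exists_basis_GL hq hq2 N
  have hz := relGL_xi hq hq2 N
  suffices H : τ ∘ₗ LinearMap.mulLeft K (xi _ j) =
      ((-1) ^ (N - 1) * q ^ (2 * ((j : ℤ) + 1) - N - 1)) • τ ∘ₗ LinearMap.mulRight K (xi _ j) by
    simpa using LinearMap.congr_fun H α
  apply b.ext
  intro S
  simp only [LinearMap.comp_apply, LinearMap.mulLeft_apply, LinearMap.smul_apply,
    LinearMap.mulRight_apply, smul_eq_mul]
  obtain ⟨hS, hc⟩ := hb S
  rw [hS]
  set L := (List.finRange N).filter (· ∈ S) with hL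
  have hm := mul_prod_eq (xi (minusGL q N)) (xi _ j) _ L fun i _ => hz.mul_comm_scalar hq i j
  change xi _ j * word _ L = _ • (word _ L * xi _ j) at hm
  by_cases hjS : j ∈ S
  · have h0 : word (minusGL q N) L * xi _ j = 0 := hz.prod_mul_eq_zero hq (by simp [hL, hjS])
    rw [hm, h0]
    simp
  by_cases hcard : S.card = N - 1
  · have hSe : S = Finset.univ.erase j := by
      apply Finset.eq_of_subset_of_card_le
      · intro i hi
        simp only [Finset.mem_erase, Finset.mem_univ, and_true]
        rintro rfl
        exact hjS hi
      · rw [Finset.card_erase_of_mem (Finset.mem_univ _), Finset.card_univ, Fintype.card_fin, hcard]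
    rw [hm, map_smul, smul_eq_mul, ← prod_skew_scalar hq j, ← hSe,
      ← List.prod_toFinset _ ((List.nodup_finRange N).filter _)]
    congr 2
    ext i
    simp
  · rw [hm, map_smul]
    have : word (minusGL q N) L * xi _ j = word _ (L ++ [j]) := by simp [word_append]
    rw [this, hτ.off]
    · simp
    · have := j.2
      simp [hc]
      omega

/-- The embedding forgetting the last generator. -/
noncomputable def inclGL (hq : q ≠ 0) (hq2 : q + q⁻¹ ≠ 0) (N : ℕ) :
    ExtAlg (minusGL q N) →ₐ[K] ExtAlg (minusGL q (N + 1)) :=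
  extLift (fun i => xi _ i.castSucc) ((quadRel_minusGL_iff hq hq2 _).2
    ⟨fun i => (relGL_xi hq hq2 _).sq _, fun i j hij => (relGL_xi hq hq2 _).comm _ _ (by simpa)⟩)

variable (hq : q ≠ 0) (hq2 : q + q⁻¹ ≠ 0) {N : ℕ}

theorem inclGL_word (L : List (Fin N)) :
    inclGL hq hq2 N (word _ L) = word _ (L.map Fin.castSucc) := by
  induction L with
  | nil => simp
  | cons c L ih =>
    rw [word_cons, map_mul, ih, inclGL, extLift_xi, List.map_cons, word_cons]

theorem last_mul_inclGL {m : ℕ} {β : ExtAlg (minusGL q N)} (hβ : β ∈ deg (minusGL q N) m) :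
    xi _ (Fin.last N) * inclGL hq hq2 N β = (-q) ^ m • (inclGL hq hq2 N β * xi _ (Fin.last N)) := by
  refine eqOn_deg (f := LinearMap.mulLeft K (xi _ (Fin.last N)) ∘ₗ (inclGL hq hq2 N).toLinearMap)
    (g := (-q) ^ m • (LinearMap.mulRight K (xi _ (Fin.last N)) ∘ₗ (inclGL hq hq2 N).toLinearMap))
    (fun L hL => ?_) hβ
  have := mul_prod_eq (fun i : Fin N => xi (minusGL q (N + 1)) i.castSucc) (xi _ (Fin.last N))
    (fun _ => -q) L fun i _ => (relGL_xi hq hq2 _).comm _ _ (Fin.castSucc_lt_last i)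
  simp only [LinearMap.comp_apply, AlgHom.toLinearMap_apply, LinearMap.mulLeft_apply,
    LinearMap.smul_apply, LinearMap.mulRight_apply, inclGL_word]
  rw [word, List.map_map]
  simpa [hL, Function.comp_def] using this

theorem theta_succ_GL :
    theta (minusGL q (N + 1)) =
      Algebra.TensorProduct.map (inclGL hq hq2 N) (inclGL hq hq2 N) (theta (minusGL q N)) +
        xi _ (Fin.last N) ⊗ₜ[K] xi _ (Fin.last N) := by
  simp [theta, Fin.sum_univ_castSucc, map_sum, inclGL]

theorem contract_map_inclGL (τ : ExtAlg (minusGL q (N + 1)) →ₗ[K] K) (β : ExtAlg (minusGL q N))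
    (w : ExtAlg (minusGL q (N + 1))) (Θ : ExtAlg (minusGL q N) ⊗[K] ExtAlg (minusGL q N)) :
    contract τ (inclGL hq hq2 N β * w)
      (Algebra.TensorProduct.map (inclGL hq hq2 N) (inclGL hq hq2 N) Θ) =
    inclGL hq hq2 N
      (contract (τ ∘ₗ LinearMap.mulRight K w ∘ₗ (inclGL hq hq2 N).toLinearMap) β Θ) := by
  induction Θ using TensorProduct.induction_on with
  | zero => simp
  | tmul x y => simp [mul_assoc]
  | add x y hx hy => rw [map_add, map_add, map_add, map_add, hx, hy]

variable {τ : ExtAlg (minusGL q (N + 1)) →ₗ[K] K} {τ' : ExtAlg (minusGL q N) →ₗ[K] K}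

/-- The volume word ends in the last generator, so appending that letter recovers the volume
functional of the smaller algebra. -/
theorem volume_comp_inclGL_mul (hτ : IsVolume (minusGL q (N + 1)) τ)
    (hτ' : IsVolume (minusGL q N) τ') :
    τ ∘ₗ LinearMap.mulRight K (xi _ (Fin.last N)) ∘ₗ (inclGL hq hq2 N).toLinearMap = τ' := by
  have hw : ∀ L : List (Fin N), inclGL hq hq2 N (word _ L) * xi _ (Fin.last N) =
      word _ (L.map Fin.castSucc ++ [Fin.last N]) := by
    intro L
    simp [inclGL_word, word_append]
  have h1 := hτ'.eq_smul_of_off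
    (φ := τ ∘ₗ LinearMap.mulRight K (xi _ (Fin.last N)) ∘ₗ (inclGL hq hq2 N).toLinearMap) ?_
  · rw [h1]
    convert one_smul K τ'
    simp only [LinearMap.comp_apply, AlgHom.toLinearMap_apply, LinearMap.mulRight_apply,
      xiProd_eq_word, hw]
    rw [← hτ.top, xiProd_eq_word, List.ofFn_succ']
    simp [List.concat_eq_append, List.map_ofFn]
    rfl
  · intro L hL
    simp only [LinearMap.comp_apply, AlgHom.toLinearMap_apply, LinearMap.mulRight_apply, hw]
    exact hτ.off _ (by simpa using hL)

/-- Scaling only the last generator by `q` fixes the image of the inclusion but multiplies `τ` by `q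
≠ 1`. -/
theorem volume_comp_inclGL (hq1 : q ≠ 1) (hτ : IsVolume (minusGL q (N + 1)) τ) :
    τ ∘ₗ LinearMap.mulRight K 1 ∘ₗ (inclGL hq hq2 N).toLinearMap = 0 := by
  let t : Fin (N + 1) → K := Fin.snoc (α := fun _ => K) (fun _ => 1) q
  have hz := relGL_xi hq hq2 (N + 1)
  have hrel : RelGL q (fun i => t i • xi (minusGL q (N + 1)) i) := by
    refine ⟨fun i => by simp [hz.sq], fun i j hij => ?_⟩
    simp only [smul_mul_smul_comm, hz.comm i j hij]
    module
  let σ := extLift _ ((quadRel_minusGL_iff hq hq2 _).2 hrel)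
  have hσ : ∀ c, σ (xi _ c) = t c • xi _ c := fun c => extLift_xi _ _ c
  have hfix : ∀ L : List (Fin N), σ (inclGL hq hq2 N (word _ L)) = inclGL hq hq2 N (word _ L) := by
    intro L
    rw [inclGL_word, scale_word hσ]
    have : (List.map t (List.map Fin.castSucc L)).prod = 1 := by
      rw [List.map_map]
      apply List.prod_eq_one
      simp [t]
    rw [this, one_smul]
  apply linearMap_ext_word
  intro L
  have h1 := hτ.scale hσ (inclGL hq hq2 N (word _ L))
  rw [hfix, Fin.prod_univ_castSucc] at h1
  simp only [t, Fin.snoc_castSucc, Fin.snoc_last, Finset.prod_const_one, one_mul] at h1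
  have h2 : (q - 1) * τ (inclGL hq hq2 N (word _ L)) = 0 := by linear_combination -h1
  simpa [sub_ne_zero.2 hq1] using h2

/-- The last summand of `theta` passes the others with the factor `(-q) ^ 2`, one `-q` from each
leg, and it squares to zero. -/
theorem theta_pow_succ_GL (l : ℕ) :
    theta (minusGL q (N + 1)) ^ l =
      Algebra.TensorProduct.map (inclGL hq hq2 N) (inclGL hq hq2 N) (theta (minusGL q N) ^ l) +
        geomSum (q ^ 2) l •
          (Algebra.TensorProduct.map (inclGL hq hq2 N) (inclGL hq hq2 N)
            (theta (minusGL q N) ^ (l - 1)) * (xi _ (Fin.last N) ⊗ₜ[K] xi _ (Fin.last N))) := by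
  have hz := relGL_xi hq hq2 (N + 1)
  rw [theta_succ_GL hq hq2, map_pow, map_pow]
  refine add_pow_of_skew
    (R := ExtAlg (minusGL q (N + 1)) ⊗[K] ExtAlg (minusGL q (N + 1))) (a := q ^ 2) ?_ ?_ l
  · simp only [theta, map_sum, Algebra.TensorProduct.map_tmul, Finset.mul_sum, Finset.sum_mul,
      Finset.smul_sum, Algebra.TensorProduct.tmul_mul_tmul]
    refine Finset.sum_congr rfl fun i _ => ?_
    simp only [inclGL, extLift_xi, hz.comm _ _ (Fin.castSucc_lt_last i)]
    rw [TensorProduct.smul_tmul_smul]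
    congr 1
    ring
  · rw [Algebra.TensorProduct.tmul_mul_tmul, hz.sq, TensorProduct.zero_tmul]

/-- The linear term of the expansion meets the last generator a second time and drops out. -/
theorem hodge_incl_mul_last (hτ : IsVolume (minusGL q (N + 1)) τ)
    (hτ' : IsVolume (minusGL q N) τ') {m : ℕ} {β : ExtAlg (minusGL q N)}
    (hβ : β ∈ deg (minusGL q N) m) (l : ℕ) :
    hodge τ l (inclGL hq hq2 N β * xi _ (Fin.last N)) = inclGL hq hq2 N (hodge τ' l β) := by
  have h0 : xi _ (Fin.last N) * (inclGL hq hq2 N β * xi _ (Fin.last N)) = 0 := by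
    rw [← mul_assoc, last_mul_inclGL hq hq2 hβ, smul_mul_assoc, mul_assoc,
      (relGL_xi hq hq2 (N + 1)).sq, mul_zero, smul_zero]
  rw [hodge_eq_contract, theta_pow_succ_GL hq hq2, map_add, map_smul, contract_mul_tmul, h0,
    contract_zero_right, zero_mul, smul_zero, add_zero, contract_map_inclGL,
    volume_comp_inclGL_mul hq hq2 hτ hτ', ← hodge_eq_contract]

/-- Here the constant term drops out, because `τ` kills the image of the inclusion, and the linear
term survives with its geometric sum. -/
theorem hodge_incl (hq1 : q ≠ 1) (hτ : IsVolume (minusGL q (N + 1)) τ)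
    (hτ' : IsVolume (minusGL q N) τ') {m : ℕ} {β : ExtAlg (minusGL q N)}
    (hβ : β ∈ deg (minusGL q N) m) (l : ℕ) :
    hodge τ l (inclGL hq hq2 N β) = ((-q) ^ m * geomSum (q ^ 2) l) •
      (inclGL hq hq2 N (hodge τ' (l - 1) β) * xi _ (Fin.last N)) := by
  have h1 : contract τ (inclGL hq hq2 N β) (Algebra.TensorProduct.map (inclGL hq hq2 N)
      (inclGL hq hq2 N) (theta (minusGL q N) ^ l)) = 0 := by
    have := contract_map_inclGL hq hq2 τ β 1 (theta (minusGL q N) ^ l)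
    rw [volume_comp_inclGL hq hq2 hq1 hτ, mul_one] at this
    rw [this]
    have h0 : contract (0 : ExtAlg (minusGL q N) →ₗ[K] K) β (theta (minusGL q N) ^ l) = 0 := by
      rw [← hodge_eq_contract, hodge_apply]
      simp
    rw [h0, map_zero]
  rw [hodge_eq_contract, theta_pow_succ_GL hq hq2, map_add, map_smul, contract_mul_tmul, h1,
    last_mul_inclGL hq hq2 hβ, contract_smul_right, contract_map_inclGL,
    volume_comp_inclGL_mul hq hq2 hτ hτ', ← hodge_eq_contract, zero_add, smul_mul_assoc, smul_smul,
    mul_comm]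

/-- The clause for the empty word repairs the truncated subtraction `L.length - 1`, which would
otherwise allow a nonzero `w₂` of degree zero. -/
theorem word_decomp_GL (L : List (Fin (N + 1))) :
    ∃ w₁ ∈ deg (minusGL q N) L.length, ∃ w₂ : ExtAlg (minusGL q N),
      (L = [] → w₂ = 0) ∧ w₂ ∈ deg (minusGL q N) (L.length - 1) ∧
      word (minusGL q (N + 1)) L =
        inclGL hq hq2 N w₁ + inclGL hq hq2 N w₂ * xi _ (Fin.last N) := by
  induction L with
  | nil => exact ⟨1, one_mem_deg, 0, fun _ => rfl, zero_mem _, by simp⟩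
  | cons c L ih =>
    obtain ⟨w₁, h₁, w₂, h0, h₂, e⟩ := ih
    rw [word_cons, e]
    induction c using Fin.lastCases with
    | last =>
      refine ⟨0, zero_mem _, (-q) ^ L.length • w₁, by simp, Submodule.smul_mem _ _ h₁, ?_⟩
      rw [mul_add, ← mul_assoc, last_mul_inclGL hq hq2 h₁, last_mul_inclGL hq hq2 h₂,
        smul_mul_assoc, mul_assoc, (relGL_xi hq hq2 (N + 1)).sq]
      simp
    | cast c =>
      have hι : inclGL hq hq2 N (xi _ c) = xi _ c.castSucc := by simp [inclGL]
      refine ⟨xi _ c * w₁, ?_, xi _ c * w₂, by simp, ?_, ?_⟩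
      · rw [List.length_cons, add_comm]
        exact mul_mem_deg (xi_mem_deg c) h₁
      · cases L with
        | nil => rw [h0 rfl, mul_zero]; exact zero_mem _
        | cons d L =>
          rw [List.length_cons, List.length_cons, Nat.add_sub_cancel, add_comm]
          exact mul_mem_deg (xi_mem_deg c) h₂
      · rw [map_mul, map_mul, hι, mul_add, mul_assoc]

end LinearFrobenius

end QEpsilon

namespace QEpsilon

open scoped TensorProduct

universe v

/-! ### `q`-numbers away from roots of unity. -/

section QNumbers

variable {K : Type*} [Field K] {q : K}

theorem qFactorial_succ (q : K) (n : ℕ) :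
    qFactorial q (n + 1) = qFactorial q n * qNum q (n + 1) := Finset.prod_range_succ _ _

@[simp] theorem qFactorial_zero (q : K) : qFactorial q 0 = 1 := by simp [qFactorial]

/-- If the sum vanished, `q ^ 2 = -1` and `q` would be a fourth root of unity. -/
theorem ne_zero_of_pow_ne_one {q : K} (hq : q ≠ 0) (h : ∀ r : ℕ, 1 ≤ r → q ^ r ≠ 1) :
    q + q⁻¹ ≠ 0 := by
  intro h0
  apply h 4 (by norm_num)
  have h1 : q ^ 2 = -1 := by
    have : q * (q + q⁻¹) = 0 := by rw [h0, mul_zero]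
    rw [mul_add, mul_inv_cancel₀ hq] at this
    linear_combination this
  rw [show q ^ 4 = (q ^ 2) ^ 2 by ring, h1]
  norm_num

theorem sub_inv_ne_zero {q : K} (hq : q ≠ 0) (h : ∀ r : ℕ, 1 ≤ r → q ^ r ≠ 1) :
    q - q⁻¹ ≠ 0 := by
  intro h0
  apply h 2 (by norm_num)
  have : q * (q - q⁻¹) = 0 := by rw [h0, mul_zero]
  rw [mul_sub, mul_inv_cancel₀ hq] at this
  linear_combination this

theorem qNum_ne_zero (hq : q ≠ 0) (h : ∀ r : ℕ, 1 ≤ r → q ^ r ≠ 1) {n : ℕ} (hn : 1 ≤ n) :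
    qNum q n ≠ 0 := by
  refine div_ne_zero ?_ (sub_inv_ne_zero hq h)
  intro h0
  apply h (2 * n) (by omega)
  rw [zpow_neg, zpow_natCast] at h0
  have h1 : q ^ n * (q ^ n - (q ^ n)⁻¹) = 0 := by rw [h0, mul_zero]
  rw [mul_sub, mul_inv_cancel₀ (pow_ne_zero n hq)] at h1
  linear_combination h1

theorem qFactorial_ne_zero (hq : q ≠ 0) (h : ∀ r : ℕ, 1 ≤ r → q ^ r ≠ 1) (n : ℕ) :
    qFactorial q n ≠ 0 :=
  Finset.prod_ne_zero_iff.2 fun _ _ => qNum_ne_zero hq h (by omega)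

theorem geomSum_sq (hq : q ≠ 0) (h : ∀ r : ℕ, 1 ≤ r → q ^ r ≠ 1) (l : ℕ) :
    q * geomSum (q ^ 2) l = q ^ l * qNum q l := by
  have h1 : geomSum (q ^ 2) l * (q ^ 2 - 1) = (q ^ 2) ^ l - 1 := geom_sum_mul (q ^ 2) l
  have h2 := sub_inv_ne_zero hq h
  rw [qNum, zpow_neg, zpow_natCast, ← mul_div_assoc, eq_div_iff h2]
  have e1 : q ^ l * (q ^ l - (q ^ l)⁻¹) = (q ^ 2) ^ l - 1 := by
    rw [mul_sub, mul_inv_cancel₀ (pow_ne_zero l hq)]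
    ring
  rw [e1, ← h1]
  field_simp

theorem geomSum_sq_succ (hq : q ≠ 0) (h : ∀ r : ℕ, 1 ≤ r → q ^ r ≠ 1) (l : ℕ) :
    geomSum (q ^ 2) (l + 1) = q ^ l * qNum q (l + 1) := by
  apply mul_left_cancel₀ hq
  rw [geomSum_sq hq h]
  ring

end QNumbers

/-! ### The square of the Hodge map and the theorem for `gl`. -/

section LinearCase

variable {K : Type v} [Field K] {q : K}

/-- The eigenvalues of the square of the Hodge map, for `U_q gl(N)`. -/
def hodgeConstGL (q : K) (N m : ℕ) : K :=
  (-1) ^ (m * (N - m)) * q ^ N.choose 2 * qFactorial q m * qFactorial q (N - m)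

/-- The factors `q ^ m` and `q ^ l` of the recursion multiply to `q ^ (l + m)`, the increment of the
power `q ^ N.choose 2`. -/
theorem hodgeConstGL_succ (hq : q ≠ 0) (h : ∀ r : ℕ, 1 ≤ r → q ^ r ≠ 1) (l m : ℕ) :
    hodgeConstGL q (l + m + 1) (l + 1) =
      (-q) ^ m * geomSum (q ^ 2) (l + 1) * hodgeConstGL q (l + m) l := by
  rw [hodgeConstGL, hodgeConstGL, geomSum_sq_succ hq h, show l + m + 1 - (l + 1) = m by omega,
    show l + m - l = m by omega, qFactorial_succ, Nat.choose_succ_succ' (l + m) 1,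
    Nat.choose_one_right, neg_pow q]
  ring

theorem hodgeConstGL_succ' (hq : q ≠ 0) (h : ∀ r : ℕ, 1 ≤ r → q ^ r ≠ 1) (l m : ℕ) :
    hodgeConstGL q (l + m + 1) l =
      (-q) ^ l * geomSum (q ^ 2) (m + 1) * hodgeConstGL q (l + m) l := by
  rw [hodgeConstGL, hodgeConstGL, geomSum_sq_succ hq h, show l + m + 1 - l = m + 1 by omega,
    show l + m - l = m by omega, qFactorial_succ, Nat.choose_succ_succ' (l + m) 1,
    Nat.choose_one_right, neg_pow q]
  ring

/-- A word splits into a part without the last generator and a part ending in it. On each part, one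
of the two Hodge maps appends the last generator and the other removes it, so the constant is
multiplied exactly once by the factor of `hodge_incl`. -/
theorem hodge_hodge_GL (hq : q ≠ 0) (h : ∀ r : ℕ, 1 ≤ r → q ^ r ≠ 1) (N : ℕ)
    {τ : ExtAlg (minusGL q N) →ₗ[K] K} (hτ : IsVolume (minusGL q N) τ) (l m : ℕ) (hlm : l + m = N)
    (a : ExtAlg (minusGL q N)) (ha : a ∈ deg (minusGL q N) l) :
    hodge τ l (hodge τ m a) = hodgeConstGL q N l • a := by
  have hq2 := ne_zero_of_pow_ne_one hq h
  have hq1 : q ≠ 1 := by simpa using h 1 le_rfl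
  induction N generalizing l m with
  | zero =>
    obtain ⟨rfl, rfl⟩ : l = 0 ∧ m = 0 := by omega
    refine eqOn_deg (f := hodge τ 0 ∘ₗ hodge τ 0) (g := hodgeConstGL q 0 0 • LinearMap.id)
      (fun L hL => ?_) ha
    obtain rfl := List.length_eq_zero_iff.1 hL
    have h1 := hτ.top
    simp only [xiProd_zero] at h1
    simp [hodge_apply, h1, hodgeConstGL]
  | succ N ih =>
    obtain ⟨τ', hτ'⟩ := exists_volume_GL hq hq2 N
    refine eqOn_deg (f := hodge τ l ∘ₗ hodge τ m)
      (g := hodgeConstGL q (N + 1) l • LinearMap.id) (fun L hL => ?_) ha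
    obtain ⟨w₁, h₁, w₂, h0, h₂, e⟩ := word_decomp_GL hq hq2 L
    rw [hL] at h₁ h₂
    simp only [LinearMap.comp_apply, LinearMap.smul_apply, LinearMap.id_apply, e, map_add]
    congr 1
    · cases m with
      | zero =>
        -- For `m = 0` the part without the last generator has degree `N + 1` in an algebra whose
        -- top degree is `N`, so it vanishes.
        obtain ⟨b, hb⟩ := exists_basis_GL hq hq2 N
        have : w₁ = 0 := eq_zero_of_mem_deg b (fun S => ⟨_, (hb S).2, (hb S).1⟩)
          (by omega : N < l) h₁
        simp [this]
      | succ m =>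
        obtain rfl : l + m = N := by omega
        rw [hodge_incl hq hq2 hq1 hτ hτ' h₁, map_smul, Nat.add_sub_cancel,
          hodge_incl_mul_last hq hq2 hτ hτ' (hodge_mem_deg τ' m w₁), ih hτ' l m rfl w₁ h₁,
          map_smul, smul_smul, hodgeConstGL_succ' hq h]
    · cases l with
      | zero =>
        rw [h0 (List.length_eq_zero_iff.1 hL)]
        simp
      | succ l =>
        rw [Nat.add_sub_cancel] at h₂
        obtain rfl : l + m = N := by omega
        rw [hodge_incl_mul_last hq hq2 hτ hτ' h₂,
          hodge_incl hq hq2 hq1 hτ hτ' (hodge_mem_deg τ' m w₂), Nat.add_sub_cancel,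
          ih hτ' l m rfl w₂ h₂, map_smul, smul_mul_assoc, smul_smul, hodgeConstGL_succ hq h]

theorem isFrobenius_GL (hq : q ≠ 0) (h : ∀ r : ℕ, 1 ≤ r → q ^ r ≠ 1) (N : ℕ) :
    ∃ τ, IsFrobenius (minusGL q N) (fun j => q ^ (2 * ((j : ℤ) + 1) - N - 1)) τ
      (hodgeConstGL q N) := by
  have hq2 := ne_zero_of_pow_ne_one hq h
  obtain ⟨τ, hτ⟩ := exists_volume_GL hq hq2 N
  obtain ⟨b, hb⟩ := exists_basis_GL hq hq2 N
  exact ⟨τ, hτ, cyc_GL hq hq2 hτ,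
    fun l m hlm I => hodge_hodge_GL hq h N hτ l m hlm _ (xiProd_mem_deg I),
    b, fun S => ⟨_, (hb S).2, (hb S).1⟩⟩

theorem transpose_kronecker_e {N : ℕ} (a b c d : Fin N) :
    ((e a b : Matrix (Fin N) (Fin N) K) ⊗ₖ e c d).transpose = e b a ⊗ₖ e d c := by
  ext ⟨i, j⟩ ⟨k, l⟩
  simp [e, Matrix.single_apply, and_comm]

theorem braidGL_transpose (q : K) (N : ℕ) : (braidGL q N).transpose = braidGL q N := by
  simp only [braidGL, Matrix.transpose_add, Matrix.transpose_smul, Matrix.transpose_sum,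
    transpose_kronecker_e]
  congr 2
  simp only [Finset.sum_filter]
  rw [Finset.sum_comm]
  simp only [ne_comm]

theorem minusGL_transpose (q : K) (N : ℕ) : (minusGL q N).transpose = minusGL q N := by
  simp only [minusGL, Matrix.transpose_sub, Matrix.transpose_smul, Matrix.transpose_one,
    braidGL_transpose]

theorem epsilon_antisymmetrizer_GL [CharZero K] (N : ℕ) (q : K) (hq : q ≠ 0)
    (h : ∀ r : ℕ, 1 ≤ r → q ^ r ≠ 1) (γ : K) (hγ : γ ≠ 0) :
    (∃! ε : (Fin N → Fin N) → K, IsEpsilon (minusGL q N) γ ε) ∧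
      ∀ ε : (Fin N → Fin N) → K, IsEpsilon (minusGL q N) γ ε →
        (∑ a : Fin N → Fin N, ε a ^ 2) ≠ 0 ∧
        ∀ (l m : ℕ) (h : l + m = N),
          dGL q ε l = dGL q ε m ∧
          (∃! P : Matrix (Fin l → Fin N) (Fin l → Fin N) K,
            IsAntisymmetrizer (minusGL q N) {plusGL q N} l P) ∧
          ∀ P : Matrix (Fin l → Fin N) (Fin l → Fin N) K,
            IsAntisymmetrizer (minusGL q N) {plusGL q N} l P →
            ∀ i j : Fin l → Fin N,
              P i j = dGL q ε l *
                ∑ k : Fin l → Fin N, ∑ a : Fin m → Fin N,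
                  (∏ t : Fin l, uGL q N (k t) (j t)) *
                    ε (cat ((add_comm m l).trans h) a i) *
                    ε (cat ((add_comm m l).trans h) a k) ∧
              P i j = (-1) ^ (l * (N - 1)) * dGL q ε l *
                ∑ a : Fin m → Fin N,
                  ε (cat h j a) * ε (cat ((add_comm m l).trans h) a i) := by
  obtain ⟨τ, hτ⟩ := isFrobenius_GL hq h N
  refine ⟨existsUnique_isEpsilon hτ.vol hγ, fun ε hε => ?_⟩
  rw [isEpsilon_iff hτ.vol hγ] at hε
  have hf := qFactorial_ne_zero hq h
  have hsum : ∑ a : Fin N → Fin N, ε a ^ 2 = γ ^ 2 * (q ^ N.choose 2 * qFactorial q N) := by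
    have := hτ.sum_sq
    simp only [hε, mul_pow, ← Finset.mul_sum]
    rw [this]
    simp [hodgeConstGL]
  have hsum0 : ∑ a : Fin N → Fin N, ε a ^ 2 ≠ 0 := by
    rw [hsum]
    exact mul_ne_zero (pow_ne_zero _ hγ) (mul_ne_zero (pow_ne_zero _ hq) (hf N))
  refine ⟨hsum0, fun l m hlm => ?_⟩
  -- The constant `d_l` is the inverse of the scalar by which the Gram matrix, formed with `ε`
  -- instead of `τ` (hence `γ ^ 2`), acts on fixed vectors.
  have hd : dGL q ε l * γ ^ 2 * ((-1) ^ (m * (N - 1)) * hodgeConstGL q N l) = 1 := by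
    have hsign : (-1 : K) ^ (m * (N - 1)) * (-1) ^ (l * m) = 1 := by
      rw [← pow_add]
      apply Even.neg_one_pow
      rcases Nat.eq_zero_or_pos m with rfl | hm
      · simp
      · obtain ⟨m, rfl⟩ : ∃ k, m = k + 1 := ⟨m - 1, by omega⟩
        rw [show N - 1 = l + m by omega,
          show (m + 1) * (l + m) + l * (m + 1) = 2 * (l * (m + 1)) + m * (m + 1) by ring]
        exact (even_two_mul _).add (Nat.even_mul_succ_self m)
    have hNl : N - l = m := by omega
    rw [dGL, dZero, hsum, hodgeConstGL, hNl]
    have h1 := hf l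
    have h2 := hf m
    have h3 := hf N
    have h4 := pow_ne_zero (N.choose 2) hq
    rw [show ∀ x y z w : K, x * ((y * z * w * qFactorial q m)) = (x * y) * (z * w * qFactorial q m)
      by intros; ring, hsign]
    field_simp
  have hothers : ∀ M ∈ ({plusGL q N} : Set (Matrix (Fin N × Fin N) (Fin N × Fin N) K)),
      (∃ X, M = X * (1 - minusGL q N)) ∧ ∃ X, M = (1 - minusGL q N) * X := by
    rintro _ rfl
    rw [one_sub_minusGL (ne_zero_of_pow_ne_one hq h)]
    exact ⟨⟨1, by simp⟩, 1, by simp⟩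
  refine ⟨?_, ?_, fun P hP i j => ?_⟩
  · rw [dGL, dGL, show N - l = m by omega, show N - m = l by omega, mul_comm (qFactorial q l)]
  · exact hτ.existsUnique_antisymmetrizer (minusGL_transpose q N) hothers hlm hd
  · exact hτ.antisymmetrizer_formulas (minusGL_transpose q N) hothers hlm hd hε hP i j

end LinearCase

end QEpsilon

namespace QEpsilon

open scoped TensorProduct

universe v

/-! ### Rows of the braid matrix for `so` and partial sums over opposite pairs. -/

section OrthogonalBraid

variable {K : Type*} [Field K] {N : ℕ} {V : Type*} [AddCommGroup V] [Module K V]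

theorem pairAct_braidSO (s : K) (w : Fin N → Fin N → V) (a b : Fin N) :
    pairAct w (a, b) (braidSO s N) =
      (if a = b ∧ a ≠ a.rev then s ^ 2 • w a a else 0) +
      (if (b ≠ a ∧ b ≠ a.rev) ∨ (b = a.rev ∧ a = a.rev) then w b a else 0) +
      (if a = b.rev ∧ b ≠ b.rev then (s ^ 2)⁻¹ • w b b.rev else 0) +
      (s ^ 2 - (s ^ 2)⁻¹) • ((if a < b then w a b else 0) -
        if a = b.rev then
          ∑ i : Fin N with i < b, s ^ (-twoRho i + twoRho b) • w i i.rev else 0) := by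
  rw [braidSO, map_add, map_add, map_add, map_smul, map_smul, map_smul, map_sub, map_sum, map_sum,
    map_sum, map_sum, map_sum]
  simp only [map_sum, map_smul, pairAct_kronecker]
  simp only [Finset.sum_filter]
  congr 1
  · congr 1
    · congr 1
      · rw [Finset.sum_eq_single a]
        · by_cases h1 : a = b <;> by_cases h2 : a = a.rev <;> simp [h1]
        · intro i _ hi
          simp [hi]
        · simp
      · rw [Finset.sum_eq_single b]
        · rw [Finset.sum_eq_single a]
          · simp
          · intro i _ hi
            simp [hi]
          · simp
        · intro i _ hi
          exact Finset.sum_eq_zero fun j _ => by simp [hi]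
        · simp
    · rw [Finset.sum_eq_single b]
      · by_cases h2 : b = b.rev
        · rw [if_neg (not_not.2 h2), if_neg (fun h => h.2 h2), smul_zero]
        · by_cases h1 : a = b.rev
          · rw [if_pos h2, if_pos ⟨h1.symm, rfl⟩, if_pos ⟨h1, h2⟩]
          · rw [if_pos h2, if_neg (fun h => h1 h.1.symm), if_neg (fun h => h1 h.1), smul_zero]
      · intro i _ hi
        simp [hi]
      · simp
  · congr 2
    · rw [Finset.sum_eq_single a]
      · rw [Finset.sum_eq_single b]
        · simp
        · intro i _ hi
          simp [hi]
        · simp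
      · intro i _ hi
        exact Finset.sum_eq_zero fun j _ => by simp [hi]
      · simp
    · rw [Finset.sum_comm, Finset.sum_eq_single b]
      · by_cases h : a = b.rev
        · simp [h]
        · simp [h, Ne.symm h]
      · intro i _ hi
        exact Finset.sum_eq_zero fun j _ => by simp [hi]
      · simp

/-- The numbers `2ρ_j`, as a function of a natural number. -/
def rhoNat (N i : ℕ) : ℤ :=
  if 2 * i + 1 < N then (N : ℤ) - 2 - 2 * i else if 2 * i + 1 = N then 0 else (N : ℤ) - 2 * i

theorem twoRho_eq (j : Fin N) : twoRho j = rhoNat N j := by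
  have := j.2
  simp only [twoRho, rhoNat, Fin.lt_def, Fin.val_rev]
  split_ifs <;> omega

theorem twoRho_rev (j : Fin N) : twoRho j.rev = -twoRho j := by
  have := j.2
  simp only [twoRho_eq, rhoNat, Fin.val_rev]
  split_ifs <;> omega

/-- Extension of a family by zero. -/
def extendZero (f : Fin N → V) (i : ℕ) : V := if h : i < N then f ⟨i, h⟩ else 0

@[simp] theorem extendZero_val (f : Fin N → V) (i : Fin N) : extendZero f i = f i := by
  simp [extendZero]

/-- The partial sums `∑_{i<b} q^{-ρ_i} F_i`. -/
def rhoSum (s : K) (N : ℕ) (F : ℕ → V) (b : ℕ) : V :=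
  ∑ i ∈ Finset.range b, s ^ (-rhoNat N i) • F i

theorem rhoSum_succ (s : K) (F : ℕ → V) (b : ℕ) :
    rhoSum s N F (b + 1) = rhoSum s N F b + s ^ (-rhoNat N b) • F b :=
  Finset.sum_range_succ _ _

@[simp] theorem rhoSum_zero (s : K) (F : ℕ → V) : rhoSum s N F 0 = 0 := Finset.sum_range_zero _

theorem sum_lt_eq_rhoSum (s : K) (f : Fin N → V) (b : Fin N) :
    ∑ i : Fin N with i < b, s ^ (-twoRho i) • f i = rhoSum s N (extendZero f) b := by
  refine Finset.sum_bij (fun i _ => (i : ℕ)) ?_ ?_ ?_ ?_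
  · intro i hi
    simpa using hi
  · intro i _ j _ h
    exact Fin.ext h
  · intro i hi
    have := b.2
    exact ⟨⟨i, by have := Finset.mem_range.1 hi; omega⟩,
      Finset.mem_filter.2 ⟨Finset.mem_univ _, Finset.mem_range.1 hi⟩, rfl⟩
  · intro i _
    simp [twoRho_eq]

theorem sum_eq_rhoSum (s : K) (f : Fin N → V) :
    ∑ i : Fin N, s ^ (-twoRho i) • f i = rhoSum s N (extendZero f) N := by
  rw [rhoSum, ← Fin.sum_univ_eq_sum_range (fun i => s ^ (-rhoNat N i) • extendZero f i)]
  simp [twoRho_eq]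

theorem sum_lt_eq_smul_rhoSum {s : K} (hs : s ≠ 0) (f : Fin N → V) (b : Fin N) :
    ∑ i : Fin N with i < b, s ^ (-twoRho i + twoRho b) • f i =
      s ^ rhoNat N b • rhoSum s N (extendZero f) b := by
  rw [← sum_lt_eq_rhoSum, Finset.smul_sum]
  refine Finset.sum_congr rfl fun i _ => ?_
  rw [smul_smul, ← zpow_add₀ hs, twoRho_eq b, add_comm]

section Rows

variable {s : K} (w : Fin N → Fin N → V)

theorem pairAct_braidSO_same {a : Fin N} (h : a ≠ a.rev) :
    pairAct w (a, a) (braidSO s N) = s ^ 2 • w a a := by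
  rw [pairAct_braidSO, if_pos ⟨rfl, h⟩, if_neg (by simp [h]), if_neg (by simp [h]),
    if_neg (lt_irrefl a), if_neg h]
  simp

theorem pairAct_braidSO_lt {a b : Fin N} (h : a ≠ b.rev) (hab : a < b) :
    pairAct w (a, b) (braidSO s N) = w b a + (s ^ 2 - (s ^ 2)⁻¹) • w a b := by
  have hba : b ≠ a.rev := fun h' => h (by rw [h', Fin.rev_rev])
  rw [pairAct_braidSO, if_neg (fun h' => hab.ne h'.1), if_pos (Or.inl ⟨hab.ne', hba⟩),
    if_neg (fun h' => h h'.1), if_pos hab, if_neg h]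
  simp

theorem pairAct_braidSO_gt {a b : Fin N} (h : a ≠ b.rev) (hab : b < a) :
    pairAct w (a, b) (braidSO s N) = w b a := by
  have hba : b ≠ a.rev := fun h' => h (by rw [h', Fin.rev_rev])
  rw [pairAct_braidSO, if_neg (fun h' => hab.ne' h'.1), if_pos (Or.inl ⟨hab.ne, hba⟩),
    if_neg (fun h' => h h'.1), if_neg hab.not_gt, if_neg h]
  simp

theorem pairAct_braidSO_rev (hs : s ≠ 0) {b : Fin N} (h : b ≠ b.rev) :
    pairAct w (b.rev, b) (braidSO s N) = (s ^ 2)⁻¹ • w b b.rev +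
      (s ^ 2 - (s ^ 2)⁻¹) • ((if b.rev < b then w b.rev b else 0) -
        s ^ rhoNat N b • rhoSum s N (extendZero fun i => w i i.rev) b) := by
  rw [pairAct_braidSO, if_neg (fun h' => h h'.1.symm), if_neg, if_pos ⟨rfl, h⟩, if_pos rfl,
    sum_lt_eq_smul_rhoSum hs (fun i => w i i.rev), add_zero, zero_add]
  rintro (h' | h')
  · simp at h'
  · exact h (by simpa using h'.2.symm)

theorem pairAct_braidSO_mid (hs : s ≠ 0) {b : Fin N} (h : b = b.rev) :
    pairAct w (b, b) (braidSO s N) = w b b -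
      (s ^ 2 - (s ^ 2)⁻¹) • rhoSum s N (extendZero fun i => w i i.rev) b := by
  have hr : rhoNat N b = 0 := by
    have := congrArg Fin.val h
    rw [Fin.val_rev] at this
    rw [rhoNat]; split_ifs <;> omega
  rw [pairAct_braidSO, if_neg (fun h' => h'.2 h), if_pos (Or.inr ⟨h, h⟩),
    if_neg (fun h' => h'.2 h), if_neg (lt_irrefl b), if_pos h,
    sum_lt_eq_smul_rhoSum hs (fun i => w i i.rev), hr, zpow_zero, one_smul]
  module

end Rows

/-- The conditions on the products of opposite generators determine all partial sums. -/
theorem rhoSum_reflect {s : K} (hs : s ≠ 0) (hs2 : 1 + s ^ 2 ≠ 0) (F : ℕ → V)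
    (hpair : ∀ r, 2 * r + 1 < N →
      F r + F (N - 1 - r) = ((s ^ 4 - 1) * s ^ ((N : ℤ) - 2 - 2 * r)) • rhoSum s N F r)
    (hmid : ∀ n, 2 * n + 1 = N → (1 + s ^ 2) • F n = (s ^ 4 - 1) • rhoSum s N F n) :
    ∀ j b, b + j = N → N ≤ 2 * b → rhoSum s N F b = s ^ (2 * (b - j : ℤ)) • rhoSum s N F j := by
  intro j b hb hN
  -- The induction moves outward from the middle: passing from `(b, j + 1)` to `(b + 1, j)` adds one
  -- summand on the right and removes its opposite on the left, and `hpair` relates the two. An odd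
  -- `N` starts from `hmid`.
  induction b generalizing j with
  | zero =>
    obtain rfl : j = 0 := by omega
    simp
  | succ b ih =>
    rcases Nat.lt_or_ge (2 * b) N with h | h
    · rcases Nat.eq_or_lt_of_le hN with h2 | h2
      · obtain rfl : b + 1 = j := by omega
        simp
      · -- the middle index
        obtain rfl : b = j := by omega
        have hb' : 2 * b + 1 = N := by omega
        have h3 := hmid b hb'
        rw [rhoSum_succ, show rhoNat N b = 0 by rw [rhoNat]; split_ifs <;> omega]
        have h4 : F b = (s ^ 2 - 1) • rhoSum s N F b := by
          apply smul_right_injective V hs2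
          simp only
          rw [h3, smul_smul]
          congr 1
          ring
        rw [h4, show (2 * (((b + 1 : ℕ) : ℤ) - b)) = 2 by push_cast; ring]
        simp only [neg_zero, zpow_zero, one_smul]
        rw [show (s ^ (2 : ℤ)) = s ^ 2 from zpow_natCast s 2]
        module
    · have h1 := ih (j + 1) (by omega) h
      rw [rhoSum_succ] at h1
      have h2 := hpair j (by omega)
      rw [show N - 1 - j = b by omega] at h2
      rw [rhoSum_succ, h1]
      have e1 : rhoNat N b = -((N : ℤ) - 2 - 2 * j) := by rw [rhoNat]; split_ifs <;> omega
      have e2 : rhoNat N j = (N : ℤ) - 2 - 2 * j := by rw [rhoNat]; split_ifs <;> omega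
      rw [eq_sub_of_add_eq' h2, e1, e2, show (2 * ((b : ℤ) - ((j + 1 : ℕ) : ℤ))) =
        ((N : ℤ) - 2 - 2 * j) + ((N : ℤ) - 2 - 2 * j) by push_cast; omega,
        show (2 * (((b + 1 : ℕ) : ℤ) - j)) = 4 + (((N : ℤ) - 2 - 2 * j) + ((N : ℤ) - 2 - 2 * j)) by
          push_cast; omega, zpow_add₀ hs, zpow_add₀ hs 4, zpow_add₀ hs, neg_neg, zpow_neg]
      have he : s ^ ((N : ℤ) - 2 - 2 * j) ≠ 0 := zpow_ne_zero _ hs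
      generalize s ^ ((N : ℤ) - 2 - 2 * j) = e at *
      rw [show (s ^ (4 : ℤ)) = s ^ 4 from zpow_natCast s 4, smul_add, smul_smul,
        show e * e * e⁻¹ = e by field_simp]
      module

end OrthogonalBraid

end QEpsilon

namespace QEpsilon

open scoped TensorProduct

universe v

/-! ### The trace constant, the metric as eigenvector and the three projectors for `so`. -/

section OrthogonalProjectors

variable {K : Type*} [Field K] {N : ℕ} {s : K}

theorem metric_apply (a b : Fin N) : metric s N a b = if a = b.rev then s ^ twoRho b else 0 := by
  simp only [metric, Matrix.of_apply]
  refine if_congr ?_ rfl rfl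
  rw [Fin.rev_eq_iff]

theorem sq_zpow (s : K) (t : ℤ) : s ^ (2 * t) = (s ^ 2) ^ t := by
  rw [zpow_mul, ← zpow_natCast s 2]
  norm_num

/-- The partial sums of `q^{-2ρ_i}`. -/
theorem mul_rhoSum_lower (hs : s ≠ 0) {j : ℕ} (hj : 2 * j ≤ N) :
    (s ^ 2 - (s ^ 2)⁻¹) * rhoSum s N (fun i => s ^ (-rhoNat N i)) j =
      s ^ (2 - 2 * N : ℤ) * (s ^ (4 * j) - 1) := by
  induction j with
  | zero => simp
  | succ j ih =>
    rw [rhoSum_succ, mul_add, ih (by omega), show rhoNat N j = (N : ℤ) - 2 - 2 * j by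
      rw [rhoNat]; split_ifs <;> omega, smul_eq_mul, ← zpow_add₀ hs,
      show -((N : ℤ) - 2 - 2 * j) + -((N : ℤ) - 2 - 2 * j) = (2 - 2 * N) + (2 + ((4 * j : ℕ) : ℤ)) by
        push_cast; ring, zpow_add₀ hs _ (2 + _), zpow_add₀ hs 2, zpow_natCast,
      show (s ^ (2 : ℤ)) = s ^ 2 from zpow_natCast s 2]
    field_simp
    ring

/-- The geometric progression is interrupted at the middle, where `2ρ` repeats the value `0` for
even `N` and has steps of half the size for odd `N`. This is why a second closed form is needed. -/
theorem mul_rhoSum_upper (hs : s ≠ 0) {j : ℕ} (hj : N ≤ 2 * j) :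
    (s ^ 2 - (s ^ 2)⁻¹) * rhoSum s N (fun i => s ^ (-rhoNat N i)) j =
      s ^ 2 - (s ^ 2)⁻¹ - s ^ (2 - 2 * N : ℤ) + s ^ (4 * j - 2 * N - 2 : ℤ) := by
  induction j with
  | zero =>
    obtain rfl : N = 0 := by omega
    simp only [rhoSum_zero, mul_zero, Nat.cast_zero, mul_zero, sub_zero, zero_sub]
    rw [show (s ^ (2 : ℤ)) = s ^ 2 from zpow_natCast s 2,
      show (s ^ (-2 : ℤ)) = (s ^ 2)⁻¹ by rw [zpow_neg]; norm_cast]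
    ring
  | succ j ih =>
    rcases Nat.lt_or_ge (2 * j) N with h | h
    · rw [rhoSum_succ, mul_add, mul_rhoSum_lower hs h.le, mul_sub, ← zpow_natCast s (4 * j),
        ← zpow_add₀ hs]
      rcases Nat.lt_or_ge (2 * j + 1) N with h1 | h1
      · rw [show rhoNat N j = 0 by rw [rhoNat]; split_ifs <;> omega,
          show (2 - 2 * N + ((4 * j : ℕ) : ℤ)) = -2 by push_cast; omega,
          show (4 * ((j + 1 : ℕ) : ℤ) - 2 * N - 2) = -2 by push_cast; omega]
        simp
        ring
      · rw [show rhoNat N j = 0 by rw [rhoNat]; split_ifs <;> omega,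
          show (2 - 2 * N + ((4 * j : ℕ) : ℤ)) = 0 by push_cast; omega,
          show (4 * ((j + 1 : ℕ) : ℤ) - 2 * N - 2) = 0 by push_cast; omega]
        simp
        ring
    · rw [rhoSum_succ, mul_add, ih h, show rhoNat N j = (N : ℤ) - 2 * j by
        rw [rhoNat]; split_ifs <;> omega, smul_eq_mul, ← zpow_add₀ hs,
        show -((N : ℤ) - 2 * j) + -((N : ℤ) - 2 * j) = (4 * j - 2 * N - 2) + 2 by ring,
        show (4 * ((j + 1 : ℕ) : ℤ) - 2 * N - 2) = (4 * j - 2 * N - 2) + 4 by push_cast; ring,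
        zpow_add₀ hs, zpow_add₀ hs _ 4, show (s ^ (2 : ℤ)) = s ^ 2 from zpow_natCast s 2,
        show (s ^ (4 : ℤ)) = s ^ 4 from zpow_natCast s 4]
      field_simp
      ring

theorem traceConst_eq (s : K) (N : ℕ) :
    traceConst s N = rhoSum s N (fun i => s ^ (-rhoNat N i)) N := by
  have h : ∀ l : Fin N, ∑ m : Fin N, metric s N l m * metric s N l m =
      s ^ (-twoRho l) • s ^ (-twoRho l) := by
    intro l
    rw [Finset.sum_eq_single l.rev]
    · simp [metric_apply, twoRho_rev]
    · intro m _ hm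
      rw [metric_apply, if_neg, zero_mul]
      rintro rfl
      simp at hm
    · simp
  rw [traceConst, Finset.sum_congr rfl fun l _ => h l,
    sum_eq_rhoSum s (fun l : Fin N => s ^ (-twoRho l))]
  refine Finset.sum_congr rfl fun i hi => ?_
  rw [extendZero, dif_pos (Finset.mem_range.1 hi), twoRho_eq]

/-- The factored form makes the zeros of `Q_N` visible. -/
theorem mul_traceConst (hs : s ≠ 0) (N : ℕ) :
    (s ^ 2 - (s ^ 2)⁻¹) * traceConst s N =
      (1 + (s ^ 2) ^ ((N : ℤ) - 2)) * (s ^ 2 - (s ^ 2) ^ (1 - (N : ℤ))) := by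
  have hq : s ^ 2 ≠ 0 := pow_ne_zero 2 hs
  rw [traceConst_eq, mul_rhoSum_upper hs (by omega)]
  rw [show (2 - 2 * N : ℤ) = 2 * (1 - N) by ring, show (4 * N - 2 * N - 2 : ℤ) = 2 * (N - 1) by ring,
    sq_zpow, sq_zpow, zpow_sub₀ hq, zpow_sub₀ hq, zpow_sub₀ hq, zpow_natCast]
  have := pow_ne_zero N hq
  rw [zpow_one, show ((s ^ 2) ^ (2 : ℤ)) = (s ^ 2) ^ 2 from zpow_natCast _ 2]
  generalize (s ^ 2) ^ N = t at *
  field_simp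
  ring

/-- A vanishing factor would make `q` a root of unity, except that for `N = 2` the first factor is
`2`, where characteristic zero is used. For `N = 0` the sum is empty, hence `hN`. -/
theorem traceConst_ne_zero [CharZero K] (hs : s ≠ 0) (h : ∀ r : ℕ, 1 ≤ r → (s ^ 2) ^ r ≠ 1)
    (hN : 1 ≤ N) : traceConst s N ≠ 0 := by
  have hq : s ^ 2 ≠ 0 := pow_ne_zero 2 hs
  intro h0
  have h1 := mul_traceConst hs N
  rw [h0, mul_zero, eq_comm, mul_eq_zero] at h1
  rcases h1 with h1 | h1
  · have h2 : ((s ^ 2) ^ ((N : ℤ) - 2)) ^ (2 : ℤ) = 1 := by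
      rw [eq_neg_of_add_eq_zero_right h1]; norm_num
    rcases Nat.lt_trichotomy N 2 with h3 | h3 | h3
    · obtain rfl : N = 1 := by omega
      rw [← zpow_mul] at h2
      apply h 2 (by norm_num)
      rw [← inv_inj, inv_one, ← h2, ← zpow_natCast, ← zpow_neg]
      norm_num
    · subst h3
      norm_num at h1
    · obtain ⟨m, rfl⟩ : ∃ m, N = m + 2 := ⟨N - 2, by omega⟩
      rw [← zpow_mul] at h2
      apply h (m * 2) (by omega)
      rw [← h2, ← zpow_natCast]
      congr 1
      push_cast
      ring
  · apply h N hN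
    rw [zpow_sub₀ hq, zpow_one, zpow_natCast] at h1
    have := pow_ne_zero N hq
    generalize (s ^ 2) ^ N = t at *
    field_simp at h1
    rw [mul_zero, mul_eq_zero, or_iff_right hq] at h1
    linear_combination h1

/-- The metric is an eigenvector of the braid matrix. -/
theorem pairAct_metric (hs : s ≠ 0) (a b : Fin N) :
    pairAct (fun i j => metric s N i j) (a, b) (braidSO s N) =
      (s ^ 2) ^ (1 - (N : ℤ)) * metric s N a b := by
  have hF : ∀ i : Fin N, metric s N i i.rev = s ^ (-twoRho i) := by
    intro i
    rw [metric_apply, if_pos (by simp), twoRho_rev]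
  have hsum : ∀ b : Fin N, rhoSum s N (extendZero fun i => metric s N i i.rev) b =
      rhoSum s N (fun i => s ^ (-rhoNat N i)) b := by
    intro b
    refine Finset.sum_congr rfl fun i hi => ?_
    rw [extendZero, dif_pos ((Finset.mem_range.1 hi).trans b.2), hF, twoRho_eq]
  have hb := b.2
  by_cases hab : a = b.rev
  · subst hab
    have e3 : metric s N b.rev b = s ^ rhoNat N b := by
      rw [metric_apply, if_pos rfl, twoRho_eq]
    have hr0 := zpow_ne_zero (rhoNat N b) hs
    rw [← sq_zpow, show (2 * (1 - (N : ℤ))) = 2 - 2 * N by ring]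
    rcases lt_trichotomy b b.rev with h | h | h
    · have h' : 2 * (b : ℕ) + 1 < N := by
        rw [Fin.lt_def, Fin.val_rev] at h; omega
      have hS := mul_rhoSum_lower (N := N) hs (j := b) (by omega)
      have hr : rhoNat N b = (N : ℤ) - 2 - 2 * (b : ℕ) := by rw [rhoNat]; split_ifs <;> omega
      rw [pairAct_braidSO_rev _ hs h.ne, if_neg h.not_gt, hsum, e3, hF, twoRho_eq]
      simp only [smul_eq_mul]
      rw [zero_sub, mul_neg, mul_left_comm, hS, zpow_neg]
      have h4 : s ^ rhoNat N b * s ^ rhoNat N b * s ^ (2 - 2 * N : ℤ) * s ^ (4 * (b : ℕ)) * s ^ 2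
          = 1 := by
        rw [← zpow_natCast s (4 * (b : ℕ)), ← zpow_natCast s 2, hr]
        simp only [← zpow_add₀ hs]
        convert zpow_zero s using 2
        push_cast
        ring
      generalize s ^ rhoNat N b = r at *
      field_simp
      linear_combination -h4
    · have h' : 2 * (b : ℕ) + 1 = N := by
        have := congrArg Fin.val h
        rw [Fin.val_rev] at this; omega
      have hS := mul_rhoSum_lower (N := N) hs (j := b) (by omega)
      have hr : rhoNat N b = 0 := by rw [rhoNat]; split_ifs <;> omega
      rw [← h] at e3 ⊢
      rw [pairAct_braidSO_mid _ hs h, hsum, e3, hr, smul_eq_mul, hS, zpow_zero]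
      have h4 : s ^ (2 - 2 * N : ℤ) * s ^ (4 * (b : ℕ)) = 1 := by
        rw [← zpow_natCast s (4 * (b : ℕ)), ← zpow_add₀ hs]
        convert zpow_zero s using 2
        push_cast
        omega
      linear_combination -h4
    · have h' : N < 2 * (b : ℕ) + 1 := by
        rw [Fin.lt_def, Fin.val_rev] at h; omega
      have hS := mul_rhoSum_upper (N := N) hs (j := b) (by omega)
      have hr : rhoNat N b = (N : ℤ) - 2 * (b : ℕ) := by rw [rhoNat]; split_ifs <;> omega
      rw [pairAct_braidSO_rev _ hs h.ne', if_pos h, hsum, e3, hF, twoRho_eq]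
      simp only [smul_eq_mul]
      rw [mul_sub, mul_left_comm, hS, zpow_neg]
      have h4 : s ^ rhoNat N b * s ^ rhoNat N b * s ^ (4 * (b : ℕ) - 2 * N - 2 : ℤ) * s ^ 2
          = 1 := by
        rw [← zpow_natCast s 2, hr]
        simp only [← zpow_add₀ hs]
        convert zpow_zero s using 2
        push_cast
        ring
      generalize s ^ rhoNat N b = r at *
      field_simp
      linear_combination -h4
  · have hba : b ≠ a.rev := fun h => hab (by rw [h, Fin.rev_rev])
    have e1 : metric s N a b = 0 := by rw [metric_apply, if_neg hab]
    have e2 : metric s N b a = 0 := by rw [metric_apply, if_neg hba]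
    rcases lt_trichotomy a b with h | rfl | h
    · rw [pairAct_braidSO_lt _ hab h, e1, e2]; simp
    · rw [pairAct_braidSO_same _ hab, e1]; simp
    · rw [pairAct_braidSO_gt _ hab h, e1, e2]; simp

/-- Transposition exchanges the two summation indices; the terms that mix opposite indices are
matched by `i ↦ -i` together with `ρ_{-i} = -ρ_i`. -/
theorem braidSO_transpose (s : K) (N : ℕ) : (braidSO s N).transpose = braidSO s N := by
  simp only [braidSO, Matrix.transpose_add, Matrix.transpose_sub, Matrix.transpose_smul,
    Matrix.transpose_sum, transpose_kronecker_e]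
  congr 1
  · congr 1
    · congr 1
      simp only [Finset.sum_filter]
      rw [Finset.sum_comm]
      refine Finset.sum_congr rfl fun i _ => Finset.sum_congr rfl fun j _ => if_congr ?_ rfl rfl
      have := @Fin.rev_eq_iff N i j
      have := @Fin.rev_eq_iff N j i
      grind
    · congr 1
      simp only [Finset.sum_filter]
      refine Finset.sum_bij (fun i _ => i.rev) (by simp) (by simp) (fun i _ => ⟨i.rev, by simp⟩) ?_
      intro i _
      simp [eq_comm]
  · congr 2
    simp only [Finset.sum_filter]
    rw [Finset.sum_comm]
    refine Finset.sum_bij (fun i _ => i.rev) (by simp) (by simp) (fun i _ => ⟨i.rev, by simp⟩) ?_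
    intro i _
    refine Finset.sum_bij (fun i _ => i.rev) (by simp) (by simp) (fun i _ => ⟨i.rev, by simp⟩) ?_
    intro j _
    simp [twoRho_rev, add_comm]

theorem traceSO_transpose (s : K) (N : ℕ) : (traceSO s N).transpose = traceSO s N := by
  ext x y
  simp only [traceSO, Matrix.transpose_apply, Matrix.of_apply]
  ring

theorem minusSO_transpose (s : K) (N : ℕ) : (minusSO s N).transpose = minusSO s N := by
  simp only [minusSO, Matrix.transpose_sub, Matrix.transpose_smul, Matrix.transpose_one,
    braidSO_transpose, traceSO_transpose]

theorem braidSO_mul_traceSO (hs : s ≠ 0) :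
    braidSO s N * traceSO s N = (s ^ 2) ^ (1 - (N : ℤ)) • traceSO s N := by
  ext ⟨a, b⟩ ⟨c, d⟩
  have h := pairAct_metric hs a b
  simp only [pairAct_apply, smul_eq_mul] at h
  simp only [Matrix.mul_apply, Fintype.sum_prod_type, Matrix.smul_apply, traceSO, Matrix.of_apply,
    smul_eq_mul]
  rw [show ∀ x y z w : K, x * (y * (z * w)) = (x * z) * (y * w) by intros; ring, ← h,
    Finset.sum_mul]
  refine Finset.sum_congr rfl fun i _ => ?_
  rw [Finset.sum_mul]
  refine Finset.sum_congr rfl fun j _ => ?_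
  ring

theorem traceSO_mul_traceSO (hQ : traceConst s N ≠ 0) :
    traceSO s N * traceSO s N = traceSO s N := by
  ext ⟨a, b⟩ ⟨c, d⟩
  simp only [Matrix.mul_apply, Fintype.sum_prod_type, traceSO, Matrix.of_apply]
  have : ∀ i j, (traceConst s N)⁻¹ * (metric s N a b * metric s N i j) *
      ((traceConst s N)⁻¹ * (metric s N i j * metric s N c d)) =
      ((traceConst s N)⁻¹ * (traceConst s N)⁻¹ * (metric s N a b * metric s N c d)) *
        (metric s N i j * metric s N i j) := by intros; ring
  simp only [this, ← Finset.mul_sum]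
  rw [← traceConst]
  field_simp

theorem one_sub_minusSO (hq : s ^ 2 + (s ^ 2)⁻¹ ≠ 0) :
    1 - minusSO s N = (s ^ 2 + (s ^ 2)⁻¹)⁻¹ • ((s ^ 2)⁻¹ • 1 + braidSO s N +
      (s ^ 2 - (s ^ 2) ^ (1 - (N : ℤ))) • traceSO s N) := by
  rw [minusSO]
  have : (1 : Matrix (Fin N × Fin N) (Fin N × Fin N) K) =
      (s ^ 2 + (s ^ 2)⁻¹)⁻¹ • ((s ^ 2 + (s ^ 2)⁻¹) • 1) := by
    rw [smul_smul, inv_mul_cancel₀ hq, one_smul]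
  nth_rewrite 1 [this]
  rw [← smul_sub]
  congr 1
  module

/-- The coefficient of `𝒫^t` in `𝒫^-` is tuned to the eigenvalue `q ^ (1 - N)` of the braid matrix
on the metric, so that `𝒫^t` lies under `1 - 𝒫^-`. -/
theorem one_sub_minusSO_mul_traceSO (hs : s ≠ 0) (hq : s ^ 2 + (s ^ 2)⁻¹ ≠ 0)
    (hQ : traceConst s N ≠ 0) : (1 - minusSO s N) * traceSO s N = traceSO s N := by
  rw [one_sub_minusSO hq, smul_mul_assoc, add_mul, add_mul, smul_mul_assoc, smul_mul_assoc, one_mul,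
    braidSO_mul_traceSO hs, traceSO_mul_traceSO hQ, ← add_smul, ← add_smul, smul_smul,
    show (s ^ 2 + (s ^ 2)⁻¹)⁻¹ * ((s ^ 2)⁻¹ + (s ^ 2) ^ (1 - (N : ℤ)) +
      (s ^ 2 - (s ^ 2) ^ (1 - (N : ℤ)))) = (s ^ 2 + (s ^ 2)⁻¹)⁻¹ * (s ^ 2 + (s ^ 2)⁻¹) by ring,
    inv_mul_cancel₀ hq, one_smul]

theorem traceSO_mul_one_sub_minusSO (hs : s ≠ 0) (hq : s ^ 2 + (s ^ 2)⁻¹ ≠ 0)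
    (hQ : traceConst s N ≠ 0) : traceSO s N * (1 - minusSO s N) = traceSO s N := by
  have := congrArg Matrix.transpose (one_sub_minusSO_mul_traceSO hs hq hQ)
  rwa [Matrix.transpose_mul, Matrix.transpose_sub, Matrix.transpose_one, minusSO_transpose,
    traceSO_transpose] at this

theorem plusSO_eq (hq : s ^ 2 + (s ^ 2)⁻¹ ≠ 0) :
    plusSO s N = (1 - minusSO s N) - traceSO s N := by
  rw [one_sub_minusSO hq, plusSO]
  have : traceSO s N = (s ^ 2 + (s ^ 2)⁻¹)⁻¹ • ((s ^ 2 + (s ^ 2)⁻¹) • traceSO s N) := by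
    rw [smul_smul, inv_mul_cancel₀ hq, one_smul]
  nth_rewrite 3 [this]
  rw [← smul_sub]
  congr 1
  module

/-- Here `𝒫^+ = (1 - 𝒫^-) - 𝒫^t`, and `𝒫^t` is absorbed by `1 - 𝒫^-` on both sides; the
factorization is all that the general argument asks of the other projectors. -/
theorem others_SO (hs : s ≠ 0) (hq : s ^ 2 + (s ^ 2)⁻¹ ≠ 0) (hQ : traceConst s N ≠ 0) :
    ∀ M ∈ ({plusSO s N, traceSO s N} : Set (Matrix (Fin N × Fin N) (Fin N × Fin N) K)),
      (∃ X, M = X * (1 - minusSO s N)) ∧ ∃ X, M = (1 - minusSO s N) * X := by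
  have h1 := one_sub_minusSO_mul_traceSO hs hq hQ
  have h2 := traceSO_mul_one_sub_minusSO hs hq hQ
  rintro M (rfl | rfl)
  · rw [plusSO_eq hq]
    exact ⟨⟨1 - traceSO s N, by rw [sub_mul, one_mul, h2]⟩, 1 - traceSO s N, by
      rw [mul_sub, mul_one, h1]⟩
  · exact ⟨⟨_, h2.symm⟩, _, h1.symm⟩

end OrthogonalProjectors

end QEpsilon

namespace QEpsilon

open scoped TensorProduct

universe v

/-! ### The relations for `so`, first for all generators and then for pairs. -/

section OrthogonalRelations

variable {K : Type*} [Field K] {B : Type*}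

/-- The family of generators with given pairs and given central element. -/
def ofPairs (N : ℕ) (X Y : ℕ → B) (C : B) (i : Fin N) : B :=
  if 2 * (i : ℕ) + 1 < N then X i else if 2 * (i : ℕ) + 1 = N then C else Y (N - 1 - i)

theorem ofPairs_left (X Y : ℕ → B) (C : B) {N : ℕ} {i : Fin N} (h : 2 * (i : ℕ) + 1 < N) :
    ofPairs N X Y C i = X i := if_pos h

theorem ofPairs_mid (X Y : ℕ → B) (C : B) {N : ℕ} {i : Fin N} (h : 2 * (i : ℕ) + 1 = N) :
    ofPairs N X Y C i = C := by
  rw [ofPairs, if_neg (by omega), if_pos h]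

theorem ofPairs_right (X Y : ℕ → B) (C : B) {N : ℕ} {i : Fin N} (h : N < 2 * (i : ℕ) + 1) :
    ofPairs N X Y C i = Y (N - 1 - i) := by
  rw [ofPairs, if_neg (by omega), if_neg (by omega)]

variable [Ring B] [Algebra K B]

/-- The anticommutators of opposite generators. -/
def omega (q : K) (X Y : ℕ → B) : ℕ → B
  | 0 => 0
  | p + 1 => q⁻¹ • omega q X Y p + (q - q⁻¹) • (X p * Y p)

/-- The relations between the first `n` pairs of opposite generators of the `U_q so(N)`-covariant
exterior algebra. -/
structure PairRel (q : K) (n : ℕ) (X Y : ℕ → B) : Prop where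
  X_sq : ∀ r < n, X r * X r = 0
  Y_sq : ∀ r < n, Y r * Y r = 0
  XX : ∀ r t, r < t → t < n → X t * X r = -q • (X r * X t)
  YX : ∀ r t, r < t → t < n → Y t * X r = -q • (X r * Y t)
  XY : ∀ r t, r < t → t < n → X t * Y r = -q⁻¹ • (Y r * X t)
  YY : ∀ r t, r < t → t < n → Y t * Y r = -q⁻¹ • (Y r * Y t)
  cross : ∀ r < n, Y r * X r = omega q X Y r - X r * Y r

/-- The relations of the `U_q so(N)`-covariant exterior algebra, in terms of the pairs of opposite
generators and the central one. -/
structure SORel (s : K) (N : ℕ) (X Y : ℕ → B) (C : B) : Prop where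
  pairs : PairRel (s ^ 2) (N / 2) X Y
  CX : ∀ r < N / 2, C * X r = -(s ^ 2) • (X r * C)
  CY : ∀ r < N / 2, C * Y r = -(s ^ 2)⁻¹ • (Y r * C)
  C_sq : N % 2 = 1 → (1 + s ^ 2) • (C * C) = s • omega (s ^ 2) X Y (N / 2)
  C_even : N % 2 = 0 → C = 0

variable {s : K} {N : ℕ}

theorem smul_eq_of_skew {q : K} (hq : q ≠ 0) {a b : B} (h : a = -q⁻¹ • b) : b = -q • a := by
  rw [h, smul_smul]
  simp [hq]

/-- In terms of all generators, the relations of opposite generators. -/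
theorem omega_eq_rhoSum (hs : s ≠ 0) (X Y : ℕ → B) (F : ℕ → B)
    (hF : ∀ r, 2 * r + 1 < N → F r = X r * Y r) {r : ℕ} (hr : 2 * r ≤ N) :
    omega (s ^ 2) X Y r = ((s ^ 4 - 1) * s ^ ((N : ℤ) - 2 - 2 * r)) • rhoSum s N F r := by
  induction r with
  | zero => simp [omega]
  | succ r ih =>
    rw [omega, rhoSum_succ, ih (by omega), hF r (by omega), show rhoNat N r = (N : ℤ) - 2 - 2 * r by
      rw [rhoNat]; split_ifs <;> omega,
      show (N : ℤ) - 2 - 2 * ((r + 1 : ℕ) : ℤ) = (N - 2 - 2 * r) - 2 by push_cast; ring,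
      zpow_sub₀ hs _ 2, zpow_neg, show (s ^ (2 : ℤ)) = s ^ 2 from zpow_natCast s 2]
    have := zpow_ne_zero ((N : ℤ) - 2 - 2 * r) hs
    generalize s ^ ((N : ℤ) - 2 - 2 * r) = e at *
    rw [smul_add, smul_smul, smul_smul]
    congr 2 <;> field_simp

variable (s N) in
/-- The relations of the `U_q so(N)`-covariant exterior algebra in terms of a family of generators. -/
structure RelSO (z : Fin N → B) : Prop where
  sq : ∀ a, a ≠ a.rev → z a * z a = 0
  comm : ∀ a b, a ≠ b.rev → a < b → z b * z a = -(s ^ 2) • (z a * z b)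
  pair : ∀ a, a < a.rev → z a * z a.rev + z a.rev * z a =
    ((s ^ 4 - 1) * s ^ ((N : ℤ) - 2 - 2 * (a : ℕ))) •
      rhoSum s N (extendZero fun i => z i * z i.rev) a
  mid : ∀ a, a = a.rev → (1 + s ^ 2) • (z a * z a) =
    (s ^ 4 - 1) • rhoSum s N (extendZero fun i => z i * z i.rev) a

theorem pairAct_traceSO (w : Fin N → Fin N → B) (a b : Fin N) :
    pairAct w (a, b) (traceSO s N) =
      ((traceConst s N)⁻¹ * metric s N a b) • rhoSum s N (extendZero fun i => w i i.rev) N := by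
  rw [← sum_eq_rhoSum, pairAct_apply, Finset.smul_sum]
  refine Finset.sum_congr rfl fun h _ => ?_
  rw [Finset.sum_eq_single h.rev]
  · rw [smul_smul, traceSO, Matrix.of_apply, metric_apply h, if_pos (by simp), twoRho_rev, mul_assoc]
  · intro k _ hk
    rw [traceSO, Matrix.of_apply, metric_apply h, if_neg, mul_zero, mul_zero, zero_smul]
    intro h'
    exact hk (by rw [h', Fin.rev_rev])
  · simp

/-- The relations split into braid relations and the vanishing of the metric contraction `T N`. The
rows up to the middle determine everything: the rows `(-b, b)` beyond the middle and `T N = 0`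
itself follow by `rhoSum_reflect`. -/
theorem quadRel_minusSO_iff (hs : s ≠ 0) (h : ∀ r : ℕ, 1 ≤ r → (s ^ 2) ^ r ≠ 1)
    (hQ : 1 ≤ N → traceConst s N ≠ 0) (z : Fin N → B) :
    QuadRel (minusSO s N) z ↔ RelSO s N z := by
  have hq0 : s ^ 2 ≠ 0 := pow_ne_zero 2 hs
  have hq := ne_zero_of_pow_ne_one hq0 h
  have hq1 : 1 + s ^ 2 ≠ 0 := by
    intro h0
    apply h 2 (by norm_num)
    linear_combination (s ^ 2 - 1) * h0
  rw [quadRel_iff]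
  set w : Fin N → Fin N → B := fun a b => z a * z b with hw
  set T := rhoSum s N (extendZero fun i => w i i.rev) with hT
  have key : (∀ p, pairAct w p (1 - minusSO s N) = 0) ↔
      (∀ a b, (s ^ 2)⁻¹ • w a b + pairAct w (a, b) (braidSO s N) = 0) ∧ T N = 0 := by
    constructor
    · intro h1
      have hT0 : T N = 0 := by
        rcases Nat.eq_zero_or_pos N with rfl | hN
        · simp [hT]
        -- Multiplying the relations by `𝒫^t` isolates the contraction; the row of the first index
        -- and its opposite is chosen because the metric is nonzero there.
        · have h2 : pairAct w (⟨0, hN⟩, Fin.rev ⟨0, hN⟩) (traceSO s N * (1 - minusSO s N)) = 0 := by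
            rw [pairAct_mul]
            exact Finset.sum_eq_zero fun r _ => by rw [h1, smul_zero]
          rw [traceSO_mul_one_sub_minusSO hs hq (hQ hN), pairAct_traceSO, metric_apply,
            if_pos (by simp)] at h2
          refine (smul_eq_zero_iff_right (mul_ne_zero (inv_ne_zero (hQ hN)) ?_)).1 h2
          exact zpow_ne_zero _ hs
      refine ⟨fun a b => ?_, hT0⟩
      have h2 := h1 (a, b)
      rw [one_sub_minusSO hq, map_smul, smul_eq_zero_iff_right (inv_ne_zero hq), map_add, map_add,
        map_smul, map_smul, pairAct_one, pairAct_traceSO] at h2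
      change _ + _ • _ • T N = 0 at h2
      rw [hT0] at h2
      simpa using h2
    · rintro ⟨h1, hT0⟩ ⟨a, b⟩
      rw [one_sub_minusSO hq, map_smul, smul_eq_zero_iff_right (inv_ne_zero hq), map_add, map_add,
        map_smul, map_smul, pairAct_one, pairAct_traceSO]
      change _ + _ • _ • T N = 0
      rw [hT0, h1]
      simp
  rw [key]
  constructor
  · rintro ⟨h1, -⟩
    refine ⟨fun a ha => ?_, fun a b hab hlt => ?_, fun a ha => ?_, fun a ha => ?_⟩
    · have h2 := h1 a a
      rw [pairAct_braidSO_same _ ha, ← add_smul, smul_eq_zero_iff_right (by rwa [add_comm])] at h2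
      exact h2
    · have h2 := h1 a b
      rw [pairAct_braidSO_lt _ hab hlt] at h2
      rw [neg_smul, eq_neg_iff_add_eq_zero, ← h2]
      simp only [hw]
      module
    · have h2 := h1 a.rev a
      have h3 : 2 * (a : ℕ) + 1 < N := by rw [Fin.lt_def, Fin.val_rev] at ha; omega
      rw [pairAct_braidSO_rev _ hs ha.ne, if_neg ha.not_gt,
        show rhoNat N a = (N : ℤ) - 2 - 2 * (a : ℕ) by rw [rhoNat]; split_ifs <;> omega] at h2
      have h4 : s ^ 2 • ((s ^ 2)⁻¹ • w a.rev a + ((s ^ 2)⁻¹ • w a a.rev +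
        (s ^ 2 - (s ^ 2)⁻¹) • (0 - s ^ ((N : ℤ) - 2 - 2 * (a : ℕ)) • T a))) = 0 := by
        rw [h2, smul_zero]
      simp only [smul_add, smul_smul, zero_sub, smul_neg, mul_inv_cancel₀ hq0, one_smul] at h4
      rw [show s ^ 2 * ((s ^ 2 - (s ^ 2)⁻¹) * s ^ ((N : ℤ) - 2 - 2 * (a : ℕ))) =
        (s ^ 4 - 1) * s ^ ((N : ℤ) - 2 - 2 * (a : ℕ)) by field_simp] at h4
      rw [← sub_eq_zero, ← h4]
      simp only [hw]
      abel
    · have h2 := h1 a a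
      rw [pairAct_braidSO_mid _ hs ha] at h2
      have h4 : s ^ 2 • ((s ^ 2)⁻¹ • w a a + (w a a - (s ^ 2 - (s ^ 2)⁻¹) • T a)) = 0 := by
        rw [h2, smul_zero]
      simp only [smul_add, smul_sub, smul_smul, mul_inv_cancel₀ hq0] at h4
      rw [show s ^ 2 * (s ^ 2 - (s ^ 2)⁻¹) = s ^ 4 - 1 by field_simp] at h4
      rw [← sub_eq_zero, ← h4, add_smul]
      simp only [hw]
      abel
  · intro hz
    -- The pair and middle relations are precisely the hypotheses of the reflection formula.
    have hrefl := rhoSum_reflect (N := N) hs hq1 (extendZero fun i => w i i.rev) ?_ ?_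
    · refine ⟨fun a b => ?_, ?_⟩
      · by_cases hab : a = b.rev
        · subst hab
          rcases lt_trichotomy b b.rev with hb | hb | hb
          · have h3 : 2 * (b : ℕ) + 1 < N := by rw [Fin.lt_def, Fin.val_rev] at hb; omega
            rw [pairAct_braidSO_rev _ hs hb.ne, if_neg hb.not_gt,
              show rhoNat N b = (N : ℤ) - 2 - 2 * (b : ℕ) by rw [rhoNat]; split_ifs <;> omega,
              ← add_assoc, ← smul_add, add_comm (w b.rev b), hz.pair b hb, zero_sub, smul_neg,
              smul_smul, smul_smul, ← sub_eq_add_neg, sub_eq_zero]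
            congr 1
            field_simp
          · rw [← hb, pairAct_braidSO_mid _ hs hb, ← add_sub_assoc, sub_eq_zero]
            apply smul_right_injective B hq0
            simp only
            rw [smul_add, smul_smul, mul_inv_cancel₀ hq0, ← add_smul, hz.mid b hb, smul_smul]
            congr 1
            field_simp
          · have h3 : N < 2 * (b : ℕ) + 1 := by rw [Fin.lt_def, Fin.val_rev] at hb; omega
            have hbN := b.2
            have h5 := hrefl (N - b) b (by omega) (by omega)
            rw [show N - (b : ℕ) = (b.rev : ℕ) + 1 by rw [Fin.val_rev]; omega, rhoSum_succ,
              extendZero_val] at h5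
            have hr' : ((b.rev : ℕ) : ℤ) = N - 1 - b := by rw [Fin.val_rev]; omega
            have e1 : rhoNat N b.rev = 2 * (b : ℤ) - N := by
              rw [rhoNat, if_pos (by rw [Fin.val_rev]; omega), hr']; ring
            have e2 : rhoNat N b = -(2 * (b : ℤ) - N) := by rw [rhoNat]; split_ifs <;> omega
            have h4 := hz.pair b.rev (by simpa using hb)
            rw [Fin.rev_rev, hr', show (N : ℤ) - 2 - 2 * (N - 1 - b) = 2 * (b : ℤ) - N by ring] at h4
            rw [pairAct_braidSO_rev _ hs hb.ne', if_pos hb, h5, e1, e2,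
              show (2 * ((b : ℤ) - ((b.rev : ℕ) + 1 : ℕ))) = (2 * (b : ℤ) - N) + (2 * (b : ℤ) - N) by
                push_cast; rw [hr']; ring, zpow_add₀ hs, zpow_neg]
            have he := zpow_ne_zero (2 * (b : ℤ) - N) hs
            generalize s ^ (2 * (b : ℤ) - N) = e at *
            have h6 : w b b.rev = ((s ^ 4 - 1) * e) • T b.rev - w b.rev b := eq_sub_of_add_eq' h4
            have h7 : rhoSum s N (extendZero fun i => w i i.rev) b.rev = T b.rev := rfl
            rw [h6, h7, Fin.rev_rev, smul_smul, smul_add, smul_smul,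
              show e⁻¹ * (e * e) = e by field_simp, mul_inv_cancel₀ he]
            rw [show (s ^ 4 - 1) * e = s ^ 2 * ((s ^ 2 - (s ^ 2)⁻¹) * e) by field_simp]
            rw [smul_sub, smul_smul, inv_mul_cancel_left₀ hq0]
            module
        · rcases lt_trichotomy a b with hlt | rfl | hlt
          · rw [pairAct_braidSO_lt _ hab hlt]
            simp only [hw, hz.comm a b hab hlt]
            module
          · rw [pairAct_braidSO_same _ hab]
            simp only [hw, hz.sq a hab]
            simp
          · rw [pairAct_braidSO_gt _ hab hlt]
            have : b ≠ a.rev := fun h' => hab (by rw [h', Fin.rev_rev])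
            simp only [hw, hz.comm b a this hlt]
            rw [smul_smul, mul_neg, inv_mul_cancel₀ hq0]
            module
      -- Reflecting the empty partial sum gives the full one, so the contraction vanishes.
      · have := hrefl 0 N (by simp) (by omega)
        simpa using this
    · intro r hr
      have := hz.pair ⟨r, by omega⟩ (by rw [Fin.lt_def, Fin.val_rev]; simp only; omega)
      rw [← this, extendZero, extendZero, dif_pos (by omega), dif_pos (by omega)]
      have e : (⟨N - 1 - r, by omega⟩ : Fin N) = Fin.rev ⟨r, by omega⟩ := by
        ext; rw [Fin.val_rev]; simp only; omega
      rw [e, Fin.rev_rev]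
    · intro n hn
      have hmid : (⟨n, by omega⟩ : Fin N) = Fin.rev ⟨n, by omega⟩ := by
        ext; rw [Fin.val_rev]; simp only; omega
      have := hz.mid ⟨n, by omega⟩ hmid
      rw [← this, extendZero, dif_pos (by omega), ← hmid]

/-- The `r`-th generator. -/
def leftGen (z : Fin N → B) (r : ℕ) : B := extendZero z r

/-- The generator opposite to the `r`-th one. -/
def rightGen (z : Fin N → B) (r : ℕ) : B := extendZero (fun i => z i.rev) r

/-- The generator which is its own opposite, zero if there is none. -/
def midGen (z : Fin N → B) : B := if N % 2 = 1 then extendZero z (N / 2) else 0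

theorem leftGen_of_lt (z : Fin N → B) {r : ℕ} (h : r < N) : leftGen z r = z ⟨r, h⟩ := by
  rw [leftGen, extendZero, dif_pos h]

theorem rightGen_of_lt (z : Fin N → B) {r : ℕ} (h : r < N) :
    rightGen z r = z (Fin.rev ⟨r, h⟩) := by
  rw [rightGen, extendZero, dif_pos h]

theorem midGen_of_odd (z : Fin N → B) (h : N % 2 = 1) : midGen z = z ⟨N / 2, by omega⟩ := by
  rw [midGen, if_pos h, extendZero, dif_pos]

theorem ofPairs_gen (z : Fin N → B) :
    ofPairs N (leftGen z) (rightGen z) (midGen z) = z := by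
  funext i
  have hi := i.2
  rcases lt_trichotomy (2 * (i : ℕ) + 1) N with h | h | h
  · rw [ofPairs_left _ _ _ h, leftGen_of_lt _ hi]
  · rw [ofPairs_mid _ _ _ h, midGen_of_odd _ (by omega)]
    congr 1
    ext
    simp only
    omega
  · rw [ofPairs_right _ _ _ h, rightGen_of_lt _ (by omega)]
    congr 1
    ext
    rw [Fin.val_rev]
    simp only
    omega

/-- In the pair notation the relations among the first pairs no longer mention `N`; the partial sums
turn into `omega`, which depends only on earlier pairs. This makes an induction on the number of
pairs possible. -/
theorem RelSO.soRel (hs : s ≠ 0) {z : Fin N → B} (hz : RelSO s N z) :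
    SORel s N (leftGen z) (rightGen z) (midGen z) := by
  have hq0 : s ^ 2 ≠ 0 := pow_ne_zero 2 hs
  have skew : ∀ {a b : B}, a = -(s ^ 2) • b → b = -(s ^ 2)⁻¹ • a := by
    intro a b hab
    rw [hab, smul_smul]
    simp [hq0]
  have hF : ∀ r, 2 * r + 1 < N →
      extendZero (fun i => z i * z i.rev) r = leftGen z r * rightGen z r := by
    intro r hr
    rw [leftGen_of_lt _ (by omega), rightGen_of_lt _ (by omega), extendZero, dif_pos]
  refine ⟨⟨?_, ?_, ?_, ?_, ?_, ?_, ?_⟩, ?_, ?_, ?_, ?_⟩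
  · intro r hr
    rw [leftGen_of_lt _ (by omega)]
    refine hz.sq _ fun h => ?_
    have := congrArg Fin.val h
    rw [Fin.val_rev] at this
    simp only at this
    omega
  · intro r hr
    rw [rightGen_of_lt _ (by omega)]
    refine hz.sq _ fun h => ?_
    have := congrArg Fin.val h
    simp only [Fin.val_rev] at this
    omega
  · intro r t hrt ht
    rw [leftGen_of_lt _ (by omega), leftGen_of_lt _ (by omega)]
    refine hz.comm _ _ (fun h => ?_) (by simpa [Fin.lt_def] using hrt)
    have := congrArg Fin.val h
    simp only [Fin.val_rev] at this
    omega
  · intro r t hrt ht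
    rw [leftGen_of_lt _ (by omega), rightGen_of_lt _ (by omega)]
    refine hz.comm _ _ (fun h => ?_) ?_
    · have := congrArg Fin.val h
      simp only [Fin.val_rev] at this
      omega
    · simp only [Fin.lt_def, Fin.val_rev]
      omega
  · intro r t hrt ht
    rw [leftGen_of_lt _ (by omega), rightGen_of_lt _ (by omega)]
    refine skew (hz.comm _ _ (fun h => ?_) ?_)
    · have := congrArg Fin.val h
      simp only [Fin.val_rev] at this
      omega
    · simp only [Fin.lt_def, Fin.val_rev]
      omega
  · intro r t hrt ht
    rw [rightGen_of_lt _ (by omega), rightGen_of_lt _ (by omega)]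
    refine skew (hz.comm _ _ (fun h => ?_) ?_)
    · have := congrArg Fin.val h
      simp only [Fin.val_rev] at this
      omega
    · simp only [Fin.lt_def, Fin.val_rev]
      omega
  · intro r hr
    have := hz.pair ⟨r, by omega⟩ (by simp only [Fin.lt_def, Fin.val_rev]; omega)
    rw [omega_eq_rhoSum hs _ _ _ hF (by omega), eq_sub_iff_add_eq', leftGen_of_lt _ (by omega),
      rightGen_of_lt _ (by omega), this]
  · intro r hr
    rw [leftGen_of_lt _ (by omega)]
    rcases Nat.mod_two_eq_zero_or_one N with h | h
    · simp [midGen, h]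
    · rw [midGen_of_odd _ h]
      refine hz.comm _ _ (fun h => ?_) (by simpa [Fin.lt_def] using hr)
      have := congrArg Fin.val h
      simp only [Fin.val_rev] at this
      omega
  · intro r hr
    rw [rightGen_of_lt _ (by omega)]
    rcases Nat.mod_two_eq_zero_or_one N with h | h
    · simp [midGen, h]
    · rw [midGen_of_odd _ h]
      refine skew (hz.comm _ _ (fun h => ?_) ?_)
      · have := congrArg Fin.val h
        simp only [Fin.val_rev] at this
        omega
      · simp only [Fin.lt_def, Fin.val_rev]
        omega
  · intro h
    have h1 := hz.mid ⟨N / 2, by omega⟩ (by ext; rw [Fin.val_rev]; simp only; omega)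
    rw [midGen_of_odd _ h, h1, omega_eq_rhoSum hs _ _ _ hF (by omega), smul_smul,
      show (N : ℤ) - 2 - 2 * ((N / 2 : ℕ) : ℤ) = -1 by omega, mul_left_comm, zpow_neg_one,
      mul_inv_cancel₀ hs, mul_one]
  · intro h
    simp [midGen, h]

theorem SORel.relSO (hs : s ≠ 0) {X Y : ℕ → B} {C : B} (h : SORel s N X Y C) :
    RelSO s N (ofPairs N X Y C) := by
  have hq0 : s ^ 2 ≠ 0 := pow_ne_zero 2 hs
  have hL : ∀ {i : Fin N}, 2 * (i : ℕ) + 1 < N → 2 * (i.rev : ℕ) + 1 > N := by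
    intro i hi
    rw [Fin.val_rev]; omega
  have hF : ∀ r, 2 * r + 1 < N →
      extendZero (fun i => ofPairs N X Y C i * ofPairs N X Y C i.rev) r = X r * Y r := by
    intro r hr
    rw [extendZero, dif_pos (by omega), ofPairs_left _ _ _ (by simpa using hr),
      ofPairs_right _ _ _ (hL (by simpa using hr))]
    congr 2
    simp only [Fin.val_rev]
    omega
  refine ⟨?_, ?_, ?_, ?_⟩
  · intro a ha
    have hne : 2 * (a : ℕ) + 1 ≠ N := fun h' => ha (by ext; rw [Fin.val_rev]; omega)
    rcases Nat.lt_or_gt_of_ne hne with h' | h'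
    · rw [ofPairs_left _ _ _ h', h.pairs.X_sq _ (by omega)]
    · have := a.2
      rw [ofPairs_right _ _ _ h', h.pairs.Y_sq _ (by omega)]
  · intro a b hab hlt
    have hb := b.2
    have hab' : (a : ℕ) ≠ N - 1 - b := fun h' => hab (by ext; rw [Fin.val_rev]; omega)
    rw [Fin.lt_def] at hlt
    rcases lt_trichotomy (2 * (a : ℕ) + 1) N with h1 | h1 | h1
    · rw [ofPairs_left _ _ _ h1]
      rcases lt_trichotomy (2 * (b : ℕ) + 1) N with h2 | h2 | h2
      · rw [ofPairs_left _ _ _ h2, h.pairs.XX _ _ hlt (by omega)]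
      · rw [ofPairs_mid _ _ _ h2, h.CX _ (by omega)]
      · rw [ofPairs_right _ _ _ h2]
        rcases Nat.lt_or_gt_of_ne hab' with h3 | h3
        · rw [h.pairs.YX _ _ h3 (by omega)]
        · exact smul_eq_of_skew hq0 (h.pairs.XY _ _ h3 (by omega))
    · rw [ofPairs_mid _ _ _ h1, ofPairs_right _ _ _ (by omega)]
      exact smul_eq_of_skew hq0 (h.CY _ (by omega))
    · rw [ofPairs_right _ _ _ h1, ofPairs_right _ _ _ (by omega)]
      exact smul_eq_of_skew hq0 (h.pairs.YY _ _ (by omega) (by omega))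
  · intro a ha
    have h1 : 2 * (a : ℕ) + 1 < N := by
      rw [Fin.lt_def, Fin.val_rev] at ha
      omega
    have h2 : N - 1 - (a.rev : ℕ) = a := by
      rw [Fin.val_rev]
      omega
    rw [ofPairs_left _ _ _ h1, ofPairs_right _ _ _ (hL h1), h2, h.pairs.cross _ (by omega),
      omega_eq_rhoSum hs _ _ _ hF (by omega)]
    abel
  · intro a ha
    have h1 : 2 * (a : ℕ) + 1 = N := by
      have := congrArg Fin.val ha
      rw [Fin.val_rev] at this
      omega
    have h2 : (a : ℕ) = N / 2 := by omega
    rw [ofPairs_mid _ _ _ h1, h.C_sq (by omega), omega_eq_rhoSum hs _ _ _ hF (by omega), smul_smul,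
      show (N : ℤ) - 2 - 2 * ((N / 2 : ℕ) : ℤ) = -1 by omega, mul_left_comm, zpow_neg_one,
      mul_inv_cancel₀ hs, mul_one, h2]

end OrthogonalRelations

end QEpsilon

namespace QEpsilon

open scoped TensorProduct

universe v

/-! ### Commutation of `omega` with the generators. -/

section PairRelations

variable {K : Type*} [Field K] {B : Type*} [Ring B] [Algebra K B] {q : K} {n : ℕ} {X Y : ℕ → B}

theorem omega_congr {X' Y' : ℕ → B} {p : ℕ} (hX : ∀ r < p, X r = X' r) (hY : ∀ r < p, Y r = Y' r) :
    omega q X Y p = omega q X' Y' p := by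
  induction p with
  | zero => rfl
  | succ p ih =>
    rw [omega, omega, ih (fun r hr => hX r (by omega)) (fun r hr => hY r (by omega)),
      hX p (by omega), hY p (by omega)]

/-- An element which anticommutes up to `q` with the first `p` pairs commutes with their `omega`. -/
theorem mul_omega_of_skew (hq : q ≠ 0) {c : B} {p : ℕ} (hX : ∀ r < p, c * X r = -q • (X r * c))
    (hY : ∀ r < p, c * Y r = -q⁻¹ • (Y r * c)) : c * omega q X Y p = omega q X Y p * c := by
  induction p with
  | zero => simp [omega]
  | succ p ih =>
    have h1 : c * (X p * Y p) = X p * Y p * c := by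
      rw [← mul_assoc, hX p (by omega), smul_mul_assoc, mul_assoc, hY p (by omega), mul_smul_comm,
        smul_smul, mul_assoc]
      simp [hq]
    rw [omega, mul_add, add_mul, mul_smul_comm, mul_smul_comm, smul_mul_assoc, smul_mul_assoc,
      ih (fun r hr => hX r (by omega)) (fun r hr => hY r (by omega)), h1]

namespace PairRel

theorem X_mul_omega (hq : q ≠ 0) (h : PairRel q n X Y) {p r : ℕ} (hp : p ≤ r) (hr : r < n) :
    X r * omega q X Y p = omega q X Y p * X r :=
  mul_omega_of_skew hq (fun t ht => h.XX t r (by omega) hr) (fun t ht => h.XY t r (by omega) hr)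

theorem Y_mul_omega (hq : q ≠ 0) (h : PairRel q n X Y) {p r : ℕ} (hp : p ≤ r) (hr : r < n) :
    Y r * omega q X Y p = omega q X Y p * Y r :=
  mul_omega_of_skew hq (fun t ht => h.YX t r (by omega) hr) (fun t ht => h.YY t r (by omega) hr)

/-- For an older pair, two factors `-q` appear. For the newest pair `X Y X = X * omega`, because `X
^ 2 = 0`, and `q⁻¹ + (q - q⁻¹) = q` against `q⁻¹` on the other side gives the ratio `q ^ 2`. -/
theorem omega_mul_X (hq : q ≠ 0) (h : PairRel q n X Y) {p r : ℕ} (hr : r < p) (hp : p ≤ n) :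
    omega q X Y p * X r = q ^ 2 • (X r * omega q X Y p) := by
  induction p with
  | zero => omega
  | succ p ih =>
    rcases Nat.lt_or_ge r p with h1 | h1
    · have e : X p * Y p * X r = q ^ 2 • (X r * (X p * Y p)) := by
        rw [mul_assoc, h.YX r p h1 (by omega), mul_smul_comm, ← mul_assoc, h.XX r p h1 (by omega),
          smul_mul_assoc, smul_smul, mul_assoc]
        congr 1
        ring
      rw [omega, add_mul, mul_add, smul_mul_assoc, smul_mul_assoc, ih h1 (by omega), e]
      simp only [mul_smul_comm]
      module
    · obtain rfl : r = p := by omega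
      have e1 : X r * Y r * X r = X r * omega q X Y r := by
        rw [mul_assoc, h.cross r (by omega), mul_sub, ← mul_assoc (X r) (X r), h.X_sq r (by omega)]
        simp
      have e2 : X r * (X r * Y r) = 0 := by rw [← mul_assoc, h.X_sq r (by omega), zero_mul]
      rw [omega, add_mul, mul_add, smul_mul_assoc, smul_mul_assoc, mul_smul_comm, mul_smul_comm, e1,
        e2, ← h.X_mul_omega hq le_rfl (by omega), smul_zero, add_zero, ← add_smul, smul_smul]
      congr 1
      field_simp
      ring

theorem omega_mul_Y (hq : q ≠ 0) (h : PairRel q n X Y) {p r : ℕ} (hr : r < p) (hp : p ≤ n) :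
    q ^ 2 • (omega q X Y p * Y r) = Y r * omega q X Y p := by
  induction p with
  | zero => omega
  | succ p ih =>
    rcases Nat.lt_or_ge r p with h1 | h1
    · have e : q ^ 2 • (X p * Y p * Y r) = Y r * (X p * Y p) := by
        rw [mul_assoc, h.YY r p h1 (by omega), mul_smul_comm, ← mul_assoc, h.XY r p h1 (by omega),
          smul_mul_assoc, smul_smul, smul_smul, mul_assoc]
        rw [show q ^ 2 * (-q⁻¹ * -q⁻¹) = 1 by field_simp, one_smul,
          mul_assoc]
      rw [omega, add_mul, mul_add, smul_mul_assoc, smul_mul_assoc, mul_smul_comm, mul_smul_comm,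
        ← ih h1 (by omega), ← e]
      module
    · obtain rfl : r = p := by omega
      have e1 : Y r * (X r * Y r) = Y r * omega q X Y r := by
        rw [← mul_assoc, h.cross r (by omega), sub_mul, mul_assoc (X r), h.Y_sq r (by omega),
          h.Y_mul_omega hq le_rfl (by omega)]
        simp
      have e2 : X r * Y r * Y r = 0 := by rw [mul_assoc, h.Y_sq r (by omega), mul_zero]
      rw [omega, add_mul, mul_add, smul_mul_assoc, smul_mul_assoc, mul_smul_comm, mul_smul_comm, e1,
        e2, h.Y_mul_omega hq le_rfl (by omega), smul_zero, add_zero, ← add_smul, smul_smul]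
      congr 1
      field_simp
      ring

end PairRel

end PairRelations

/-! ### Fock representation for `so`. -/

section OrthogonalFock

variable {K : Type v} [Field K] {q : K} {M : Type v} [AddCommGroup M] [Module K M]

/-- The action of an endomorphism on four copies of a module, scaled according to the degree. -/
def diagEnd (κ : K) (f : Module.End K M) : Module.End K (M × M × M × M) where
  toFun v := (f v.1, κ • f v.2.1, κ • f v.2.2.1, κ ^ 2 • f v.2.2.2)
  map_add' v w := by simp
  map_smul' r v := by simp [smul_comm r]

/-- The first new creation operator. -/
def fockX : Module.End K (M × M × M × M) where
  toFun v := (0, v.1, 0, v.2.2.1)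
  map_add' v w := by simp
  map_smul' r v := by simp

/-- The second new creation operator. -/
def fockY (Ω : Module.End K M) : Module.End K (M × M × M × M) where
  toFun v := (Ω v.2.1, 0, v.1 + Ω v.2.2.2, -v.2.1)
  map_add' v w := by
    simp only [Prod.fst_add, Prod.snd_add, map_add, Prod.mk_add_mk, add_zero, neg_add]
    congr 3
    abel
  map_smul' r v := by simp

theorem diagEnd_mul (κ κ' : K) (f g : Module.End K M) :
    diagEnd κ f * diagEnd κ' g = diagEnd (κ * κ') (f * g) := by
  refine LinearMap.ext fun v => ?_
  simp [diagEnd, smul_smul, mul_pow]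

theorem diagEnd_smul (κ r : K) (f : Module.End K M) : diagEnd κ (r • f) = r • diagEnd κ f := by
  refine LinearMap.ext fun v => ?_
  simp [diagEnd, smul_comm r]

theorem diagEnd_add (κ : K) (f g : Module.End K M) :
    diagEnd κ (f + g) = diagEnd κ f + diagEnd κ g := by
  refine LinearMap.ext fun v => ?_
  simp [diagEnd]

theorem diagEnd_sub (κ : K) (f g : Module.End K M) :
    diagEnd κ (f - g) = diagEnd κ f - diagEnd κ g := by
  refine LinearMap.ext fun v => ?_
  simp [diagEnd, smul_sub]

@[simp] theorem diagEnd_zero (κ : K) : diagEnd κ (0 : Module.End K M) = 0 := by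
  refine LinearMap.ext fun v => ?_
  simp [diagEnd]

theorem fockX_mul_diagEnd {κ κ' : K} (h : κ' * κ = 1) (f : Module.End K M) :
    fockX * diagEnd κ f = κ' • (diagEnd κ f * fockX) := by
  refine LinearMap.ext fun v => ?_
  simp [diagEnd, fockX, smul_smul, pow_two, h, ← mul_assoc]

theorem fockY_mul_diagEnd {κ κ' : K} (h : κ' * κ = 1) {f Ω : Module.End K M}
    (hf : κ • (Ω * f) = κ' • (f * Ω)) :
    fockY Ω * diagEnd κ f = κ' • (diagEnd κ f * fockY Ω) := by
  have hf' : ∀ m, κ • Ω (f m) = κ' • f (Ω m) := fun m => LinearMap.congr_fun hf m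
  have hf2 : ∀ m, κ ^ 2 • Ω (f m) = f (Ω m) := fun m => by
    rw [pow_two, mul_smul, hf', smul_smul, mul_comm, h, one_smul]
  refine LinearMap.ext fun v => ?_
  simp [diagEnd, fockY, smul_smul, pow_two, h, ← mul_assoc, hf']
  simp [← pow_two, hf2]

/-- A Fock representation of the relations between pairs of opposite generators. -/
theorem exists_fock_pairs (hq : q ≠ 0) (n : ℕ) :
    ∃ (M : Type v) (_ : AddCommGroup M) (_ : Module K M) (_ : Module.Finite K M)
      (X Y : ℕ → Module.End K M) (w : M), PairRel q n X Y ∧ Module.finrank K M = 2 ^ (2 * n) ∧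
      ∀ Q : Submodule K M, w ∈ Q → (∀ r < n, ∀ x ∈ Q, X r x ∈ Q ∧ Y r x ∈ Q) → Q = ⊤ := by
  induction n with
  | zero =>
    refine ⟨K, inferInstance, inferInstance, inferInstance, 0, 0, 1,
      ⟨by simp, by simp, by simp, by simp, by simp, by simp, by simp⟩, by simp, fun Q h1 _ => ?_⟩
    rw [eq_top_iff]
    intro x _
    simpa using Q.smul_mem x h1
  | succ n ih =>
    obtain ⟨M, _, _, _, X, Y, w, hz, hM, hcyc⟩ := ih
    -- Four copies of `M` stand for `M`, `X M`, `Y M` and `X Y M` with the new pair `X, Y`. The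
    -- operator `Ω` is the prescribed value of the anticommutator of that pair.
    set Ω := omega q X Y n with hΩ
    let X' : ℕ → Module.End K (M × M × M × M) := fun r =>
      if r < n then diagEnd (-q⁻¹) (X r) else fockX
    let Y' : ℕ → Module.End K (M × M × M × M) := fun r =>
      if r < n then diagEnd (-q) (Y r) else fockY Ω
    have hX : ∀ r < n, X' r = diagEnd (-q⁻¹) (X r) := fun r hr => if_pos hr
    have hY : ∀ r < n, Y' r = diagEnd (-q) (Y r) := fun r hr => if_pos hr
    have hXn : X' n = fockX := if_neg (lt_irrefl n)
    have hYn : Y' n = fockY Ω := if_neg (lt_irrefl n)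
    -- The twists `-q⁻¹` and `-q` of an old pair cancel in the product, so `omega` acts untwisted on
    -- all four copies.
    have hom : ∀ p ≤ n, omega q X' Y' p = diagEnd 1 (omega q X Y p) := by
      intro p hp
      induction p with
      | zero => simp [omega]
      | succ p ih =>
        rw [omega, omega, ih (by omega), hX p (by omega), hY p (by omega), diagEnd_mul, diagEnd_add,
          diagEnd_smul, diagEnd_smul]
        simp [hq]
    refine ⟨M × M × M × M, inferInstance, inferInstance, inferInstance, X', Y', (w, 0, 0, 0),
      ⟨?_, ?_, ?_, ?_, ?_, ?_, ?_⟩, ?_, ?_⟩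
    · intro r hr
      rcases Nat.lt_or_ge r n with h | h
      · rw [hX r h, diagEnd_mul, hz.X_sq r h, diagEnd_zero]
      · obtain rfl : r = n := by omega
        rw [hXn]
        exact LinearMap.ext fun v => by simp [fockX]
    · intro r hr
      rcases Nat.lt_or_ge r n with h | h
      · rw [hY r h, diagEnd_mul, hz.Y_sq r h, diagEnd_zero]
      · obtain rfl : r = n := by omega
        rw [hYn]
        exact LinearMap.ext fun v => by simp [fockY]
    · intro r t hrt ht
      rcases Nat.lt_or_ge t n with h | h
      · rw [hX r (by omega), hX t h, diagEnd_mul, hz.XX r t hrt h, diagEnd_smul, diagEnd_mul]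
      · obtain rfl : t = n := by omega
        rw [hXn, hX r hrt, fockX_mul_diagEnd (κ' := -q) (by simp [hq])]
    · intro r t hrt ht
      rcases Nat.lt_or_ge t n with h | h
      · rw [hX r (by omega), hY t h, diagEnd_mul, hz.YX r t hrt h, diagEnd_smul, diagEnd_mul,
          mul_comm]
      · obtain rfl : t = n := by omega
        rw [hYn, hX r hrt, fockY_mul_diagEnd (κ' := -q) (by simp [hq])]
        rw [hz.omega_mul_X hq hrt le_rfl, smul_smul]
        congr 1
        field_simp
    · intro r t hrt ht
      rcases Nat.lt_or_ge t n with h | h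
      · rw [hY r (by omega), hX t h, diagEnd_mul, hz.XY r t hrt h, diagEnd_smul, diagEnd_mul,
          mul_comm]
      · obtain rfl : t = n := by omega
        rw [hXn, hY r hrt, fockX_mul_diagEnd (κ' := -q⁻¹) (by simp [hq])]
    · intro r t hrt ht
      rcases Nat.lt_or_ge t n with h | h
      · rw [hY r (by omega), hY t h, diagEnd_mul, hz.YY r t hrt h, diagEnd_smul, diagEnd_mul]
      · obtain rfl : t = n := by omega
        rw [hYn, hY r hrt, fockY_mul_diagEnd (κ' := -q⁻¹) (by simp [hq])]
        rw [← hz.omega_mul_Y hq hrt le_rfl, smul_smul]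
        congr 1
        field_simp
    · intro r hr
      rw [hom r (by omega)]
      rcases Nat.lt_or_ge r n with h | h
      · rw [hX r h, hY r h, diagEnd_mul, diagEnd_mul, hz.cross r h, diagEnd_sub]
        simp [hq]
      · obtain rfl : r = n := by omega
        rw [hXn, hYn]
        refine LinearMap.ext fun v => ?_
        simp [fockX, fockY, diagEnd, Ω]
    · simp only [Module.finrank_prod, hM]
      ring
    · intro Q hw hQ
      have h0 : ∀ x : M, (x, (0 : M), (0 : M), (0 : M)) ∈ Q := by
        have : Q.comap (LinearMap.inl K M (M × M × M)) = ⊤ := by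
          apply hcyc
          · exact hw
          · intro r hr x hx
            have := hQ r (by omega) _ hx
            rw [hX r hr, hY r hr] at this
            simp only [diagEnd, LinearMap.coe_mk, AddHom.coe_mk, LinearMap.inl_apply, Prod.fst_zero,
              Prod.snd_zero, map_zero, smul_zero] at this
            exact this
        intro x
        exact (this ▸ Submodule.mem_top : x ∈ Q.comap (LinearMap.inl K M (M × M × M)))
      have hx : ∀ v ∈ Q, fockX v ∈ Q := fun v hv => hXn ▸ (hQ n (by omega) v hv).1
      have hy : ∀ v ∈ Q, fockY Ω v ∈ Q := fun v hv => hYn ▸ (hQ n (by omega) v hv).2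
      rw [eq_top_iff]
      rintro ⟨a, b, c, d⟩ _
      have : (a, b, c, d) = (a, (0 : M), (0 : M), (0 : M)) + fockX (K := K) (b, 0, 0, 0) +
          fockY Ω (c, 0, 0, 0) + fockX (K := K) (fockY Ω (d, 0, 0, 0)) := by simp [fockX, fockY]
      rw [this]
      exact Q.add_mem (Q.add_mem (Q.add_mem (h0 a) (hx _ (h0 b))) (hy _ (h0 c)))
        (hx _ (hy _ (h0 d)))

/-- A Fock representation of the relations of the `U_q so(N)`-covariant exterior algebra. -/
theorem exists_fock_SO {s : K} (hs : s ≠ 0) (hs2 : 1 + s ^ 2 ≠ 0) (N : ℕ) :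
    ∃ (M : Type v) (_ : AddCommGroup M) (_ : Module K M) (_ : Module.Finite K M)
      (X Y : ℕ → Module.End K M) (C : Module.End K M) (w : M), SORel s N X Y C ∧
      Module.finrank K M = 2 ^ N ∧
      ∀ Q : Submodule K M, w ∈ Q → (∀ r < N / 2, ∀ x ∈ Q, X r x ∈ Q ∧ Y r x ∈ Q) →
        (∀ x ∈ Q, C x ∈ Q) → Q = ⊤ := by
  have hq : s ^ 2 ≠ 0 := pow_ne_zero 2 hs
  obtain ⟨M, _, _, _, X, Y, w, hz, hM, hcyc⟩ := exists_fock_pairs hq (N / 2)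
  rcases Nat.mod_two_eq_zero_or_one N with hN | hN
  · exact ⟨M, inferInstance, inferInstance, inferInstance, X, Y, 0, w,
      ⟨hz, by simp, by simp, by omega, by simp⟩, by rw [hM]; congr 1; omega,
      fun Q h1 h2 _ => hcyc Q h1 h2⟩
  -- This is the value of `C * C` forced by the relations. On the two copies `M` and `C M`, the
  -- operator `C` moves the first to the second and returns the second through `Ω`.
  set Ω := (s / (1 + s ^ 2)) • omega (s ^ 2) X Y (N / 2) with hΩ
  let D : K → Module.End K M → Module.End K (M × M) := fun κ f => f.prodMap (κ • f)
  have hDmul : ∀ κ κ' f g, D κ f * D κ' g = D (κ * κ') (f * g) := fun κ κ' f g =>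
    LinearMap.ext fun v => by simp [D, smul_smul, mul_comm κ]
  have hDsmul : ∀ (κ r : K) f, D κ (r • f) = r • D κ f := fun κ r f =>
    LinearMap.ext fun v => by simp [D, smul_comm r]
  have hDadd : ∀ κ f g, D κ (f + g) = D κ f + D κ g := fun κ f g =>
    LinearMap.ext fun v => by simp [D]
  have hDsub : ∀ κ f g, D κ (f - g) = D κ f - D κ g := fun κ f g =>
    LinearMap.ext fun v => by simp [D, smul_sub]
  have hD0 : ∀ κ, D κ 0 = 0 := fun κ => LinearMap.ext fun v => by simp [D]
  let X' : ℕ → Module.End K (M × M) := fun r => D (-(s ^ 2)⁻¹) (X r)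
  let Y' : ℕ → Module.End K (M × M) := fun r => D (-(s ^ 2)) (Y r)
  let C : Module.End K (M × M) :=
    (Ω ∘ₗ LinearMap.snd K M M).prod (LinearMap.fst K M M)
  have hom : ∀ p, omega (s ^ 2) X' Y' p = D 1 (omega (s ^ 2) X Y p) := by
    intro p
    induction p with
    | zero => simp [omega, hD0]
    | succ p ih =>
      simp only [omega, ih, X', Y', hDmul, hDadd, hDsmul]
      simp [hs]
  have hC : ∀ κ κ' f, κ' * κ = 1 → κ • (Ω * f) = κ' • (f * Ω) → C * D κ f = κ' • (D κ f * C) := by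
    intro κ κ' f h1 hf
    have hf' : ∀ m, κ • Ω (f m) = κ' • f (Ω m) := fun m => LinearMap.congr_fun hf m
    refine LinearMap.ext fun v => ?_
    simp [D, C, smul_smul, h1, hf']
  refine ⟨M × M, inferInstance, inferInstance, inferInstance, X', Y', C, (w, 0),
    ⟨⟨?_, ?_, ?_, ?_, ?_, ?_, ?_⟩, ?_, ?_, ?_, by omega⟩, ?_, ?_⟩
  · intro r hr
    simp only [X', hDmul, hz.X_sq r hr, hD0]
  · intro r hr
    simp only [Y', hDmul, hz.Y_sq r hr, hD0]
  · intro r t h1 h2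
    simp only [X', hDmul, hz.XX r t h1 h2, hDsmul]
  · intro r t h1 h2
    simp only [X', Y', hDmul, hz.YX r t h1 h2, hDsmul]
    rw [mul_comm]
  · intro r t h1 h2
    simp only [X', Y', hDmul, hz.XY r t h1 h2, hDsmul]
    rw [mul_comm]
  · intro r t h1 h2
    simp only [Y', hDmul, hz.YY r t h1 h2, hDsmul]
  · intro r hr
    rw [hom r]
    simp only [X', Y', hDmul, hz.cross r hr, hDsub]
    simp [hs]
  · intro r hr
    refine hC _ _ _ (by simp [hs]) ?_
    rw [hΩ, smul_mul_assoc, hz.omega_mul_X hq hr le_rfl, mul_smul_comm, smul_smul, smul_smul,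
      smul_smul]
    congr 1
    field_simp
  · intro r hr
    refine hC _ _ _ (by simp [hs]) ?_
    rw [hΩ, mul_smul_comm, ← hz.omega_mul_Y hq hr le_rfl, smul_mul_assoc, smul_smul, smul_smul,
      smul_smul]
    congr 1
    field_simp
  · intro _
    rw [hom]
    refine LinearMap.ext fun v => ?_
    simp [C, D, Ω, smul_smul, mul_div_cancel₀, hs2]
  · rw [Module.finrank_prod, hM, ← two_mul, ← pow_succ']
    congr 1
    omega
  · intro Q hw hQ hQC
    have h0 : ∀ x : M, (x, (0 : M)) ∈ Q := by
      have : Q.comap (LinearMap.inl K M M) = ⊤ := by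
        apply hcyc
        · exact hw
        · intro r hr x hx
          have := hQ r hr _ hx
          simpa [X', Y', D] using this
      intro x
      exact (this ▸ Submodule.mem_top : x ∈ Q.comap (LinearMap.inl K M M))
    rw [eq_top_iff]
    rintro ⟨a, b⟩ _
    have : (a, b) = (a, (0 : M)) + C (b, 0) := by simp [C]
    rw [this]
    exact Q.add_mem (h0 a) (hQC _ (h0 b))

end OrthogonalFock

end QEpsilon

namespace QEpsilon

open scoped TensorProduct

universe v

/-- The parameter `s` is a square root of an element which is not a root of unity. -/
structure IsGeneric {K : Type*} [Field K] (s : K) : Prop where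
  ne_zero : s ≠ 0
  pow_ne_one : ∀ r : ℕ, 1 ≤ r → (s ^ 2) ^ r ≠ 1

namespace IsGeneric

variable {K : Type*} [Field K] {s : K}

theorem sq_ne_zero (hg : IsGeneric s) : s ^ 2 ≠ 0 := pow_ne_zero 2 hg.ne_zero

theorem one_add_pow_ne_zero (hg : IsGeneric s) {r : ℕ} (hr : 1 ≤ r) : 1 + (s ^ 2) ^ r ≠ 0 := by
  intro h0
  apply hg.pow_ne_one (r * 2) (by omega)
  rw [pow_mul]
  linear_combination ((s ^ 2) ^ r - 1) * h0

theorem one_add_ne_zero (hg : IsGeneric s) : 1 + s ^ 2 ≠ 0 := by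
  simpa using hg.one_add_pow_ne_zero le_rfl

end IsGeneric

/-! ### The order of the letters in the basis words for `so`. -/

section PairList

/-- The first `p` pairs of opposite indices, in decreasing order of the pairs. -/
def pairList (N : ℕ) : ℕ → List (Fin N)
  | 0 => []
  | p + 1 => if h : p < N then ⟨p, h⟩ :: Fin.rev ⟨p, h⟩ :: pairList N p else []

/-- The ordering of the generators in the Poincaré–Birkhoff–Witt basis. -/
def pbwList (N : ℕ) : List (Fin N) :=
  if h : N % 2 = 1 then ⟨N / 2, by omega⟩ :: pairList N (N / 2) else pairList N (N / 2)

variable {N : ℕ}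

theorem pairList_succ {p : ℕ} (h : p < N) :
    pairList N (p + 1) = ⟨p, h⟩ :: Fin.rev ⟨p, h⟩ :: pairList N p := by
  rw [pairList, dif_pos h]

theorem mem_pairList {p : ℕ} (hp : 2 * p ≤ N) (j : Fin N) :
    j ∈ pairList N p ↔ (j : ℕ) < p ∨ N - 1 - (j : ℕ) < p := by
  have hj := j.2
  induction p with
  | zero => simp [pairList]
  | succ p ih =>
    have ih' := ih (by omega)
    rw [pairList_succ (by omega), List.mem_cons, List.mem_cons]
    simp only [ih', Fin.ext_iff, Fin.val_rev]
    omega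

theorem nodup_pairList {p : ℕ} (hp : 2 * p ≤ N) : (pairList N p).Nodup := by
  induction p with
  | zero => simp [pairList]
  | succ p ih =>
    rw [pairList_succ (by omega), List.nodup_cons, List.nodup_cons, List.mem_cons,
      mem_pairList (by omega), mem_pairList (by omega), Fin.ext_iff, Fin.val_rev]
    refine ⟨?_, ?_, ih (by omega)⟩ <;> simp only <;> omega

theorem pbwList_perm : (pbwList N).Perm (List.finRange N) := by
  refine (List.perm_ext_iff_of_nodup ?_ (List.nodup_finRange N)).2 fun j => ?_
  · rw [pbwList]
    split_ifs with h
    · rw [List.nodup_cons, mem_pairList (by omega)]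
      refine ⟨?_, nodup_pairList (by omega)⟩
      simp only
      omega
    · exact nodup_pairList (by omega)
  · have hj := j.2
    rw [pbwList]
    split_ifs with h
    · rw [List.mem_cons, mem_pairList (by omega), Fin.ext_iff]
      simp only [List.mem_finRange, iff_true]
      omega
    · rw [mem_pairList (by omega)]
      simp only [List.mem_finRange, iff_true]
      omega

variable {K : Type*} [Field K] {B : Type*} [Ring B] [Algebra K B] {z : Fin N → B}

theorem exists_gen_of_mem_pairList (z : Fin N → B) {p : ℕ} (hp : 2 * p ≤ N) {j : Fin N}
    (hj : j ∈ pairList N p) : ∃ r < p, z j = leftGen z r ∨ z j = rightGen z r := by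
  rcases (mem_pairList hp j).1 hj with h | h
  · exact ⟨j, h, Or.inl (by rw [leftGen_of_lt z j.2])⟩
  · refine ⟨N - 1 - j, h, Or.inr ?_⟩
    rw [rightGen_of_lt z (by omega)]
    congr 1
    ext
    simp only [Fin.val_rev]
    omega

theorem leftGen_mem_adjoin (z : Fin N → B) {p r : ℕ} (hp : 2 * p ≤ N) (hr : r < p) :
    leftGen z r ∈ Algebra.adjoin K (z '' {j | j ∈ pairList N p}) := by
  rw [leftGen_of_lt z (by omega)]
  exact Algebra.subset_adjoin ⟨_, (mem_pairList hp _).2 (Or.inl hr), rfl⟩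

theorem rightGen_mem_adjoin (z : Fin N → B) {p r : ℕ} (hp : 2 * p ≤ N) (hr : r < p) :
    rightGen z r ∈ Algebra.adjoin K (z '' {j | j ∈ pairList N p}) := by
  rw [rightGen_of_lt z (by omega)]
  refine Algebra.subset_adjoin ⟨_, (mem_pairList hp _).2 (Or.inr ?_), rfl⟩
  simp only [Fin.val_rev]
  omega

theorem omega_mem_adjoin (q : K) (z : Fin N → B) {p t : ℕ} (hp : 2 * p ≤ N) (ht : t ≤ p) :
    omega q (leftGen z) (rightGen z) t ∈ Algebra.adjoin K (z '' {j | j ∈ pairList N p}) := by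
  induction t with
  | zero => exact zero_mem _
  | succ t ih =>
    exact add_mem (Subalgebra.smul_mem _ (ih (by omega)) _)
      (Subalgebra.smul_mem _ (mul_mem (leftGen_mem_adjoin z hp (by omega))
        (rightGen_mem_adjoin z hp (by omega))) _)

/-- Pairs are adjoined starting from the outermost. Lower terms appear only when the two members of
the same pair are exchanged, and they equal `omega`, which lies in the algebra of the earlier pairs.
-/
theorem isTower_pairList {q : K} (hq : q ≠ 0) {n : ℕ} (hn : 2 * n ≤ N)
    (hz : PairRel q n (leftGen z) (rightGen z)) {p : ℕ} (hp : p ≤ n) :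
    IsTower K z (pairList N p) := by
  induction p with
  | zero => trivial
  | succ p ih =>
    have hle : Algebra.adjoin K (z '' {j | j ∈ pairList N p}) ≤
        Algebra.adjoin K (z '' {j | j ∈ Fin.rev ⟨p, by omega⟩ :: pairList N p}) :=
      Algebra.adjoin_mono (Set.image_mono fun j hj => List.mem_cons_of_mem _ hj)
    have hX : z ⟨p, by omega⟩ = leftGen z p := (leftGen_of_lt z _).symm
    have hY : z (Fin.rev ⟨p, by omega⟩) = rightGen z p := (rightGen_of_lt z _).symm
    have skew : ∀ {a b : B} {c : K}, c ≠ 0 → b = c • a → a - c⁻¹ • b = 0 := by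
      intro a b c hc h
      rw [h, smul_smul, inv_mul_cancel₀ hc, one_smul, sub_self]
    rw [pairList_succ (by omega)]
    refine ⟨⟨?_, ?_⟩, ⟨?_, ?_⟩, ih (by omega)⟩
    · rw [hX, hz.X_sq p (by omega)]
      exact zero_mem _
    · intro j hj
      rcases List.mem_cons.1 hj with rfl | hj
      · refine ⟨-1, ?_⟩
        rw [hX, hY, hz.cross p (by omega), neg_one_smul, sub_neg_eq_add, sub_add_cancel]
        exact hle (omega_mem_adjoin q z (by omega) le_rfl)
      · obtain ⟨r, hr, h | h⟩ := exists_gen_of_mem_pairList z (by omega) hj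
        · refine ⟨(-q)⁻¹, ?_⟩
          rw [hX, h, skew (neg_ne_zero.2 hq) (hz.XX r p hr (by omega))]
          exact zero_mem _
        · refine ⟨(-q⁻¹)⁻¹, ?_⟩
          rw [hX, h, skew (neg_ne_zero.2 (inv_ne_zero hq)) (hz.XY r p hr (by omega))]
          exact zero_mem _
    · rw [hY, hz.Y_sq p (by omega)]
      exact zero_mem _
    · intro j hj
      obtain ⟨r, hr, h | h⟩ := exists_gen_of_mem_pairList z (by omega) hj
      · refine ⟨(-q)⁻¹, ?_⟩
        rw [hY, h, skew (neg_ne_zero.2 hq) (hz.YX r p hr (by omega))]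
        exact zero_mem _
      · refine ⟨(-q⁻¹)⁻¹, ?_⟩
        rw [hY, h, skew (neg_ne_zero.2 (inv_ne_zero hq)) (hz.YY r p hr (by omega))]
        exact zero_mem _

/-- The central letter must be adjoined after all pairs, because its square is a combination of
their products. -/
theorem isTower_pbwList {s : K} (hg : IsGeneric s)
    (hz : SORel s N (leftGen z) (rightGen z) (midGen z)) : IsTower K z (pbwList N) := by
  have hq := hg.sq_ne_zero
  have hT := isTower_pairList hq (by omega) hz.pairs le_rfl
  rw [pbwList]
  split_ifs with h
  · have hC : z ⟨N / 2, by omega⟩ = midGen z := (midGen_of_odd z h).symm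
    have skew : ∀ {a b : B} {c : K}, c ≠ 0 → b = c • a → a - c⁻¹ • b = 0 := by
      intro a b c hc h
      rw [h, smul_smul, inv_mul_cancel₀ hc, one_smul, sub_self]
    refine ⟨⟨?_, ?_⟩, hT⟩
    · have h1 : midGen z * midGen z =
          (s / (1 + s ^ 2)) • omega (s ^ 2) (leftGen z) (rightGen z) (N / 2) := by
        apply smul_right_injective B hg.one_add_ne_zero
        simp only
        rw [hz.C_sq h, smul_smul, mul_div_cancel₀ _ hg.one_add_ne_zero]
      rw [hC, h1]
      exact Subalgebra.smul_mem _ (omega_mem_adjoin _ z (by omega) le_rfl) _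
    · intro j hj
      obtain ⟨r, hr, h | h⟩ := exists_gen_of_mem_pairList z (by omega) hj
      · refine ⟨(-(s ^ 2))⁻¹, ?_⟩
        rw [hC, h, skew (neg_ne_zero.2 hq) (hz.CX r hr)]
        exact zero_mem _
      · refine ⟨(-(s ^ 2)⁻¹)⁻¹, ?_⟩
        rw [hC, h, skew (neg_ne_zero.2 (inv_ne_zero hq)) (hz.CY r hr)]
        exact zero_mem _
  · exact hT

end PairList

/-! ### Generators, homomorphisms and the basis of the exterior algebra for `so`. -/

section OrthogonalAlgebra

variable {K : Type v} [Field K] {s : K} {N : ℕ} {B : Type*} [Ring B] [Algebra K B]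

variable (s N) in
/-- The `U_q so(N)`-covariant exterior algebra. -/
abbrev SOAlg : Type v := ExtAlg (minusSO s N)

variable (s N) in
/-- The generators `ξ^{-n}, …, ξ^{-1}`. -/
noncomputable def gX (r : ℕ) : SOAlg s N := leftGen (xi (minusSO s N)) r

variable (s N) in
/-- The generators `ξ^n, …, ξ^1`. -/
noncomputable def gY (r : ℕ) : SOAlg s N := rightGen (xi (minusSO s N)) r

variable (s N) in
/-- The generator `ξ^0`, zero if `N` is even. -/
noncomputable def gC : SOAlg s N := midGen (xi (minusSO s N))

theorem eq_ofPairs_gen (c : Fin N) :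
    xi (minusSO s N) c = ofPairs N (gX s N) (gY s N) (gC s N) c :=
  (congrFun (ofPairs_gen (xi (minusSO s N))) c).symm

variable [CharZero K]

theorem quadRel_iff_relSO (hg : IsGeneric s) (z : Fin N → B) :
    QuadRel (minusSO s N) z ↔ RelSO s N z :=
  quadRel_minusSO_iff hg.ne_zero hg.pow_ne_one
    (fun hN => traceConst_ne_zero hg.ne_zero hg.pow_ne_one hN) z

theorem relSO_xi (hg : IsGeneric s) : RelSO s N (xi (minusSO s N)) :=
  (quadRel_iff_relSO hg _).1 (quadRel_xi _)

theorem soRel_gen (hg : IsGeneric s) : SORel s N (gX s N) (gY s N) (gC s N) :=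
  (relSO_xi hg).soRel hg.ne_zero

/-- The homomorphism from the exterior algebra with given values on the generators. -/
noncomputable def soLift (hg : IsGeneric s) {X Y : ℕ → B} {C : B} (h : SORel s N X Y C) :
    SOAlg s N →ₐ[K] B :=
  extLift (ofPairs N X Y C) ((quadRel_iff_relSO hg _).2 (h.relSO hg.ne_zero))

section Lift

variable (hg : IsGeneric s) {X Y : ℕ → B} {C : B} (h : SORel s N X Y C)

theorem soLift_xi (c : Fin N) : soLift hg h (xi _ c) = ofPairs N X Y C c := extLift_xi _ _ c

theorem soLift_X {r : ℕ} (hr : r < N / 2) : soLift hg h (gX s N r) = X r := by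
  rw [gX, leftGen_of_lt _ (by omega), soLift_xi, ofPairs_left _ _ _ (by simp only; omega)]

theorem soLift_Y {r : ℕ} (hr : r < N / 2) : soLift hg h (gY s N r) = Y r := by
  rw [gY, rightGen_of_lt _ (by omega), soLift_xi,
    ofPairs_right _ _ _ (by simp only [Fin.val_rev]; omega)]
  congr 1
  simp only [Fin.val_rev]
  omega

theorem soLift_C : soLift hg h (gC s N) = C := by
  rcases Nat.mod_two_eq_zero_or_one N with hN | hN
  · rw [(soRel_gen hg).C_even hN, map_zero, h.C_even hN]
  · rw [gC, midGen_of_odd _ hN, soLift_xi, ofPairs_mid _ _ _ (by simp only; omega)]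

end Lift

theorem exists_basis_SO (hg : IsGeneric s) (N : ℕ) :
    ∃ b : Module.Basis (Finset (Fin N)) K (SOAlg s N),
      ∀ S, b S = word (minusSO s N) ((pbwList N).filter (· ∈ S)) ∧
        ((pbwList N).filter (· ∈ S)).length = S.card := by
  obtain ⟨M, _, _, _, X, Y, C, w, hz, hM, hcyc⟩ := exists_fock_SO hg.ne_zero hg.one_add_ne_zero N
  refine exists_pbw_basis (pbwList N) pbwList_perm (isTower_pbwList hg (soRel_gen hg)) hM
    (soLift hg hz) w fun Q h1 h2 => hcyc Q h1 (fun r hr x hx => ⟨?_, ?_⟩) fun x hx => ?_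
  · have := h2 ⟨r, by omega⟩ x hx
    rwa [soLift_xi, ofPairs_left _ _ _ (by simp only; omega)] at this
  · have := h2 (Fin.rev ⟨r, by omega⟩) x hx
    rw [soLift_xi, ofPairs_right _ _ _ (by simp only [Fin.val_rev]; omega)] at this
    convert this using 3
    simp only [Fin.val_rev]
    omega
  · rcases Nat.mod_two_eq_zero_or_one N with hN | hN
    · rw [hz.C_even hN]
      simp
    · have := h2 ⟨N / 2, by omega⟩ x hx
      rwa [soLift_xi, ofPairs_mid _ _ _ (by simp only; omega)] at this

end OrthogonalAlgebra

end QEpsilon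

namespace QEpsilon

open scoped TensorProduct

universe v

/-! ### Torus automorphisms and weights. -/

section Torus

variable {K : Type v} [Field K] {s : K} {N : ℕ} {B : Type*} [Ring B] [Algebra K B]

theorem omega_scale (q : K) (X Y : ℕ → B) {t : ℕ → K} (ht : ∀ r, t r ≠ 0) (p : ℕ) :
    omega q (fun r => t r • X r) (fun r => (t r)⁻¹ • Y r) p = omega q X Y p := by
  induction p with
  | zero => rfl
  | succ p ih =>
    rw [omega, omega, ih, smul_mul_smul_comm, mul_inv_cancel₀ (ht p), one_smul]

/-- The relations are homogeneous when opposite generators have inverse weights: the products `X r *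
Y r` that enter `omega` have weight one. -/
theorem SORel.scale {X Y : ℕ → B} {C : B} (h : SORel s N X Y C) {t : ℕ → K} (ht : ∀ r, t r ≠ 0) :
    SORel s N (fun r => t r • X r) (fun r => (t r)⁻¹ • Y r) C := by
  refine ⟨⟨?_, ?_, ?_, ?_, ?_, ?_, ?_⟩, ?_, ?_, ?_, h.C_even⟩
  · intro r hr
    rw [smul_mul_smul_comm, h.pairs.X_sq r hr, smul_zero]
  · intro r hr
    rw [smul_mul_smul_comm, h.pairs.Y_sq r hr, smul_zero]
  · intro r t' h1 h2
    simp only [smul_mul_smul_comm, h.pairs.XX r t' h1 h2]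
    module
  · intro r t' h1 h2
    simp only [smul_mul_smul_comm, h.pairs.YX r t' h1 h2]
    module
  · intro r t' h1 h2
    simp only [smul_mul_smul_comm, h.pairs.XY r t' h1 h2]
    module
  · intro r t' h1 h2
    simp only [smul_mul_smul_comm, h.pairs.YY r t' h1 h2]
    module
  · intro r hr
    rw [omega_scale _ _ _ ht, smul_mul_smul_comm, smul_mul_smul_comm, inv_mul_cancel₀ (ht r),
      mul_inv_cancel₀ (ht r), one_smul, one_smul, h.pairs.cross r hr]
  · intro r hr
    rw [mul_smul_comm, h.CX r hr, smul_mul_assoc, smul_comm]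
  · intro r hr
    rw [mul_smul_comm, h.CY r hr, smul_mul_assoc, smul_comm]
  · intro hN
    rw [omega_scale _ _ _ ht, h.C_sq hN]

/-- The weights of the generators under the torus automorphism with parameters `t`. -/
def torusWeight (t : ℕ → K) (c : Fin N) : K :=
  ofPairs N t (fun r => (t r)⁻¹) 1 c

theorem prod_torusWeight {t : ℕ → K} (ht : ∀ r, t r ≠ 0) : ∏ c : Fin N, torusWeight t c = 1 := by
  refine Finset.prod_involution (fun c _ => c.rev) ?_ ?_ (by simp) (by simp)
  · intro c _
    have hc := c.2
    rcases lt_trichotomy (2 * (c : ℕ) + 1) N with h | h | h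
    · rw [torusWeight, torusWeight, ofPairs_left _ _ _ h,
        ofPairs_right _ _ _ (by rw [Fin.val_rev]; omega),
        show N - 1 - (c.rev : ℕ) = c by rw [Fin.val_rev]; omega, mul_inv_cancel₀ (ht _)]
    · rw [torusWeight, torusWeight, ofPairs_mid _ _ _ h,
        ofPairs_mid _ _ _ (by rw [Fin.val_rev]; omega), one_mul]
    · rw [torusWeight, torusWeight, ofPairs_right _ _ _ h,
        ofPairs_left _ _ _ (by rw [Fin.val_rev]; omega),
        show (c.rev : ℕ) = N - 1 - c by rw [Fin.val_rev]; omega, inv_mul_cancel₀ (ht _)]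
  · intro c _ hc h
    apply hc
    have := congrArg Fin.val h
    rw [Fin.val_rev] at this
    rw [torusWeight, ofPairs_mid _ _ _ (by omega)]

variable [CharZero K]

/-- The automorphism scaling the pairs of opposite generators. -/
noncomputable def torus (hg : IsGeneric s) {t : ℕ → K} (ht : ∀ r, t r ≠ 0) :
    SOAlg s N →ₐ[K] SOAlg s N :=
  soLift hg ((soRel_gen hg).scale ht)

theorem torus_xi (hg : IsGeneric s) {t : ℕ → K} (ht : ∀ r, t r ≠ 0) (c : Fin N) :
    torus hg ht (xi (minusSO s N) c) = torusWeight t c • xi _ c := by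
  rw [torus, soLift_xi, eq_ofPairs_gen]
  simp only [ofPairs, torusWeight]
  split_ifs <;> simp

theorem IsVolume.torus {τ : SOAlg s N →ₗ[K] K} (hτ : IsVolume (minusSO s N) τ) (hg : IsGeneric s)
    {t : ℕ → K} (ht : ∀ r, t r ≠ 0) (a : SOAlg s N) : τ (torus hg ht a) = τ a := by
  rw [hτ.scale (torus_xi hg ht) a, prod_torusWeight ht, one_mul]

/-- The volume functional vanishes on elements of nonzero weight. -/
theorem IsVolume.eq_zero_of_torus {τ : SOAlg s N →ₗ[K] K} (hτ : IsVolume (minusSO s N) τ)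
    (hg : IsGeneric s) {t : ℕ → K} (ht : ∀ r, t r ≠ 0) {a : SOAlg s N} {r : K} (hr : r ≠ 1)
    (ha : QEpsilon.torus hg ht a = r • a) : τ a = 0 := by
  have h := hτ.torus hg ht a
  rw [ha, map_smul, smul_eq_mul] at h
  have h2 : (r - 1) * τ a = 0 := by linear_combination h
  simpa [sub_ne_zero.2 hr] using h2

end Torus

/-! ### Inner generators acting on the annihilator of the outermost pair. -/

section Inner

/-- The inclusion of the indices of `U_q so(N)` in those of `U_q so(N + 2)`. -/
def innerIdx {N : ℕ} (c : Fin N) : Fin (N + 2) := c.succ.castSucc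

@[simp] theorem val_innerIdx {N : ℕ} (c : Fin N) : (innerIdx c : ℕ) = c + 1 := rfl

theorem innerIdx_injective {N : ℕ} : Function.Injective (innerIdx (N := N)) := fun _ _ h =>
  Fin.ext (Nat.succ_injective (congrArg Fin.val h))

theorem innerIdx_rev {N : ℕ} (c : Fin N) : innerIdx c.rev = (innerIdx c).rev := by
  ext
  simp only [val_innerIdx, Fin.val_rev]
  omega

theorem sum_univ_inner {M : Type*} [AddCommMonoid M] {N : ℕ} (f : Fin (N + 2) → M) :
    ∑ c, f c = f 0 + ∑ c : Fin N, f (innerIdx c) + f (Fin.last (N + 1)) := by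
  rw [Fin.sum_univ_castSucc, Fin.sum_univ_succ]
  rfl

theorem rhoNat_succ (N i : ℕ) : rhoNat (N + 2) (i + 1) = rhoNat N i := by
  simp only [rhoNat]
  split_ifs <;> push_cast <;> omega

variable {K : Type v} [Field K] {s : K} {N : ℕ} {B : Type*} [Ring B] [Algebra K B]
  {z : Fin (N + 2) → B}

namespace RelSO

theorem left_sq (hz : RelSO s (N + 2) z) : z 0 * z 0 = 0 :=
  hz.sq _ (by rw [Ne, Fin.ext_iff, Fin.val_rev]; simp)

theorem right_sq (hz : RelSO s (N + 2) z) : z (Fin.last _) * z (Fin.last _) = 0 :=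
  hz.sq _ (by rw [Ne, Fin.ext_iff, Fin.val_rev]; simp)

theorem right_mul_left (hz : RelSO s (N + 2) z) :
    z (Fin.last _) * z 0 = (-1 : K) • (z 0 * z (Fin.last _)) := by
  have h := hz.pair 0 (by rw [Fin.lt_def, Fin.val_rev]; simp)
  rw [Fin.rev_zero, Fin.val_zero, rhoSum_zero, smul_zero] at h
  rw [neg_one_smul]
  exact eq_neg_of_add_eq_zero_right h

theorem inner_mul_left (hz : RelSO s (N + 2) z) (c : Fin N) :
    z (innerIdx c) * z 0 = -(s ^ 2) • (z 0 * z (innerIdx c)) :=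
  hz.comm _ _ (by rw [Ne, Fin.ext_iff, Fin.val_rev]; simp; omega) (by rw [Fin.lt_def]; simp)

theorem right_mul_inner (hz : RelSO s (N + 2) z) (c : Fin N) :
    z (Fin.last _) * z (innerIdx c) = -(s ^ 2) • (z (innerIdx c) * z (Fin.last _)) :=
  hz.comm _ _ (by rw [Ne, Fin.ext_iff, Fin.val_rev]; simp) (by rw [Fin.lt_def]; simp)

theorem left_mul_inner (hs : s ≠ 0) (hz : RelSO s (N + 2) z) (c : Fin N) :
    z 0 * z (innerIdx c) = -(s ^ 2)⁻¹ • (z (innerIdx c) * z 0) := by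
  rw [hz.inner_mul_left, smul_smul]
  simp [hs]

theorem inner_mul_right (hs : s ≠ 0) (hz : RelSO s (N + 2) z) (c : Fin N) :
    z (innerIdx c) * z (Fin.last _) = -(s ^ 2)⁻¹ • (z (Fin.last _) * z (innerIdx c)) := by
  rw [hz.right_mul_inner, smul_smul]
  simp [hs]

/-- The scalars from the two outer letters are inverse to one another. Consequently the annihilator
of the outer product is stable under inner letters. -/
theorem outer_mul_inner (hz : RelSO s (N + 2) z) (c : Fin N) :
    z 0 * z (Fin.last _) * z (innerIdx c) = z (innerIdx c) * (z 0 * z (Fin.last _)) := by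
  rw [← mul_assoc, hz.inner_mul_left, smul_mul_assoc, mul_assoc, hz.right_mul_inner, mul_smul_comm,
    mul_assoc]

end RelSO

variable (K z) in
/-- The annihilator of the outermost pair. -/
def outerAnn : Submodule K B := LinearMap.ker (LinearMap.mulLeft K (z 0 * z (Fin.last _)))

theorem mem_outerAnn {a : B} : a ∈ outerAnn K z ↔ z 0 * z (Fin.last _) * a = 0 := Iff.rfl

/-- Left multiplication by an inner generator. -/
def innerMul (hz : RelSO s (N + 2) z) (c : Fin N) : Module.End K (outerAnn K z) :=
  (LinearMap.mulLeft K (z (innerIdx c))).restrict fun b hb => by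
    rw [mem_outerAnn] at hb ⊢
    rw [LinearMap.mulLeft_apply, ← mul_assoc, hz.outer_mul_inner, mul_assoc, hb, mul_zero]

theorem coe_innerMul (hz : RelSO s (N + 2) z) (c : Fin N) (b : outerAnn K z) :
    (innerMul hz c b : B) = z (innerIdx c) * b := rfl

/-- The partial sums of the larger algebra contain one extra summand, the product of the outer pair.
It is invisible on its annihilator, where the inner letters therefore satisfy the relations of the
smaller algebra. -/
theorem coe_rhoSum_innerMul (hz : RelSO s (N + 2) z) (p : ℕ) (hp : p ≤ N) (b : outerAnn K z) :
    (rhoSum s N (extendZero fun i => innerMul hz i * innerMul hz i.rev) p b : B) =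
      rhoSum s (N + 2) (extendZero fun i => z i * z i.rev) (p + 1) * b := by
  have h0 : extendZero (fun i => z i * z i.rev) 0 = z 0 * z (Fin.last _) := by
    rw [extendZero, dif_pos (by omega)]
    rfl
  induction p with
  | zero =>
    rw [rhoSum_succ, h0, rhoSum_zero, rhoSum_zero, zero_add, smul_mul_assoc, mem_outerAnn.1 b.2]
    simp
  | succ p ih =>
    have h1 : extendZero (fun i => z i * z i.rev) (p + 1) =
        z (innerIdx ⟨p, hp⟩) * z (innerIdx ⟨p, hp⟩).rev := by
      rw [extendZero, dif_pos (by omega)]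
      rfl
    rw [rhoSum_succ, rhoSum_succ s _ (p + 1), LinearMap.add_apply, Submodule.coe_add,
      ih (by omega), rhoNat_succ, add_mul, LinearMap.smul_apply, Submodule.coe_smul, extendZero,
      dif_pos (by omega), h1, smul_mul_assoc, mul_assoc, ← innerIdx_rev]
    rfl

theorem relSO_innerMul (hz : RelSO s (N + 2) z) : RelSO s N (innerMul hz) := by
  refine ⟨fun a ha => ?_, fun a b h1 h2 => ?_, fun a ha => ?_, fun a ha => ?_⟩
  · refine LinearMap.ext fun v => Subtype.ext ?_
    simp only [Module.End.mul_apply, coe_innerMul, LinearMap.zero_apply, ZeroMemClass.coe_zero]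
    rw [← mul_assoc, hz.sq, zero_mul]
    rw [← innerIdx_rev]
    intro h
    exact ha (innerIdx_injective h)
  · refine LinearMap.ext fun v => Subtype.ext ?_
    rw [Module.End.mul_apply, coe_innerMul, coe_innerMul, LinearMap.smul_apply, Submodule.coe_smul,
      Module.End.mul_apply, coe_innerMul, coe_innerMul, ← mul_assoc,
      hz.comm (innerIdx a) (innerIdx b), smul_mul_assoc, mul_assoc]
    · rw [← innerIdx_rev]
      intro h
      exact h1 (innerIdx_injective h)
    · exact Nat.succ_lt_succ h2
  · refine LinearMap.ext fun v => Subtype.ext ?_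
    have h := hz.pair (innerIdx a) (by rw [← innerIdx_rev]; simpa [Fin.lt_def] using ha)
    rw [LinearMap.smul_apply, Submodule.coe_smul, coe_rhoSum_innerMul hz _ a.2.le]
    rw [val_innerIdx, ← innerIdx_rev] at h
    simp only [LinearMap.add_apply, Module.End.mul_apply, coe_innerMul, Submodule.coe_add]
    rw [← mul_assoc, ← mul_assoc, ← add_mul, h, smul_mul_assoc]
    congr 3
    push_cast
    ring
  · refine LinearMap.ext fun v => Subtype.ext ?_
    have h := hz.mid (innerIdx a) (by rw [← innerIdx_rev, ← ha])
    rw [LinearMap.smul_apply, Submodule.coe_smul, LinearMap.smul_apply, Submodule.coe_smul,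
      coe_rhoSum_innerMul hz _ a.2.le]
    rw [val_innerIdx] at h
    rw [Module.End.mul_apply, coe_innerMul, coe_innerMul, ← mul_assoc, ← smul_mul_assoc, h,
      smul_mul_assoc]

/-- Elements annihilated by the outermost pair give maps from the smaller exterior algebra. -/
theorem exists_innerMap [CharZero K] (hg : IsGeneric s) (hz : RelSO s (N + 2) z) {v : B}
    (hv : z 0 * z (Fin.last _) * v = 0) :
    ∃ J : SOAlg s N →ₗ[K] B, J 1 = v ∧ ∀ c b, J (xi _ c * b) = z (innerIdx c) * J b := by
  -- The annihilator is a module over the smaller algebra; `J` is the orbit map of `v`.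
  let ρ := extLift (innerMul hz) ((quadRel_iff_relSO hg _).2 (relSO_innerMul hz))
  refine ⟨(outerAnn K z).subtype ∘ₗ LinearMap.applyₗ (⟨v, hv⟩ : outerAnn K z) ∘ₗ ρ.toLinearMap,
    by simp, fun c b => ?_⟩
  simp [ρ, coe_innerMul]

end Inner

/-! ### The maps from the smaller algebra given by right multiplication with outer letters. -/

section InnerMap

variable {K : Type v} [Field K] [CharZero K] {s : K} {N : ℕ}

variable (s N) in
/-- The first generator. -/
noncomputable abbrev oX : SOAlg s (N + 2) := xi (minusSO s (N + 2)) 0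

variable (s N) in
/-- The last generator. -/
noncomputable abbrev oY : SOAlg s (N + 2) := xi (minusSO s (N + 2)) (Fin.last (N + 1))

/-- The map `β ↦ β v` from the exterior algebra of `U_q so(N)` to that of `U_q so(N + 2)`, for `v`
annihilated by the outermost pair of generators. -/
noncomputable def innerMap (hg : IsGeneric s) {v : SOAlg s (N + 2)}
    (hv : oX s N * oY s N * v = 0) : SOAlg s N →ₗ[K] SOAlg s (N + 2) :=
  (exists_innerMap hg (relSO_xi hg) hv).choose

variable (hg : IsGeneric s) {v : SOAlg s (N + 2)} (hv : oX s N * oY s N * v = 0)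

@[simp] theorem innerMap_one : innerMap hg hv 1 = v :=
  (exists_innerMap hg (relSO_xi hg) hv).choose_spec.1

@[simp] theorem innerMap_xi_mul (c : Fin N) (b : SOAlg s N) :
    innerMap hg hv (xi _ c * b) = xi _ (innerIdx c) * innerMap hg hv b :=
  (exists_innerMap hg (relSO_xi hg) hv).choose_spec.2 c b

theorem innerMap_word (L : List (Fin N)) :
    innerMap hg hv (word _ L) = word _ (L.map innerIdx) * v := by
  induction L with
  | nil => simp
  | cons c L ih => rw [word_cons, innerMap_xi_mul, ih, List.map_cons, word_cons, mul_assoc]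

theorem outer_mul_left (hg : IsGeneric s) : oX s N * oY s N * oX s N = 0 := by
  have hz := relSO_xi (N := N + 2) hg
  rw [mul_assoc, hz.right_mul_left, mul_smul_comm, ← mul_assoc, hz.left_sq, zero_mul, smul_zero]

theorem outer_mul_right (hg : IsGeneric s) : oX s N * oY s N * oY s N = 0 := by
  rw [mul_assoc, (relSO_xi hg).right_sq, mul_zero]

theorem outer_mul_outer (hg : IsGeneric s) : oX s N * oY s N * (oX s N * oY s N) = 0 := by
  rw [← mul_assoc, outer_mul_left hg, zero_mul]

/-- The map `β ↦ β x`. -/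
noncomputable def mapX : SOAlg s N →ₗ[K] SOAlg s (N + 2) := innerMap hg (outer_mul_left hg)

/-- The map `β ↦ β y`. -/
noncomputable def mapY : SOAlg s N →ₗ[K] SOAlg s (N + 2) := innerMap hg (outer_mul_right hg)

/-- The map `β ↦ β x y`. -/
noncomputable def mapXY : SOAlg s N →ₗ[K] SOAlg s (N + 2) := innerMap hg (outer_mul_outer hg)

theorem mul_innerMap_of_skew {w : SOAlg s (N + 2)} {κ ρ : K}
    (hw : ∀ c : Fin N, w * xi _ (innerIdx c) = κ • (xi _ (innerIdx c) * w))
    {m : ℕ} {b : SOAlg s N} (hb : b ∈ deg (minusSO s N) m) {v' : SOAlg s (N + 2)}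
    (hv' : oX s N * oY s N * v' = 0) (hwv : w * v = ρ • v') :
    w * innerMap hg hv b = (κ ^ m * ρ) • innerMap hg hv' b := by
  refine eqOn_deg (f := LinearMap.mulLeft K w ∘ₗ innerMap hg hv)
    (g := (κ ^ m * ρ) • innerMap hg hv') (fun L hL => ?_) hb
  have h := mul_prod_eq (fun c : Fin N => xi (minusSO s (N + 2)) (innerIdx c)) w
    (fun _ => κ) L fun c _ => hw c
  rw [LinearMap.comp_apply, LinearMap.mulLeft_apply, LinearMap.smul_apply, innerMap_word,
    innerMap_word, ← mul_assoc]
  have h2 : word (minusSO s (N + 2)) (L.map innerIdx) =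
      (L.map fun c => xi (minusSO s (N + 2)) (innerIdx c)).prod := by
    rw [word, List.map_map]
    rfl
  rw [h2, h, smul_mul_assoc, mul_assoc, hwv, mul_smul_comm, smul_smul]
  simp [hL]

theorem innerMap_mul_xi {κ : K} {c : Fin N}
    (hc : xi _ (innerIdx c) * v = κ • (v * xi _ (innerIdx c))) (b : SOAlg s N) :
    innerMap hg hv (b * xi _ c) = κ • (innerMap hg hv b * xi _ (innerIdx c)) := by
  suffices H : innerMap hg hv ∘ₗ LinearMap.mulRight K (xi _ c) =
      κ • LinearMap.mulRight K (xi _ (innerIdx c)) ∘ₗ innerMap hg hv from LinearMap.congr_fun H b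
  apply linearMap_ext_word
  intro L
  have h2 : word (minusSO s N) L * xi _ c = word _ (L ++ [c]) := by simp [word_append]
  rw [LinearMap.comp_apply, LinearMap.mulRight_apply, h2, LinearMap.smul_apply,
    LinearMap.comp_apply, LinearMap.mulRight_apply, innerMap_word, innerMap_word, List.map_append,
    word_append, List.map_cons, List.map_nil, word_cons, word_nil, mul_one, mul_assoc, hc,
    mul_smul_comm, mul_assoc]

end InnerMap

end QEpsilon

namespace QEpsilon

open scoped TensorProduct

universe v

/-! ### The volume form and the volume functional for `so`. -/

section TopForm

theorem pairList_succ_inner {N p : ℕ} (hp : p ≤ N) :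
    pairList (N + 2) (p + 1) = (pairList N p).map innerIdx ++ [0, Fin.last (N + 1)] := by
  induction p with
  | zero =>
    rw [pairList_succ (by omega)]
    simp [pairList]
  | succ p ih =>
    rw [pairList_succ (by omega), ih (by omega), pairList_succ (by omega), List.map_cons,
      List.map_cons, innerIdx_rev]
    rfl

theorem pbwList_succ_inner (N : ℕ) :
    pbwList (N + 2) = (pbwList N).map innerIdx ++ [0, Fin.last (N + 1)] := by
  have h2 : (N + 2) / 2 = N / 2 + 1 := by omega
  rcases Nat.mod_two_eq_zero_or_one N with h | h
  · rw [pbwList, pbwList, dif_neg (by omega), dif_neg (by omega), h2,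
      pairList_succ_inner (by omega)]
  · rw [pbwList, pbwList, dif_pos (by omega), dif_pos h, List.map_cons, List.cons_append,
      ← pairList_succ_inner (by omega)]
    congr 1
    · ext
      simp only [val_innerIdx]
      omega
    · rw [h2]

theorem ofFn_inner (N : ℕ) : List.ofFn (fun k : Fin (N + 2) => k) =
    0 :: ((List.ofFn fun k : Fin N => k).map innerIdx ++ [Fin.last (N + 1)]) := by
  rw [List.ofFn_succ', List.ofFn_succ, List.concat_eq_append, List.map_ofFn]
  rfl

variable {K : Type v} [Field K] [CharZero K] {s : K} {N : ℕ} (hg : IsGeneric s)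

theorem left_mul_mapX {m : ℕ} {b : SOAlg s N} (hb : b ∈ deg (minusSO s N) m) :
    oX s N * mapX hg b = 0 := by
  have hz := relSO_xi (N := N + 2) hg
  rw [mapX, mul_innerMap_of_skew hg _ (hz.left_mul_inner hg.ne_zero) hb (outer_mul_left hg) (ρ := 0)
    (by rw [hz.left_sq, zero_smul]), mul_zero, zero_smul]

theorem right_mul_mapX {m : ℕ} {b : SOAlg s N} (hb : b ∈ deg (minusSO s N) m) :
    oY s N * mapX hg b = ((-(s ^ 2)) ^ m * (-1)) • mapXY hg b := by
  have hz := relSO_xi (N := N + 2) hg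
  rw [mapX, mul_innerMap_of_skew hg _ hz.right_mul_inner hb (outer_mul_outer hg)
    hz.right_mul_left, mapXY]

theorem left_mul_mapY {m : ℕ} {b : SOAlg s N} (hb : b ∈ deg (minusSO s N) m) :
    oX s N * mapY hg b = (-(s ^ 2)⁻¹) ^ m • mapXY hg b := by
  have hz := relSO_xi (N := N + 2) hg
  rw [mapY, mul_innerMap_of_skew hg _ (hz.left_mul_inner hg.ne_zero) hb (outer_mul_outer hg)
    (ρ := 1) (by rw [one_smul]), mapXY, mul_one]

theorem right_mul_mapY {m : ℕ} {b : SOAlg s N} (hb : b ∈ deg (minusSO s N) m) :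
    oY s N * mapY hg b = 0 := by
  have hz := relSO_xi (N := N + 2) hg
  rw [mapY, mul_innerMap_of_skew hg _ hz.right_mul_inner hb (outer_mul_left hg) (ρ := 0)
    (by rw [hz.right_sq, zero_smul]), mul_zero, zero_smul]

theorem left_mul_mapXY {m : ℕ} {b : SOAlg s N} (hb : b ∈ deg (minusSO s N) m) :
    oX s N * mapXY hg b = 0 := by
  have hz := relSO_xi (N := N + 2) hg
  rw [mapXY, mul_innerMap_of_skew hg _ (hz.left_mul_inner hg.ne_zero) hb (outer_mul_left hg)
    (ρ := 0) (by rw [← mul_assoc, hz.left_sq, zero_mul, zero_smul]), mul_zero, zero_smul]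

theorem right_mul_mapXY {m : ℕ} {b : SOAlg s N} (hb : b ∈ deg (minusSO s N) m) :
    oY s N * mapXY hg b = 0 := by
  have hz := relSO_xi (N := N + 2) hg
  rw [mapXY, mul_innerMap_of_skew hg _ hz.right_mul_inner hb (outer_mul_left hg) (ρ := 0)
    (by rw [← mul_assoc, hz.right_mul_left, smul_mul_assoc, mul_assoc, hz.right_sq, mul_zero,
      smul_zero, zero_smul]), mul_zero, zero_smul]

theorem mapX_mul_xi (b : SOAlg s N) (c : Fin N) :
    mapX hg (b * xi _ c) = -(s ^ 2) • (mapX hg b * xi _ (innerIdx c)) :=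
  innerMap_mul_xi hg _ ((relSO_xi (N := N + 2) hg).inner_mul_left c) b

theorem mapY_mul_xi (b : SOAlg s N) (c : Fin N) :
    mapY hg (b * xi _ c) = -(s ^ 2)⁻¹ • (mapY hg b * xi _ (innerIdx c)) :=
  innerMap_mul_xi hg _ ((relSO_xi (N := N + 2) hg).inner_mul_right hg.ne_zero c) b

/-- The volume word has the first letter in front and the last letter at the end; carrying the first
letter through `N` inner letters costs `-q⁻¹` each time. -/
theorem xiProd_id_succ (N : ℕ) : xiProd (minusSO s (N + 2)) (fun k => k) =
    (-(s ^ 2)⁻¹) ^ N • mapXY hg (xiProd (minusSO s N) fun k => k) := by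
  rw [← left_mul_mapY hg (xiProd_mem_deg _), mapY, xiProd_eq_word, xiProd_eq_word, innerMap_word,
    ofFn_inner, word_cons, word_append]
  simp

theorem exists_xiProd_id_eq (hg : IsGeneric s) : ∀ N, ∃ κ : K, κ ≠ 0 ∧
    xiProd (minusSO s N) (fun k => k) = κ • word _ (pbwList N)
  | 0 => ⟨1, one_ne_zero, by simp [pbwList, pairList]⟩
  | 1 => ⟨1, one_ne_zero, by simp [pbwList, pairList, xiProd_eq_word]⟩
  | N + 2 => by
    obtain ⟨κ, h0, h⟩ := exists_xiProd_id_eq hg N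
    refine ⟨(-(s ^ 2)⁻¹) ^ N * κ, mul_ne_zero (pow_ne_zero _ ?_) h0, ?_⟩
    · simp [hg.ne_zero]
    · rw [xiProd_id_succ hg, h, map_smul, smul_smul, mapXY, innerMap_word, pbwList_succ_inner,
        word_append]
      simp

theorem exists_volume_SO (hg : IsGeneric s) (N : ℕ) :
    ∃ τ : SOAlg s N →ₗ[K] K, IsVolume (minusSO s N) τ := by
  obtain ⟨b, hb⟩ := exists_basis_SO hg N
  obtain ⟨κ, h0, h⟩ := exists_xiProd_id_eq hg N
  refine exists_isVolume b (fun S => ⟨_, (hb S).2, (hb S).1⟩) h0 ?_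
  rw [h, (hb _).1]
  congr 2
  simp

end TopForm

/-! ### The Hodge map on the images of the smaller algebra. -/

section HodgeRecursion

variable {K : Type v} [Field K]

theorem hodge_zero {N : ℕ} {Pm : Matrix (Fin N × Fin N) (Fin N × Fin N) K}
    (τ : ExtAlg Pm →ₗ[K] K) (β : ExtAlg Pm) : hodge τ 0 β = τ β • 1 := by
  simp [hodge_apply]

/-- Writing `theta ^ (l + 1)` as `theta ^ l * theta` detaches the last letter: on one leg it joins
`β`, on the other it stays at the right. This one-letter recursion serves for `so`, where the inner
letters do not form a subalgebra isomorphic to the smaller algebra. -/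
theorem hodge_succ {N : ℕ} {Pm : Matrix (Fin N × Fin N) (Fin N × Fin N) K}
    (τ : ExtAlg Pm →ₗ[K] K) (l : ℕ) (β : ExtAlg Pm) :
    hodge τ (l + 1) β = ∑ c, hodge τ l (xi _ c * β) * xi _ c := by
  rw [hodge_eq_contract, pow_succ, theta, Finset.mul_sum, map_sum]
  refine Finset.sum_congr rfl fun c _ => ?_
  rw [hodge_eq_contract]
  exact contract_mul_tmul τ β _ _ _

theorem hodge_succ_split {s : K} {N : ℕ} (τ : SOAlg s (N + 2) →ₗ[K] K) (l : ℕ) (β : SOAlg s (N + 2)) :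
    hodge τ (l + 1) β = hodge τ l (oX s N * β) * oX s N +
      ∑ c : Fin N, hodge τ l (xi _ (innerIdx c) * β) * xi _ (innerIdx c) +
      hodge τ l (oY s N * β) * oY s N := by
  rw [hodge_succ, sum_univ_inner]

/-- The parameters of the torus automorphism scaling the `p`-th pair. -/
def unitTorus (p : ℕ) (a : K) (r : ℕ) : K := if r = p then a else 1

theorem unitTorus_ne_zero (p : ℕ) {a : K} (ha : a ≠ 0) (r : ℕ) : unitTorus p a r ≠ 0 := by
  rw [unitTorus]
  split_ifs <;> simp [ha]

theorem torusWeight_innerIdx {N : ℕ} (a : K) (c : Fin N) :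
    torusWeight (unitTorus 0 a) (innerIdx c) = 1 := by
  have hc := c.2
  rw [torusWeight]
  rcases lt_trichotomy (2 * (innerIdx c : ℕ) + 1) (N + 2) with h | h | h
  · rw [ofPairs_left _ _ _ h, unitTorus, if_neg (by simp)]
  · rw [ofPairs_mid _ _ _ h]
  · rw [ofPairs_right _ _ _ h, unitTorus, if_neg (by rw [val_innerIdx]; omega), inv_one]

variable [CharZero K] {s : K} {N : ℕ} (hg : IsGeneric s)
  {τ : SOAlg s (N + 2) →ₗ[K] K} {τ' : SOAlg s N →ₗ[K] K}

theorem torus_innerMap {v : SOAlg s (N + 2)} (hv : oX s N * oY s N * v = 0) {r : K}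
    (h : torus hg (unitTorus_ne_zero 0 hg.sq_ne_zero) v = r • v) (b : SOAlg s N) :
    torus hg (unitTorus_ne_zero 0 hg.sq_ne_zero) (innerMap hg hv b) = r • innerMap hg hv b := by
  suffices H : (torus hg (unitTorus_ne_zero 0 hg.sq_ne_zero)).toLinearMap ∘ₗ innerMap hg hv =
    r • innerMap hg hv from LinearMap.congr_fun H b
  apply linearMap_ext_word
  intro L
  rw [LinearMap.comp_apply, LinearMap.smul_apply, innerMap_word, AlgHom.toLinearMap_apply, map_mul,
    h, scale_word (torus_xi hg _), List.map_map, List.prod_eq_one, one_smul, mul_smul_comm]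
  intro x hx
  obtain ⟨c, -, rfl⟩ := List.mem_map.1 hx
  exact torusWeight_innerIdx _ c

/-- The image has weight `q ≠ 1` under the torus of the outermost pair, whereas `τ` is invariant. -/
theorem volume_mapX (hτ : IsVolume (minusSO s (N + 2)) τ) (b : SOAlg s N) :
    τ (mapX hg b) = 0 := by
  refine hτ.eq_zero_of_torus hg (unitTorus_ne_zero 0 hg.sq_ne_zero) (r := s ^ 2)
    (by simpa using hg.pow_ne_one 1 le_rfl) (torus_innerMap hg _ ?_ b)
  rw [torus_xi, torusWeight, ofPairs_left _ _ _ (by simp)]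
  rfl

theorem volume_mapY (hτ : IsVolume (minusSO s (N + 2)) τ) (b : SOAlg s N) :
    τ (mapY hg b) = 0 := by
  refine hτ.eq_zero_of_torus hg (unitTorus_ne_zero 0 hg.sq_ne_zero) (r := (s ^ 2)⁻¹)
    (by simpa using hg.pow_ne_one 1 le_rfl) (torus_innerMap hg _ ?_ b)
  rw [torus_xi, torusWeight, ofPairs_right _ _ _ (by simp; omega)]
  simp [unitTorus]

theorem volume_mapXY (hτ : IsVolume (minusSO s (N + 2)) τ) (hτ' : IsVolume (minusSO s N) τ')
    (b : SOAlg s N) : τ (mapXY hg b) = (-(s ^ 2)) ^ N * τ' b := by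
  have h1 := hτ'.eq_smul_of_off (φ := τ ∘ₗ mapXY hg) fun L hL => by
    rw [LinearMap.comp_apply, mapXY, innerMap_word]
    have := hτ.off (L.map innerIdx ++ [0, Fin.last (N + 1)]) (by simpa using hL)
    simpa [word_append] using this
  have h2 : (τ ∘ₗ mapXY hg) (xiProd (minusSO s N) fun k => k) = (-(s ^ 2)) ^ N := by
    have h3 := hτ.top
    rw [xiProd_id_succ hg, map_smul, smul_eq_mul] at h3
    rw [LinearMap.comp_apply]
    have h4 : (-(s ^ 2)) ^ N * (-(s ^ 2)⁻¹) ^ N = 1 := by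
      rw [← mul_pow]
      simp [hg.ne_zero]
    rw [← mul_one ((-(s ^ 2)) ^ N), ← h3, ← mul_assoc, h4, one_mul]
  have := LinearMap.congr_fun h1 b
  rw [h2] at this
  simpa using this

/-- Inner letters obey the smaller relations only on elements annihilated by the outer product. The
trailing outer letter provides this, so the result can be expressed by `mapX`. -/
theorem hodge_mapXY_mul_left (hτ : IsVolume (minusSO s (N + 2)) τ) (hτ' : IsVolume (minusSO s N) τ')
    (l : ℕ) {m : ℕ} {b : SOAlg s N} (hb : b ∈ deg (minusSO s N) m) :
    hodge τ l (mapXY hg b) * oX s N = (-(s ^ 2)) ^ N • mapX hg (hodge τ' l b) := by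
  induction l generalizing m b with
  | zero =>
    rw [hodge_zero, hodge_zero, volume_mapXY hg hτ hτ', map_smul, mapX, innerMap_one,
      smul_mul_assoc, one_mul, smul_smul]
  | succ l ih =>
    rw [hodge_succ_split, left_mul_mapXY hg hb, right_mul_mapXY hg hb, map_zero, zero_mul,
      zero_mul, zero_add, add_zero, hodge_succ, map_sum, Finset.sum_mul, Finset.smul_sum]
    refine Finset.sum_congr rfl fun c _ => ?_
    have hc : xi _ c * b ∈ deg (minusSO s N) (1 + m) := mul_mem_deg (xi_mem_deg c) hb
    have h1 := ih hc
    rw [mapXY, innerMap_xi_mul, ← mapXY] at h1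
    rw [mul_assoc, (relSO_xi hg).inner_mul_left, mul_smul_comm, ← mul_assoc, h1, mapX_mul_xi,
      smul_mul_assoc, smul_comm]

theorem hodge_mapXY_mul_right (hτ : IsVolume (minusSO s (N + 2)) τ)
    (hτ' : IsVolume (minusSO s N) τ') (l : ℕ) {m : ℕ} {b : SOAlg s N}
    (hb : b ∈ deg (minusSO s N) m) :
    hodge τ l (mapXY hg b) * oY s N = (-(s ^ 2)) ^ N • mapY hg (hodge τ' l b) := by
  induction l generalizing m b with
  | zero =>
    rw [hodge_zero, hodge_zero, volume_mapXY hg hτ hτ', map_smul, mapY, innerMap_one,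
      smul_mul_assoc, one_mul, smul_smul]
  | succ l ih =>
    rw [hodge_succ_split, left_mul_mapXY hg hb, right_mul_mapXY hg hb, map_zero, zero_mul,
      zero_mul, zero_add, add_zero, hodge_succ, map_sum, Finset.sum_mul, Finset.smul_sum]
    refine Finset.sum_congr rfl fun c _ => ?_
    have hc : xi _ c * b ∈ deg (minusSO s N) (1 + m) := mul_mem_deg (xi_mem_deg c) hb
    have h1 := ih hc
    rw [mapXY, innerMap_xi_mul, ← mapXY] at h1
    rw [mul_assoc, (relSO_xi hg).inner_mul_right hg.ne_zero, mul_smul_comm, ← mul_assoc, h1,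
      mapY_mul_xi, smul_mul_assoc, smul_comm]

/-- When the last letter is detached, the first generator contributes a new term through `mapXY`,
the last generator contributes nothing, and the inner letters reproduce the previous step with a
factor `q ^ (-2)`. The factors add up to a geometric sum, and `mapY` is turned into `mapX`. -/
theorem hodge_mapY (hτ : IsVolume (minusSO s (N + 2)) τ)
    (hτ' : IsVolume (minusSO s N) τ') (l : ℕ) {m : ℕ} {b : SOAlg s N}
    (hb : b ∈ deg (minusSO s N) m) :
    hodge τ (l + 1) (mapY hg b) =
      ((-(s ^ 2)) ^ N * (-(s ^ 2)⁻¹) ^ m * geomSum ((s ^ 2)⁻¹ ^ 2) (l + 1)) •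
        mapX hg (hodge τ' l b) := by
  induction l generalizing m b with
  | zero =>
    rw [hodge_succ_split, left_mul_mapY hg hb, right_mul_mapY hg hb, map_zero, zero_mul, add_zero,
      map_smul, smul_mul_assoc, hodge_mapXY_mul_left hg hτ hτ' 0 hb, Finset.sum_eq_zero, add_zero,
      smul_smul]
    · congr 1
      simp [geomSum]
      ring
    · intro c _
      rw [mapY, ← innerMap_xi_mul, ← mapY, hodge_zero, volume_mapY hg hτ, zero_smul, zero_mul]
  | succ l ih =>
    rw [hodge_succ_split, left_mul_mapY hg hb, right_mul_mapY hg hb, map_zero, zero_mul, add_zero,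
      map_smul, smul_mul_assoc, hodge_mapXY_mul_left hg hτ hτ' _ hb]
    have h2 : ∑ c : Fin N, hodge τ (l + 1) (xi _ (innerIdx c) * mapY hg b) * xi _ (innerIdx c) =
        ((-(s ^ 2)) ^ N * (-(s ^ 2)⁻¹) ^ (1 + m) * geomSum ((s ^ 2)⁻¹ ^ 2) (l + 1) *
          (-(s ^ 2)⁻¹)) • mapX hg (hodge τ' (l + 1) b) := by
      rw [hodge_succ, map_sum, Finset.smul_sum]
      refine Finset.sum_congr rfl fun c _ => ?_
      have hc : xi _ c * b ∈ deg (minusSO s N) (1 + m) := mul_mem_deg (xi_mem_deg c) hb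
      have h1 := ih hc
      rw [mapY, innerMap_xi_mul, ← mapY] at h1
      rw [h1, mapX_mul_xi, smul_smul, smul_mul_assoc]
      congr 1
      have := hg.ne_zero
      field_simp
    rw [h2, smul_smul, ← add_smul, geomSum_succ _ (l + 1)]
    congr 1
    ring

theorem hodge_mapX (hτ : IsVolume (minusSO s (N + 2)) τ)
    (hτ' : IsVolume (minusSO s N) τ') (l : ℕ) {m : ℕ} {b : SOAlg s N}
    (hb : b ∈ deg (minusSO s N) m) :
    hodge τ (l + 1) (mapX hg b) =
      (-((-(s ^ 2)) ^ N * (-(s ^ 2)) ^ m * geomSum ((s ^ 2) ^ 2) (l + 1))) •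
        mapY hg (hodge τ' l b) := by
  induction l generalizing m b with
  | zero =>
    rw [hodge_succ_split, left_mul_mapX hg hb, right_mul_mapX hg hb, map_zero, zero_mul, zero_add,
      map_smul, smul_mul_assoc, hodge_mapXY_mul_right hg hτ hτ' 0 hb, Finset.sum_eq_zero, zero_add,
      smul_smul]
    · congr 1
      simp [geomSum]
      ring
    · intro c _
      rw [mapX, ← innerMap_xi_mul, ← mapX, hodge_zero, volume_mapX hg hτ, zero_smul, zero_mul]
  | succ l ih =>
    rw [hodge_succ_split, left_mul_mapX hg hb, right_mul_mapX hg hb, map_zero, zero_mul, zero_add,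
      map_smul, smul_mul_assoc, hodge_mapXY_mul_right hg hτ hτ' _ hb]
    have h2 : ∑ c : Fin N, hodge τ (l + 1) (xi _ (innerIdx c) * mapX hg b) * xi _ (innerIdx c) =
        (-((-(s ^ 2)) ^ N * (-(s ^ 2)) ^ (1 + m) * geomSum ((s ^ 2) ^ 2) (l + 1)) *
          (-(s ^ 2))) • mapY hg (hodge τ' (l + 1) b) := by
      rw [hodge_succ, map_sum, Finset.smul_sum]
      refine Finset.sum_congr rfl fun c _ => ?_
      have hc : xi _ c * b ∈ deg (minusSO s N) (1 + m) := mul_mem_deg (xi_mem_deg c) hb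
      have h1 := ih hc
      rw [mapX, innerMap_xi_mul, ← mapX] at h1
      rw [h1, mapY_mul_xi, smul_smul, smul_mul_assoc]
      congr 1
      have := hg.ne_zero
      field_simp
    rw [h2, smul_smul, ← add_smul, geomSum_succ _ (l + 1)]
    congr 1
    ring

end HodgeRecursion

end QEpsilon

namespace QEpsilon

open scoped TensorProduct

universe v

/-! ### Cyclicity of the volume functional for `so`. -/

section Cyclicity

variable {K : Type v} [Field K] [CharZero K] {s : K} {N : ℕ}

theorem innerMap_mul (hg : IsGeneric s) {v v' w : SOAlg s (N + 2)} (hv : oX s N * oY s N * v = 0)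
    (hv' : oX s N * oY s N * v' = 0) {ρ : K} (h : v * w = ρ • v') (b : SOAlg s N) :
    innerMap hg hv b * w = ρ • innerMap hg hv' b := by
  suffices H : LinearMap.mulRight K w ∘ₗ innerMap hg hv = ρ • innerMap hg hv' from
    LinearMap.congr_fun H b
  apply linearMap_ext_word
  intro L
  rw [LinearMap.comp_apply, LinearMap.mulRight_apply, LinearMap.smul_apply, innerMap_word,
    innerMap_word, mul_assoc, h, mul_smul_comm]

/-- Linear maps on the larger algebra are determined by the elements coming from the smaller one. -/
theorem linearMap_ext_inner (hg : IsGeneric s) {M : Type*} [AddCommGroup M] [Module K M]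
    {f g : SOAlg s (N + 2) →ₗ[K] M}
    (h0 : ∀ L : List (Fin N), L.length ≤ N →
      f (word _ (L.map innerIdx)) = g (word _ (L.map innerIdx)))
    (hx : ∀ L : List (Fin N), f (mapX hg (word _ L)) = g (mapX hg (word _ L)))
    (hy : ∀ L : List (Fin N), f (mapY hg (word _ L)) = g (mapY hg (word _ L)))
    (hxy : ∀ L : List (Fin N), f (mapXY hg (word _ L)) = g (mapXY hg (word _ L))) : f = g := by
  obtain ⟨b, hb⟩ := exists_basis_SO hg (N + 2)
  apply b.ext
  intro S
  rw [(hb S).1, pbwList_succ_inner, List.filter_append, List.filter_map]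
  set L := (pbwList N).filter ((fun c => decide (c ∈ S)) ∘ innerIdx) with hL
  have hlen : L.length ≤ N := by
    refine (List.length_filter_le _ _).trans ?_
    rw [pbwList_perm.length_eq, List.length_finRange]
  have hx' := hx L
  have hy' := hy L
  have hxy' := hxy L
  rw [mapX, innerMap_word] at hx'
  rw [mapY, innerMap_word] at hy'
  rw [mapXY, innerMap_word] at hxy'
  by_cases h1 : (0 : Fin (N + 2)) ∈ S <;> by_cases h2 : Fin.last (N + 1) ∈ S
  · simpa [h1, h2, word_append] using hxy'
  · simpa [h1, h2, word_append] using hx'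
  · simpa [h1, h2, word_append] using hy'
  · simpa [h1, h2, word_append] using h0 L hlen

theorem eq_inner_or (j : Fin (N + 2)) :
    j = 0 ∨ j = Fin.last (N + 1) ∨ ∃ c : Fin N, j = innerIdx c := by
  induction j using Fin.lastCases with
  | last => exact Or.inr (Or.inl rfl)
  | cast j =>
    induction j using Fin.cases with
    | zero => exact Or.inl rfl
    | succ c => exact Or.inr (Or.inr ⟨c, rfl⟩)

theorem twoRho_innerIdx (c : Fin N) : twoRho (innerIdx c) = twoRho c := by
  rw [twoRho_eq, twoRho_eq, val_innerIdx, rhoNat_succ]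

theorem twoRho_zero : twoRho (0 : Fin (N + 2)) = N := by
  rw [twoRho_eq, rhoNat]
  simp

theorem twoRho_last : twoRho (Fin.last (N + 1)) = -N := by
  rw [← Fin.rev_zero, twoRho_rev, twoRho_zero]

/-- Induction from `N` to `N + 2`, checked on basis words sorted by their outer letters. Without
outer letters the words are too short. With one of them, torus weight leaves only the case that `j`
is the other one. With both, only inner `j` can contribute, and this is the smaller case. -/
theorem cyc_SO (hg : IsGeneric s) : ∀ {N : ℕ} {τ : SOAlg s N →ₗ[K] K}
    (_ : IsVolume (minusSO s N) τ) (j : Fin N) (α : SOAlg s N),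
    τ (xi _ j * α) = (-1) ^ (N - 1) * (s ^ 2) ^ (-twoRho j) * τ (α * xi _ j)
  | 0, _, _, j, _ => j.elim0
  | 1, τ, _, j, α => by
    have h : xi _ j * α = α * xi _ j := by
      suffices H : LinearMap.mulLeft K (xi (minusSO s 1) j) = LinearMap.mulRight K (xi _ j) from
        LinearMap.congr_fun H α
      apply linearMap_ext_word
      intro L
      rw [LinearMap.mulLeft_apply, LinearMap.mulRight_apply]
      induction L with
      | nil => simp
      | cons c L ih =>
        obtain rfl : c = j := Subsingleton.elim _ _
        rw [word_cons, mul_assoc, ih]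
    have hr : twoRho j = 0 := by
      obtain rfl : j = 0 := Subsingleton.elim _ _
      simp [twoRho]
    rw [h, hr]
    simp
  | N + 2, τ, hτ, j, α => by
    obtain ⟨τ', hτ'⟩ := exists_volume_SO hg N
    have ih := cyc_SO hg hτ'
    have hz := relSO_xi (N := N + 2) hg
    suffices H : τ ∘ₗ LinearMap.mulLeft K (xi _ j) = ((-1) ^ (N + 2 - 1) *
        (s ^ 2) ^ (-twoRho j)) • τ ∘ₗ LinearMap.mulRight K (xi _ j) by
      simpa using LinearMap.congr_fun H α
    refine linearMap_ext_inner hg (fun L hL => ?_) (fun L => ?_) (fun L => ?_) (fun L => ?_) <;>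
      simp only [LinearMap.comp_apply, LinearMap.mulLeft_apply, LinearMap.smul_apply,
        LinearMap.mulRight_apply, smul_eq_mul]
    · have h1 : word _ (L.map innerIdx) * xi (minusSO s (N + 2)) j =
        word _ (L.map innerIdx ++ [j]) := by simp [word_append]
      rw [← word_cons, h1, hτ.off _ (by simp; omega), hτ.off _ (by simp; omega), mul_zero]
    · have hL := word_mem_deg (Pm := minusSO s N) L
      rcases eq_inner_or j with rfl | rfl | ⟨c, rfl⟩
      · rw [left_mul_mapX hg hL, mapX, innerMap_mul hg _ (outer_mul_left hg) (ρ := 0)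
          (by rw [hz.left_sq, zero_smul]), zero_smul, map_zero, mul_zero]
      · rw [right_mul_mapX hg hL, map_smul, smul_eq_mul, volume_mapXY hg hτ hτ']
        have h1 : mapX hg (word _ L) * xi (minusSO s (N + 2)) (Fin.last (N + 1)) =
            mapXY hg (word _ L) := by
          rw [mapX, innerMap_mul hg _ (outer_mul_outer hg) (one_smul K _).symm, one_smul, mapXY]
        rw [h1, volume_mapXY hg hτ hτ', twoRho_last, neg_neg, zpow_natCast]
        by_cases hLN : L.length = N
        · rw [hLN, neg_pow, show N + 2 - 1 = N + 1 by omega]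
          ring
        · rw [hτ'.off L hLN]
          simp
      · rw [mapX, ← innerMap_xi_mul, ← mapX, volume_mapX hg hτ]
        have h1 : mapX hg (word _ L) * xi (minusSO s (N + 2)) (innerIdx c) =
            (-(s ^ 2)⁻¹) • mapX hg (word _ L * xi _ c) := by
          rw [mapX_mul_xi, smul_smul]
          simp [hg.ne_zero]
        rw [h1, map_smul, volume_mapX hg hτ, smul_zero, mul_zero]
    · have hL := word_mem_deg (Pm := minusSO s N) L
      rcases eq_inner_or j with rfl | rfl | ⟨c, rfl⟩
      · rw [left_mul_mapY hg hL, map_smul, smul_eq_mul, volume_mapXY hg hτ hτ']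
        have h1 : mapY hg (word _ L) * xi (minusSO s (N + 2)) 0 =
            (-1 : K) • mapXY hg (word _ L) := by
          rw [mapY, innerMap_mul hg _ (outer_mul_outer hg) hz.right_mul_left, mapXY]
        rw [h1, map_smul, smul_eq_mul, volume_mapXY hg hτ hτ', twoRho_zero, zpow_neg, zpow_natCast]
        by_cases hLN : L.length = N
        · rw [hLN, neg_pow (s ^ 2)⁻¹, show N + 2 - 1 = N + 1 by omega, inv_pow]
          ring
        · rw [hτ'.off L hLN]
          simp
      · rw [right_mul_mapY hg hL, mapY, innerMap_mul hg _ (outer_mul_left hg) (ρ := 0)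
          (by rw [hz.right_sq, zero_smul]), zero_smul, map_zero, mul_zero]
      · rw [mapY, ← innerMap_xi_mul, ← mapY, volume_mapY hg hτ]
        have h1 : mapY hg (word _ L) * xi (minusSO s (N + 2)) (innerIdx c) =
            (-(s ^ 2)) • mapY hg (word _ L * xi _ c) := by
          rw [mapY_mul_xi, smul_smul]
          simp [hg.ne_zero]
        rw [h1, map_smul, volume_mapY hg hτ, smul_zero, mul_zero]
    · have hL := word_mem_deg (Pm := minusSO s N) L
      rcases eq_inner_or j with rfl | rfl | ⟨c, rfl⟩
      · rw [left_mul_mapXY hg hL, mapXY, innerMap_mul hg _ (outer_mul_left hg) (ρ := 0)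
          (by rw [outer_mul_left hg, zero_smul]), zero_smul, map_zero, mul_zero]
      · rw [right_mul_mapXY hg hL, mapXY, innerMap_mul hg _ (outer_mul_left hg) (ρ := 0)
          (by rw [outer_mul_right hg, zero_smul]), zero_smul, map_zero, mul_zero]
      · have h1 : mapXY hg (word _ L) * xi (minusSO s (N + 2)) (innerIdx c) =
            mapXY hg (word _ L * xi _ c) := by
          rw [mapXY, innerMap_mul_xi hg (outer_mul_outer hg) (κ := 1), one_smul]
          rw [one_smul, hz.outer_mul_inner]
        rw [h1, mapXY, ← innerMap_xi_mul, ← mapXY, volume_mapXY hg hτ hτ', volume_mapXY hg hτ hτ',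
          ih, twoRho_innerIdx]
        have hN : 1 ≤ N := by have := c.2; omega
        have hsign : (-1 : K) ^ (N + 2 - 1) = (-1) ^ (N - 1) := by
          rw [show N + 2 - 1 = (N - 1) + 2 by omega, pow_add]
          norm_num
        rw [hsign]
        ring

end Cyclicity

end QEpsilon

namespace QEpsilon

open scoped TensorProduct

universe v

/-! ### Skew derivations as homomorphisms into upper triangular matrices. -/

section UpperTriangular

variable {K : Type*} [Field K] {B : Type*} [Ring B] [Algebra K B]

/-- An upper triangular matrix. -/
def upper (a f d : B) : Matrix (Fin 2) (Fin 2) B := !![a, f; 0, d]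

theorem upper_mul (a f d a' f' d' : B) :
    upper a f d * upper a' f' d' = upper (a * a') (a * f' + f * d') (d * d') := by
  ext i j
  fin_cases i <;> fin_cases j <;> simp [upper, Matrix.mul_apply]

theorem upper_add (a f d a' f' d' : B) :
    upper a f d + upper a' f' d' = upper (a + a') (f + f') (d + d') := by
  ext i j
  fin_cases i <;> fin_cases j <;> simp [upper]

theorem upper_sub (a f d a' f' d' : B) :
    upper a f d - upper a' f' d' = upper (a - a') (f - f') (d - d') := by
  ext i j
  fin_cases i <;> fin_cases j <;> simp [upper]

theorem upper_smul (r : K) (a f d : B) : r • upper a f d = upper (r • a) (r • f) (r • d) := by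
  ext i j
  fin_cases i <;> fin_cases j <;> simp [upper]

theorem upper_zero : upper (0 : B) 0 0 = 0 := by
  ext i j
  fin_cases i <;> fin_cases j <;> simp [upper]

variable {s : K} {N : ℕ} {X Y : ℕ → B} {C : B}

variable (s N X Y C) in
/-- The data of a derivation, twisted by the torus automorphism with parameters `t`. -/
structure TwistedDerivation (t : ℕ → K) (fX fY : ℕ → B) (fC : B) (dΩ : ℕ → B) : Prop where
  t_ne : ∀ r, t r ≠ 0
  Ω_zero : dΩ 0 = 0
  Ω_succ : ∀ p < N / 2, dΩ (p + 1) =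
    (s ^ 2)⁻¹ • dΩ p + (s ^ 2 - (s ^ 2)⁻¹) • (t p • X p * fY p + fX p * Y p)
  X_sq : ∀ r < N / 2, t r • X r * fX r + fX r * X r = 0
  Y_sq : ∀ r < N / 2, (t r)⁻¹ • Y r * fY r + fY r * Y r = 0
  XX : ∀ r p, r < p → p < N / 2 → t p • X p * fX r + fX p * X r =
    -(s ^ 2) • (t r • X r * fX p + fX r * X p)
  YX : ∀ r p, r < p → p < N / 2 → (t p)⁻¹ • Y p * fX r + fY p * X r =
    -(s ^ 2) • (t r • X r * fY p + fX r * Y p)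
  XY : ∀ r p, r < p → p < N / 2 → t p • X p * fY r + fX p * Y r =
    -(s ^ 2)⁻¹ • ((t r)⁻¹ • Y r * fX p + fY r * X p)
  YY : ∀ r p, r < p → p < N / 2 → (t p)⁻¹ • Y p * fY r + fY p * Y r =
    -(s ^ 2)⁻¹ • ((t r)⁻¹ • Y r * fY p + fY r * Y p)
  cross : ∀ r < N / 2, (t r)⁻¹ • Y r * fX r + fY r * X r =
    dΩ r - (t r • X r * fY r + fX r * Y r)
  CX : ∀ r < N / 2, C * fX r + fC * X r = -(s ^ 2) • (t r • X r * fC + fX r * C)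
  CY : ∀ r < N / 2, C * fY r + fC * Y r = -(s ^ 2)⁻¹ • ((t r)⁻¹ • Y r * fC + fY r * C)
  C_sq : N % 2 = 1 → (1 + s ^ 2) • (C * fC + fC * C) = s • dΩ (N / 2)
  C_even : N % 2 = 0 → fC = 0

variable {t : ℕ → K} {fX fY : ℕ → B} {fC : B} {dΩ : ℕ → B}

/-- The upper right corner of a product of such matrices is the twisted Leibniz rule. The matrices
thus satisfy the relations as soon as the derived relations hold, and the universal property then
produces the derivation. -/
theorem TwistedDerivation.soRel (h : TwistedDerivation s N X Y C t fX fY fC dΩ)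
    (hz : SORel s N X Y C) :
    SORel s N (fun r => upper (t r • X r) (fX r) (X r))
      (fun r => upper ((t r)⁻¹ • Y r) (fY r) (Y r)) (upper C fC C) := by
  have hz' := hz.scale h.t_ne
  have hΩ : ∀ p ≤ N / 2, omega (s ^ 2) (fun r => upper (t r • X r) (fX r) (X r))
      (fun r => upper ((t r)⁻¹ • Y r) (fY r) (Y r)) p =
      upper (omega (s ^ 2) X Y p) (dΩ p) (omega (s ^ 2) X Y p) := by
    intro p hp
    induction p with
    | zero => simp only [omega, h.Ω_zero, upper_zero]
    | succ p ih =>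
      simp only [omega, ih (by omega), upper_mul, upper_smul, upper_add, h.Ω_succ p (by omega),
        smul_mul_smul_comm, mul_inv_cancel₀ (h.t_ne p), one_smul]
  refine ⟨⟨?_, ?_, ?_, ?_, ?_, ?_, ?_⟩, ?_, ?_, ?_, ?_⟩
  · intro r hr
    rw [upper_mul, hz'.pairs.X_sq r hr, h.X_sq r hr, hz.pairs.X_sq r hr, upper_zero]
  · intro r hr
    rw [upper_mul, hz'.pairs.Y_sq r hr, h.Y_sq r hr, hz.pairs.Y_sq r hr, upper_zero]
  · intro r p h1 h2
    rw [upper_mul, upper_mul, hz'.pairs.XX r p h1 h2, h.XX r p h1 h2, hz.pairs.XX r p h1 h2,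
      upper_smul]
  · intro r p h1 h2
    rw [upper_mul, upper_mul, hz'.pairs.YX r p h1 h2, h.YX r p h1 h2, hz.pairs.YX r p h1 h2,
      upper_smul]
  · intro r p h1 h2
    rw [upper_mul, upper_mul, hz'.pairs.XY r p h1 h2, h.XY r p h1 h2, hz.pairs.XY r p h1 h2,
      upper_smul]
  · intro r p h1 h2
    rw [upper_mul, upper_mul, hz'.pairs.YY r p h1 h2, h.YY r p h1 h2, hz.pairs.YY r p h1 h2,
      upper_smul]
  · intro r hr
    rw [hΩ r hr.le, upper_mul, upper_mul, hz'.pairs.cross r hr, h.cross r hr, hz.pairs.cross r hr,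
      upper_sub, omega_scale _ _ _ h.t_ne]
  · intro r hr
    rw [upper_mul, upper_mul, hz'.CX r hr, h.CX r hr, hz.CX r hr, upper_smul]
  · intro r hr
    rw [upper_mul, upper_mul, hz'.CY r hr, h.CY r hr, hz.CY r hr, upper_smul]
  · intro hN
    rw [hΩ _ le_rfl, upper_mul, upper_smul, upper_smul, hz.C_sq hN, h.C_sq hN]
  · intro hN
    rw [hz.C_even hN, h.C_even hN, upper_zero]

end UpperTriangular

section Derivations

variable {K : Type v} [Field K] [CharZero K] {s : K} {N : ℕ} {B : Type*} [Ring B] [Algebra K B]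
  {X Y : ℕ → B} {C : B} {t : ℕ → K} {fX fY : ℕ → B} {fC : B} {dΩ : ℕ → B}

theorem TwistedDerivation.exists_linearMap (hg : IsGeneric s)
    (h : TwistedDerivation s N X Y C t fX fY fC dΩ) (hz : SORel s N X Y C) :
    ∃ D : SOAlg s N →ₗ[K] B, D 1 = 0 ∧ ∀ c b, D (xi _ c * b) =
      torusWeight t c • (ofPairs N X Y C c * D b) + ofPairs N fX fY fC c * soLift hg hz b := by
  let ρ := soLift hg (h.soRel hz)
  have hρ : ∀ c, ρ (xi _ c) = upper (torusWeight t c • ofPairs N X Y C c) (ofPairs N fX fY fC c)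
      (ofPairs N X Y C c) := by
    intro c
    rw [soLift_xi]
    simp only [ofPairs, torusWeight]
    split_ifs <;> simp
  have h2 : ∀ a, ρ a 1 1 = soLift hg hz a := by
    intro a
    let f : SOAlg s N →ₗ[K] B := Matrix.entryLinearMap K B 1 1 ∘ₗ ρ.toLinearMap
    have : f = (soLift hg hz).toLinearMap := by
      apply linearMap_ext_word
      intro L
      induction L with
      | nil => simp [f]
      | cons c L ih =>
        simp only [f, LinearMap.comp_apply, AlgHom.toLinearMap_apply, word_cons, map_mul,
          Matrix.entryLinearMap_apply] at ih ⊢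
        rw [hρ, Matrix.mul_apply, Fin.sum_univ_two, ih, soLift_xi]
        simp [upper]
    exact LinearMap.congr_fun this a
  refine ⟨Matrix.entryLinearMap K B 0 1 ∘ₗ ρ.toLinearMap, by simp, fun c b => ?_⟩
  simp only [LinearMap.comp_apply, AlgHom.toLinearMap_apply, map_mul, Matrix.entryLinearMap_apply]
  rw [hρ, Matrix.mul_apply, Fin.sum_univ_two, h2]
  simp [upper]

end Derivations

/-! ### The skew derivations attached to the simple roots. -/

section Nodes

variable {K : Type*} [Field K] {B : Type*} [Ring B] [Algebra K B] {s : K} {N : ℕ} {X Y : ℕ → B}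
  {C : B}

/-- The torus parameters of the simple root relating the pairs `p` and `p + 1`. -/
def nodeTorus (q : K) (p r : ℕ) : K := if r = p then q else if r = p + 1 then q⁻¹ else 1

theorem nodeTorus_ne_zero {q : K} (hq : q ≠ 0) (p r : ℕ) : nodeTorus q p r ≠ 0 := by
  rw [nodeTorus]
  split_ifs <;> simp [hq]

/-- The derivation of the simple root relating the pairs `p` and `p + 1`. -/
theorem SORel.nodeDerivation (hs : s ≠ 0) (hz : SORel s N X Y C) {p : ℕ} (hp : p + 1 < N / 2) :
    TwistedDerivation s N X Y C (nodeTorus (s ^ 2) p) (fun r => if r = p + 1 then (-1 : K) • X p else 0)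
      (fun r => if r = p then Y (p + 1) else 0) 0
      (fun r => if r = p + 1 then (s ^ 4 - 1) • (X p * Y (p + 1)) else 0) := by
  simp only [neg_one_smul]
  have hq : s ^ 2 ≠ 0 := pow_ne_zero 2 hs
  have h := hz.pairs
  have n0 : nodeTorus (s ^ 2) p p = s ^ 2 := if_pos rfl
  have n1 : nodeTorus (s ^ 2) p (p + 1) = (s ^ 2)⁻¹ := by
    rw [nodeTorus, if_neg (by omega), if_pos rfl]
  have n2 : ∀ r, r ≠ p → r ≠ p + 1 → nodeTorus (s ^ 2) p r = 1 := by
    intro r h1 h2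
    rw [nodeTorus, if_neg h1, if_neg h2]
  refine ⟨nodeTorus_ne_zero hq p, ?_, ?_, ?_, ?_, ?_, ?_, ?_, ?_, ?_, ?_, ?_, ?_, fun _ => rfl⟩
  · simp
  · intro r hr
    rcases eq_or_ne r p with rfl | h1
    · simp only [if_true, n0, if_neg (show r ≠ r + 1 by omega), smul_zero, zero_mul, add_zero,
        zero_add, smul_mul_assoc, smul_smul]
      congr 1
      field_simp
    rcases eq_or_ne r (p + 1) with rfl | h2
    · simp only [if_true, if_neg h1, if_neg (show p + 1 + 1 ≠ p + 1 by omega), mul_zero, zero_add,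
        neg_mul, smul_neg, smul_smul]
      rw [show (s ^ 2)⁻¹ * (s ^ 4 - 1) = s ^ 2 - (s ^ 2)⁻¹ by field_simp]
      abel
    · simp [h1, h2]
  · intro r hr
    rcases eq_or_ne r (p + 1) with rfl | h2
    · simp only [if_true, n1]
      rw [mul_neg, neg_mul, smul_mul_assoc, h.XX p (p + 1) (by omega) hp, smul_smul, mul_neg,
        inv_mul_cancel₀ hq]
      simp
    · simp [h2]
  · intro r hr
    rcases eq_or_ne r p with rfl | h2
    · simp only [if_true, n0]
      rw [smul_mul_assoc, h.YY r (r + 1) (by omega) hp]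
      module
    · simp [h2]
  · intro r u h1 h2
    rcases eq_or_ne u (p + 1) with rfl | h3
    · simp only [if_true, if_neg h1.ne, mul_zero, zero_add, zero_mul, add_zero]
      rcases eq_or_ne r p with rfl | h4
      · simp [h.X_sq r (by omega)]
      · rw [n2 r h4 h1.ne, one_smul, mul_neg, neg_mul, h.XX r p (by omega) (by omega), smul_neg]
    rcases eq_or_ne r (p + 1) with rfl | h4
    · simp only [if_true, if_neg h3, mul_zero, zero_add, zero_mul, add_zero]
      rw [n2 u (by omega) h3, one_smul, mul_neg, neg_mul, h.XX p u (by omega) (by omega), smul_neg]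
    · simp [h3, h4]
  · intro r u h1 h2
    rcases eq_or_ne r (p + 1) with rfl | h4
    · simp only [if_true, if_neg (show u ≠ p by omega), mul_zero, zero_add, zero_mul, add_zero]
      rw [n2 u (by omega) (by omega), inv_one, one_smul, mul_neg, neg_mul,
        h.YX p u (by omega) (by omega), smul_neg]
    rcases eq_or_ne u p with rfl | h3
    · simp only [if_true, if_neg h4, mul_zero, zero_add, zero_mul, add_zero]
      rw [n2 r (by omega) (by omega), one_smul, h.YX r (u + 1) (by omega) hp]
    · simp [h3, h4]
  · intro r u h1 h2
    rcases eq_or_ne r p with rfl | h4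
    · rcases eq_or_ne u (r + 1) with rfl | h3
      · simp only [if_true, n0, n1]
        -- Here both generators of the relation have nonzero values under the derivation, so the
        -- cross relations of both pairs enter; everything is expressed by the smaller `omega` and
        -- ordered products.
        have e1 : X (r + 1) * Y (r + 1) + Y (r + 1) * X (r + 1) =
            (s ^ 2)⁻¹ • omega (s ^ 2) X Y r + (s ^ 2 - (s ^ 2)⁻¹) • (X r * Y r) := by
          rw [h.cross (r + 1) hp, omega]
          abel
        have e2 : Y r * X r = omega (s ^ 2) X Y r - X r * Y r := h.cross r (by omega)
        have e3 : Y (r + 1) * X (r + 1) = (s ^ 2)⁻¹ • omega (s ^ 2) X Y r +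
            (s ^ 2 - (s ^ 2)⁻¹) • (X r * Y r) - X (r + 1) * Y (r + 1) := by
          rw [← e1]
          abel
        rw [smul_mul_assoc, neg_mul, mul_neg, smul_mul_assoc, e2, e3]
        match_scalars <;> field_simp <;> ring
      · simp only [if_true, if_neg h3, mul_zero, zero_add, zero_mul, add_zero]
        rw [n2 u (by omega) h3, one_smul, h.XY (r + 1) u (by omega) h2]
    rcases eq_or_ne u (p + 1) with rfl | h3
    · simp only [if_true, if_neg h4, mul_zero, zero_add, zero_mul, add_zero]
      rw [n2 r h4 h1.ne, inv_one, one_smul, mul_neg, neg_mul, h.XY r p (by omega) (by omega),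
        smul_neg]
    · simp [h3, h4]
  · intro r u h1 h2
    rcases eq_or_ne r p with rfl | h4
    · simp only [if_true, if_neg h1.ne', mul_zero, zero_add, zero_mul, add_zero]
      rcases eq_or_ne u (r + 1) with rfl | h3
      · simp [h.Y_sq (r + 1) (by omega)]
      · rw [n2 u h1.ne' h3, inv_one, one_smul, h.YY (r + 1) u (by omega) h2]
    rcases eq_or_ne u p with rfl | h3
    · simp only [if_true, if_neg h4, mul_zero, zero_add, zero_mul, add_zero]
      rw [n2 r h4 (by omega), inv_one, one_smul, h.YY r (u + 1) (by omega) (by omega)]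
    · simp [h3, h4]
  · intro r hr
    rcases eq_or_ne r p with rfl | h1
    · simp only [if_true, n0, if_neg (show r ≠ r + 1 by omega), zero_mul, mul_zero, add_zero,
        zero_add]
      rw [h.YX r (r + 1) (by omega) hp, smul_mul_assoc]
      module
    rcases eq_or_ne r (p + 1) with rfl | h2
    · simp only [if_true, n1, if_neg h1, zero_mul, mul_zero, add_zero, zero_add, inv_inv]
      rw [smul_mul_assoc, mul_neg, h.YX p (p + 1) (by omega) hp, neg_mul]
      module
    · simp [h1, h2]
  · intro r hr
    rcases eq_or_ne r (p + 1) with rfl | h2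
    · simp only [if_true, zero_mul, mul_zero, add_zero, zero_add]
      rw [mul_neg, hz.CX p (by omega), neg_mul, smul_neg]
    · simp [h2]
  · intro r hr
    rcases eq_or_ne r p with rfl | h2
    · simp only [if_true, zero_mul, mul_zero, add_zero, zero_add]
      rw [hz.CY (r + 1) hp]
    · simp [h2]
  · intro _
    rw [if_neg (by omega)]
    simp

/-- The derivation of the last simple root, for odd `N`. -/
theorem SORel.lastDerivation (hs : s ≠ 0) (hz : SORel s N X Y C) (hN : N % 2 = 1) {p : ℕ}
    (hp : p + 1 = N / 2) :
    TwistedDerivation s N X Y C (fun r => if r = p then s ^ 2 else 1) 0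
      (fun r => if r = p then C else 0) (-s • X p)
      (fun r => if r = p + 1 then (s ^ 4 - 1) • (X p * C) else 0) := by
  have hq : s ^ 2 ≠ 0 := pow_ne_zero 2 hs
  have h := hz.pairs
  refine ⟨?_, ?_, ?_, ?_, ?_, ?_, ?_, ?_, ?_, ?_, ?_, ?_, ?_, by omega⟩
  · intro r
    split_ifs <;> simp [hs]
  · simp
  · intro r hr
    rcases eq_or_ne r p with rfl | h1
    · simp only [if_true, if_neg (show r ≠ r + 1 by omega), smul_zero, Pi.zero_apply, zero_mul,
        add_zero, zero_add, smul_mul_assoc, smul_smul]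
      congr 1
      field_simp
    · simp [h1, show r ≠ p + 1 by omega]
  · intro r hr
    simp
  · intro r hr
    rcases eq_or_ne r p with rfl | h1
    · simp only [if_true, smul_mul_assoc]
      rw [hz.CY r hr]
      module
    · simp [h1]
  · intro r u h1 h2
    simp
  · intro r u h1 h2
    rcases eq_or_ne u p with rfl | h3
    · simp only [if_true, if_neg h1.ne, Pi.zero_apply, mul_zero, zero_mul, zero_add, add_zero,
        one_smul]
      rw [hz.CX r (by omega)]
    · simp [h3]
  · intro r u h1 h2
    simp [show r ≠ p by omega]
  · intro r u h1 h2
    rcases eq_or_ne u p with rfl | h3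
    · simp only [if_true, if_neg h1.ne, mul_zero, zero_mul, zero_add, add_zero,
        one_smul, inv_one]
      rw [hz.CY r (by omega)]
    · simp [h3, show r ≠ p by omega]
  · intro r hr
    rcases eq_or_ne r p with rfl | h1
    · simp only [if_true, if_neg (show r ≠ r + 1 by omega), Pi.zero_apply, mul_zero, zero_mul,
        zero_add, add_zero, smul_mul_assoc]
      rw [hz.CX r hr]
      module
    · simp [h1, show r ≠ p + 1 by omega]
  · intro r hr
    rcases eq_or_ne r p with rfl | h1
    · simp [h.X_sq r hr]
    · simp only [Pi.zero_apply, mul_zero, zero_mul, zero_add, add_zero, if_neg h1, one_smul,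
        smul_mul_assoc, mul_smul_comm]
      rw [h.XX r p (by omega) (by omega), smul_comm]
  · intro r hr
    rcases eq_or_ne r p with rfl | h1
    · simp only [if_true, smul_mul_assoc, mul_smul_comm]
      -- Both the central square and `Y r * X r` are expressed through `omega` and `X r * Y r`; what
      -- remains is a comparison of scalars.
      have e1 := hz.C_sq hN
      rw [← hp, omega] at e1
      have e2 : Y r * X r = omega (s ^ 2) X Y r - X r * Y r := h.cross r (by omega)
      rw [e2]
      have e3 : (s ^ 2)⁻¹ • ((1 + s ^ 2) • (C * C)) = (s ^ 2)⁻¹ • (s • ((s ^ 2)⁻¹ •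
        omega (s ^ 2) X Y r + (s ^ 2 - (s ^ 2)⁻¹) • (X r * Y r))) := by rw [e1]
      rw [smul_smul, show (s ^ 2)⁻¹ * (1 + s ^ 2) = 1 + (s ^ 2)⁻¹ by field_simp; ring, add_smul,
        one_smul] at e3
      rw [← sub_eq_zero]
      refine Eq.trans ?_ (sub_eq_zero.2 e3)
      match_scalars <;> field_simp <;> ring
    · simp only [if_neg h1, mul_zero, zero_mul, zero_add, add_zero, inv_one, one_smul,
        smul_mul_assoc, mul_smul_comm]
      rw [h.XY r p (by omega) (by omega), smul_comm]
  · intro _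
    rw [if_pos hp.symm, smul_mul_assoc, mul_smul_comm, hz.CX p (by omega)]
    module

end Nodes

end QEpsilon

namespace QEpsilon

open scoped TensorProduct

universe v

/-! ### Transposed skew derivations commute with the square of the Hodge map. -/

section SkewDerivation

variable {K : Type*} [Field K] {N : ℕ} {Pm : Matrix (Fin N × Fin N) (Fin N × Fin N) K}

/-- `D` is a derivation twisted by the diagonal endomorphism `κ`, with values `f` on the
generators. -/
structure IsSkewDer (κ : ExtAlg Pm →ₐ[K] ExtAlg Pm) (w : Fin N → K) (f : Fin N → ExtAlg Pm)
    (D : ExtAlg Pm →ₗ[K] ExtAlg Pm) : Prop where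
  diag : ∀ c, κ (xi Pm c) = w c • xi Pm c
  one : D 1 = 0
  xi_mul : ∀ c b, D (xi Pm c * b) = w c • (xi Pm c * D b) + f c * b

namespace IsSkewDer

variable {κ : ExtAlg Pm →ₐ[K] ExtAlg Pm} {w : Fin N → K} {f e : Fin N → ExtAlg Pm}
  {D E : ExtAlg Pm →ₗ[K] ExtAlg Pm}

theorem apply_xi (h : IsSkewDer κ w f D) (c : Fin N) : D (xi Pm c) = f c := by
  have := h.xi_mul c 1
  rwa [mul_one, h.one, mul_zero, smul_zero, zero_add, mul_one] at this

theorem leibniz (h : IsSkewDer κ w f D) (a b : ExtAlg Pm) : D (a * b) = D a * b + κ a * D b := by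
  suffices H : D ∘ₗ LinearMap.mulRight K b =
      LinearMap.mulRight K b ∘ₗ D + LinearMap.mulRight K (D b) ∘ₗ κ.toLinearMap from
    LinearMap.congr_fun H a
  apply linearMap_ext_word
  intro L
  induction L with
  | nil => simp [h.one]
  | cons c L ih =>
    simp only [LinearMap.comp_apply, LinearMap.add_apply, LinearMap.mulRight_apply,
      AlgHom.toLinearMap_apply, word_cons] at ih ⊢
    rw [mul_assoc, h.xi_mul, ih, h.xi_mul, map_mul, h.diag, add_mul, mul_add, smul_add,
      smul_mul_assoc, smul_mul_assoc, smul_mul_assoc, mul_assoc, mul_assoc, mul_assoc]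
    abel

theorem mem_deg (h : IsSkewDer κ w f D) (hf : ∀ c, f c ∈ deg Pm 1) (L : List (Fin N)) :
    D (word Pm L) ∈ deg Pm L.length := by
  induction L with
  | nil => simp [h.one]
  | cons c L ih =>
    rw [word_cons, h.xi_mul, List.length_cons, add_comm]
    exact add_mem (Submodule.smul_mem _ _ (mul_mem_deg (xi_mem_deg c) ih))
      (mul_mem_deg (hf c) (word_mem_deg L))

theorem diag_apply (h : IsSkewDer κ w f D) {r : K} (hf : ∀ c, κ (f c) = (r * w c) • f c)
    (a : ExtAlg Pm) : κ (D a) = r • D (κ a) := by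
  suffices H : κ.toLinearMap ∘ₗ D = r • D ∘ₗ κ.toLinearMap from LinearMap.congr_fun H a
  apply linearMap_ext_word
  intro L
  induction L with
  | nil => simp [h.one]
  | cons c L ih =>
    simp only [LinearMap.comp_apply, LinearMap.smul_apply, AlgHom.toLinearMap_apply,
      word_cons] at ih ⊢
    rw [h.xi_mul, map_add, map_smul, map_mul, h.diag, ih, map_mul, hf, map_mul, h.diag,
      smul_mul_assoc (w c) (xi Pm c) (κ _), map_smul, h.xi_mul, smul_mul_assoc, mul_smul_comm,
      smul_mul_assoc]
    module

/-- The composite of `τ` with `D` is supported in top degree, hence a multiple of `τ`. Since `D` has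
weight `r ≠ 1` and `τ` is invariant, the multiple is zero. -/
theorem volume_apply (h : IsSkewDer κ w f D) {r : K} (hr : r ≠ 1)
    (hf : ∀ c, κ (f c) = (r * w c) • f c) (hf' : ∀ c, f c ∈ deg Pm 1) {τ : ExtAlg Pm →ₗ[K] K}
    (hτ : IsVolume Pm τ) (hκ : ∀ a, τ (κ a) = τ a) (a : ExtAlg Pm) : τ (D a) = 0 := by
  have h1 := hτ.eq_smul_of_off (φ := τ ∘ₗ D) fun L hL => by
    exact eqOn_deg (f := τ) (g := 0) (fun L' hL' => hτ.off L' (by omega)) (h.mem_deg hf' L)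
  set t : ExtAlg Pm := xiProd Pm (fun k => k)
  set c : K := (τ ∘ₗ D) t
  have h2 : ∀ b, τ (D b) = c * τ b := fun b => LinearMap.congr_fun h1 b
  have h3 : c * τ t = r * (c * τ t) := by
    refine (h2 t).symm.trans ?_
    rw [← hκ (D t), h.diag_apply hf, map_smul, h2, hκ, smul_eq_mul]
  rw [hτ.top] at h3
  have h4 : c * (1 - r) = 0 := by linear_combination h3
  have h5 : c = 0 := (mul_eq_zero.1 h4).resolve_right (sub_ne_zero.2 hr.symm)
  rw [h2, h5, zero_mul]

/-- The hypothesis `hT` says that the matrices of `D` and `E` on generators are transposed to one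
another. As both derivations have the same diagonal twist, the transposition passes to all words,
that is, to the powers of `theta`. -/
theorem map_theta_pow (h : IsSkewDer κ w f D) (h' : IsSkewDer κ w e E)
    (hT : ∑ c, f c ⊗ₜ[K] xi Pm c = ∑ c, xi Pm c ⊗ₜ[K] e c) (l : ℕ) :
    D.rTensor (ExtAlg Pm) (theta Pm ^ l) = E.lTensor (ExtAlg Pm) (theta Pm ^ l) := by
  induction l with
  | zero =>
    rw [pow_zero, Algebra.TensorProduct.one_def, LinearMap.rTensor_tmul, LinearMap.lTensor_tmul,
      h.one, h'.one, TensorProduct.zero_tmul, TensorProduct.tmul_zero]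
  | succ l ih =>
    have h1 : ∀ c (t : ExtAlg Pm ⊗[K] ExtAlg Pm),
        D.rTensor (ExtAlg Pm) ((xi Pm c ⊗ₜ[K] xi Pm c) * t) =
          w c • ((xi Pm c ⊗ₜ[K] xi Pm c) * D.rTensor (ExtAlg Pm) t) + (f c ⊗ₜ[K] xi Pm c) * t := by
      intro c t
      induction t using TensorProduct.induction_on with
      | zero => simp
      | tmul a b =>
        simp only [Algebra.TensorProduct.tmul_mul_tmul, LinearMap.rTensor_tmul, h.xi_mul,
          TensorProduct.add_tmul, TensorProduct.smul_tmul']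
      | add a b ha hb =>
        rw [mul_add, map_add, ha, hb, map_add, mul_add, mul_add, smul_add]
        abel
    have h2 : ∀ c (t : ExtAlg Pm ⊗[K] ExtAlg Pm),
        E.lTensor (ExtAlg Pm) ((xi Pm c ⊗ₜ[K] xi Pm c) * t) =
          w c • ((xi Pm c ⊗ₜ[K] xi Pm c) * E.lTensor (ExtAlg Pm) t) + (xi Pm c ⊗ₜ[K] e c) * t := by
      intro c t
      induction t using TensorProduct.induction_on with
      | zero => simp
      | tmul a b =>
        simp only [Algebra.TensorProduct.tmul_mul_tmul, LinearMap.lTensor_tmul, h'.xi_mul,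
          TensorProduct.tmul_add, TensorProduct.tmul_smul]
      | add a b ha hb =>
        rw [mul_add, map_add, ha, hb, map_add, mul_add, mul_add, smul_add]
        abel
    rw [pow_succ', theta, Finset.sum_mul, map_sum, map_sum, ← theta]
    simp only [h1, h2, ih, Finset.sum_add_distrib]
    rw [← Finset.sum_mul, ← Finset.sum_mul, hT]

theorem exists_weight (h : IsSkewDer κ w f D) {l : ℕ} (I : Fin l → Fin N) :
    ∃ r : K, κ (xiProd Pm I) = r • xiProd Pm I := by
  rw [xiProd_eq_word]
  generalize List.ofFn I = L
  induction L with
  | nil => exact ⟨1, by simp⟩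
  | cons c L ih =>
    obtain ⟨r, hr⟩ := ih
    exact ⟨w c * r, by rw [word_cons, map_mul, h.diag, hr, smul_mul_smul_comm]⟩

theorem diag_hodge (h : IsSkewDer κ w f D) (τ : ExtAlg Pm →ₗ[K] K) (l : ℕ) (a : ExtAlg Pm) :
    κ (hodge τ l a) = ∑ k : Fin l → Fin N, τ (κ (xiProd Pm k) * a) • xiProd Pm k := by
  rw [hodge_apply, map_sum]
  refine Finset.sum_congr rfl fun k _ => ?_
  obtain ⟨r, hr⟩ := h.exists_weight k
  rw [map_smul, hr, smul_mul_assoc, map_smul, smul_comm, smul_assoc]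

/-- Words are eigenvectors of `κ`, so `κ` may be moved onto the word inside `τ`, where invariance
removes both copies. -/
theorem diag_hodge_diag (h : IsSkewDer κ w f D) {τ : ExtAlg Pm →ₗ[K] K}
    (hκ : ∀ a, τ (κ a) = τ a) (l : ℕ) (a : ExtAlg Pm) :
    κ (hodge τ l (κ a)) = hodge τ l a := by
  rw [h.diag_hodge, hodge_apply]
  simp only [← map_mul, hκ]

/-- Integration by parts: since `τ` kills `D (b * a)`, the derivation moves from `a` to the word `b`
with a sign, and then to the other leg as `E`. -/
theorem diag_hodge_apply (h : IsSkewDer κ w f D) (h' : IsSkewDer κ w e E)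
    (hT : ∑ c, f c ⊗ₜ[K] xi Pm c = ∑ c, xi Pm c ⊗ₜ[K] e c) {τ : ExtAlg Pm →ₗ[K] K}
    (hD : ∀ a, τ (D a) = 0) (l : ℕ) (a : ExtAlg Pm) :
    κ (hodge τ l (D a)) = (-1 : K) • E (hodge τ l a) := by
  have h1 : ∀ b, τ (κ b * D a) = (-1 : K) * τ (D b * a) := by
    intro b
    have := hD (b * a)
    rw [h.leibniz, map_add] at this
    linear_combination this
  have h2 : contract τ a (D.rTensor (ExtAlg Pm) (theta Pm ^ l)) = E (hodge τ l a) := by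
    rw [h.map_theta_pow h' hT, hodge_eq_contract]
    generalize theta Pm ^ l = t
    induction t using TensorProduct.induction_on with
    | zero => simp
    | tmul a b => simp
    | add a b ha hb => simp only [map_add, ha, hb]
  rw [h.diag_hodge, ← h2, theta_pow, map_sum, map_sum, Finset.smul_sum]
  refine Finset.sum_congr rfl fun k _ => ?_
  rw [h1, LinearMap.rTensor_tmul, contract_tmul, smul_smul]

/-- The square of the Hodge map commutes with skew derivations. -/
theorem hodge_hodge_comm (h : IsSkewDer κ w f D) (h' : IsSkewDer κ w e E)
    (hT : ∑ c, f c ⊗ₜ[K] xi Pm c = ∑ c, xi Pm c ⊗ₜ[K] e c)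
    (hT' : ∑ c, e c ⊗ₜ[K] xi Pm c = ∑ c, xi Pm c ⊗ₜ[K] f c) {τ : ExtAlg Pm →ₗ[K] K}
    (hκ : ∀ a, τ (κ a) = τ a) (hD : ∀ a, τ (D a) = 0) (hE : ∀ a, τ (E a) = 0) (l m : ℕ)
    (a : ExtAlg Pm) : hodge τ m (hodge τ l (D a)) = D (hodge τ m (hodge τ l a)) := by
  -- Two integrations by parts turn `D` into `-E` and `E` into `-D`; the signs cancel, and the twist
  -- is absorbed by `diag_hodge_diag`.
  rw [← h.diag_hodge_diag hκ m (hodge τ l (D a)), h.diag_hodge_apply h' hT hD, map_smul, map_smul,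
    h'.diag_hodge_apply h hT' hE, smul_smul]
  norm_num

end IsSkewDer

end SkewDerivation

/-! ### The anti-automorphism exchanging opposite generators. -/

section Reversal

variable {K : Type v} [Field K] [CharZero K] {s : K} {N : ℕ}

/-- Reversing the order and exchanging opposite indices fixes every product `z i * z i.rev`, and
with it all the partial sums in the relations. -/
theorem relSO_op (hg : IsGeneric s) :
    RelSO s N (fun c => MulOpposite.op (xi (minusSO s N) c.rev)) := by
  have hz := relSO_xi (N := N) hg
  have hF : (extendZero fun i : Fin N => MulOpposite.op (xi (minusSO s N) i.rev) *
      MulOpposite.op (xi (minusSO s N) i.rev.rev)) = fun r => MulOpposite.op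
        (extendZero (fun i : Fin N => xi (minusSO s N) i * xi _ i.rev) r) := by
    funext r
    simp only [extendZero]
    split_ifs
    · rw [← MulOpposite.op_mul, Fin.rev_rev]
    · rfl
  have hR : ∀ p, rhoSum s N (extendZero fun i : Fin N => MulOpposite.op (xi (minusSO s N) i.rev) *
      MulOpposite.op (xi (minusSO s N) i.rev.rev)) p = MulOpposite.op
        (rhoSum s N (extendZero fun i : Fin N => xi (minusSO s N) i * xi _ i.rev) p) := by
    intro p
    rw [hF]
    induction p with
    | zero => simp
    | succ p ih => rw [rhoSum_succ, rhoSum_succ, ih, MulOpposite.op_add, MulOpposite.op_smul]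
  refine ⟨fun a ha => ?_, fun a b h1 h2 => ?_, fun a ha => ?_, fun a ha => ?_⟩
  · rw [← MulOpposite.op_mul, hz.sq _ (fun h => ha (by rw [← Fin.rev_inj]; exact h)),
      MulOpposite.op_zero]
  · rw [← MulOpposite.op_mul, ← MulOpposite.op_mul, hz.comm b.rev a.rev
      (fun h => h1 (by rw [h, Fin.rev_rev])) (Fin.rev_lt_rev.2 h2),
      MulOpposite.op_smul]
  · rw [hR, ← MulOpposite.op_mul, ← MulOpposite.op_mul, Fin.rev_rev, ← MulOpposite.op_add,
      hz.pair a ha, MulOpposite.op_smul]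
  · rw [hR, ← MulOpposite.op_mul, ← ha, ← MulOpposite.op_smul, hz.mid a ha, MulOpposite.op_smul]

/-- The anti-automorphism `ξ^i ↦ ξ^{-i}`. -/
noncomputable def reversal (hg : IsGeneric s) : SOAlg s N →ₗ[K] SOAlg s N :=
  (MulOpposite.opLinearEquiv K).symm.toLinearMap ∘ₗ
    (extLift _ ((quadRel_iff_relSO hg _).2 (relSO_op (N := N) hg))).toLinearMap

variable (hg : IsGeneric s)

theorem reversal_one : reversal hg (1 : SOAlg s N) = 1 := by
  simp [reversal]

theorem reversal_mul (a b : SOAlg s N) :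
    reversal hg (a * b) = reversal hg b * reversal hg a := by
  simp [reversal]

theorem reversal_xi (c : Fin N) : reversal hg (xi _ c) = xi (minusSO s N) c.rev := by
  simp [reversal]

theorem reversal_word (L : List (Fin N)) :
    reversal hg (word _ L) = word (minusSO s N) (L.map Fin.rev).reverse := by
  induction L with
  | nil => simpa using reversal_one hg
  | cons c L ih =>
    rw [word_cons, reversal_mul, ih, reversal_xi, List.map_cons, List.reverse_cons, word_append]
    simp

theorem reversal_reversal (a : SOAlg s N) : reversal hg (reversal hg a) = a := by
  suffices H : reversal hg ∘ₗ reversal hg = (LinearMap.id : SOAlg s N →ₗ[K] SOAlg s N) from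
    LinearMap.congr_fun H a
  apply linearMap_ext_word
  intro L
  rw [LinearMap.comp_apply, reversal_word, reversal_word, LinearMap.id_apply]
  congr 1
  simp [List.map_reverse, Function.comp_def]

theorem IsVolume.reversal {τ : SOAlg s N →ₗ[K] K} (hτ : IsVolume (minusSO s N) τ)
    (a : SOAlg s N) : τ (reversal hg a) = τ a := by
  have h1 := hτ.eq_smul_of_off (φ := τ ∘ₗ QEpsilon.reversal hg) fun L hL => by
    rw [LinearMap.comp_apply, reversal_word]
    exact hτ.off _ (by simpa using hL)
  have h2 : QEpsilon.reversal hg (xiProd (minusSO s N) fun k => k) = xiProd _ fun k => k := by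
    rw [xiProd_eq_word, reversal_word]
    congr 1
    apply List.ext_getElem
    · simp
    · intro i h1 h2
      simp only [List.getElem_reverse, List.getElem_map, List.getElem_ofFn, List.length_map,
        List.length_ofFn]
      ext
      simp only [List.length_ofFn] at h2
      simp only [Fin.val_rev]
      omega
  rw [LinearMap.comp_apply, h2, hτ.top, one_smul] at h1
  exact LinearMap.congr_fun h1 a

/-- Opposite generators have inverse weights, so the reversal conjugates the torus automorphism to
its inverse. This makes the conjugate of a skew derivation a skew derivation with the same twist. -/
theorem torus_reversal_torus {t : ℕ → K} (ht : ∀ r, t r ≠ 0) (a : SOAlg s N) :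
    torus hg ht (reversal hg (torus hg ht (reversal hg a))) = a := by
  have hw : ∀ c : Fin N, torusWeight t c * torusWeight t c.rev = 1 := by
    intro c
    have hc := c.2
    have hv : ((c.rev : Fin N) : ℕ) = N - 1 - c := by rw [Fin.val_rev]; omega
    rcases lt_trichotomy (2 * (c : ℕ) + 1) N with h | h | h
    · rw [torusWeight, torusWeight, ofPairs_left _ _ _ h, ofPairs_right _ _ _ (by omega), hv,
        show N - 1 - (N - 1 - (c : ℕ)) = c by omega, mul_inv_cancel₀ (ht _)]
    · rw [torusWeight, torusWeight, ofPairs_mid _ _ _ h, ofPairs_mid _ _ _ (by omega), one_mul]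
    · rw [torusWeight, torusWeight, ofPairs_right _ _ _ h, ofPairs_left _ _ _ (by omega), hv,
        inv_mul_cancel₀ (ht _)]
  suffices H : (torus hg ht).toLinearMap ∘ₗ reversal hg ∘ₗ (torus hg ht).toLinearMap ∘ₗ
      reversal hg = (LinearMap.id : SOAlg s N →ₗ[K] SOAlg s N) from LinearMap.congr_fun H a
  apply linearMap_ext_word
  intro L
  simp only [LinearMap.comp_apply, AlgHom.toLinearMap_apply, LinearMap.id_apply]
  induction L with
  | nil => rw [word_nil, reversal_one, map_one, reversal_one, map_one]
  | cons c L ih =>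
    rw [word_cons, reversal_mul, map_mul, reversal_mul, map_mul, ih, reversal_xi, torus_xi,
      map_smul, reversal_xi, map_smul, Fin.rev_rev, torus_xi, smul_smul, mul_comm _ (torusWeight t c),
      hw, one_smul]

/-- The derivation obtained by conjugation with the reversal. -/
theorem IsSkewDer.reversal {t : ℕ → K} (ht : ∀ r, t r ≠ 0) {f : Fin N → SOAlg s N}
    {D : SOAlg s N →ₗ[K] SOAlg s N} (h : IsSkewDer (torus hg ht) (torusWeight t) f D) (μ : K) :
    IsSkewDer (torus hg ht) (torusWeight t)
      (fun c => μ • torus hg ht (reversal hg (f c.rev)))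
      (μ • (torus hg ht).toLinearMap ∘ₗ QEpsilon.reversal hg ∘ₗ D ∘ₗ QEpsilon.reversal hg) := by
  refine ⟨torus_xi hg ht, ?_, fun c b => ?_⟩
  · simp only [LinearMap.smul_apply, LinearMap.comp_apply, reversal_one, h.one, map_zero, smul_zero]
  · simp only [LinearMap.smul_apply, LinearMap.comp_apply, AlgHom.toLinearMap_apply]
    rw [reversal_mul, reversal_xi, h.leibniz, h.apply_xi, map_add, map_add, reversal_mul,
      reversal_mul, reversal_xi, Fin.rev_rev, map_mul, map_mul, torus_reversal_torus, torus_xi,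
      smul_add, mul_smul_comm, smul_mul_assoc, smul_mul_assoc, smul_comm]

end Reversal

end QEpsilon

namespace QEpsilon

open scoped TensorProduct

universe v

/-! ### Reaching all words from the unbalanced ones of the outermost pair. -/

section Spanning

variable {K : Type*} [Field K] {B : Type*} [Ring B] [Algebra K B]

/-- The products of subsets of the first `p` pairs, in the order of the basis. -/
def pairWords (X Y : ℕ → B) : ℕ → Set B
  | 0 => {1}
  | p + 1 => {a | ∃ r ∈ pairWords X Y p,
      a = r ∨ a = X p * r ∨ a = Y p * r ∨ a = X p * (Y p * r)}

/-- The product of the first `k` pairs. -/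
def outerProd (X Y : ℕ → B) : ℕ → B
  | 0 => 1
  | k + 1 => X k * (Y k * outerProd X Y k)

variable (K) in
/-- The subalgebra generated by the pairs `p, …, n - 1` and the central generator. -/
def innerSub (n : ℕ) (X Y : ℕ → B) (C : B) (p : ℕ) : Subalgebra K B :=
  Algebra.adjoin K {a | (∃ r, p ≤ r ∧ r < n ∧ (a = X r ∨ a = Y r)) ∨ a = C}

variable {n : ℕ} {X Y : ℕ → B} {C : B} {q s : K}

theorem pairWords_mono {p p' : ℕ} (h : p ≤ p') : pairWords X Y p ⊆ pairWords X Y p' := by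
  induction p', h using Nat.le_induction with
  | base => exact subset_rfl
  | succ p' _ ih => exact ih.trans fun a ha => ⟨a, ha, Or.inl rfl⟩

theorem outerProd_mem_pairWords (k : ℕ) : outerProd X Y k ∈ pairWords X Y k := by
  induction k with
  | zero => rfl
  | succ k ih => exact ⟨_, ih, Or.inr (Or.inr (Or.inr rfl))⟩

theorem X_mem_innerSub {p r : ℕ} (h : p ≤ r) (hr : r < n) : X r ∈ innerSub K n X Y C p :=
  Algebra.subset_adjoin (Or.inl ⟨r, h, hr, Or.inl rfl⟩)

theorem Y_mem_innerSub {p r : ℕ} (h : p ≤ r) (hr : r < n) : Y r ∈ innerSub K n X Y C p :=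
  Algebra.subset_adjoin (Or.inl ⟨r, h, hr, Or.inr rfl⟩)

theorem C_mem_innerSub {p : ℕ} : C ∈ innerSub K n X Y C p := Algebra.subset_adjoin (Or.inr rfl)

theorem innerSub_anti {p p' : ℕ} (h : p ≤ p') : innerSub K n X Y C p' ≤ innerSub K n X Y C p := by
  apply Algebra.adjoin_mono
  rintro a (⟨r, h1, h2, h3⟩ | h1)
  · exact Or.inl ⟨r, h.trans h1, h2, h3⟩
  · exact Or.inr h1

/-- The element is fixed by `κ` and annihilated by the skew derivation `D`. -/
structure IsNeutral (κ : B →ₐ[K] B) (D : B →ₗ[K] B) (a : B) : Prop where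
  fix : κ a = a
  kill : D a = 0

/-- A skew derivation of a general algebra. -/
def IsLeibniz (κ : B →ₐ[K] B) (D : B →ₗ[K] B) : Prop := ∀ a b, D (a * b) = D a * b + κ a * D b

namespace IsLeibniz

variable {κ : B →ₐ[K] B} {D : B →ₗ[K] B}

theorem one (h : IsLeibniz κ D) : D 1 = 0 := by
  have := h 1 1
  simpa using this

theorem neutral_mul (h : IsLeibniz κ D) {a : B} (ha : IsNeutral κ D a) (b : B) : D (a * b) = a * D b := by
  rw [h, ha.kill, ha.fix, zero_mul, zero_add]

theorem mul_neutral (h : IsLeibniz κ D) {a : B} (ha : IsNeutral κ D a) (b : B) : D (b * a) = D b * a := by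
  rw [h, ha.kill, mul_zero, add_zero]

theorem neutral_mul_mul (h : IsLeibniz κ D) {a b : B} (ha : IsNeutral κ D a) (hb : IsNeutral κ D b) :
    IsNeutral κ D (a * b) :=
  ⟨by rw [map_mul, ha.fix, hb.fix], by rw [h.neutral_mul ha, hb.kill, mul_zero]⟩

theorem isNeutral_of_mem_innerSub (h : IsLeibniz κ D) {p : ℕ} (hX : ∀ r, p ≤ r → r < n → IsNeutral κ D (X r))
    (hY : ∀ r, p ≤ r → r < n → IsNeutral κ D (Y r)) (hC : IsNeutral κ D C) {a : B}
    (ha : a ∈ innerSub K n X Y C p) : IsNeutral κ D a := by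
  induction ha using Algebra.adjoin_induction with
  | mem a ha =>
    obtain (⟨r, h1, h2, rfl | rfl⟩ | rfl) := ha
    exacts [hX r h1 h2, hY r h1 h2, hC]
  | algebraMap r =>
    rw [Algebra.algebraMap_eq_smul_one]
    exact ⟨by simp, by rw [map_smul, h.one, smul_zero]⟩
  | add a b _ _ ha hb => exact ⟨by rw [map_add, ha.fix, hb.fix], by
      rw [map_add, ha.kill, hb.kill, add_zero]⟩
  | mul a b _ _ ha hb => exact h.neutral_mul_mul ha hb

theorem isNeutral_of_mem_pairWords (h : IsLeibniz κ D) {p : ℕ} (hX : ∀ r < p, IsNeutral κ D (X r))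
    (hY : ∀ r < p, IsNeutral κ D (Y r)) {a : B} (ha : a ∈ pairWords X Y p) :
    IsNeutral κ D a := by
  induction p generalizing a with
  | zero =>
    rw [Set.mem_singleton_iff.1 ha]
    exact ⟨map_one κ, h.one⟩
  | succ p ih =>
    obtain ⟨r, hr, h1⟩ := ha
    have hr' := ih (fun r hr => hX r (by omega)) (fun r hr => hY r (by omega)) hr
    have hX' := hX p (by omega)
    have hY' := hY p (by omega)
    rcases h1 with rfl | rfl | rfl | rfl
    exacts [hr', h.neutral_mul_mul hX' hr', h.neutral_mul_mul hY' hr',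
      h.neutral_mul_mul hX' (h.neutral_mul_mul hY' hr')]

end IsLeibniz

/-- The skew derivations of the simple root relating the pairs `p` and `p + 1`. -/
structure IsNode (q : K) (n : ℕ) (X Y : ℕ → B) (C : B) (p : ℕ) (κ : B →ₐ[K] B)
    (F E : B →ₗ[K] B) : Prop where
  leibF : IsLeibniz κ F
  leibE : IsLeibniz κ E
  κX : κ (X (p + 1)) = q⁻¹ • X (p + 1)
  κY : κ (Y (p + 1)) = q • Y (p + 1)
  FY : F (Y p) = Y (p + 1)
  FX : F (X (p + 1)) = (-1 : K) • X p
  FY' : F (Y (p + 1)) = 0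
  EX : E (X p) = (-1 : K) • X (p + 1)
  EY : E (Y (p + 1)) = Y p
  EX' : E (X (p + 1)) = 0
  nF : ∀ r < n, r ≠ p → r ≠ p + 1 → IsNeutral κ F (X r) ∧ IsNeutral κ F (Y r)
  nE : ∀ r < n, r ≠ p → r ≠ p + 1 → IsNeutral κ E (X r) ∧ IsNeutral κ E (Y r)
  nC : IsNeutral κ F C ∧ IsNeutral κ E C

namespace IsNode

variable {p : ℕ} {κ : B →ₐ[K] B} {F E : B →ₗ[K] B}

theorem F_mul (h : IsNode q n X Y C p κ F E) (hp : p + 1 < n) {L R : B}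
    (hL : L ∈ innerSub K n X Y C (p + 2)) (hR : R ∈ pairWords X Y p) (u : B) :
    F (L * (u * R)) = L * (F u * R) := by
  rw [h.leibF.neutral_mul, h.leibF.mul_neutral]
  · exact h.leibF.isNeutral_of_mem_pairWords (fun r hr => (h.nF r (by omega) (by omega) (by omega)).1)
      (fun r hr => (h.nF r (by omega) (by omega) (by omega)).2) hR
  · exact h.leibF.isNeutral_of_mem_innerSub
      (fun r hr hr' => (h.nF r (by omega) (by omega) (by omega)).1)
      (fun r hr hr' => (h.nF r (by omega) (by omega) (by omega)).2) h.nC.1 hL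

theorem E_mul (h : IsNode q n X Y C p κ F E) (hp : p + 1 < n) {L R : B}
    (hL : L ∈ innerSub K n X Y C (p + 2)) (hR : R ∈ pairWords X Y p) (u : B) :
    E (L * (u * R)) = L * (E u * R) := by
  rw [h.leibE.neutral_mul, h.leibE.mul_neutral]
  · exact h.leibE.isNeutral_of_mem_pairWords (fun r hr => (h.nE r (by omega) (by omega) (by omega)).1)
      (fun r hr => (h.nE r (by omega) (by omega) (by omega)).2) hR
  · exact h.leibE.isNeutral_of_mem_innerSub
      (fun r hr hr' => (h.nE r (by omega) (by omega) (by omega)).1)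
      (fun r hr hr' => (h.nE r (by omega) (by omega) (by omega)).2) h.nC.2 hL

theorem E_pair_mul_X (h : IsNode q n X Y C p κ F E) (hq : q ≠ 0) (hz : PairRel q n X Y)
    (hp : p + 1 < n) :
    E (X (p + 1) * (Y (p + 1) * X p)) = (-q) • (X (p + 1) * (X p * Y p)) := by
  rw [h.leibE, h.EX', zero_mul, zero_add, h.κX, h.leibE, h.EY, h.κY, h.EX, smul_mul_smul_comm,
    hz.cross p (by omega), hz.cross (p + 1) hp, omega, smul_mul_assoc, mul_add, mul_smul_comm,
    mul_sub, mul_sub, ← mul_assoc (X (p + 1)) (X (p + 1)), hz.X_sq (p + 1) hp, zero_mul, sub_zero,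
    mul_add, mul_smul_comm, mul_smul_comm]
  match_scalars <;> field_simp <;> ring

theorem F_pair_mul_Y (h : IsNode q n X Y C p κ F E) (hq : q ≠ 0) (hz : PairRel q n X Y)
    (hp : p + 1 < n) :
    F (X (p + 1) * (Y (p + 1) * Y p)) = q⁻¹ • (Y (p + 1) * (X p * Y p)) := by
  rw [h.leibF, h.FX, h.leibF, h.FY', h.κY, h.FY, smul_mul_assoc, smul_mul_assoc,
    hz.Y_sq (p + 1) hp, ← mul_assoc (Y (p + 1)), hz.YX p (p + 1) (by omega) hp, smul_mul_assoc,
    zero_mul, smul_zero, add_zero, mul_zero, add_zero, mul_assoc]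
  match_scalars
  field_simp

theorem F_X_mul_Y (h : IsNode q n X Y C p κ F E) :
    F (X (p + 1) * Y p) = (-1 : K) • (X p * Y p) + q⁻¹ • (X (p + 1) * Y (p + 1)) := by
  rw [h.leibF, h.FX, h.κX, h.FY, smul_mul_assoc, smul_mul_assoc]

end IsNode

/-- The submodule `G` is stable under the skew derivations of the simple roots and contains the
products in which one generator of the first pair occurs. -/
structure IsStable (q : K) (n : ℕ) (X Y : ℕ → B) (C : B) (G : Submodule K B) : Prop where
  base : ∀ L ∈ innerSub K n X Y C 1, L * X 0 ∈ G ∧ L * Y 0 ∈ G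
  node : ∀ p, p + 1 < n → ∃ κ F E, IsNode q n X Y C p κ F E ∧ (∀ a ∈ G, F a ∈ G) ∧
    ∀ a ∈ G, E a ∈ G

variable {G : Submodule K B}

namespace IsStable

/-- Treats words in which some pair contributes exactly one letter, by induction on its position. If
pair `p` is empty, a node derivation pushes the lone letter from `p` to `p + 1`. If pair `p` holds
one letter, the letter of pair `p + 1` is absorbed in `L`. If pair `p` is full, the word arises from
the one with pair `p + 1` full and a lone letter at `p`. -/
theorem unbalanced (h : IsStable q n X Y C G) (hq : q ≠ 0) (hz : PairRel q n X Y) {p : ℕ}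
    (hp : p < n) {L R : B} (hL : L ∈ innerSub K n X Y C (p + 1)) (hR : R ∈ pairWords X Y p) :
    L * (X p * R) ∈ G ∧ L * (Y p * R) ∈ G := by
  induction p generalizing L R with
  | zero =>
    rw [Set.mem_singleton_iff.1 hR, mul_one, mul_one]
    exact h.base L hL
  | succ p ih =>
    obtain ⟨κ, F, E, hN, hF, hE⟩ := h.node p hp
    have hLa : L * X (p + 1) ∈ innerSub K n X Y C (p + 1) :=
      mul_mem (innerSub_anti (by omega) hL) (X_mem_innerSub le_rfl hp)
    have hLb : L * Y (p + 1) ∈ innerSub K n X Y C (p + 1) :=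
      mul_mem (innerSub_anti (by omega) hL) (Y_mem_innerSub le_rfl hp)
    have hLab : L * X (p + 1) * Y (p + 1) ∈ innerSub K n X Y C (p + 1) :=
      mul_mem hLa (Y_mem_innerSub le_rfl hp)
    obtain ⟨r, hr, hR⟩ := hR
    rcases hR with rfl | rfl | rfl | rfl
    · have h1 := ih (by omega) (innerSub_anti (by omega) hL) hr
      constructor
      · have := G.smul_mem (-1 : K) (hE _ h1.1)
        rw [hN.E_mul hp hL hr, hN.EX] at this
        simpa using this
      · have := hF _ h1.2
        rwa [hN.F_mul hp hL hr, hN.FY] at this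
    · rw [← mul_assoc, ← mul_assoc L]
      exact ⟨(ih (by omega) hLa hr).1, (ih (by omega) hLb hr).1⟩
    · rw [← mul_assoc, ← mul_assoc L]
      exact ⟨(ih (by omega) hLa hr).2, (ih (by omega) hLb hr).2⟩
    · have h1 := ih (by omega) hLab hr
      constructor
      · have h2 := hE _ h1.1
        rw [show L * X (p + 1) * Y (p + 1) * (X p * r) =
          L * (X (p + 1) * (Y (p + 1) * X p) * r) by simp only [mul_assoc], hN.E_mul hp hL hr,
          hN.E_pair_mul_X hq hz hp, smul_mul_assoc, mul_smul_comm] at h2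
        have h3 := (G.smul_mem_iff (neg_ne_zero.2 hq)).1 h2
        simpa only [mul_assoc] using h3
      · have h2 := hF _ h1.2
        rw [show L * X (p + 1) * Y (p + 1) * (Y p * r) =
          L * (X (p + 1) * (Y (p + 1) * Y p) * r) by simp only [mul_assoc], hN.F_mul hp hL hr,
          hN.F_pair_mul_Y hq hz hp, smul_mul_assoc, mul_smul_comm] at h2
        have h3 := (G.smul_mem_iff (inv_ne_zero hq)).1 h2
        simpa only [mul_assoc] using h3

/-- The derivation maps `X (p + 1) * Y p` to a combination of the two complete pairs. The argument
is unbalanced, so modulo `G` a complete pair may be moved from `p + 1` to `p` with a factor `q`. -/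
theorem shift (h : IsStable q n X Y C G) (hq : q ≠ 0) (hz : PairRel q n X Y) {p : ℕ}
    (hp : p + 1 < n) {L R : B} (hL : L ∈ innerSub K n X Y C (p + 2)) (hR : R ∈ pairWords X Y p) :
    L * (X (p + 1) * (Y (p + 1) * R)) - q • (L * (X p * (Y p * R))) ∈ G := by
  obtain ⟨κ, F, E, hN, hF, hE⟩ := h.node p hp
  have h1 := hF _ (h.unbalanced hq hz (by omega)
    (mul_mem (innerSub_anti (by omega) hL) (X_mem_innerSub le_rfl hp)) hR).2
  rw [show L * X (p + 1) * (Y p * R) = L * (X (p + 1) * Y p * R) by simp only [mul_assoc],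
    hN.F_mul hp hL hR, hN.F_X_mul_Y, add_mul, mul_add, smul_mul_assoc, smul_mul_assoc,
    mul_smul_comm, mul_smul_comm] at h1
  have h2 := G.smul_mem q h1
  rw [smul_add, smul_smul, smul_smul, mul_inv_cancel₀ hq, one_smul, mul_neg_one, neg_smul,
    neg_add_eq_sub] at h2
  simpa only [mul_assoc] using h2

/-- By repeated `shift`, a complete pair slides down to the first free place. -/
theorem shift_outerProd (h : IsStable q n X Y C G) (hq : q ≠ 0) (hz : PairRel q n X Y) {k j : ℕ}
    (hk : k ≤ j) (hj : j < n) {L : B} (hL : L ∈ innerSub K n X Y C (j + 1)) :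
    L * (X j * (Y j * outerProd X Y k)) - q ^ (j - k) • (L * outerProd X Y (k + 1)) ∈ G := by
  induction j, hk using Nat.le_induction with
  | base => simp [outerProd]
  | succ j hkj ih =>
    have h1 := h.shift hq hz hj hL (pairWords_mono hkj (outerProd_mem_pairWords (X := X) (Y := Y) k))
    have h2 := G.smul_mem q (ih (by omega) (innerSub_anti (by omega) hL))
    have h3 := G.add_mem h1 h2
    rw [show j + 1 - k = (j - k) + 1 by omega, pow_succ']
    convert h3 using 1
    module

/-- Modulo `G`, a word built from complete pairs depends, up to a scalar, only on how many pairs it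
has. The cases of no pair and of all pairs are kept exact, because they lead to the two exceptional
words. -/
theorem reduce (h : IsStable q n X Y C G) (hq : q ≠ 0) (hz : PairRel q n X Y) {p : ℕ}
    (hp : p ≤ n) {L r : B} (hL : L ∈ innerSub K n X Y C p) (hr : r ∈ pairWords X Y p) :
    L * r ∈ G ∨ r = 1 ∨ r = outerProd X Y p ∨
      ∃ k c, 1 ≤ k ∧ k < p ∧ L * r - (c : K) • (L * outerProd X Y k) ∈ G := by
  induction p generalizing L r with
  | zero => exact Or.inr (Or.inl hr)
  | succ p ih =>
    obtain ⟨r', hr', h1⟩ := hr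
    rcases h1 with rfl | rfl | rfl | rfl
    · rcases ih (by omega) (innerSub_anti (by omega) hL) hr' with h2 | h2 | h2 | ⟨k, c, h2, h3, h4⟩
      · exact Or.inl h2
      · exact Or.inr (Or.inl h2)
      · rcases Nat.eq_zero_or_pos p with rfl | h0
        · exact Or.inr (Or.inl h2)
        · refine Or.inr (Or.inr (Or.inr ⟨p, 1, h0, by omega, ?_⟩))
          rw [h2, one_smul, sub_self]
          exact G.zero_mem
      · exact Or.inr (Or.inr (Or.inr ⟨k, c, h2, by omega, h4⟩))
    · exact Or.inl (h.unbalanced hq hz (by omega) hL hr').1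
    · exact Or.inl (h.unbalanced hq hz (by omega) hL hr').2
    · have hL' : L * X p * Y p ∈ innerSub K n X Y C p :=
        mul_mem (mul_mem (innerSub_anti (by omega) hL) (X_mem_innerSub le_rfl (by omega)))
          (Y_mem_innerSub le_rfl (by omega))
      have e : ∀ a, L * X p * Y p * a = L * (X p * (Y p * a)) := fun a => by simp only [mul_assoc]
      rcases ih (by omega) hL' hr' with h2 | h2 | h2 | ⟨k, c, h2, h3, h4⟩
      · exact Or.inl (by rwa [e] at h2)
      · rcases Nat.eq_zero_or_pos p with rfl | h0
        · exact Or.inr (Or.inr (Or.inl (by rw [h2]; rfl)))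
        · refine Or.inr (Or.inr (Or.inr ⟨1, q ^ (p - 0), le_rfl, by omega, ?_⟩))
          rw [h2]
          exact h.shift_outerProd hq hz (Nat.zero_le p) (by omega) hL
      · exact Or.inr (Or.inr (Or.inl (by rw [h2]; rfl)))
      · refine Or.inr (Or.inr (Or.inr ⟨k + 1, c * q ^ (p - k), by omega, by omega, ?_⟩))
        have h5 := G.add_mem h4 (G.smul_mem c (h.shift_outerProd hq hz h3.le (by omega) hL))
        rw [e, e] at h5
        convert h5 using 1
        module

/-- Moving `omega` past `X k` and `Y k` costs `q ^ 2` and `q ^ (-2)`. After that, the induction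
hypothesis and the squares of the generators leave nothing. -/
theorem omega_mul_outerProd (hq : q ≠ 0) (hz : PairRel q n X Y) {k : ℕ} (hk : k ≤ n) :
    omega q X Y k * outerProd X Y k = 0 := by
  induction k with
  | zero => simp [omega]
  | succ k ih =>
    have h1 : omega q X Y (k + 1) * outerProd X Y (k + 1) =
        X k * (Y k * (omega q X Y (k + 1) * outerProd X Y k)) := by
      rw [outerProd, ← mul_assoc, hz.omega_mul_X hq (by omega) hk, smul_mul_assoc, mul_assoc,
        ← mul_assoc (omega q X Y (k + 1)), ← mul_smul_comm, ← smul_mul_assoc,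
        hz.omega_mul_Y hq (by omega) hk, mul_assoc]
    have h2 : X k * (Y k * (X k * (Y k * outerProd X Y k))) = 0 := by
      rw [← mul_assoc (Y k) (X k), hz.cross k (by omega), sub_mul, ← mul_assoc (omega q X Y k),
        ← hz.Y_mul_omega hq le_rfl (by omega), mul_assoc (Y k) (omega q X Y k), ih (by omega),
        mul_assoc (X k), ← mul_assoc (Y k) (Y k), hz.Y_sq k (by omega)]
      simp
    rw [h1, omega, add_mul, smul_mul_assoc, smul_mul_assoc, ih (by omega), smul_zero, zero_add,
      mul_smul_comm, mul_smul_comm, mul_assoc, h2, smul_zero]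

/-- The pairs before `k` contribute zero, and each later summand of `omega` is a multiple of the
next product by `shift_outerProd`. The recursion for `omega` yields the difference of powers. -/
theorem omega_outerProd (h : IsStable q n X Y C G) (hq : q ≠ 0) (hz : PairRel q n X Y) {k p : ℕ}
    (hk : k ≤ p) (hp : p ≤ n) : omega q X Y p * outerProd X Y k -
      (q ^ (p - k) - q⁻¹ ^ (p - k)) • outerProd X Y (k + 1) ∈ G := by
  induction p, hk using Nat.le_induction with
  | base => simp [omega_mul_outerProd hq hz hp]
  | succ p hkp ih =>
    have h1 := G.smul_mem q⁻¹ (ih (by omega))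
    have h2 := G.smul_mem (q - q⁻¹) (h.shift_outerProd hq hz hkp (by omega) (one_mem _))
    have h3 := G.add_mem h1 h2
    rw [one_mul, one_mul] at h3
    rw [show p + 1 - k = (p - k) + 1 by omega, omega, add_mul, smul_mul_assoc, smul_mul_assoc,
      mul_assoc]
    convert h3 using 1
    rw [pow_succ, pow_succ]
    module

theorem odd_center (h : IsStable q n X Y C G) (hq : q ≠ 0) (hz : PairRel q n X Y) {p : ℕ}
    (hp : p + 1 = n) {κ : B →ₐ[K] B} {F : B →ₗ[K] B} (hF : IsLeibniz κ F)
    (hn : ∀ r < p, IsNeutral κ F (X r) ∧ IsNeutral κ F (Y r)) (hY : F (Y p) = C)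
    (hG : ∀ a ∈ G, F a ∈ G) {k : ℕ} (hk : k ≤ p) : C * outerProd X Y k ∈ G := by
  have hR := pairWords_mono hk (outerProd_mem_pairWords (X := X) (Y := Y) k)
  have h1 := hG _ (h.unbalanced hq hz (by omega) (one_mem _) hR).2
  rwa [one_mul, hF.mul_neutral (hF.isNeutral_of_mem_pairWords (fun r hr => (hn r hr).1)
    (fun r hr => (hn r hr).2) hR), hY] at h1

/-- The derivation of the last simple root sends the unbalanced `C * Y p * outerProd` to a central
square minus a multiple of a complete pair. Both reduce to the same product modulo `G`, with a total
coefficient that is nonzero because `1 + q ^ (2 * (p - k) + 1)` is. -/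
theorem odd_outerProd (hg : IsGeneric s) (h : IsStable (s ^ 2) n X Y C G)
    (hz : PairRel (s ^ 2) n X Y) (hC : (1 + s ^ 2) • (C * C) = s • omega (s ^ 2) X Y n) {p : ℕ}
    (hp : p + 1 = n) {κ : B →ₐ[K] B} {F : B →ₗ[K] B} (hF : IsLeibniz κ F)
    (hn : ∀ r < p, IsNeutral κ F (X r) ∧ IsNeutral κ F (Y r)) (hY : F (Y p) = C)
    (hFC : F C = (-s) • X p) (hκ : κ C = C)
    (hG : ∀ a ∈ G, F a ∈ G) {k : ℕ} (hk : k ≤ p) : outerProd X Y (k + 1) ∈ G := by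
  have hq := hg.sq_ne_zero
  have hR := pairWords_mono hk (outerProd_mem_pairWords (X := X) (Y := Y) k)
  have h1 := hG _ (h.unbalanced hq hz (p := p) (by omega) C_mem_innerSub hR).2
  rw [hF, hF.mul_neutral (hF.isNeutral_of_mem_pairWords (fun r hr => (hn r hr).1)
    (fun r hr => (hn r hr).2) hR), hY, hFC, hκ, smul_mul_assoc, ← mul_assoc C] at h1
  have h2 := G.smul_mem (1 + s ^ 2) h1
  rw [smul_add, ← smul_mul_assoc (1 + s ^ 2) (C * C), hC, smul_mul_assoc] at h2
  have h3 := h.shift_outerProd hq hz hk (by omega) (one_mem _)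
  rw [one_mul, one_mul] at h3
  have h4 := h.omega_outerProd hq hz (show k ≤ n by omega) le_rfl
  have h5 := G.add_mem (G.sub_mem h2 (G.smul_mem ((1 + s ^ 2) * -s) h3)) (G.smul_mem (-s) h4)
  have h6 : (-(s * ((s ^ 2)⁻¹ ^ (p - k + 1) * (1 + (s ^ 2) ^ (2 * (p - k) + 1))))) •
      outerProd X Y (k + 1) ∈ G := by
    convert h5 using 1
    rw [show n - k = p - k + 1 by omega]
    have e : (s ^ 2)⁻¹ ^ (p - k + 1) * (s ^ 2) ^ (2 * (p - k) + 1) = (s ^ 2) ^ (p - k) := by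
      rw [inv_pow]
      field_simp
      ring
    rw [mul_add, mul_one, e, pow_succ (s ^ 2)]
    module
  refine (G.smul_mem_iff ?_).1 h6
  exact neg_ne_zero.2 (mul_ne_zero hg.ne_zero (mul_ne_zero (pow_ne_zero _ (inv_ne_zero hq))
    (hg.one_add_pow_ne_zero (by omega))))

/-- There is no central letter; instead the innermost pair is exchanged. Then `X p * Y p` and `Y p *
X p` reduce to the same multiple `q ^ (p - k)` of the next product, while their sum is `omega` and
reduces to `q ^ (p - k) - q ^ (k - p)`. The comparison leaves the nonzero coefficient `q ^ (p - k) +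
q ^ (k - p)`. -/
theorem even_outerProd (hg : IsGeneric s) (h : IsStable (s ^ 2) n X Y C G)
    (hz : PairRel (s ^ 2) n X Y) {p : ℕ} (hp : p + 1 = n) {σ : B →ₐ[K] B}
    (hX : σ (X p) = Y p) (hY : σ (Y p) = X p) (hn : ∀ r < p, σ (X r) = X r ∧ σ (Y r) = Y r)
    (hG : ∀ a ∈ G, σ a ∈ G) {k : ℕ} (hk : k < p) : outerProd X Y (k + 1) ∈ G := by
  have hq := hg.sq_ne_zero
  have hσ : ∀ j ≤ p, σ (outerProd X Y j) = outerProd X Y j := by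
    intro j hj
    induction j with
    | zero => simp [outerProd]
    | succ j ih => rw [outerProd, map_mul, map_mul, (hn j (by omega)).1, (hn j (by omega)).2,
        ih (by omega)]
  have h1 := h.shift_outerProd hq hz hk.le (by omega) (one_mem _)
  rw [one_mul, one_mul] at h1
  have h2 := hG _ h1
  rw [map_sub, map_smul, map_mul, map_mul, hX, hY, hσ k hk.le, hσ (k + 1) (by omega),
    ← mul_assoc, hz.cross p (by omega), sub_mul, mul_assoc] at h2
  have h3 := h.omega_outerProd hq hz hk.le (by omega)
  have h4 := G.sub_mem h3 (G.add_mem h1 h2)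
  have h5 : ((s ^ 2)⁻¹ ^ (p - k) * (1 + (s ^ 2) ^ (2 * (p - k)))) • outerProd X Y (k + 1) ∈ G := by
    convert h4 using 1
    have e : (s ^ 2)⁻¹ ^ (p - k) * (s ^ 2) ^ (2 * (p - k)) = (s ^ 2) ^ (p - k) := by
      rw [inv_pow]
      field_simp
      ring
    rw [mul_add, mul_one, e]
    module
  refine (G.smul_mem_iff ?_).1 h5
  exact mul_ne_zero (pow_ne_zero _ (inv_ne_zero hq)) (hg.one_add_pow_ne_zero (by omega))

/-- If the products of the first pairs are in `G`, then so are all words. -/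
theorem mem_of_outerProd (h : IsStable q n X Y C G) (hq : q ≠ 0) (hz : PairRel q n X Y) {L r : B}
    (hL : L ∈ innerSub K n X Y C n) (hO : ∀ k, 1 ≤ k → k < n → L * outerProd X Y k ∈ G)
    (hr : r ∈ pairWords X Y n) : L * r ∈ G ∨ r = 1 ∨ r = outerProd X Y n := by
  rcases h.reduce hq hz le_rfl hL hr with h1 | h1 | h1 | ⟨k, c, h1, h2, h3⟩
  · exact Or.inl h1
  · exact Or.inr (Or.inl h1)
  · exact Or.inr (Or.inr h1)
  · left
    have := G.add_mem h3 (G.smul_mem c (hO k h1 h2))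
    rwa [sub_add_cancel] at this

end IsStable

end Spanning

end QEpsilon

namespace QEpsilon

open scoped TensorProduct

universe v

/-! ### Bookkeeping for families indexed by pairs. -/

section SumOfPairs

theorem ofPairs_innerIdx {M : Type*} {N : ℕ} (f g : ℕ → M) (m : M) (c : Fin N) :
    ofPairs (N + 2) f g m (innerIdx c) =
      ofPairs N (fun r => f (r + 1)) (fun r => g (r + 1)) m c := by
  have hc := c.2
  rcases lt_trichotomy (2 * (c : ℕ) + 1) N with h | h | h
  · rw [ofPairs_left _ _ _ (by rw [val_innerIdx]; omega), ofPairs_left _ _ _ h, val_innerIdx]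
  · rw [ofPairs_mid _ _ _ (by rw [val_innerIdx]; omega), ofPairs_mid _ _ _ h]
  · rw [ofPairs_right _ _ _ (by rw [val_innerIdx]; omega), ofPairs_right _ _ _ h, val_innerIdx]
    congr 1
    omega

theorem sum_ofPairs {M : Type*} [AddCommMonoid M] : ∀ (N : ℕ) (f g : ℕ → M) (m : M),
    ∑ c : Fin N, ofPairs N f g m c =
      ∑ r ∈ Finset.range (N / 2), (f r + g r) + if N % 2 = 1 then m else 0
  | 0, f, g, m => by simp
  | 1, f, g, m => by simp [ofPairs]
  | N + 2, f, g, m => by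
    rw [sum_univ_inner, Finset.sum_congr rfl fun c _ => ofPairs_innerIdx f g m c, sum_ofPairs N,
      show (N + 2) / 2 = N / 2 + 1 by omega, Finset.sum_range_succ', Nat.add_mod_right,
      ofPairs_left _ _ _ (by simp), ofPairs_right _ _ _ (by simp; omega)]
    simp only [Fin.val_zero, Fin.val_last]
    rw [show N + 2 - 1 - (N + 1) = 0 by omega]
    abel

theorem ofPairs_congr {M : Type*} {N : ℕ} {f g f' g' : ℕ → M} {m m' : M}
    (hf : ∀ r < N / 2, f r = f' r) (hg : ∀ r < N / 2, g r = g' r) (hm : m = m') (c : Fin N) :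
    ofPairs N f g m c = ofPairs N f' g' m' c := by
  have hc := c.2
  simp only [ofPairs]
  split_ifs
  · exact hf _ (by omega)
  · exact hm
  · exact hg _ (by omega)

theorem ofPairs_rev {M : Type*} {N : ℕ} (f g : ℕ → M) (m : M) (c : Fin N) :
    ofPairs N f g m c.rev = ofPairs N g f m c := by
  have hc := c.2
  simp only [ofPairs, Fin.val_rev]
  split_ifs <;> first | rfl | omega | (congr 1; omega)

theorem map_ofPairs {M M' : Type*} {N : ℕ} (φ : M → M') (f g : ℕ → M) (m : M) (c : Fin N) :
    φ (ofPairs N f g m c) = ofPairs N (fun r => φ (f r)) (fun r => φ (g r)) (φ m) c := by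
  simp only [ofPairs]
  split_ifs <;> rfl

theorem map₂_ofPairs {M M' M'' : Type*} {N : ℕ} (φ : M → M' → M'') (f g : ℕ → M) (m : M)
    (f' g' : ℕ → M') (m' : M') (c : Fin N) :
    φ (ofPairs N f g m c) (ofPairs N f' g' m' c) =
      ofPairs N (fun r => φ (f r) (f' r)) (fun r => φ (g r) (g' r)) (φ m m') c := by
  simp only [ofPairs]
  split_ifs <;> rfl

theorem ofPairs_prop {M : Type*} {N : ℕ} {f g : ℕ → M} {m : M} {P : M → Prop}
    (hf : ∀ r < N / 2, P (f r)) (hg : ∀ r < N / 2, P (g r)) (hm : P m) (c : Fin N) :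
    P (ofPairs N f g m c) := by
  have hc := c.2
  simp only [ofPairs]
  split_ifs
  · exact hf _ (by omega)
  · exact hm
  · exact hg _ (by omega)

end SumOfPairs

/-! ### Mutually transposed skew derivations of the exterior algebra for `so`. -/

section Operators

variable {K : Type v} [Field K] {s : K} {N : ℕ}

theorem X_mem_deg {r : ℕ} (hr : r < N / 2) : gX s N r ∈ deg (minusSO s N) 1 := by
  rw [gX, leftGen_of_lt _ (by omega)]
  exact xi_mem_deg _

theorem Y_mem_deg {r : ℕ} (hr : r < N / 2) : gY s N r ∈ deg (minusSO s N) 1 := by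
  rw [gY, rightGen_of_lt _ (by omega)]
  exact xi_mem_deg _

theorem IsSkewDer.isLeibniz {κ : SOAlg s N →ₐ[K] SOAlg s N} {w : Fin N → K} {f : Fin N → SOAlg s N}
    {D : SOAlg s N →ₗ[K] SOAlg s N} (h : IsSkewDer κ w f D) : IsLeibniz κ D := h.leibniz

section Values

variable {κ : SOAlg s N →ₐ[K] SOAlg s N} {w : Fin N → K} {fX fY : ℕ → SOAlg s N} {fC : SOAlg s N}
  {D : SOAlg s N →ₗ[K] SOAlg s N}

theorem IsSkewDer.apply_X (h : IsSkewDer κ w (ofPairs N fX fY fC) D) {r : ℕ} (hr : r < N / 2) :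
    D (gX s N r) = fX r := by
  rw [gX, leftGen_of_lt _ (by omega), h.apply_xi, ofPairs_left _ _ _ (by simp only; omega)]

theorem IsSkewDer.apply_Y (h : IsSkewDer κ w (ofPairs N fX fY fC) D) {r : ℕ} (hr : r < N / 2) :
    D (gY s N r) = fY r := by
  rw [gY, rightGen_of_lt _ (by omega), h.apply_xi,
    ofPairs_right _ _ _ (by simp only [Fin.val_rev]; omega)]
  congr 1
  simp only [Fin.val_rev]
  omega

theorem IsSkewDer.apply_C [CharZero K] (hg : IsGeneric s) (h : IsSkewDer κ w (ofPairs N fX fY fC) D)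
    (hC : N % 2 = 0 → fC = 0) : D (gC s N) = fC := by
  rcases Nat.mod_two_eq_zero_or_one N with hN | hN
  · rw [(soRel_gen hg).C_even hN, map_zero, hC hN]
  · rw [gC, midGen_of_odd _ hN, h.apply_xi, ofPairs_mid _ _ _ (by simp only; omega)]

end Values

variable [CharZero K]

theorem torus_X (hg : IsGeneric s) {t : ℕ → K} (ht : ∀ r, t r ≠ 0) {r : ℕ} (hr : r < N / 2) :
    torus hg ht (gX s N r) = t r • gX s N r := soLift_X hg _ hr

theorem torus_Y (hg : IsGeneric s) {t : ℕ → K} (ht : ∀ r, t r ≠ 0) {r : ℕ} (hr : r < N / 2) :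
    torus hg ht (gY s N r) = (t r)⁻¹ • gY s N r := soLift_Y hg _ hr

theorem torus_C (hg : IsGeneric s) {t : ℕ → K} (ht : ∀ r, t r ≠ 0) :
    torus hg ht (gC s N) = gC s N := soLift_C hg _

theorem reversal_X (hg : IsGeneric s) {r : ℕ} (hr : r < N / 2) :
    reversal hg (gX s N r) = gY s N r := by
  rw [gX, gY, leftGen_of_lt _ (by omega), rightGen_of_lt _ (by omega), reversal_xi]

theorem reversal_Y (hg : IsGeneric s) {r : ℕ} (hr : r < N / 2) :
    reversal hg (gY s N r) = gX s N r := by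
  rw [← reversal_X hg hr, reversal_reversal]

theorem reversal_C (hg : IsGeneric s) : reversal hg (gC s N) = gC s N := by
  rcases Nat.mod_two_eq_zero_or_one N with hN | hN
  · rw [(soRel_gen hg).C_even hN, map_zero]
  · rw [gC, midGen_of_odd _ hN, reversal_xi]
    congr 1
    ext
    simp only [Fin.val_rev]
    omega

theorem C_mem_deg (hg : IsGeneric s) : gC s N ∈ deg (minusSO s N) 1 := by
  rcases Nat.mod_two_eq_zero_or_one N with hN | hN
  · rw [(soRel_gen hg).C_even hN]
    exact zero_mem _
  · rw [gC, midGen_of_odd _ hN]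
    exact xi_mem_deg _

theorem sum_ofPairs_tmul (hg : IsGeneric s) (fX fY : ℕ → SOAlg s N) (fC : SOAlg s N) :
    ∑ c, ofPairs N fX fY fC c ⊗ₜ[K] xi (minusSO s N) c =
      ∑ r ∈ Finset.range (N / 2), (fX r ⊗ₜ[K] gX s N r + fY r ⊗ₜ[K] gY s N r) +
        fC ⊗ₜ[K] gC s N := by
  simp only [eq_ofPairs_gen]
  rw [Finset.sum_congr rfl fun c _ => map₂_ofPairs (fun a b => a ⊗ₜ[K] b) fX fY fC _ _ _ c,
    sum_ofPairs]
  rcases Nat.mod_two_eq_zero_or_one N with hN | hN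
  · rw [(soRel_gen hg).C_even hN, TensorProduct.tmul_zero, ite_self]
  · rw [if_pos hN]

/-- The pair of mutually transposed skew derivations with given values on the generators. -/
theorem TwistedDerivation.exists_skewDer (hg : IsGeneric s) {t : ℕ → K} {fX fY eX eY : ℕ → SOAlg s N}
    {fC eC : SOAlg s N} {dΩ : ℕ → SOAlg s N}
    (h : TwistedDerivation s N (gX s N) (gY s N) (gC s N) t fX fY fC dΩ) {μ ρ : K} (hρ : ρ ≠ 1)
    (hX : ∀ r < N / 2, torus hg h.t_ne (fX r) = (ρ * t r) • fX r)
    (hY : ∀ r < N / 2, torus hg h.t_ne (fY r) = (ρ * (t r)⁻¹) • fY r)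
    (hC : torus hg h.t_ne fC = (ρ * 1) • fC)
    (dX : ∀ r < N / 2, fX r ∈ deg (minusSO s N) 1) (dY : ∀ r < N / 2, fY r ∈ deg (minusSO s N) 1)
    (dC : fC ∈ deg (minusSO s N) 1)
    (heX : ∀ r < N / 2, μ • torus hg h.t_ne (reversal hg (fY r)) = eX r)
    (heY : ∀ r < N / 2, μ • torus hg h.t_ne (reversal hg (fX r)) = eY r)
    (heC : μ • torus hg h.t_ne (reversal hg fC) = eC)
    (hT : ∑ r ∈ Finset.range (N / 2), (fX r ⊗ₜ[K] gX s N r + fY r ⊗ₜ[K] gY s N r) +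
        fC ⊗ₜ[K] gC s N = TensorProduct.comm K _ _
      (∑ r ∈ Finset.range (N / 2), (eX r ⊗ₜ[K] gX s N r + eY r ⊗ₜ[K] gY s N r) +
        eC ⊗ₜ[K] gC s N)) :
    ∃ F E, IsSkewDer (torus hg h.t_ne) (torusWeight t) (ofPairs N fX fY fC) F ∧
      IsSkewDer (torus hg h.t_ne) (torusWeight t) (ofPairs N eX eY eC) E ∧
      ∀ τ : SOAlg s N →ₗ[K] K, IsVolume (minusSO s N) τ → ∀ l m a,
        hodge τ m (hodge τ l (F a)) = F (hodge τ m (hodge τ l a)) ∧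
        hodge τ m (hodge τ l (E a)) = E (hodge τ m (hodge τ l a)) := by
  obtain ⟨F, hF1, hF⟩ := h.exists_linearMap hg (soRel_gen hg)
  have hid : ∀ b, soLift hg (soRel_gen hg) b = (b : SOAlg s N) := by
    have : soLift hg (soRel_gen (N := N) hg) = AlgHom.id K _ := ext_of_xi fun c => by
      rw [soLift_xi, ← eq_ofPairs_gen, AlgHom.id_apply]
    intro b
    rw [this, AlgHom.id_apply]
  have hF' : IsSkewDer (torus hg h.t_ne) (torusWeight t) (ofPairs N fX fY fC) F :=
    ⟨torus_xi hg h.t_ne, hF1, fun c b => by rw [hF, hid, ← eq_ofPairs_gen]⟩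
  have hE' := hF'.reversal hg h.t_ne μ
  have he : (fun c : Fin N => μ • torus hg h.t_ne (reversal hg (ofPairs N fX fY fC c.rev))) =
      ofPairs N eX eY eC := by
    funext c
    rw [ofPairs_rev, map_ofPairs fun a => μ • torus hg h.t_ne (reversal hg a)]
    exact ofPairs_congr heX heY heC c
  rw [he] at hE'
  refine ⟨F, _, hF', hE', fun τ hτ l m a => ?_⟩
  have hκ := hτ.torus hg h.t_ne
  have hτF : ∀ a, τ (F a) = 0 := hF'.volume_apply hρ (fun c => by
    rw [map_ofPairs (torus hg h.t_ne), torusWeight, map₂_ofPairs fun a b => (ρ * a) • b]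
    exact ofPairs_congr hX hY hC c) (ofPairs_prop dX dY dC) hτ hκ
  have hτE : ∀ a, τ ((μ • (torus hg h.t_ne).toLinearMap ∘ₗ reversal hg ∘ₗ F ∘ₗ reversal hg) a) = 0 := by
    intro a
    rw [LinearMap.smul_apply, map_smul, LinearMap.comp_apply, LinearMap.comp_apply,
      LinearMap.comp_apply, AlgHom.toLinearMap_apply, hκ, hτ.reversal hg, hτF, smul_zero]
  have hT1 : ∑ c, ofPairs N fX fY fC c ⊗ₜ[K] xi (minusSO s N) c =
      ∑ c, xi (minusSO s N) c ⊗ₜ[K] ofPairs N eX eY eC c := by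
    rw [sum_ofPairs_tmul hg, hT, ← sum_ofPairs_tmul hg, map_sum]
    simp only [TensorProduct.comm_tmul]
  have hT2 : ∑ c, ofPairs N eX eY eC c ⊗ₜ[K] xi (minusSO s N) c =
      ∑ c, xi (minusSO s N) c ⊗ₜ[K] ofPairs N fX fY fC c := by
    have := congrArg (TensorProduct.comm K _ _) hT1
    simp only [map_sum, TensorProduct.comm_tmul] at this
    exact this.symm
  exact ⟨hF'.hodge_hodge_comm hE' hT1 hT2 hκ hτF hτE l m a,
    hE'.hodge_hodge_comm hF' hT2 hT1 hκ hτE hτF l m a⟩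

end Operators

end QEpsilon

namespace QEpsilon

open scoped TensorProduct

universe v

/-! ### The exchange of the innermost pair and the concrete symmetries. -/

section Permutation

variable {K : Type*} [Field K] {N : ℕ} {Pm : Matrix (Fin N × Fin N) (Fin N × Fin N) K}
  {σ : ExtAlg Pm →ₐ[K] ExtAlg Pm} {π : Equiv.Perm (Fin N)}

theorem permute_word (hσ : ∀ c, σ (xi Pm c) = xi Pm (π c)) (L : List (Fin N)) :
    σ (word Pm L) = word Pm (L.map π) := by
  induction L with
  | nil => simp
  | cons c L ih => rw [word_cons, map_mul, hσ, ih, List.map_cons, word_cons]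

/-- The square of the Hodge map commutes with the involutions permuting the generators. -/
theorem hodge_hodge_permute (hσ : ∀ c, σ (xi Pm c) = xi Pm (π c)) (hπ : ∀ c, π (π c) = c)
    {τ : ExtAlg Pm →ₗ[K] K} (hτ : IsVolume Pm τ) (l m : ℕ) (a : ExtAlg Pm) :
    hodge τ m (hodge τ l (σ a)) = σ (hodge τ m (hodge τ l a)) := by
  have h1 := hτ.eq_smul_of_off (φ := τ ∘ₗ σ.toLinearMap) fun L hL => by
    rw [LinearMap.comp_apply, AlgHom.toLinearMap_apply, permute_word hσ]
    exact hτ.off _ (by simpa using hL)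
  set r : K := (τ ∘ₗ σ.toLinearMap) (xiProd Pm fun k => k)
  have h2 : ∀ b, τ (σ b) = r * τ b := fun b => LinearMap.congr_fun h1 b
  have h3 : ∀ b, σ (σ b) = b := by
    have : σ.comp σ = AlgHom.id K _ := ext_of_xi fun c => by
      rw [AlgHom.comp_apply, hσ, hσ, hπ, AlgHom.id_apply]
    exact fun b => DFunLike.congr_fun this b
  -- The involution changes `τ`, and hence each Hodge map, by the scalar `r`; it occurs twice in the
  -- composite and disappears.
  have h4 : r * r = 1 := by
    have := h2 (σ (xiProd Pm fun k => k))
    rw [h3, h2, hτ.top] at this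
    linear_combination -this
  have h5 : ∀ l b, hodge τ l (σ b) = r • σ (hodge τ l b) := by
    intro l b
    rw [hodge_apply, hodge_apply, map_sum, Finset.smul_sum]
    refine (Fintype.sum_equiv (Equiv.arrowCongr (Equiv.refl (Fin l)) π) _ _ fun k => ?_).symm
    have h6 : xiProd Pm (Equiv.arrowCongr (Equiv.refl (Fin l)) π k) = σ (xiProd Pm k) := by
      rw [xiProd_eq_word, xiProd_eq_word, permute_word hσ, List.map_ofFn]
      rfl
    rw [h6, ← map_mul, h2, map_smul, smul_smul]
  rw [h5, map_smul, h5, smul_smul, h4, one_smul]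

end Permutation

section Swap

variable {K : Type*} [Field K] {B : Type*} [Ring B] [Algebra K B] {q : K} {n : ℕ} {X Y : ℕ → B}

/-- No `omega` in these relations involves the innermost pair, so its two members enter
symmetrically. -/
theorem PairRel.swap {p : ℕ} (h : PairRel q (p + 1) X Y) :
    PairRel q (p + 1) (Function.update X p (Y p)) (Function.update Y p (X p)) := by
  have hΩ : ∀ r ≤ p, omega q (Function.update X p (Y p)) (Function.update Y p (X p)) r =
      omega q X Y r := fun r hr => omega_congr
    (fun t ht => Function.update_of_ne (by omega) _ _) (fun t ht => Function.update_of_ne (by omega) _ _)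
  have hX : ∀ r < p, Function.update X p (Y p) r = X r :=
    fun r hr => Function.update_of_ne (by omega) _ _
  have hY : ∀ r < p, Function.update Y p (X p) r = Y r :=
    fun r hr => Function.update_of_ne (by omega) _ _
  refine ⟨?_, ?_, ?_, ?_, ?_, ?_, ?_⟩
  · intro r hr
    rcases Nat.lt_succ_iff_lt_or_eq.1 hr with h1 | rfl
    · rw [hX r h1, h.X_sq r hr]
    · rw [Function.update_self, h.Y_sq r hr]
  · intro r hr
    rcases Nat.lt_succ_iff_lt_or_eq.1 hr with h1 | rfl
    · rw [hY r h1, h.Y_sq r hr]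
    · rw [Function.update_self, h.X_sq r hr]
  · intro r t h1 h2
    rw [hX r (by omega)]
    rcases Nat.lt_succ_iff_lt_or_eq.1 h2 with h3 | rfl
    · rw [hX t h3, h.XX r t h1 h2]
    · rw [Function.update_self, h.YX r t h1 h2]
  · intro r t h1 h2
    rw [hX r (by omega)]
    rcases Nat.lt_succ_iff_lt_or_eq.1 h2 with h3 | rfl
    · rw [hY t h3, h.YX r t h1 h2]
    · rw [Function.update_self, h.XX r t h1 h2]
  · intro r t h1 h2
    rw [hY r (by omega)]
    rcases Nat.lt_succ_iff_lt_or_eq.1 h2 with h3 | rfl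
    · rw [hX t h3, h.XY r t h1 h2]
    · rw [Function.update_self, h.YY r t h1 h2]
  · intro r t h1 h2
    rw [hY r (by omega)]
    rcases Nat.lt_succ_iff_lt_or_eq.1 h2 with h3 | rfl
    · rw [hY t h3, h.YY r t h1 h2]
    · rw [Function.update_self, h.XY r t h1 h2]
  · intro r hr
    rw [hΩ r (by omega)]
    rcases Nat.lt_succ_iff_lt_or_eq.1 hr with h1 | rfl
    · rw [hX r h1, hY r h1, h.cross r hr]
    · rw [Function.update_self, Function.update_self, h.cross r hr, sub_sub_cancel]

end Swap

section Operators

variable {K : Type v} [Field K] [CharZero K] {s : K} {N : ℕ}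

/-- For even `N` the relations consist of those between pairs alone, and the exchange of the
innermost pair extends to an automorphism permuting the generators. -/
theorem exists_swap (hg : IsGeneric s) (hN : N % 2 = 0) {p : ℕ} (hp : p + 1 = N / 2) :
    ∃ σ : SOAlg s N →ₐ[K] SOAlg s N, σ (gX s N p) = gY s N p ∧ σ (gY s N p) = gX s N p ∧
      (∀ r < p, σ (gX s N r) = gX s N r ∧ σ (gY s N r) = gY s N r) ∧
      ∀ τ : SOAlg s N →ₗ[K] K, IsVolume (minusSO s N) τ → ∀ l m a,
        hodge τ m (hodge τ l (σ a)) = σ (hodge τ m (hodge τ l a)) := by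
  have hz := soRel_gen (N := N) hg
  have h1 : SORel s N (Function.update (gX s N) p (gY s N p))
      (Function.update (gY s N) p (gX s N p)) (gC s N) := by
    have hC := hz.C_even hN
    refine ⟨?_, ?_, ?_, by omega, fun _ => hC⟩
    · have := hz.pairs
      rw [← hp] at this ⊢
      exact this.swap
    · intro r _
      rw [hC, zero_mul, mul_zero, smul_zero]
    · intro r _
      rw [hC, zero_mul, mul_zero, smul_zero]
  have hX : gX s N p = xi _ ⟨p, by omega⟩ := leftGen_of_lt _ _
  have hY : gY s N p = xi _ (Fin.rev ⟨p, by omega⟩) := rightGen_of_lt _ _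
  refine ⟨soLift hg h1, ?_, ?_, fun r hr => ⟨?_, ?_⟩, fun τ hτ l m a => ?_⟩
  · rw [soLift_X hg h1 (by omega), Function.update_self]
  · rw [soLift_Y hg h1 (by omega), Function.update_self]
  · rw [soLift_X hg h1 (by omega), Function.update_of_ne (by omega)]
  · rw [soLift_Y hg h1 (by omega), Function.update_of_ne (by omega)]
  · refine hodge_hodge_permute (π := Equiv.swap ⟨p, by omega⟩ (Fin.rev ⟨p, by omega⟩)) (fun c => ?_)
      (Equiv.swap_apply_self _ _) hτ l m a
    have hc := c.2
    rcases eq_or_ne c ⟨p, by omega⟩ with h2 | h2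
    · rw [h2, ← hX, soLift_X hg h1 (by omega), Function.update_self, Equiv.swap_apply_left, hY]
    rcases eq_or_ne c (Fin.rev ⟨p, by omega⟩) with h3 | h3
    · rw [h3, ← hY, soLift_Y hg h1 (by omega), Function.update_self, Equiv.swap_apply_right, hX]
    rw [Equiv.swap_apply_of_ne_of_ne h2 h3, soLift_xi, eq_ofPairs_gen]
    rw [Ne, Fin.ext_iff] at h2 h3
    simp only [Fin.val_rev] at h2 h3
    simp only [ofPairs]
    split_ifs
    · rw [Function.update_of_ne h2]
    · rfl
    · rw [Function.update_of_ne (by omega)]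

theorem exists_node (hg : IsGeneric s) {p : ℕ} (hp : p + 1 < N / 2) :
    ∃ κ F E, IsNode (s ^ 2) (N / 2) (gX s N) (gY s N) (gC s N) p κ F E ∧
      ∀ τ : SOAlg s N →ₗ[K] K, IsVolume (minusSO s N) τ → ∀ l m a,
        hodge τ m (hodge τ l (F a)) = F (hodge τ m (hodge τ l a)) ∧
        hodge τ m (hodge τ l (E a)) = E (hodge τ m (hodge τ l a)) := by
  have hq := hg.sq_ne_zero
  have h := (soRel_gen (N := N) hg).nodeDerivation hg.ne_zero hp
  have n0 : nodeTorus (s ^ 2) p p = s ^ 2 := if_pos rfl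
  have n1 : nodeTorus (s ^ 2) p (p + 1) = (s ^ 2)⁻¹ := by
    rw [nodeTorus, if_neg (by omega), if_pos rfl]
  have n2 : ∀ r, r ≠ p → r ≠ p + 1 → nodeTorus (s ^ 2) p r = 1 := by
    intro r h1 h2
    rw [nodeTorus, if_neg h1, if_neg h2]
  -- The factor `μ` normalizes the conjugate by the reversal so that `E` is exactly the transpose of
  -- `F` on generators; `ρ` is the torus weight by which `F` shifts.
  obtain ⟨F, E, hF, hE, hH⟩ := h.exists_skewDer hg (μ := -(s ^ 2)) (ρ := (s ^ 2) ^ 2)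
    (eX := fun r => if r = p then (-1 : K) • gX s N (p + 1) else 0)
    (eY := fun r => if r = p + 1 then gY s N p else 0) (eC := 0)
    (hg.pow_ne_one 2 (by norm_num))
    (fun r hr => by
      rcases eq_or_ne r (p + 1) with rfl | h1
      · rw [if_pos rfl, map_smul, torus_X hg _ (by omega), n0, n1, smul_comm]
        congr 1
        field_simp
      · rw [if_neg h1, map_zero, smul_zero])
    (fun r hr => by
      rcases eq_or_ne r p with rfl | h1
      · rw [if_pos rfl, torus_Y hg _ (by omega), n0, n1]
        congr 1
        field_simp
      · rw [if_neg h1, map_zero, smul_zero])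
    (by rw [map_zero, smul_zero])
    (fun r hr => by
      split_ifs
      · exact Submodule.smul_mem _ _ (X_mem_deg (by omega))
      · exact zero_mem _)
    (fun r hr => by
      split_ifs
      · exact Y_mem_deg (by omega)
      · exact zero_mem _)
    (zero_mem _)
    (fun r hr => by
      rcases eq_or_ne r p with rfl | h1
      · rw [if_pos rfl, if_pos rfl, reversal_Y hg hp, torus_X hg _ hp, n1, smul_smul, neg_mul,
          mul_inv_cancel₀ hq]
      · rw [if_neg h1, if_neg h1, map_zero, map_zero, smul_zero])
    (fun r hr => by
      rcases eq_or_ne r (p + 1) with rfl | h1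
      · rw [if_pos rfl, if_pos rfl, map_smul, reversal_X hg (by omega), map_smul,
          torus_Y hg _ (by omega), n0, smul_smul, smul_smul, neg_mul_neg, mul_one,
          mul_inv_cancel₀ hq, one_smul]
      · rw [if_neg h1, if_neg h1, map_zero, map_zero, smul_zero])
    (by rw [map_zero, map_zero, smul_zero])
    (by
      have e1 : ∀ (r : ℕ) (c : ℕ) (a b : SOAlg s N), (if r = c then a else 0) ⊗ₜ[K] b =
          if r = c then a ⊗ₜ[K] b else 0 := by
        intro r c a b
        split_ifs
        · rfl
        · exact TensorProduct.zero_tmul _ _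
      simp only [e1, TensorProduct.zero_tmul, add_zero, Finset.sum_add_distrib, Finset.sum_ite_eq',
        Finset.mem_range, hp, show p < N / 2 by omega, if_true, map_add, TensorProduct.comm_tmul]
      rw [TensorProduct.smul_tmul])
  have hn : ∀ r < N / 2, r ≠ p → r ≠ p + 1 → torus hg h.t_ne (gX s N r) = gX s N r ∧
      torus hg h.t_ne (gY s N r) = gY s N r := by
    intro r hr h1 h2
    rw [torus_X hg _ hr, torus_Y hg _ hr, n2 r h1 h2, inv_one, one_smul, one_smul]
    exact ⟨rfl, rfl⟩
  refine ⟨_, F, E, ⟨hF.isLeibniz, hE.isLeibniz, ?_, ?_, ?_, ?_, ?_, ?_, ?_, ?_, ?_, ?_, ?_⟩, hH⟩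
  · rw [torus_X hg _ hp, n1]
  · rw [torus_Y hg _ hp, n1, inv_inv]
  · rw [hF.apply_Y (by omega), if_pos rfl]
  · rw [hF.apply_X hp, if_pos rfl]
  · rw [hF.apply_Y hp, if_neg (by omega)]
  · rw [hE.apply_X (by omega), if_pos rfl]
  · rw [hE.apply_Y hp, if_pos rfl]
  · rw [hE.apply_X hp, if_neg (by omega)]
  · intro r hr h1 h2
    exact ⟨⟨(hn r hr h1 h2).1, by rw [hF.apply_X hr, if_neg h2]⟩,
      ⟨(hn r hr h1 h2).2, by rw [hF.apply_Y hr, if_neg h1]⟩⟩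
  · intro r hr h1 h2
    exact ⟨⟨(hn r hr h1 h2).1, by rw [hE.apply_X hr, if_neg h1]⟩,
      ⟨(hn r hr h1 h2).2, by rw [hE.apply_Y hr, if_neg h2]⟩⟩
  · exact ⟨⟨torus_C hg _, hF.apply_C hg fun _ => rfl⟩, ⟨torus_C hg _, hE.apply_C hg fun _ => rfl⟩⟩

theorem exists_last (hg : IsGeneric s) (hN : N % 2 = 1) {p : ℕ} (hp : p + 1 = N / 2) :
    ∃ (κ : SOAlg s N →ₐ[K] SOAlg s N) (F : SOAlg s N →ₗ[K] SOAlg s N), IsLeibniz κ F ∧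
      (∀ r < p, IsNeutral κ F (gX s N r) ∧ IsNeutral κ F (gY s N r)) ∧ F (gY s N p) = gC s N ∧
      F (gC s N) = (-s) • gX s N p ∧ κ (gC s N) = gC s N ∧
      ∀ τ : SOAlg s N →ₗ[K] K, IsVolume (minusSO s N) τ → ∀ l m a,
        hodge τ m (hodge τ l (F a)) = F (hodge τ m (hodge τ l a)) := by
  have hq := hg.sq_ne_zero
  have hs := hg.ne_zero
  have h := (soRel_gen (N := N) hg).lastDerivation hg.ne_zero hN hp
  -- As for the other nodes, `μ` makes `E` the transpose of `F`. Here `F` sends the innermost `Y` to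
  -- the central letter and that letter to `-s` times the innermost `X`.
  obtain ⟨F, E, hF, hE, hH⟩ := h.exists_skewDer hg (μ := -s) (ρ := s ^ 2)
    (eX := fun r => if r = p then (-s) • gC s N else 0)
    (eY := fun r => 0) (eC := gY s N p)
    (by simpa using hg.pow_ne_one 1 le_rfl)
    (fun r hr => by rw [Pi.zero_apply, map_zero, smul_zero])
    (fun r hr => by
      rcases eq_or_ne r p with rfl | h1
      · rw [if_pos rfl, if_pos rfl, torus_C, mul_inv_cancel₀ hq, one_smul]
      · rw [if_neg h1, map_zero, smul_zero])
    (by rw [map_smul, torus_X hg _ (by omega), if_pos rfl, mul_one, smul_comm])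
    (fun r hr => zero_mem _)
    (fun r hr => by
      split_ifs
      · exact C_mem_deg hg
      · exact zero_mem _)
    (Submodule.smul_mem _ _ (X_mem_deg (by omega)))
    (fun r hr => by
      rcases eq_or_ne r p with rfl | h1
      · rw [if_pos rfl, if_pos rfl, reversal_C, torus_C]
      · rw [if_neg h1, if_neg h1, map_zero, map_zero, smul_zero])
    (fun r hr => by rw [Pi.zero_apply, map_zero, map_zero, smul_zero])
    (by
      rw [map_smul, map_smul, reversal_X hg (by omega), torus_Y hg _ (by omega), if_pos rfl,
        smul_smul, smul_smul]
      convert one_smul K _ using 2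
      field_simp)
    (by
      have e1 : ∀ (r : ℕ) (c : ℕ) (a b : SOAlg s N), (if r = c then a else 0) ⊗ₜ[K] b =
          if r = c then a ⊗ₜ[K] b else 0 := by
        intro r c a b
        split_ifs
        · rfl
        · exact TensorProduct.zero_tmul _ _
      simp only [e1, Pi.zero_apply, TensorProduct.zero_tmul, add_zero, zero_add, Finset.sum_ite_eq',
        Finset.mem_range, show p < N / 2 by omega, if_true, map_add, TensorProduct.comm_tmul]
      rw [TensorProduct.smul_tmul, add_comm])
  refine ⟨_, F, hF.isLeibniz, fun r hr => ⟨⟨?_, ?_⟩, ⟨?_, ?_⟩⟩, ?_, ?_, torus_C hg _,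
    fun τ hτ l m a => (hH τ hτ l m a).1⟩
  · rw [torus_X hg _ (by omega), if_neg (by omega), one_smul]
  · rw [hF.apply_X (by omega), Pi.zero_apply]
  · rw [torus_Y hg _ (by omega), if_neg (by omega), inv_one, one_smul]
  · rw [hF.apply_Y (by omega), if_neg (by omega)]
  · rw [hF.apply_Y (by omega), if_pos rfl]
  · exact hF.apply_C hg (by omega)

end Operators

end QEpsilon

namespace QEpsilon

open scoped TensorProduct

universe v

/-! ### Maps determined in a single degree. -/

section Degree

variable {K : Type*} [Field K] {N : ℕ} {Pm : Matrix (Fin N × Fin N) (Fin N × Fin N) K}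

theorem hodge_eq_zero_of_mem_deg {τ : ExtAlg Pm →ₗ[K] K} (hτ : IsVolume Pm τ) {l m : ℕ}
    (h : l + m ≠ N) {a : ExtAlg Pm} (ha : a ∈ deg Pm m) : hodge τ l a = 0 := by
  rw [hodge_apply]
  refine Finset.sum_eq_zero fun k _ => ?_
  have h1 : τ (xiProd Pm k * a) = (0 : ExtAlg Pm →ₗ[K] K) (xiProd Pm k * a) :=
    eqOn_deg (f := τ) (fun L hL => hτ.off L (by omega)) (mul_mem_deg (xiProd_mem_deg k) ha)
  rw [h1, LinearMap.zero_apply, zero_smul]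

theorem repr_eq_zero_of_mem_deg (b : Module.Basis (Finset (Fin N)) K (ExtAlg Pm))
    (hb : ∀ S, ∃ L : List (Fin N), L.length = S.card ∧ b S = word Pm L) {m : ℕ} {a : ExtAlg Pm}
    (ha : a ∈ deg Pm m) {S : Finset (Fin N)} (hS : S.card ≠ m) : b.repr a S = 0 := by
  obtain ⟨ψ, hψ⟩ := exists_truncate (b.coord S) S.card
  have h1 : ψ = b.coord S := by
    apply b.ext
    intro S'
    obtain ⟨L, hL, h2⟩ := hb S'
    rw [h2, hψ, ← h2]
    split_ifs with h3
    · rfl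
    · rw [Module.Basis.coord_apply, Module.Basis.repr_self, Finsupp.single_eq_of_ne]
      rintro rfl
      exact h3 hL
  have h2 : b.coord S a = (0 : ExtAlg Pm →ₗ[K] K) a :=
    eqOn_deg (f := b.coord S) (fun L hL => by
      rw [← h1, hψ, if_neg (by omega), LinearMap.zero_apply]) ha
  exact h2

theorem eqOn_deg_of_basis (b : Module.Basis (Finset (Fin N)) K (ExtAlg Pm))
    (hb : ∀ S, ∃ L : List (Fin N), L.length = S.card ∧ b S = word Pm L) {M : Type*}
    [AddCommGroup M] [Module K M] {f g : ExtAlg Pm →ₗ[K] M} {m : ℕ}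
    (h : ∀ S : Finset (Fin N), S.card = m → f (b S) = g (b S)) {a : ExtAlg Pm} (ha : a ∈ deg Pm m) :
    f a = g a := by
  rw [← b.sum_repr a, map_sum, map_sum]
  refine Finset.sum_congr rfl fun S _ => ?_
  rw [map_smul, map_smul]
  by_cases hS : S.card = m
  · rw [h S hS]
  · rw [repr_eq_zero_of_mem_deg b hb ha hS, zero_smul, zero_smul]

end Degree

section Words

variable {K : Type v} [Field K] {s : K} {N : ℕ}

theorem word_pairList {p : ℕ} (hp : p ≤ N / 2) :
    word (minusSO s N) (pairList N p) = outerProd (gX s N) (gY s N) p := by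
  induction p with
  | zero => rfl
  | succ p ih =>
    rw [pairList_succ (by omega), word_cons, word_cons, ih (by omega), outerProd, gX, gY,
      leftGen_of_lt _ (by omega), rightGen_of_lt _ (by omega)]

theorem word_filter_pairList (S : Finset (Fin N)) {p : ℕ} (hp : p ≤ N / 2) :
    word (minusSO s N) ((pairList N p).filter (· ∈ S)) ∈ pairWords (gX s N) (gY s N) p := by
  induction p with
  | zero => rfl
  | succ p ih =>
    have hX : gX s N p = xi _ ⟨p, by omega⟩ := leftGen_of_lt _ _
    have hY : gY s N p = xi _ (Fin.rev ⟨p, by omega⟩) := rightGen_of_lt _ _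
    refine ⟨_, ih (by omega), ?_⟩
    rw [pairList_succ (by omega), hX, hY]
    by_cases h1 : (⟨p, by omega⟩ : Fin N) ∈ S <;>
      by_cases h2 : Fin.rev (⟨p, by omega⟩ : Fin N) ∈ S <;> simp [h1, h2]

end Words

/-! ### Subspaces stable under the symmetries contain almost all basis words. -/

section HodgeSquare

variable {K : Type v} [Field K] [CharZero K] {s : K} {N : ℕ}

/-- Supplies the starting point of `IsStable`: inner elements times an outer letter lie in the image
of the smaller algebra. -/
theorem exists_mapX_of_innerSub (hg : IsGeneric s) {v : SOAlg s (N + 2)}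
    (hv : oX s N * oY s N * v = 0) {a : SOAlg s (N + 2)}
    (ha : a ∈ innerSub K ((N + 2) / 2) (gX s (N + 2)) (gY s (N + 2)) (gC s (N + 2)) 1)
    (b : SOAlg s N) : ∃ b', a * innerMap hg hv b = innerMap hg hv b' := by
  induction ha using Algebra.adjoin_induction generalizing b with
  | mem a ha =>
    obtain (⟨r, h1, h2, rfl | rfl⟩ | rfl) := ha
    · refine ⟨xi _ ⟨r - 1, by omega⟩ * b, ?_⟩
      rw [innerMap_xi_mul, gX, leftGen_of_lt _ (by omega)]
      congr 2
      ext
      simp only [val_innerIdx]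
      omega
    · refine ⟨xi _ (Fin.rev ⟨r - 1, by omega⟩) * b, ?_⟩
      rw [innerMap_xi_mul, gY, rightGen_of_lt _ (by omega)]
      congr 2
      ext
      simp only [val_innerIdx, Fin.val_rev]
      omega
    · rcases Nat.mod_two_eq_zero_or_one N with hN | hN
      · refine ⟨0, ?_⟩
        rw [(soRel_gen hg).C_even (by omega), zero_mul, map_zero]
      · refine ⟨xi _ ⟨N / 2, by omega⟩ * b, ?_⟩
        rw [innerMap_xi_mul, gC, midGen_of_odd _ (by omega)]
        congr 2
        ext
        simp only [val_innerIdx]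
        omega
  | algebraMap r => exact ⟨r • b, by rw [map_smul, Algebra.algebraMap_eq_smul_one, smul_mul_assoc,
      one_mul]⟩
  | add a a' _ _ ha ha' =>
    obtain ⟨b₁, h1⟩ := ha b
    obtain ⟨b₂, h2⟩ := ha' b
    exact ⟨b₁ + b₂, by rw [add_mul, h1, h2, map_add]⟩
  | mul a a' _ _ ha ha' =>
    obtain ⟨b₁, h1⟩ := ha' b
    obtain ⟨b₂, h2⟩ := ha b₁
    exact ⟨b₂, by rw [mul_assoc, h1, h2]⟩

/-- A submodule which is stable under the symmetries and contains the images of the smaller algebra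
contains all words except the empty one and the volume form. -/
theorem basis_mem_of_stable (hg : IsGeneric s) {G : Submodule K (SOAlg s (N + 2))}
    (hX : ∀ b, mapX hg b ∈ G) (hY : ∀ b, mapY hg b ∈ G)
    (hG : ∀ D : SOAlg s (N + 2) →ₗ[K] SOAlg s (N + 2),
      (∀ τ : SOAlg s (N + 2) →ₗ[K] K, IsVolume (minusSO s (N + 2)) τ → ∀ l m a,
        hodge τ m (hodge τ l (D a)) = D (hodge τ m (hodge τ l a))) → ∀ a ∈ G, D a ∈ G)
    {b : Module.Basis (Finset (Fin (N + 2))) K (SOAlg s (N + 2))}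
    (hb : ∀ S, b S = word (minusSO s (N + 2)) ((pbwList (N + 2)).filter (· ∈ S)))
    {S : Finset (Fin (N + 2))} (hS : S ≠ ∅) (hS' : S ≠ Finset.univ) : b S ∈ G := by
  have hq := hg.sq_ne_zero
  have hz := soRel_gen (N := N + 2) hg
  have hn : N / 2 + 1 = (N + 2) / 2 := by omega
  have hst : IsStable (s ^ 2) ((N + 2) / 2) (gX s (N + 2)) (gY s (N + 2)) (gC s (N + 2)) G := by
    refine ⟨fun L hL => ⟨?_, ?_⟩, fun p hp => ?_⟩
    · obtain ⟨b', h1⟩ := exists_mapX_of_innerSub hg (outer_mul_left hg) hL 1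
      rw [innerMap_one] at h1
      rw [show gX s (N + 2) 0 = oX s N from leftGen_of_lt _ (by omega), h1]
      exact hX b'
    · obtain ⟨b', h1⟩ := exists_mapX_of_innerSub hg (outer_mul_right hg) hL 1
      rw [innerMap_one] at h1
      rw [show gY s (N + 2) 0 = oY s N from rightGen_of_lt _ (by omega), h1]
      exact hY b'
    · obtain ⟨κ, F, E, h1, h2⟩ := exists_node hg hp
      exact ⟨κ, F, E, h1, hG F fun τ hτ l m a => (h2 τ hτ l m a).1,
        hG E fun τ hτ l m a => (h2 τ hτ l m a).2⟩
  have h1 : b ∅ = 1 := by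
    rw [hb]
    simp
  have hr := word_filter_pairList (s := s) S (p := (N + 2) / 2) le_rfl
  set r := word (minusSO s (N + 2)) ((pairList (N + 2) ((N + 2) / 2)).filter (· ∈ S)) with hr_def
  rcases Nat.mod_two_eq_zero_or_one (N + 2) with hN | hN
  · have h2 : b Finset.univ = outerProd (gX s (N + 2)) (gY s (N + 2)) ((N + 2) / 2) := by
      rw [hb, pbwList, dif_neg (by omega), ← word_pairList le_rfl]
      congr 1
      simp
    have h3 : b S = r := by rw [hb, pbwList, dif_neg (by omega)]
    -- For even `N` the two exact cases of `mem_of_outerProd` are the empty word and the volume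
    -- word, both excluded.
    obtain ⟨σ, s1, s2, s3, s4⟩ := exists_swap hg hN hn
    rcases hst.mem_of_outerProd hq hz.pairs (L := 1) (one_mem _) (fun k hk hk' => by
      obtain ⟨k, rfl⟩ : ∃ j, k = j + 1 := ⟨k - 1, by omega⟩
      rw [one_mul]
      exact hst.even_outerProd hg hz.pairs hn s1 s2 s3 (hG σ.toLinearMap s4) (by omega)) hr
      with h4 | h4 | h4
    · rwa [h3, ← one_mul r]
    · exact absurd (b.injective (h3.trans (h4.trans h1.symm))) hS
    · exact absurd (b.injective (h3.trans (h4.trans h2.symm))) hS'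
  · have hC : gC s (N + 2) = xi _ ⟨(N + 2) / 2, by omega⟩ := midGen_of_odd _ hN
    have h2 : b Finset.univ =
        gC s (N + 2) * outerProd (gX s (N + 2)) (gY s (N + 2)) ((N + 2) / 2) := by
      rw [hb, pbwList, dif_pos hN, ← word_pairList le_rfl, hC, ← word_cons]
      congr 1
      simp
    obtain ⟨κ, F, f1, f2, f3, f4, f5, f6⟩ := exists_last hg hN hn
    by_cases h5 : (⟨(N + 2) / 2, by omega⟩ : Fin (N + 2)) ∈ S
    · have h3 : b S = gC s (N + 2) * r := by
        rw [hb, pbwList, dif_pos hN, List.filter_cons_of_pos (by simpa using h5), word_cons, hC]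
      rw [h3]
      have hO : ∀ k ≤ N / 2, gC s (N + 2) * outerProd (gX s (N + 2)) (gY s (N + 2)) k ∈ G :=
        fun k hk => hst.odd_center hq hz.pairs hn f1 f2 f3 (hG F f6) hk
      rcases hst.mem_of_outerProd hq hz.pairs C_mem_innerSub (fun k _ hk => hO k (by omega)) hr
        with h4 | h4 | h4
      · exact h4
      · rw [h4]
        exact hO 0 (Nat.zero_le _)
      · rw [h4] at h3
        exact absurd (b.injective (h3.trans h2.symm)) hS'
    · have h3 : b S = r := by
        rw [hb, pbwList, dif_pos hN, List.filter_cons_of_neg (by simpa using h5)]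
      -- The range includes the product of all pairs: without the central letter it is not the
      -- volume word, so it has to be reached as well.
      have hO : ∀ k ≤ N / 2, outerProd (gX s (N + 2)) (gY s (N + 2)) (k + 1) ∈ G :=
        fun k hk => hst.odd_outerProd hg hz.pairs (hz.C_sq hN) hn f1 f2 f3 f4 f5 (hG F f6) hk
      rcases hst.mem_of_outerProd hq hz.pairs (L := 1) (one_mem _) (fun k hk hk' => by
        obtain ⟨k, rfl⟩ : ∃ j, k = j + 1 := ⟨k - 1, by omega⟩
        rw [one_mul]
        exact hO k (by omega)) hr with h4 | h4 | h4
      · rwa [h3, ← one_mul r]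
      · exact absurd (b.injective (h3.trans (h4.trans h1.symm))) hS
      · rw [h3, h4, ← hn]
        exact hO _ le_rfl

end HodgeSquare

end QEpsilon

namespace QEpsilon

open scoped TensorProduct

universe v

/-! ### The change of the Hodge constant when two generators are added. -/

section HodgeFactor

variable {K : Type v} [Field K]

theorem qNum_inv {q : K} (n : ℕ) : qNum q⁻¹ n = qNum q n := by
  rw [qNum, qNum, inv_zpow, ← zpow_neg, inv_zpow, ← zpow_neg, neg_neg, inv_inv, ← neg_sub, ← neg_sub q,
    neg_div_neg_eq]

variable {s : K}

theorem geomSum_inv (hg : IsGeneric s) (l : ℕ) :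
    geomSum ((s ^ 2)⁻¹ ^ 2) (l + 1) = (s ^ 2)⁻¹ ^ l * qNum (s ^ 2) (l + 1) := by
  rw [geomSum_sq_succ (inv_ne_zero hg.sq_ne_zero) (fun r hr h => hg.pow_ne_one r hr (by
    rwa [inv_pow, inv_eq_one] at h)), qNum_inv]

/-- The constant by which the square of the Hodge map changes when `N` is increased by two. -/
def hodgeFactor (s : K) (N l m : ℕ) : K :=
  (-1) ^ (N + 1) * (s ^ 2) ^ (2 * N) * (qNum (s ^ 2) (l + 1) * qNum (s ^ 2) (m + 1))

theorem hodgeFactor_ne_zero (hg : IsGeneric s) (N l m : ℕ) : hodgeFactor s N l m ≠ 0 :=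
  mul_ne_zero (mul_ne_zero (pow_ne_zero _ (neg_ne_zero.2 one_ne_zero))
    (pow_ne_zero _ hg.sq_ne_zero)) (mul_ne_zero (qNum_ne_zero hg.sq_ne_zero hg.pow_ne_one (by omega))
      (qNum_ne_zero hg.sq_ne_zero hg.pow_ne_one (by omega)))

theorem neg_pow_mul_neg_pow {q : K} (hq : q ≠ 0) (l m : ℕ) (x y : K) :
    ((-q) ^ (l + m) * (-q) ^ l * (q ^ m * x)) * ((-q) ^ (l + m) * (-q⁻¹) ^ m * (q⁻¹ ^ l * y)) =
      (-1) ^ (l + m) * q ^ (2 * (l + m)) * (x * y) := by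
  have h : ∀ (a : K) (n : ℕ), (-a) ^ n = (-1) ^ n * a ^ n := fun a n => by
    rw [← mul_pow, neg_one_mul]
  have h1 : ∀ n : ℕ, (-1 : K) ^ n * (-1) ^ n = 1 := fun n => by rw [← mul_pow]; simp
  have h2 : ∀ n : ℕ, q ^ n * q⁻¹ ^ n = 1 := fun n => by rw [← mul_pow, mul_inv_cancel₀ hq, one_pow]
  have hl := h2 l
  have hm := h2 m
  have hl' := h1 l
  have hm' := h1 m
  rw [h q, h q, h q⁻¹, two_mul]
  simp only [pow_add]
  generalize q⁻¹ ^ l = a', q⁻¹ ^ m = b', q ^ l = a, q ^ m = b, (-1 : K) ^ l = u,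
    (-1 : K) ^ m = v at *
  linear_combination (u * v * (a * b) ^ 2 * x * y) *
    (u * u * (v * v) * (a * a') * hm + u * u * (v * v) * hl + u * u * hm' + hl')

end HodgeFactor

/-! ### The square of the Hodge map in the intermediate degrees. -/

section HodgeConstant

variable {K : Type v} [Field K] [CharZero K] {s : K} {N : ℕ}
  {τ : SOAlg s (N + 2) →ₗ[K] K} {τ' : SOAlg s N →ₗ[K] K}

/-- The Hodge map exchanges `mapX` and `mapY`, so two steps return to `mapX`. The product of the two
factors is the same as for `mapY`, which is what makes a single constant per degree possible. -/
theorem hodge_hodge_mapX (hg : IsGeneric s) (hτ : IsVolume (minusSO s (N + 2)) τ)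
    (hτ' : IsVolume (minusSO s N) τ') {l m : ℕ} (hlm : l + m = N) {r : K} {b : SOAlg s N}
    (hb : b ∈ deg (minusSO s N) l) (h : hodge τ' l (hodge τ' m b) = r • b) :
    hodge τ (l + 1) (hodge τ (m + 1) (mapX hg b)) = (hodgeFactor s N l m * r) • mapX hg b := by
  rw [hodge_mapX hg hτ hτ' m hb, map_smul, hodge_mapY hg hτ hτ' l (hodge_mem_deg τ' m b), h,
    map_smul, smul_smul, smul_smul, geomSum_inv hg, geomSum_sq_succ hg.sq_ne_zero hg.pow_ne_one,
    hodgeFactor]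
  congr 1
  subst hlm
  linear_combination (-r) * neg_pow_mul_neg_pow hg.sq_ne_zero l m (qNum (s ^ 2) (m + 1))
    (qNum (s ^ 2) (l + 1))

theorem hodge_hodge_mapY (hg : IsGeneric s) (hτ : IsVolume (minusSO s (N + 2)) τ)
    (hτ' : IsVolume (minusSO s N) τ') {l m : ℕ} (hlm : l + m = N) {r : K} {b : SOAlg s N}
    (hb : b ∈ deg (minusSO s N) l) (h : hodge τ' l (hodge τ' m b) = r • b) :
    hodge τ (l + 1) (hodge τ (m + 1) (mapY hg b)) = (hodgeFactor s N l m * r) • mapY hg b := by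
  rw [hodge_mapY hg hτ hτ' m hb, map_smul, hodge_mapX hg hτ hτ' l (hodge_mem_deg τ' m b), h,
    map_smul, smul_smul, smul_smul, geomSum_inv hg, geomSum_sq_succ hg.sq_ne_zero hg.pow_ne_one,
    hodgeFactor]
  congr 1
  subst hlm
  have := neg_pow_mul_neg_pow hg.sq_ne_zero m l (qNum (s ^ 2) (l + 1)) (qNum (s ^ 2) (m + 1))
  rw [add_comm m l] at this
  linear_combination (-r) * this

theorem innerMap_mem_deg (hg : IsGeneric s) {v : SOAlg s (N + 2)}
    (hv : oX s N * oY s N * v = 0) (hv' : v ∈ deg (minusSO s (N + 2)) 1) (L : List (Fin N)) :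
    innerMap hg hv (word _ L) ∈ deg (minusSO s (N + 2)) (L.length + 1) := by
  rw [innerMap_word]
  exact mul_mem_deg (word_mem_deg' (by simp)) hv'

/-- The square of the Hodge map in the degrees `1, …, N + 1`. -/
theorem hodge_hodge_succ (hg : IsGeneric s) (hτ : IsVolume (minusSO s (N + 2)) τ)
    (hτ' : IsVolume (minusSO s N) τ') {c : ℕ → K} (hc : ∀ l ≤ N, c l ≠ 0)
    (h : ∀ l m, l + m = N → ∀ b ∈ deg (minusSO s N) l, hodge τ' l (hodge τ' m b) = c l • b)
    {l m : ℕ} (hlm : l + m = N) {a : SOAlg s (N + 2)} (ha : a ∈ deg (minusSO s (N + 2)) (l + 1)) :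
    hodge τ (l + 1) (hodge τ (m + 1) a) = (hodgeFactor s N l m * c l) • a := by
  have hne : ∀ l ≤ N, hodgeFactor s N l (N - l) * c l ≠ 0 := fun l hl =>
    mul_ne_zero (hodgeFactor_ne_zero hg _ _ _) (hc l hl)
  -- All the intermediate Hodge squares, divided by their expected constants, are added into one
  -- operator. In a given degree only one summand is nonzero, so the claim in all these degrees says
  -- that `T` acts as the identity there.
  let T : SOAlg s (N + 2) →ₗ[K] SOAlg s (N + 2) := ∑ l ∈ Finset.range (N + 1),
    (hodgeFactor s N l (N - l) * c l)⁻¹ • hodge τ (l + 1) ∘ₗ hodge τ (N - l + 1)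
  have hT : ∀ a, T a = ∑ l ∈ Finset.range (N + 1),
      (hodgeFactor s N l (N - l) * c l)⁻¹ • hodge τ (l + 1) (hodge τ (N - l + 1) a) := by
    intro a
    simp only [T, LinearMap.sum_apply, LinearMap.smul_apply, LinearMap.comp_apply]
  have hT' : ∀ l ≤ N, ∀ a ∈ deg (minusSO s (N + 2)) (l + 1), T a =
      (hodgeFactor s N l (N - l) * c l)⁻¹ • hodge τ (l + 1) (hodge τ (N - l + 1) a) := by
    intro l hl a ha
    rw [hT]
    refine Finset.sum_eq_single_of_mem l (Finset.mem_range.2 (by omega)) fun k hk hkl => ?_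
    rw [Finset.mem_range] at hk
    rw [hodge_eq_zero_of_mem_deg hτ (by omega) ha, map_zero, smul_zero]
  -- The fixed space of `T` is stable under every operator commuting with the Hodge squares, and it
  -- contains the images of the smaller algebra; hence it contains all words but two.
  let G : Submodule K (SOAlg s (N + 2)) := LinearMap.eqLocus T LinearMap.id
  have hG : ∀ a, a ∈ G ↔ T a = a := fun a => Iff.rfl
  obtain ⟨b', hb'⟩ := exists_basis_SO hg N
  have hmem : ∀ {v : SOAlg s (N + 2)} (hv : oX s N * oY s N * v = 0)
      (_ : v ∈ deg (minusSO s (N + 2)) 1)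
      (_ : ∀ l ≤ N, ∀ b ∈ deg (minusSO s N) l, hodge τ (l + 1) (hodge τ (N - l + 1)
        (innerMap hg hv b)) = (hodgeFactor s N l (N - l) * c l) • innerMap hg hv b)
      (b : SOAlg s N), innerMap hg hv b ∈ G := by
    intro v hv hv' hh b
    rw [hG]
    suffices H : T ∘ₗ innerMap hg hv = innerMap hg hv from LinearMap.congr_fun H b
    apply linearMap_ext_word
    intro L
    rw [LinearMap.comp_apply]
    rcases Nat.lt_or_ge N L.length with h1 | h1
    · rw [word_eq_zero_of_basis b' (fun S => ⟨_, (hb' S).2, (hb' S).1⟩) L h1, map_zero, map_zero]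
    · rw [hT' L.length h1 _ (innerMap_mem_deg hg hv hv' L), hh _ h1 _ (word_mem_deg L), smul_smul,
        inv_mul_cancel₀ (hne _ h1), one_smul]
  obtain ⟨b, hb⟩ := exists_basis_SO hg (N + 2)
  have key : ∀ S : Finset (Fin (N + 2)), S.card = l + 1 →
      (hodge τ (l + 1) ∘ₗ hodge τ (m + 1)) (b S) =
        ((hodgeFactor s N l m * c l) • (LinearMap.id : SOAlg s (N + 2) →ₗ[K] _)) (b S) := by
    intro S hS
    have h1 : b S ∈ G := by
      refine basis_mem_of_stable hg ?_ ?_ ?_ (fun S => (hb S).1) ?_ ?_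
      · exact hmem _ (xi_mem_deg _) fun l hl b hb =>
          hodge_hodge_mapX hg hτ hτ' (by omega) hb (h l (N - l) (by omega) b hb)
      · exact hmem _ (xi_mem_deg _) fun l hl b hb =>
          hodge_hodge_mapY hg hτ hτ' (by omega) hb (h l (N - l) (by omega) b hb)
      · intro D hD a ha
        rw [hG] at ha ⊢
        conv_rhs => rw [← ha]
        rw [hT, hT, map_sum]
        refine Finset.sum_congr rfl fun k _ => ?_
        rw [hD τ hτ, map_smul]
      · rintro rfl
        simp at hS
      · rintro rfl
        rw [Finset.card_univ, Fintype.card_fin] at hS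
        omega
    have h2 : b S ∈ deg (minusSO s (N + 2)) (l + 1) := by
      rw [(hb S).1]
      exact word_mem_deg' ((hb S).2.trans hS)
    rw [hG, hT' l (by omega) _ h2, show N - l = m by omega] at h1
    have h3 := hne l (by omega)
    rw [show N - l = m by omega] at h3
    rw [LinearMap.comp_apply, LinearMap.smul_apply, LinearMap.id_apply]
    conv_rhs => rw [← h1]
    rw [smul_smul, mul_inv_cancel₀ h3, one_smul]
  exact eqOn_deg_of_basis b (fun S => ⟨_, (hb S).2, (hb S).1⟩) key ha

end HodgeConstant

end QEpsilon

namespace QEpsilon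

open scoped TensorProduct

universe v

/-! ### The square of the Hodge map in degrees `0` and `N`. -/

section Ends

variable {K : Type*} [Field K] {N : ℕ} {Pm : Matrix (Fin N × Fin N) (Fin N × Fin N) K}
  {τ : ExtAlg Pm →ₗ[K] K}

theorem hodge_top_one (hτ : IsVolume Pm τ) : hodge τ N 1 =
    (∑ k : Fin N → Fin N, τ (xiProd Pm k) ^ 2) • xiProd Pm (fun k => k) := by
  rw [hodge_apply, Finset.sum_smul]
  refine Finset.sum_congr rfl fun k _ => ?_
  rw [mul_one, sq, mul_smul, ← hτ.eq_smul]

/-- Degrees `0` and `N` are spanned by `1` and by the volume form, so the constant there is the sum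
of squares without any use of symmetry. -/
theorem hodge_hodge_zero (hτ : IsVolume Pm τ) {a : ExtAlg Pm} (ha : a ∈ deg Pm 0) :
    hodge τ 0 (hodge τ N a) = (∑ k : Fin N → Fin N, τ (xiProd Pm k) ^ 2) • a := by
  refine eqOn_deg (f := hodge τ 0 ∘ₗ hodge τ N) (g := (∑ k : Fin N → Fin N,
    τ (xiProd Pm k) ^ 2) • LinearMap.id) (fun L hL => ?_) ha
  rw [List.length_eq_zero_iff.1 hL, word_nil, LinearMap.comp_apply, hodge_top_one hτ, hodge_zero,
    map_smul, hτ.top, LinearMap.smul_apply, LinearMap.id_apply, smul_eq_mul, mul_one]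

theorem hodge_hodge_top (hτ : IsVolume Pm τ) {a : ExtAlg Pm} (ha : a ∈ deg Pm N) :
    hodge τ N (hodge τ 0 a) = (∑ k : Fin N → Fin N, τ (xiProd Pm k) ^ 2) • a := by
  refine eqOn_deg (f := hodge τ N ∘ₗ hodge τ 0) (g := (∑ k : Fin N → Fin N,
    τ (xiProd Pm k) ^ 2) • LinearMap.id) (fun L hL => ?_) ha
  obtain ⟨I, rfl⟩ := exists_eq_ofFn L hL
  rw [← xiProd_eq_word, LinearMap.comp_apply, hodge_zero, map_smul, hodge_top_one hτ,
    LinearMap.smul_apply, LinearMap.id_apply]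
  conv_rhs => rw [hτ.eq_smul I]
  rw [smul_comm]

end Ends

/-! ### Quotients of the constants `d_l` and the sum of the weights. -/

section Constants

variable {K : Type*} [Field K] {N : ℕ}

theorem sum_weight_inv (s : K) (N : ℕ) :
    ∑ c : Fin N, ((s ^ 2) ^ (-twoRho c))⁻¹ = traceConst s N := by
  rw [traceConst, Finset.sum_comm]
  refine Finset.sum_congr rfl fun c _ => ?_
  rw [Finset.sum_eq_single c.rev]
  · rw [metric_apply, if_pos rfl, zpow_neg, inv_inv, ← sq_zpow, two_mul, zpow_add']
    by_cases hs : s = 0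
    · rcases eq_or_ne (twoRho c) 0 with h | h
      · simp [h]
      · right; left; omega
    · exact Or.inl hs
  · intro d _ hd
    rw [metric_apply, if_neg hd, mul_zero]
  · simp

/-- The quotients `d_m / d_0`. -/
def binomSO (s : K) (N m : ℕ) : K :=
  qFactorial (s ^ 2) N / (qFactorial (s ^ 2) m * qFactorial (s ^ 2) (N - m)) *
    ((s ^ (2 * (m : ℤ) - N) + s ^ ((N : ℤ) - 2 * m)) / (s ^ (-(N : ℤ)) + s ^ (N : ℤ)))

theorem binomSO_symm (s : K) {l m : ℕ} (h : l + m = N) : binomSO s N l = binomSO s N m := by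
  rw [binomSO, binomSO, show N - l = m by omega, show N - m = l by omega,
    mul_comm (qFactorial _ l), add_comm (s ^ (2 * (l : ℤ) - N)),
    show (N : ℤ) - 2 * l = 2 * m - N by omega, show 2 * (l : ℤ) - N = N - 2 * m by omega]

end Constants

/-! ### The constants of the square of the Hodge map for `so`. -/

section HodgeSquare

variable {K : Type v} [Field K] [CharZero K] {s : K} {N : ℕ}

theorem linearIndependent_xi (hg : IsGeneric s) (N : ℕ) :
    LinearIndependent K (xi (minusSO s N)) := by
  obtain ⟨b, hb⟩ := exists_basis_SO hg N
  have h : xi (minusSO s N) = b ∘ fun c : Fin N => {c} := by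
    funext c
    rw [Function.comp_apply, (hb {c}).1]
    have h1 := (hb {c}).2
    rw [Finset.card_singleton, List.length_eq_one_iff] at h1
    obtain ⟨d, hd⟩ := h1
    have h2 : d ∈ (pbwList N).filter (· ∈ ({c} : Finset (Fin N))) := by rw [hd]; simp
    have h3 : d = c := by simpa using (List.mem_filter.1 h2).2
    rw [hd, h3]
    simp
  rw [h]
  exact b.linearIndependent.comp _ Finset.singleton_injective

/-- The sum of the squares of the components of the `ε`-tensor, in terms of the square of the Hodge
map in degree one. -/
theorem sum_sq_eq (hg : IsGeneric s) {τ : SOAlg s (N + 1) →ₗ[K] K}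
    (hτ : IsVolume (minusSO s (N + 1)) τ) {r : K}
    (h : ∀ a ∈ deg (minusSO s (N + 1)) 1, hodge τ 1 (hodge τ N a) = r • a) :
    ∑ k : Fin (N + 1) → Fin (N + 1), τ (xiProd _ k) ^ 2 =
      (-1) ^ N * traceConst s (N + 1) * r := by
  have h1 : ∀ c, τ (xi _ c * hodge τ N (xi _ c)) = r := by
    intro c
    have h2 := h _ (xi_mem_deg c)
    rw [hodge_apply, ← (Equiv.funUnique (Fin 1) (Fin (N + 1))).symm.sum_comp] at h2
    have h3 : ∀ d, xiProd (minusSO s (N + 1)) ((Equiv.funUnique (Fin 1) (Fin (N + 1))).symm d) =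
        xi _ d := by
      intro d
      rw [xiProd_eq_word]
      simp
    simp only [h3] at h2
    have h4 : ∑ d, τ (xi (minusSO s (N + 1)) d * hodge τ N (xi (minusSO s (N + 1)) c)) •
        xi (minusSO s (N + 1)) d = ∑ d, (if d = c then r else 0) • xi (minusSO s (N + 1)) d := by
      rw [h2]
      simp only [ite_smul, zero_smul, Finset.sum_ite_eq', Finset.mem_univ, if_true]
    simpa using Fintype.linearIndependent_iffₛ.1 (linearIndependent_xi hg (N + 1)) _ _ h4 c
  have h2 : τ (hodge τ (N + 1) 1) = ∑ k : Fin (N + 1) → Fin (N + 1), τ (xiProd _ k) ^ 2 := by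
    rw [hodge_top_one hτ, map_smul, hτ.top, smul_eq_mul, mul_one]
  -- One letter is detached from the sum of squares and rotated to the front. Each letter
  -- contributes its inverse weight times `r`, and the inverse weights sum to `Q_N`.
  rw [← h2, hodge_succ, map_sum, ← sum_weight_inv, Finset.mul_sum, Finset.sum_mul]
  refine Finset.sum_congr rfl fun c _ => ?_
  have h3 := cyc_SO hg hτ c (hodge τ N (xi _ c))
  rw [h1, Nat.add_sub_cancel] at h3
  have h4 : (s ^ 2) ^ (-twoRho c) ≠ 0 := zpow_ne_zero _ hg.sq_ne_zero
  have h5 : ((-1 : K) ^ N) * (-1) ^ N = 1 := by rw [← mul_pow]; simp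
  rw [mul_one, h3]
  field_simp
  linear_combination (-τ (hodge τ N (xi (minusSO s (N + 1)) c) * xi (minusSO s (N + 1)) c)) * h5

theorem zpow_add_inv_ne_zero (hg : IsGeneric s) (N : ℕ) : s ^ (-(N : ℤ)) + s ^ (N : ℤ) ≠ 0 := by
  have h : s ^ (-(N : ℤ)) + s ^ (N : ℤ) = s ^ (-(N : ℤ)) * (1 + (s ^ 2) ^ N) := by
    rw [zpow_neg, zpow_natCast]
    have := pow_ne_zero N hg.ne_zero
    field_simp
    ring
  rw [h]
  refine mul_ne_zero (zpow_ne_zero _ hg.ne_zero) ?_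
  rcases Nat.eq_zero_or_pos N with rfl | hN
  · norm_num
  · exact hg.one_add_pow_ne_zero hN

theorem binomSO_zero (hg : IsGeneric s) (N : ℕ) : binomSO s N 0 = 1 := by
  have h1 := qFactorial_ne_zero hg.sq_ne_zero hg.pow_ne_one N
  have h2 := zpow_add_inv_ne_zero hg N
  rw [binomSO, qFactorial_zero, one_mul, Nat.sub_zero, div_self h1, one_mul]
  simp only [Nat.cast_zero, mul_zero, zero_sub, sub_zero]
  exact div_self h2

/-- This recursion for the ratios `d_l / d_0` matches `hodgeFactor` in the intermediate degrees and
the factor `Q_N` from `sum_sq_eq` in degree zero. -/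
theorem binomSO_succ (hg : IsGeneric s) {l m : ℕ} (h : l + m = N) :
    qNum (s ^ 2) (l + 1) * qNum (s ^ 2) (m + 1) * binomSO s (N + 2) (l + 1) =
      traceConst s (N + 2) * qNum (s ^ 2) (N + 1) * binomSO s N l := by
  have hs := hg.ne_zero
  have hq := hg.sq_ne_zero
  have h1 := qNum_ne_zero hq hg.pow_ne_one (show 1 ≤ l + 1 by omega)
  have h2 := qNum_ne_zero hq hg.pow_ne_one (show 1 ≤ m + 1 by omega)
  have h3 := qFactorial_ne_zero hq hg.pow_ne_one l
  have h4 := qFactorial_ne_zero hq hg.pow_ne_one m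
  have hd := zpow_add_inv_ne_zero hg N
  have hd' := zpow_add_inv_ne_zero hg (N + 2)
  -- The trace constant is a `q`-number times a quotient of two symmetric sums of powers; these sums
  -- are the denominators occurring in `binomSO`.
  have key : qNum (s ^ 2) (N + 2) * (s ^ (-(N : ℤ)) + s ^ (N : ℤ)) =
      traceConst s (N + 2) * (s ^ (-((N + 2 : ℕ) : ℤ)) + s ^ ((N + 2 : ℕ) : ℤ)) := by
    have e := mul_traceConst hs (N + 2)
    have hk := sub_inv_ne_zero hq hg.pow_ne_one
    apply mul_left_cancel₀ hk
    rw [← mul_assoc _ (traceConst s (N + 2)), e, qNum, ← mul_assoc, mul_div_cancel₀ _ hk,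
      show ((N + 2 : ℕ) : ℤ) - 2 = N by push_cast; ring,
      show 1 - ((N + 2 : ℕ) : ℤ) = -((N + 1 : ℕ) : ℤ) by push_cast; ring]
    simp only [zpow_neg, zpow_natCast]
    have := pow_ne_zero N hs
    field_simp
    ring
  rw [binomSO, binomSO, show N + 2 - (l + 1) = m + 1 by omega, show N - l = m by omega,
    qFactorial_succ, qFactorial_succ, qFactorial_succ _ l, qFactorial_succ _ m,
    show 2 * ((l + 1 : ℕ) : ℤ) - (N + 2 : ℕ) = 2 * l - N by push_cast; ring,
    show ((N + 2 : ℕ) : ℤ) - 2 * (l + 1 : ℕ) = N - 2 * l by push_cast; ring]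
  generalize s ^ (-(N : ℤ)) + s ^ (N : ℤ) = d at *
  generalize s ^ (-((N + 2 : ℕ) : ℤ)) + s ^ ((N + 2 : ℕ) : ℤ) = d' at *
  generalize s ^ (2 * (l : ℤ) - N) + s ^ ((N : ℤ) - 2 * l) = x at *
  field_simp
  linear_combination (qFactorial (s ^ 2) N * qNum (s ^ 2) (N + 1) * x) * key

theorem hodgeConst_succ (hg : IsGeneric s) {c : ℕ → K} {l m : ℕ} (h : l + m = N)
    (hc : c l * binomSO s N l = (-1) ^ (l * (N - 1)) * c 0) :
    hodgeFactor s N l m * c l * binomSO s (N + 2) (l + 1) = (-1) ^ ((l + 1) * (N + 1)) *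
      ((-1) ^ (N + 1) * traceConst s (N + 2) * (hodgeFactor s N 0 N * c 0)) := by
  have h1 : qNum (s ^ 2) (0 + 1) = 1 := by
    rw [qNum]
    simpa using div_self (sub_inv_ne_zero hg.sq_ne_zero hg.pow_ne_one)
  -- The numbers `N - 1` and `N + 1` have the same parity; for `N = 0`, where the subtraction is
  -- truncated, `l` is zero.
  have h2 : (-1 : K) ^ (l * (N - 1)) = (-1) ^ (l * (N + 1)) := by
    rcases Nat.eq_zero_or_pos N with rfl | hN
    · obtain rfl : l = 0 := by omega
      rfl
    · rw [show l * (N + 1) = l * (N - 1) + 2 * l by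
        obtain ⟨k, rfl⟩ : ∃ k, N = k + 1 := ⟨N - 1, by omega⟩
        rw [Nat.add_sub_cancel]
        ring, pow_add, pow_mul _ 2]
      simp
  have h3 : (-1 : K) ^ (N + 1) * (-1) ^ (N + 1) = 1 := by rw [← mul_pow]; simp
  rw [h2] at hc
  have h4 := binomSO_succ hg h
  rw [hodgeFactor, hodgeFactor, h1, add_mul l, one_mul, pow_add]
  linear_combination ((-1) ^ (N + 1) * (s ^ 2) ^ (2 * N) * c l) * h4 +
    ((-1) ^ (N + 1) * (s ^ 2) ^ (2 * N) * traceConst s (N + 2) * qNum (s ^ 2) (N + 1)) * hc -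
    ((-1) ^ (N + 1) * (-1) ^ (l * (N + 1)) * traceConst s (N + 2) * (s ^ 2) ^ (2 * N) *
      qNum (s ^ 2) (N + 1) * c 0) * h3

/-- The square of the Hodge map. -/
theorem exists_hodgeConst (hg : IsGeneric s) : ∀ N, ∃ c : ℕ → K, (∀ l ≤ N, c l ≠ 0) ∧
    (∀ τ : SOAlg s N →ₗ[K] K, IsVolume (minusSO s N) τ → ∀ l m, l + m = N →
      ∀ a ∈ deg (minusSO s N) l, hodge τ l (hodge τ m a) = c l • a) ∧
    ∀ l ≤ N, c l * binomSO s N l = (-1) ^ (l * (N - 1)) * c 0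
  | 0 => by
    refine ⟨fun _ => 1, fun _ _ => one_ne_zero, fun τ hτ l m hlm a ha => ?_, fun l hl => ?_⟩
    · obtain rfl : l = 0 := by omega
      obtain rfl : m = 0 := by omega
      rw [hodge_hodge_zero hτ ha]
      congr 1
      rw [Fintype.sum_unique, Subsingleton.elim (default : Fin 0 → Fin 0) fun k => k, hτ.top, one_pow]
    · obtain rfl : l = 0 := by omega
      simp [binomSO_zero hg]
  | 1 => by
    refine ⟨fun _ => 1, fun _ _ => one_ne_zero, fun τ hτ l m hlm a ha => ?_, fun l hl => ?_⟩
    · have h1 : ∑ k : Fin 1 → Fin 1, τ (xiProd (minusSO s 1) k) ^ 2 = 1 := by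
        rw [Fintype.sum_unique, Subsingleton.elim (default : Fin 1 → Fin 1) fun k => k, hτ.top,
          one_pow]
      rcases Nat.eq_zero_or_pos l with rfl | hl
      · obtain rfl : m = 1 := by omega
        rw [hodge_hodge_zero hτ ha, h1]
      · obtain rfl : l = 1 := by omega
        obtain rfl : m = 0 := by omega
        rw [hodge_hodge_top hτ ha, h1]
    · rcases Nat.eq_zero_or_pos l with rfl | hl'
      · simp [binomSO_zero hg]
      · obtain rfl : l = 1 := by omega
        rw [binomSO_symm s (show 1 + 0 = 1 by omega), binomSO_zero hg]
        simp
  | N + 2 => by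
    obtain ⟨c, hc, hh, hB⟩ := exists_hodgeConst hg N
    obtain ⟨τ', hτ'⟩ := exists_volume_SO hg N
    -- The common constant of the two extreme degrees, computed from degree one by `sum_sq_eq`.
    set c0 : K := (-1) ^ (N + 1) * traceConst s (N + 2) * (hodgeFactor s N 0 N * c 0) with hc0
    have hc0' : c0 ≠ 0 := mul_ne_zero (mul_ne_zero (pow_ne_zero _ (neg_ne_zero.2 one_ne_zero))
      (traceConst_ne_zero hg.ne_zero hg.pow_ne_one (by omega)))
      (mul_ne_zero (hodgeFactor_ne_zero hg _ _ _) (hc 0 (Nat.zero_le _)))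
    have hlast : ∀ l ≤ N + 2, l ≠ 0 → l ≠ N + 2 → ∃ k ≤ N, l = k + 1 := fun l h1 h2 h3 =>
      ⟨l - 1, by omega, by omega⟩
    refine ⟨fun l => if l = 0 ∨ l = N + 2 then c0 else
      hodgeFactor s N (l - 1) (N - (l - 1)) * c (l - 1), fun l hl => ?_,
      fun τ hτ l m hlm a ha => ?_, fun l hl => ?_⟩ <;> beta_reduce
    · split_ifs with h
      · exact hc0'
      · exact mul_ne_zero (hodgeFactor_ne_zero hg _ _ _) (hc _ (by omega))
    · have hmid : ∀ l m, l + m = N → ∀ a ∈ deg (minusSO s (N + 2)) (l + 1),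
          hodge τ (l + 1) (hodge τ (m + 1) a) = (hodgeFactor s N l m * c l) • a :=
        fun l m hlm a ha => hodge_hodge_succ hg hτ hτ' hc (hh τ' hτ') hlm ha
      have hsum := sum_sq_eq hg hτ (hmid 0 N (Nat.zero_add N))
      rcases eq_or_ne l 0 with rfl | h0
      · obtain rfl : m = N + 2 := by omega
        rw [hodge_hodge_zero hτ ha, hsum, if_pos (Or.inl rfl)]
      rcases eq_or_ne l (N + 2) with rfl | h1
      · obtain rfl : m = 0 := by omega
        rw [hodge_hodge_top hτ ha, hsum, if_pos (Or.inr rfl)]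
      obtain ⟨k, hk, rfl⟩ := hlast l (by omega) h0 h1
      obtain ⟨m, rfl⟩ : ∃ j, m = j + 1 := ⟨m - 1, by omega⟩
      rw [hmid k m (by omega) a ha, if_neg (by omega), Nat.add_sub_cancel, show N - k = m by omega]
    · rw [if_pos (Or.inl rfl), show N + 2 - 1 = N + 1 by omega]
      rcases eq_or_ne l 0 with rfl | h0
      · rw [if_pos (Or.inl rfl), binomSO_zero hg]
        simp
      rcases eq_or_ne l (N + 2) with rfl | h1
      · rw [if_pos (Or.inr rfl), binomSO_symm s (show N + 2 + 0 = N + 2 by omega), binomSO_zero hg,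
          Even.neg_one_pow]
        · ring
        · rw [mul_comm]
          exact Nat.even_mul_succ_self (N + 1)
      obtain ⟨k, hk, rfl⟩ := hlast l hl h0 h1
      rw [if_neg (by omega), Nat.add_sub_cancel]
      exact hodgeConst_succ hg (by omega) (hB k hk)

end HodgeSquare

end QEpsilon

namespace QEpsilon

open scoped TensorProduct

universe v

/-! ### Contractions with lowered indices. -/

section LoweredIndices

variable {K : Type v} [Field K] {s : K} {N : ℕ}

theorem uSO_eq_diagonal (hs : s ≠ 0) (N : ℕ) :
    uSO s N = Matrix.diagonal fun j => (s ^ 2) ^ (-twoRho j) := by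
  ext a b
  rw [uSO, Matrix.mul_apply, Finset.sum_eq_single a.rev]
  · rw [Matrix.transpose_apply, metric_apply, metric_apply, Fin.rev_rev, if_pos rfl, twoRho_rev,
      Matrix.diagonal_apply]
    by_cases h : a = b
    · subst h
      rw [if_pos rfl, if_pos rfl, ← sq_zpow, ← zpow_add₀ hs, two_mul]
    · rw [if_neg h, if_neg fun h' => h h'.symm, mul_zero]
  · intro c _ hc
    rw [metric_apply, if_neg fun h => hc (by rw [h, Fin.rev_rev]), zero_mul]
  · simp

theorem dSO_eq (s : K) {N : ℕ} (ε : (Fin N → Fin N) → K) (l : ℕ) :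
    dSO s ε l = dZero ε * binomSO s N l := mul_assoc _ _ _

theorem lowerEps_eq {a b : ℕ} (h : a + b = N) (ε : (Fin N → Fin N) → K) (x : Fin a → Fin N)
    (y : Fin b → Fin N) :
    lowerEps s h ε x y = (∏ t, s ^ (-twoRho (x t))) * ε (cat h (fun t => (x t).rev) y) := by
  rw [lowerEps, Finset.sum_eq_single fun t => (x t).rev]
  · simp only [metric_apply, Fin.rev_rev, if_true, twoRho_rev]
  · intro k _ hk
    obtain ⟨t, ht⟩ := Function.ne_iff.1 hk
    rw [Finset.prod_eq_zero (Finset.mem_univ t), zero_mul]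
    rw [metric_apply, if_neg fun h => ht (by rw [h, Fin.rev_rev])]
  · simp

theorem torusWeight_rhoNat (c : Fin N) : torusWeight (fun r => s ^ rhoNat N r) c = s ^ twoRho c := by
  have hc := c.2
  rw [torusWeight, twoRho_eq]
  rcases lt_trichotomy (2 * (c : ℕ) + 1) N with h | h | h
  · rw [ofPairs_left _ _ _ h]
  · rw [ofPairs_mid _ _ _ h, rhoNat, if_neg (by omega), if_pos h, zpow_zero]
  · rw [ofPairs_right _ _ _ h, ← zpow_neg]
    congr 1
    simp only [rhoNat]
    split_ifs <;> omega

variable [CharZero K] {τ : SOAlg s N →ₗ[K] K}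

theorem reversal_xiProd (hg : IsGeneric s) {l : ℕ} (I : Fin l → Fin N) :
    reversal hg (xiProd _ I) = xiProd (minusSO s N) fun t => (I t.rev).rev := by
  rw [xiProd_eq_word, reversal_word, xiProd_eq_word, List.map_ofFn]
  congr 1
  apply List.ext_getElem <;> simp [Fin.rev, Nat.sub_sub, add_comm]

/-- The torus with parameters `q ^ ρ` preserves `τ`, so wherever `τ` is nonzero the total weight of
the word is one and the weight of `a` is inverse to that of `j`. -/
theorem IsVolume.zpow_twoRho (hτ : IsVolume (minusSO s N) τ) (hg : IsGeneric s) {l m : ℕ}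
    (a : Fin m → Fin N) (j : Fin l → Fin N) :
    (∏ t, s ^ twoRho (a t)) * τ (xiProd _ a * xiProd _ j) =
      (∏ t, s ^ (-twoRho (j t))) * τ (xiProd _ a * xiProd _ j) := by
  have hs := hg.ne_zero
  have hσ := torus_xi (N := N) hg (t := fun r => s ^ rhoNat N r) fun r => zpow_ne_zero _ hs
  have h := hτ.torus hg (t := fun r => s ^ rhoNat N r) (fun r => zpow_ne_zero _ hs)
    (xiProd _ a * xiProd _ j)
  rw [map_mul, xiProd_eq_word, xiProd_eq_word, scale_word hσ, scale_word hσ, smul_mul_smul_comm,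
    map_smul, ← xiProd_eq_word, ← xiProd_eq_word, smul_eq_mul, List.map_ofFn, List.map_ofFn,
    List.prod_ofFn, List.prod_ofFn] at h
  simp only [Function.comp_apply, torusWeight_rhoNat] at h
  have h0 : (∏ t, s ^ (-twoRho (j t))) * ∏ t, s ^ twoRho (j t) = 1 := by
    rw [← Finset.prod_mul_distrib]
    exact Finset.prod_eq_one fun t _ => by rw [zpow_neg, inv_mul_cancel₀ (zpow_ne_zero _ hs)]
  linear_combination (-(∏ t, s ^ twoRho (a t)) * τ (xiProd _ a * xiProd _ j)) * h0 +
    (∏ t, s ^ (-twoRho (j t))) * h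

/-- The contraction of two `ε`-tensors with lowered indices. -/
theorem IsVolume.sum_lowerEps (hτ : IsVolume (minusSO s N) τ) (hg : IsGeneric s) {γ : K} {l m : ℕ}
    (h : l + m = N) (h' : m + l = N) (i j : Fin l → Fin N) :
    ∑ a : Fin m → Fin N,
        lowerEps s h (fun I => γ * τ (xiProd _ I)) (fun t => j t.rev) a *
          lowerEps s h' (fun I => γ * τ (xiProd _ I)) (fun t => a t.rev) i =
      γ ^ 2 * ((∏ t, (s ^ 2) ^ (-twoRho (j t))) * ∑ a : Fin m → Fin N,
        τ (xiProd _ a * xiProd _ i) * τ (xiProd _ a * xiProd _ j)) := by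
  -- Reversing a multi-index and negating its entries is an involution of the summation range; it
  -- undoes the effect of lowering.
  have hinv : Function.Involutive fun (a : Fin m → Fin N) t => (a t.rev).rev := fun a => by simp
  rw [← Equiv.sum_comp hinv.toPerm fun a : Fin m → Fin N =>
      τ (xiProd (minusSO s N) a * xiProd _ i) * τ (xiProd (minusSO s N) a * xiProd _ j),
    Finset.mul_sum, Finset.mul_sum]
  refine Finset.sum_congr rfl fun a _ => ?_
  -- The volume functional is invariant under the reversal, which exchanges the two blocks of
  -- indices.
  have e1 : τ (xiProd (minusSO s N) (fun t => (j t.rev).rev) * xiProd _ a) =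
      τ (xiProd _ (fun t => (a t.rev).rev) * xiProd _ j) := by
    rw [← hτ.reversal hg, reversal_mul, reversal_xiProd, reversal_xiProd]
    simp
  have e2 := hτ.zpow_twoRho hg (fun t => (a t.rev).rev) j
  have e3 : ∏ t, s ^ (-twoRho (a (Fin.rev t))) = ∏ t, s ^ twoRho (a (Fin.rev t)).rev := by
    simp only [twoRho_rev]
  have e4 : ∏ t, s ^ (-twoRho (j (Fin.rev t))) = ∏ t, s ^ (-twoRho (j t)) :=
    Equiv.prod_comp Fin.revPerm fun t => s ^ (-twoRho (j t))
  have e5 : ∏ t, (s ^ 2) ^ (-twoRho (j t)) =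
      (∏ t, s ^ (-twoRho (j t))) * ∏ t, s ^ (-twoRho (j t)) := by
    rw [← Finset.prod_mul_distrib]
    exact Finset.prod_congr rfl fun t _ => by rw [← sq_zpow, ← zpow_add₀ hg.ne_zero, two_mul]
  simp only [lowerEps_eq, xiProd_cat, Function.Involutive.coe_toPerm]
  rw [e1, e3, e4, e5]
  linear_combination (γ ^ 2 * (∏ t, s ^ (-twoRho (j t))) *
    τ (xiProd _ (fun t => (a t.rev).rev) * xiProd _ i)) * e2

end LoweredIndices

/-! ### The theorem for `so`. -/

section OrthogonalCase

variable {K : Type v} [Field K] [CharZero K] {s : K}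

theorem isFrobenius_SO (hg : IsGeneric s) (N : ℕ) : ∃ τ c,
    IsFrobenius (minusSO s N) (fun j => (s ^ 2) ^ (-twoRho j)) τ c ∧ (∀ l ≤ N, c l ≠ 0) ∧
      ∀ l ≤ N, c l * binomSO s N l = (-1) ^ (l * (N - 1)) * c 0 := by
  obtain ⟨τ, hτ⟩ := exists_volume_SO hg N
  obtain ⟨b, hb⟩ := exists_basis_SO hg N
  obtain ⟨c, hc0, hc, hcb⟩ := exists_hodgeConst hg N
  exact ⟨τ, c, ⟨hτ, cyc_SO hg hτ, fun l m hlm I => hc τ hτ l m hlm _ (xiProd_mem_deg I),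
    b, fun S => ⟨_, (hb S).2, (hb S).1⟩⟩, hc0, hcb⟩

theorem epsilon_antisymmetrizer_SO (N : ℕ) (hN : 1 ≤ N) (s : K) (hs : s ≠ 0)
    (h : ∀ r : ℕ, 1 ≤ r → (s ^ 2) ^ r ≠ 1) (γ : K) (hγ : γ ≠ 0) :
    (∃! ε : (Fin N → Fin N) → K, IsEpsilon (minusSO s N) γ ε) ∧
      ∀ ε : (Fin N → Fin N) → K, IsEpsilon (minusSO s N) γ ε →
        (∑ a : Fin N → Fin N, ε a ^ 2) ≠ 0 ∧
        ∀ (l m : ℕ) (h : l + m = N),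
          dSO s ε l = dSO s ε m ∧
          (∃! P : Matrix (Fin l → Fin N) (Fin l → Fin N) K,
            IsAntisymmetrizer (minusSO s N) {plusSO s N, traceSO s N} l P) ∧
          ∀ P : Matrix (Fin l → Fin N) (Fin l → Fin N) K,
            IsAntisymmetrizer (minusSO s N) {plusSO s N, traceSO s N} l P →
            ∀ i j : Fin l → Fin N,
              P i j = dSO s ε l *
                ∑ k : Fin l → Fin N, ∑ a : Fin m → Fin N,
                  (∏ t : Fin l, uSO s N (k t) (j t)) *
                    ε (cat ((add_comm m l).trans h) a i) *
                    ε (cat ((add_comm m l).trans h) a k) ∧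
              P i j = (-1) ^ (l * (N - 1)) * dSO s ε l *
                ∑ a : Fin m → Fin N,
                  ε (cat h j a) * ε (cat ((add_comm m l).trans h) a i) ∧
              P i j = dSO s ε l *
                ∑ a : Fin m → Fin N,
                  lowerEps s h ε (fun t => j t.rev) a *
                    lowerEps s ((add_comm m l).trans h) ε (fun t => a t.rev) i := by
  have hg : IsGeneric s := ⟨hs, h⟩
  obtain ⟨τ, c, hτ, hc0, hcb⟩ := isFrobenius_SO hg N
  refine ⟨existsUnique_isEpsilon hτ.vol hγ, fun ε hε => ?_⟩
  rw [isEpsilon_iff hτ.vol hγ] at hε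
  have hsum : ∑ a : Fin N → Fin N, ε a ^ 2 = γ ^ 2 * c 0 := by
    simp only [hε, mul_pow, ← Finset.mul_sum]
    rw [hτ.sum_sq]
  have hsum0 : ∑ a : Fin N → Fin N, ε a ^ 2 ≠ 0 := by
    rw [hsum]
    exact mul_ne_zero (pow_ne_zero _ hγ) (hc0 0 (Nat.zero_le N))
  refine ⟨hsum0, fun l m hlm => ?_⟩
  -- The constants `c l` differ from `c 0` by the inverse of `binomSO` and a sign. The latter
  -- cancels the sign in the action of the Gram matrix, since `N * (N - 1)` is even.
  have hd : dSO s ε l * γ ^ 2 * ((-1) ^ (m * (N - 1)) * c l) = 1 := by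
    have hsign : (-1 : K) ^ (m * (N - 1)) * (-1) ^ (l * (N - 1)) = 1 := by
      rw [← pow_add, ← add_mul, add_comm m, hlm]
      exact (Nat.even_mul_pred_self N).neg_one_pow
    have hz : dZero ε * (γ ^ 2 * c 0) = 1 := by
      rw [dZero, ← hsum, inv_mul_cancel₀ hsum0]
    rw [dSO_eq]
    linear_combination (dZero ε * γ ^ 2 * (-1) ^ (m * (N - 1))) * hcb l (by omega) +
      dZero ε * γ ^ 2 * c 0 * hsign + hz
  have hothers := others_SO hs (ne_zero_of_pow_ne_one hg.sq_ne_zero h) (traceConst_ne_zero hs h hN)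
  refine ⟨?_, hτ.existsUnique_antisymmetrizer (minusSO_transpose s N) hothers hlm hd,
    fun P hP i j => ?_⟩
  · rw [dSO_eq, dSO_eq, binomSO_symm s hlm]
  · obtain ⟨h1, h2⟩ :=
      hτ.antisymmetrizer_formulas (minusSO_transpose s N) hothers hlm hd hε hP i j
    refine ⟨?_, h2, ?_⟩
    · rw [h1, uSO_eq_diagonal hs]
    · rw [hε, hτ.vol.sum_lowerEps hg, ← hτ.gram_eq_left hlm, ← hε,
        hτ.antisymmetrizer_eq (minusSO_transpose s N) hothers hlm hd hP, Matrix.smul_apply,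
        smul_eq_mul, mul_assoc]

end OrthogonalCase

end QEpsilon

theorem proposition3 {K : Type*} [Field K] [CharZero K] (N : ℕ) (hN : 1 ≤ N) :
    -- the case of `U_q gl(N)`
    (∀ q : K, q ≠ 0 → (∀ r : ℕ, 1 ≤ r → q ^ r ≠ 1) → ∀ γ : K, γ ≠ 0 →
      (∃! ε : (Fin N → Fin N) → K, QEpsilon.IsEpsilon (QEpsilon.minusGL q N) γ ε) ∧
      ∀ ε : (Fin N → Fin N) → K, QEpsilon.IsEpsilon (QEpsilon.minusGL q N) γ ε →
        (∑ a : Fin N → Fin N, ε a ^ 2) ≠ 0 ∧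
        ∀ (l m : ℕ) (h : l + m = N),
          QEpsilon.dGL q ε l = QEpsilon.dGL q ε m ∧
          (∃! P : Matrix (Fin l → Fin N) (Fin l → Fin N) K,
            QEpsilon.IsAntisymmetrizer (QEpsilon.minusGL q N) {QEpsilon.plusGL q N} l P) ∧
          ∀ P : Matrix (Fin l → Fin N) (Fin l → Fin N) K,
            QEpsilon.IsAntisymmetrizer (QEpsilon.minusGL q N) {QEpsilon.plusGL q N} l P →
            ∀ i j : Fin l → Fin N,
              P i j = QEpsilon.dGL q ε l *
                ∑ k : Fin l → Fin N, ∑ a : Fin m → Fin N,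
                  (∏ t : Fin l, QEpsilon.uGL q N (k t) (j t)) *
                    ε (QEpsilon.cat ((add_comm m l).trans h) a i) *
                    ε (QEpsilon.cat ((add_comm m l).trans h) a k) ∧
              P i j = (-1) ^ (l * (N - 1)) * QEpsilon.dGL q ε l *
                ∑ a : Fin m → Fin N,
                  ε (QEpsilon.cat h j a) * ε (QEpsilon.cat ((add_comm m l).trans h) a i)) ∧
    -- the case of `U_q so(N)`, with `q = s ^ 2`
    (∀ s : K, s ≠ 0 → (∀ r : ℕ, 1 ≤ r → (s ^ 2) ^ r ≠ 1) → ∀ γ : K, γ ≠ 0 →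
      (∃! ε : (Fin N → Fin N) → K, QEpsilon.IsEpsilon (QEpsilon.minusSO s N) γ ε) ∧
      ∀ ε : (Fin N → Fin N) → K, QEpsilon.IsEpsilon (QEpsilon.minusSO s N) γ ε →
        (∑ a : Fin N → Fin N, ε a ^ 2) ≠ 0 ∧
        ∀ (l m : ℕ) (h : l + m = N),
          QEpsilon.dSO s ε l = QEpsilon.dSO s ε m ∧
          (∃! P : Matrix (Fin l → Fin N) (Fin l → Fin N) K,
            QEpsilon.IsAntisymmetrizer (QEpsilon.minusSO s N)
              {QEpsilon.plusSO s N, QEpsilon.traceSO s N} l P) ∧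
          ∀ P : Matrix (Fin l → Fin N) (Fin l → Fin N) K,
            QEpsilon.IsAntisymmetrizer (QEpsilon.minusSO s N)
              {QEpsilon.plusSO s N, QEpsilon.traceSO s N} l P →
            ∀ i j : Fin l → Fin N,
              P i j = QEpsilon.dSO s ε l *
                ∑ k : Fin l → Fin N, ∑ a : Fin m → Fin N,
                  (∏ t : Fin l, QEpsilon.uSO s N (k t) (j t)) *
                    ε (QEpsilon.cat ((add_comm m l).trans h) a i) *
                    ε (QEpsilon.cat ((add_comm m l).trans h) a k) ∧
              P i j = (-1) ^ (l * (N - 1)) * QEpsilon.dSO s ε l *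
                ∑ a : Fin m → Fin N,
                  ε (QEpsilon.cat h j a) * ε (QEpsilon.cat ((add_comm m l).trans h) a i) ∧
              P i j = QEpsilon.dSO s ε l *
                ∑ a : Fin m → Fin N,
                  QEpsilon.lowerEps s h ε (fun t => j t.rev) a *
                    QEpsilon.lowerEps s ((add_comm m l).trans h) ε (fun t => a t.rev) i) :=
  ⟨fun q hq h γ hγ => QEpsilon.epsilon_antisymmetrizer_GL N q hq h γ hγ,
    fun s hs h γ hγ => QEpsilon.epsilon_antisymmetrizer_SO N hN s hs h γ hγ⟩
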